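/- **Notation.** Fix integers $n,N\ge 0$ ($n$ is the number of variables). For $0<|p|<1$ put $\theta(x;p)=\prod_{r\ge0}(1-xp^r)(1-p^{r+1}/x)$ and $\theta(x;q;p)_m=\prod_{r=0}^{m-1}\theta(xq^r;p)$. For a partition $\lambda$ with diagram $\{(i,j):1\le j\le\lambda_i\}$ let $$C^0_\lambda(x)=\prod_{(i,j)\in\lambda}\theta(q^{j-1}t^{1-i}x;p),\quad C^-_\lambda(x)=\prod_{(i,j)\in\lambda}\theta(q^{\lambda_i-j}t^{\lambda'_j-i}x;p),\quad C^+_\lambda(x)=\prod_{(i,j)\in\lambda}\theta(q^{\lambda_i+j-1}t^{2-\lambda'_j-i}x;p),$$ and let $\tilde C^0_\lambda,\tilde C^\pm_\lambda$ be the same products with $\theta(y;p)$ replaced by $1-y$. Several arguments of a $C$- or $\tilde C$-symbol indicate a product. Put $|\lambda|=\sum_i\lambda_i$, $n(\lambda)=\sum_i(i-1)\lambda_i$, $n(\lambda')=\sum_i\binom{\lambda_i}{2}$, $(2\lambda^2)_i=2\lambda_{\lceil i/2\rceil}$, $$\Delta^0_\lambda(a|b_1,\dots,b_r)=\prod_{s=1}^r\frac{C^0_\lambda(b_s)}{C^0_\lambda(pqa/b_s)},\qquad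 \Delta_\lambda(a|b_1,\dots,b_r)=\Delta^0_\lambda(a|b_1,\dots,b_r)\,\frac{C^0_{2\lambda^2}(pqa)}{C^-_\lambda(pq,t)\,C^+_\lambda(a,pqa/t)}.$$ $N^n$ is the rectangular partition with $n$ rows of length $N$, and $\mu\subset N^n$ means $N\ge\mu_1\ge\dots\ge\mu_n\ge0$. If $t^{n-1}t_0t_1=q^{-N}$ and $t^{n-1}t_2t_3t_4t_5=pq^{N+1}$, the finitely supported bilinear form is $$\langle f,g\rangle_{t_r}=\sum_{\mu\subset N^n}f(\dots,t_0t^{n-i}q^{\mu_i},\dots)\,g(\dots,t_0t^{n-i}q^{\mu_i},\dots)\,w_\mu(t_r),$$ $$w_\mu(t_r)=\frac{\Delta_\mu(t^{2(n-1)}t_0^2\,|\,t^n,t^{n-1}t_0t_1,\dots,t^{n-1}t_0t_5)}{\Delta^0_{N^n}(t^{n-1}t_1/t_4\,|\,t_1/t_0,\,pq/(t_4t_2),\,pq/(t_4t_3),\,pq/(t_4t_5))}.$$ **Power series in $p$.** Real powers of $p$ are taken with the principal branch. $M(x)$ is the field of functions $F(x;p)$ that are meromorphic in $x\in(\mathbb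 C^*)^k$ for every $0<|p|<1$ and have an expansion $F=\sum_{e\in T}a_e(x)p^e$, where $T\subset\mathbb R$ is bounded from below and has finitely many elements below any bound, the $a_e$ are rational functions, all denominators are powers of one nonzero polynomial $P$, the degrees of numerators and denominators grow at most linearly in $|e|$, and on every compact set of points $x\in(\mathbb C^*)^k$ with $P(x)\ne0$ the series converges normally to $F$ for all small enough $p\neq 0$. $val(F)$ is the smallest exponent that occurs and $lc(F)$ is its coefficient. **Function spaces.** $A^{(n)}(u;p,q)$ is the space of meromorphic $f(z_1,\dots,z_n)$ on $(\mathbb C^*)^n$ that are invariant under permutations of the $z_i$, under $z_i\to1/z_i$ and under $z_i\to pz_i$ (for single $i$), such that $\prod_i\theta(pqz_i/u;q;p)_m\,\theta(pq/(uz_i);q;p)_m\,f(z)$ is holomorphic for large $m$. $\tilde A^{(n)}(u)$ consists of the families $f(z;u;q;p)$ of such functions (with $m$ uniform), possibly depending on further variables $s_j$ and on $t$, such that $f(p^{\zeta_i}z_i;p^{\gamma}u;p^{\beta_j}s_j;q,t;p)\in M(z,u,s,q,t)$ for all real $\zeta_i,\gamma,\beta_j$, and such that for all $B>0$ and $\zeta\in\mathbb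 R$ (and fixed $s,q,t$) there are $C>0$, $e\in\mathbb R$ with $|\prod_i\theta(pqz_i^{\pm1}/u;q;p)_m f|\le C|p|^{-e}$ whenever $0<|p|<\frac12$ and $1/(B|p|^\zeta)<|z_i|,|u|<B|p|^\zeta$. **Theorem.** Let $\alpha=(\alpha_0,\dots,\alpha_5)\in\mathbb R^6$ satisfy $-\frac12\le\alpha_0\le0$, $\alpha_1=-\alpha_0$, $\alpha_0\le\alpha_r\le\alpha_0+1$ for $2\le r\le5$, $\alpha_r+\alpha_s\le1$ for $2\le r<s\le5$, $\alpha_2+\alpha_3+\alpha_4+\alpha_5=1$ and $$\sum_{2\le r\le5:\ \alpha_0+\alpha_r<0}(\alpha_0+\alpha_r)=2\alpha_0.$$ Let $t_0,\dots,t_5,q,t\in\mathbb C^*$ be parameters with $t^{n-1}t_0t_1=q^{-N}$ and $t^{n-1}t_2t_3t_4t_5=q^{N+1}$; thus $t_0,t_2,t_3,t_4,q,t$ are free coordinates. Let $f\in\tilde A^{(n)}(t_4)$ and $g\in\tilde A^{(n)}(t_5)$, both possibly depending on all the parameters. Then $\langle f,g\rangle_{t_rp^{\alpha_r}}\in M(t_r,q,t)$.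 With $val(f),lc(f)$ the valuation and leading coefficient of $f(zp^{\alpha_0};t_rp^{\alpha_r})$, and likewise for $g$, $$\lim_{p\to0}p^{-val(f)-val(g)}\langle f,g\rangle_{t_rp^{\alpha_r}}=\sum_{\mu\subset N^n}lc(f)(t_0t^{n-i}q^{\mu_i})\,lc(g)(t_0t^{n-i}q^{\mu_i})\,w_{\mu,\alpha}(t_r),$$ uniformly on compact sets of parameters outside the zero set of some nonzero polynomial in $t_0,t_2,t_3,t_4,q,t$ (and outside that zero set no denominator of $w_{\mu,\alpha}$ vanishes). Moreover $$\sum_{\mu\subset N^n}w_{\mu,\alpha}(t_r)=1$$ for all parameters as above at which no denominator in the formulas for $w_{\mu,\alpha}$ vanishes. The weights are as follows; $r,s$ range over $\{2,3,4,5\}$, and $D=\prod_{r<s:\ \alpha_r+\alpha_s=1}\tilde C^0_{N^n}(q/(t_rt_s))^{-1}$. * If $\alpha_0=0$: $$w_{\mu,\alpha}=\frac{\tilde C^0_{2\mu^2}(qt^{2(n-1)}t_0^2)\,\tilde C^0_\mu(t^n,q^{-N})\,(qt^{4(n-1)}t_0^3t_1)^{-|\mu|}q^{-2n(\mu')}t^{4n(\mu)}}{\tilde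 C^0_\mu(qt^{n-2}t_0^2,qt^{n-1}t_0/t_1)\,\tilde C^-_\mu(q,t)\,\tilde C^+_\mu(t^{2(n-1)}t_0^2,qt^{2n-3}t_0^2)\,\tilde C^0_{N^n}(t_1/t_0)}$$ $$\times\prod_{r:\alpha_r=0}\frac{\tilde C^0_\mu(t^{n-1}t_0t_r)\,\tilde C^0_{N^n}(t^{n-1}t_1t_r)}{\tilde C^0_\mu(qt^{n-1}t_0/t_r)}\Big(-\frac{qt^{n-1}t_0}{t_r}\Big)^{|\mu|}q^{n(\mu')}t^{-n(\mu)}$$ $$\times\prod_{r:\alpha_r=1}\frac{\tilde C^0_\mu(t^{n-1}t_0t_r)\,\tilde C^0_{N^n}(q^{1-N}/(t_1t_r))}{\tilde C^0_\mu(qt^{n-1}t_0/t_r)}(-t^{n-1}t_0t_r)^{-|\mu|}q^{-n(\mu')}t^{n(\mu)}\cdot D.$$ * If $-\frac12<\alpha_0<0$: $$w_{\mu,\alpha}=\frac{\tilde C^0_\mu(t^n,q^{-N})\,(t_0^2t^{2(n-1)})^{-|\mu|}q^{-2n(\mu')}t^{4n(\mu)}}{\tilde C^-_\mu(q,t)}\prod_{r:\alpha_r=\alpha_0}\frac{(qt^{2(n-1)}t_0^2)^{|\mu|}q^{2n(\mu')}t^{-2n(\mu)}}{\tilde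 C^0_\mu(qt^{n-1}t_0/t_r)}\tilde C^0_{N^n}(t^{n-1}t_1t_r)$$ $$\times\prod_{r:\alpha_0<\alpha_r<-\alpha_0}(-t^{n-1}t_0t_r)^{|\mu|}q^{n(\mu')}t^{-n(\mu)}\prod_{r:\alpha_r=-\alpha_0}\tilde C^0_\mu(t^{n-1}t_0t_r)\prod_{r:\alpha_r=1+\alpha_0}\frac{\tilde C^0_{N^n}(qt^{n-1}t_0/t_r)}{\tilde C^0_\mu(qt^{n-1}t_0/t_r)}\cdot D.$$ * If $\alpha_0=-\frac12$: $$w_{\mu,\alpha}=\frac{\tilde C^0_{2\mu^2}(qt^{2(n-1)}t_0^2)\,\tilde C^0_\mu(t^n,q^{-N})\,(qt_0/t_1)^{|\mu|}q^{2n(\mu')}}{\tilde C^0_\mu(qt^{n-2}t_0^2,qt^{n-1}t_0/t_1)\,\tilde C^-_\mu(q,t)\,\tilde C^+_\mu(t^{2(n-1)}t_0^2,qt^{2n-3}t_0^2)\,\tilde C^0_{N^n}(q^{1-N}t^{n-1}t_0/t_1)}$$ $$\times\prod_{r:\alpha_r=-1/2}\frac{\tilde C^0_\mu(t^{n-1}t_0t_r)\,\tilde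 C^0_{N^n}(t^{n-1}t_1t_r)}{\tilde C^0_\mu(qt^{n-1}t_0/t_r)}\Big(-\frac{qt^{n-1}t_0}{t_r}\Big)^{|\mu|}q^{n(\mu')}t^{-n(\mu)}$$ $$\times\prod_{r:\alpha_r=1/2}\frac{\tilde C^0_\mu(t^{n-1}t_0t_r)\,\tilde C^0_{N^n}(q^{1-N}/(t_1t_r))}{\tilde C^0_\mu(qt^{n-1}t_0/t_r)}(-t^{n-1}t_0t_r)^{-|\mu|}q^{-n(\mu')}t^{n(\mu)}\cdot D.$$ -/

import Mathlib

open Filter Topology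

noncomputable section

namespace EllipticSelberg

/-! ### Theta functions and generalized `q`-symbols -/

/-- `(x; p) = ∏_{r ≥ 0} (1 - x p^r)`. -/
def qPochInf (x p : ℂ) : ℂ := ∏' r : ℕ, (1 - x * p ^ r)

/-- `θ(x; p) = (x; p) (p / x; p)`. -/
def theta (p x : ℂ) : ℂ := qPochInf x p * qPochInf (p / x) p

/-- The factor `1 - x`, which replaces `θ(x; p)` in the symbols with a tilde. -/
def oneSub (x : ℂ) : ℂ := 1 - x

/-- The length of column `j` (counted from `0`) of the diagram with row lengths `l`. -/
def colLen {m : ℕ} (l : Fin m → ℕ) (j : ℕ) : ℕ :=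
  (Finset.univ.filter fun i => j < l i).card

/-- `C⁰_l(x; q, t)` built from a factor `φ`, which is `theta p` or `oneSub`. Rows and columns are
counted from `0`, so that the box `(i, j)` here is the box `(i + 1, j + 1)` in the usual
convention. -/
def C0 (φ : ℂ → ℂ) (q t : ℂ) {m : ℕ} (l : Fin m → ℕ) (x : ℂ) : ℂ :=
  ∏ i : Fin m, ∏ j ∈ Finset.range (l i), φ (q ^ (j : ℤ) * t ^ (-(i : ℤ)) * x)

/-- `C⁻_l(x; q, t)` built from a factor `φ`. -/
def Cm (φ : ℂ → ℂ) (q t : ℂ) {m : ℕ} (l : Fin m → ℕ) (x : ℂ) : ℂ :=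
  ∏ i : Fin m, ∏ j ∈ Finset.range (l i),
    φ (q ^ ((l i : ℤ) - (j + 1)) * t ^ ((colLen l j : ℤ) - (i + 1)) * x)

/-- `C⁺_l(x; q, t)` built from a factor `φ`. -/
def Cp (φ : ℂ → ℂ) (q t : ℂ) {m : ℕ} (l : Fin m → ℕ) (x : ℂ) : ℂ :=
  ∏ i : Fin m, ∏ j ∈ Finset.range (l i),
    φ (q ^ ((l i : ℤ) + (j + 1) - 1) * t ^ (2 - (colLen l j : ℤ) - (i + 1)) * x)

/-- The partition `2l²`: every row is doubled in length and then repeated. -/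
def twiceSq {m : ℕ} (l : Fin m → ℕ) : Fin (2 * m) → ℕ :=
  fun i => 2 * l ⟨i / 2, by omega⟩

/-- The rectangular partition `N^n`. -/
def rect (n N : ℕ) : Fin n → ℕ := fun _ => N

/-- `|l|`. -/
def size {m : ℕ} (l : Fin m → ℕ) : ℤ := ∑ i, (l i : ℤ)

/-- `n(l) = ∑_i (i - 1) l_i`. -/
def nStat {m : ℕ} (l : Fin m → ℕ) : ℤ := ∑ i : Fin m, (i : ℤ) * (l i : ℤ)

/-- `n(l') = ∑_i binom(l_i, 2)`. -/
def nStatConj {m : ℕ} (l : Fin m → ℕ) : ℤ := ∑ i, ((l i).choose 2 : ℤ)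

/-- `Δ⁰_l(a | b₁, …, b_r; q, t; p)`. -/
def Delta0 (q t p : ℂ) {m : ℕ} (l : Fin m → ℕ) (a : ℂ) {r : ℕ} (b : Fin r → ℂ) : ℂ :=
  ∏ i, C0 (theta p) q t l (b i) / C0 (theta p) q t l (p * q * a / b i)

/-- `Δ_l(a | b₁, …, b_r; q, t; p)`. -/
def Delta (q t p : ℂ) {m : ℕ} (l : Fin m → ℕ) (a : ℂ) {r : ℕ} (b : Fin r → ℂ) : ℂ :=
  Delta0 q t p l a b *
    (C0 (theta p) q t (twiceSq l) (p * q * a) /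
      (Cm (theta p) q t l (p * q) * Cm (theta p) q t l t *
        (Cp (theta p) q t l a * Cp (theta p) q t l (p * q * a / t))))

/-- The partitions `μ ⊂ N^n`. -/
def boxPartitions (n N : ℕ) : Finset (Fin n → ℕ) :=
  open Classical in
  (Fintype.piFinset fun _ : Fin n => Finset.range (N + 1)).filter fun μ => Antitone μ

/-! ### The finitely supported bilinear form -/

/-- The weight `w_μ(τ₀, τ₁; τ₂, τ₃, u₀, u₁)`, where `u₀ = τ₄` and `u₁ = τ₅`. -/
def weight (n N : ℕ) (τ : Fin 6 → ℂ) (q t p : ℂ) (μ : Fin n → ℕ) : ℂ :=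
  let s := t ^ ((n : ℤ) - 1)
  Delta q t p μ (s ^ 2 * τ 0 ^ 2)
      ![t ^ n, s * τ 0 * τ 1, s * τ 0 * τ 2, s * τ 0 * τ 3, s * τ 0 * τ 4, s * τ 0 * τ 5] /
    Delta0 q t p (rect n N) (s * τ 1 / τ 4)
      ![τ 1 / τ 0, p * q / (τ 4 * τ 2), p * q / (τ 4 * τ 3), p * q / (τ 4 * τ 5)]

/-- The point `(t₀ t^{n-1} q^{μ₁}, t₀ t^{n-2} q^{μ₂}, …, t₀ q^{μ_n})`. -/
def node {n : ℕ} (t₀ q t : ℂ) (μ : Fin n → ℕ) : Fin n → ℂ :=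
  fun i => t₀ * t ^ (n - 1 - (i : ℕ)) * q ^ μ i

/-- The bilinear form `⟨f, g⟩_τ` (for `τ` subject to `t^{n-1} τ₀ τ₁ = q^{-N}` and
`t^{n-1} τ₂ τ₃ τ₄ τ₅ = p q^{N+1}`). -/
def bilinForm (n N : ℕ) (f g : (Fin n → ℂ) → ℂ) (τ : Fin 6 → ℂ) (q t p : ℂ) : ℂ :=
  ∑ μ ∈ boxPartitions n N,
    f (node (τ 0) q t μ) * g (node (τ 0) q t μ) * weight n N τ q t p μ

/-! ### The field `M(x)` of power series in `p` -/

/-- The field of rational functions in variables indexed by `σ`. -/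
abbrev Rat (σ : Type) : Type := FractionRing (MvPolynomial σ ℂ)

/-- The value of a rational function at a point (in lowest terms). -/
def ratEval {σ : Type} (a : Rat σ) (x : σ → ℂ) : ℂ :=
  MvPolynomial.eval x (IsFractionRing.num (MvPolynomial σ ℂ) a) /
    MvPolynomial.eval x (IsFractionRing.den (MvPolynomial σ ℂ) a : MvPolynomial σ ℂ)

/-- The real power `p^a` of a complex number (principal branch). -/
def ppow (p : ℂ) (a : ℝ) : ℂ := p ^ (a : ℂ)

/-- `F = ∑_{e ∈ T} a_e(x) p^e` with rational `a_e`, where `T = {e | a_e ≠ 0}` is discrete and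
bounded from below. There is one polynomial `P` whose powers serve as denominators of all `a_e`,
and the series converges to `F`, normally on every compact set of points `x ∈ (ℂ*)^σ` with
`P(x) ≠ 0`, for all sufficiently small `p`. The degrees of numerators and denominators grow at most
linearly in `e`; this is what makes substitutions `x ↦ p^{ε u} x` with small `ε` compatible with
leading coefficients. -/
structure HasPExpansion {σ : Type} (F : (σ → ℂ) → ℂ → ℂ) (a : ℝ → Rat σ) : Prop where
  finite_le : ∀ B : ℝ, {e : ℝ | a e ≠ 0 ∧ e ≤ B}.Finite
  converges : ∃ P : MvPolynomial σ ℂ, P ≠ 0 ∧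
    (∃ c : ℝ, ∀ e : ℝ, ∃ (N : MvPolynomial σ ℂ) (m : ℕ),
      (m : ℝ) ≤ c * (1 + |e|) ∧ (N.totalDegree : ℝ) ≤ c * (1 + |e|) ∧
      a e * algebraMap (MvPolynomial σ ℂ) (Rat σ) (P ^ m) =
        algebraMap (MvPolynomial σ ℂ) (Rat σ) N) ∧
    ∀ K : Set (σ → ℂ), IsCompact K → (∀ x ∈ K, (∀ i, x i ≠ 0) ∧ MvPolynomial.eval x P ≠ 0) →
      ∃ ε : ℝ, 0 < ε ∧ ∃ b : ℝ → ℝ,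
        (∀ e, ∀ x ∈ K, ‖ratEval (a e) x‖ ≤ b e) ∧
        Summable (fun e : ℝ => b e * ε ^ e) ∧
        ∀ x ∈ K, ∀ p : ℂ, 0 < ‖p‖ → ‖p‖ < ε →
          HasSum (fun e : ℝ => ratEval (a e) x * ppow p e) (F x p)

/-- `F` is meromorphic on `U`: locally a quotient of analytic functions. -/
def IsMeroOn {σ : Type} [Fintype σ] (F : (σ → ℂ) → ℂ) (U : Set (σ → ℂ)) : Prop :=
  ∀ x₀ ∈ U, ∃ G H : (σ → ℂ) → ℂ, AnalyticAt ℂ G x₀ ∧ AnalyticAt ℂ H x₀ ∧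
    (∃ᶠ x in 𝓝 x₀, H x ≠ 0) ∧ ∀ᶠ x in 𝓝 x₀, H x ≠ 0 → F x = G x / H x

/-- Membership in the field `M(x)`, where `x ∈ (ℂ*)^σ`. -/
def InM {σ : Type} [Fintype σ] (F : (σ → ℂ) → ℂ → ℂ) : Prop :=
  (∀ p : ℂ, 0 < ‖p‖ → ‖p‖ < 1 → IsMeroOn (fun x => F x p) {x | ∀ i, x i ≠ 0}) ∧
    ∃ a : ℝ → Rat σ, HasPExpansion F a

/-- The coefficients `a_e` of the series of an element of `M(x)`. -/
def pCoeff {σ : Type} (F : (σ → ℂ) → ℂ → ℂ) : ℝ → Rat σ :=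
  open Classical in
  if h : ∃ a : ℝ → Rat σ, HasPExpansion F a then h.choose else 0

/-- The valuation, i.e. the smallest exponent that occurs (`0` for the zero series). -/
def val {σ : Type} (F : (σ → ℂ) → ℂ → ℂ) : ℝ := sInf {e : ℝ | pCoeff F e ≠ 0}

/-- The leading coefficient, a rational function (`0` for the zero series). -/
def lc {σ : Type} (F : (σ → ℂ) → ℂ → ℂ) : Rat σ := pCoeff F (val F)

/-! ### The spaces `A^{(n)}(u)` and `Ã^{(n)}(u)` -/

/-- `∏_i θ(p q z_i^{±1} / u; q; p)_m`. -/
def poleFactor (n m : ℕ) (u q p : ℂ) (z : Fin n → ℂ) : ℂ :=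
  ∏ i, ∏ r ∈ Finset.range m,
    theta p (p * q * z i / u * q ^ r) * theta p (p * q * (z i)⁻¹ / u * q ^ r)

/-- `f` is a `BC_n`-symmetric `p`-abelian function and `poleFactor · f` is holomorphic on
`(ℂ*)^n`. As `f` may have poles at the zeros of the pole factor, its values there are
disregarded. -/
structure IsAbelian (n m : ℕ) (u q p : ℂ) (f : (Fin n → ℂ) → ℂ) : Prop where
  perm : ∀ (π : Equiv.Perm (Fin n)) (z : Fin n → ℂ), (∀ i, z i ≠ 0) →
    poleFactor n m u q p z ≠ 0 → f (fun i => z (π i)) = f z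
  inv : ∀ (i : Fin n) (z : Fin n → ℂ), (∀ i, z i ≠ 0) →
    poleFactor n m u q p z ≠ 0 → f (Function.update z i (z i)⁻¹) = f z
  shift : ∀ (i : Fin n) (z : Fin n → ℂ), (∀ i, z i ≠ 0) →
    poleFactor n m u q p z ≠ 0 → f (Function.update z i (p * z i)) = f z
  holo : ∃ H : (Fin n → ℂ) → ℂ, AnalyticOnNhd ℂ H {z | ∀ i, z i ≠ 0} ∧
    ∀ z : Fin n → ℂ, (∀ i, z i ≠ 0) → poleFactor n m u q p z ≠ 0 →
      poleFactor n m u q p z * f z = H z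

/-- Functions `f(z; u; s; q, t; p)` of `z₁, …, z_n`, of `u`, `q`, `p`, and of further variables
`s₁, …, s_k` and `t`. -/
abbrev ParamFun (n k : ℕ) : Type :=
  (Fin n → ℂ) → ℂ → (Fin k → ℂ) → ℂ → ℂ → ℂ → ℂ

/-- Indices of the variables `z₁, …, z_n`, then `s₁, …, s_k`, then `u, q, t`. -/
abbrev AVar (n k : ℕ) : Type := Fin n ⊕ Fin k ⊕ Fin 3

/-- The point with coordinates `z, s, u, q, t`. -/
def aPoint {n k : ℕ} (z : Fin n → ℂ) (u : ℂ) (s : Fin k → ℂ) (q t : ℂ) : AVar n k → ℂ :=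
  Sum.elim z (Sum.elim s ![u, q, t])

/-- `f(p^ζ z; p^γ u; p^β s; q, t; p)` as a function of `x = (z, s, u, q, t)` and `p`. -/
def shifted {n k : ℕ} (f : ParamFun n k) (ζ : Fin n → ℝ) (γ : ℝ) (β : Fin k → ℝ) :
    (AVar n k → ℂ) → ℂ → ℂ := fun x p =>
  f (fun i => x (Sum.inl i) * ppow p (ζ i)) (x (Sum.inr (Sum.inr 0)) * ppow p γ)
    (fun j => x (Sum.inr (Sum.inl j)) * ppow p (β j))
    (x (Sum.inr (Sum.inr 1))) (x (Sum.inr (Sum.inr 2))) p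

/-- The space `Ã^{(n)}(u)` of families of functions in `A^{(n)}(u)` that behave well as
`p → 0`. -/
def InATilde {n k : ℕ} (f : ParamFun n k) : Prop :=
  (∀ (ζ : Fin n → ℝ) (γ : ℝ) (β : Fin k → ℝ), InM (shifted f ζ γ β)) ∧
  ∃ m : ℕ,
    (∀ (u : ℂ) (s : Fin k → ℂ) (q t p : ℂ), u ≠ 0 → (∀ j, s j ≠ 0) → q ≠ 0 → t ≠ 0 →
      0 < ‖p‖ → ‖p‖ < 1 → IsAbelian n m u q p (fun z => f z u s q t p)) ∧
    (∀ (s : Fin k → ℂ) (q t : ℂ), (∀ j, s j ≠ 0) → q ≠ 0 → t ≠ 0 → ∀ B ζ : ℝ, 0 < B →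
      ∃ C e : ℝ, 0 < C ∧ ∀ (p u : ℂ) (z : Fin n → ℂ), 0 < ‖p‖ → ‖p‖ < 1 / 2 →
        1 / (B * ‖p‖ ^ ζ) < ‖u‖ → ‖u‖ < B * ‖p‖ ^ ζ →
        (∀ i, 1 / (B * ‖p‖ ^ ζ) < ‖z i‖ ∧ ‖z i‖ < B * ‖p‖ ^ ζ) →
        ‖poleFactor n m u q p z * f z u s q t p‖ ≤ C * ‖p‖ ^ (-e))

/-! ### Parameters depending on `p` -/

/-- The parameters `(t₀, …, t₅)` with `t^{n-1} t₀ t₁ = q^{-N}` and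
`t^{n-1} t₂ t₃ t₄ t₅ = q^{N+1}`, in terms of the free coordinates `x = (t₀, t₂, t₃, t₄, q, t)`. -/
def balanced (n N : ℕ) (x : Fin 6 → ℂ) : Fin 6 → ℂ :=
  let q := x 4
  let t := x 5
  ![x 0, q ^ (-(N : ℤ)) * t ^ (1 - (n : ℤ)) / x 0, x 1, x 2, x 3,
    q ^ ((N : ℤ) + 1) * t ^ (1 - (n : ℤ)) / (x 1 * x 2 * x 3)]

/-- The parameters `t_r p^{α_r}`. -/
def scaled (α : Fin 6 → ℝ) (τ : Fin 6 → ℂ) (p : ℂ) : Fin 6 → ℂ :=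
  fun r => τ r * ppow p (α r)

/-- `⟨f, g⟩_{t_r p^{α_r}}`, as a function of `x = (t₀, t₂, t₃, t₄, q, t)` and `p`. Here `f` has the
pole parameter `t₄` and `g` has the pole parameter `t₅`, and both may depend on all the
parameters `t_r p^{α_r}`: those that are not passed to them are fixed by the balancing
conditions. -/
def scaledForm (n N : ℕ) (α : Fin 6 → ℝ) (f g : ParamFun n 3) (x : Fin 6 → ℂ) (p : ℂ) : ℂ :=
  let T := scaled α (balanced n N x) p
  bilinForm n N (fun z => f z (T 4) ![T 0, T 2, T 3] (x 4) (x 5) p)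
    (fun z => g z (T 5) ![T 0, T 2, T 3] (x 4) (x 5) p) T (x 4) (x 5) p

/-- The function `f(z p^{α₀}; t_r p^{α_r})` for a function `f` with pole parameter `t_j`
(`j = 4` or `j = 5`). -/
def scaledFun {n : ℕ} (α : Fin 6 → ℝ) (j : Fin 6) (f : ParamFun n 3) :
    (AVar n 3 → ℂ) → ℂ → ℂ :=
  shifted f (fun _ => α 0) (α j) ![α 0, α 2, α 3]

/-- The value of `lc(f) = lc(f(z p^{α₀}; t_r p^{α_r}))` at `z = (…, t₀ t^{n-i} q^{μ_i}, …)`. -/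
def lcAt {n : ℕ} (α : Fin 6 → ℝ) (j : Fin 6) (f : ParamFun n 3) (τ : Fin 6 → ℂ) (q t : ℂ)
    (μ : Fin n → ℕ) : ℂ :=
  ratEval (lc (scaledFun α j f)) (aPoint (node (τ 0) q t μ) (τ j) ![τ 0, τ 2, τ 3] q t)

/-- The conditions on the exponents `α`. -/
structure Admissible (α : Fin 6 → ℝ) : Prop where
  lower : -(1 / 2) ≤ α 0
  upper : α 0 ≤ 0
  one : α 1 = -α 0
  between : ∀ r : Fin 6, 2 ≤ r → α 0 ≤ α r ∧ α r ≤ α 0 + 1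
  pairs : ∀ r s : Fin 6, 2 ≤ r → r < s → α r + α s ≤ 1
  sum_eq : α 2 + α 3 + α 4 + α 5 = 1
  vanish : ∑ r ∈ (Finset.Ici (2 : Fin 6)).filter (fun r => α 0 + α r < 0), (α 0 + α r) = 2 * α 0

/-! ### The limiting weights -/

/-- `∏_{2 ≤ r < s ≤ 5 : α_r + α_s = 1} C̃⁰_{N^n}(q / (t_r t_s))`. -/
def pairProd (n N : ℕ) (α : Fin 6 → ℝ) (τ : Fin 6 → ℂ) (q t : ℂ) : ℂ :=
  ∏ r ∈ Finset.Ici (2 : Fin 6), ∏ s ∈ (Finset.Ioi r).filter (fun s => α r + α s = 1),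
    C0 oneSub q t (rect n N) (q / (τ r * τ s))

/-- The limiting weight for `α₀ = 0`. -/
def limWeightZero (n N : ℕ) (α : Fin 6 → ℝ) (τ : Fin 6 → ℂ) (q t : ℂ) (μ : Fin n → ℕ) : ℂ :=
  let s := t ^ ((n : ℤ) - 1)
  let c := C0 oneSub q t μ
  let cN := C0 oneSub q t (rect n N)
  C0 oneSub q t (twiceSq μ) (q * s ^ 2 * τ 0 ^ 2) * (c (t ^ n) * c (q ^ (-(N : ℤ)))) *
      (1 / (q * s ^ 4 * τ 0 ^ 3 * τ 1)) ^ size μ *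
      q ^ (-2 * nStatConj μ) * t ^ (4 * nStat μ) /
    (c (q * t ^ ((n : ℤ) - 2) * τ 0 ^ 2) * c (q * s * τ 0 / τ 1) *
      (Cm oneSub q t μ q * Cm oneSub q t μ t) *
      (Cp oneSub q t μ (s ^ 2 * τ 0 ^ 2) *
        Cp oneSub q t μ (q * t ^ (2 * (n : ℤ) - 3) * τ 0 ^ 2)) *
      cN (τ 1 / τ 0)) *
  (∏ r ∈ (Finset.Ici (2 : Fin 6)).filter (fun r => α r = 0),
    c (s * τ 0 * τ r) * cN (s * τ 1 * τ r) / c (q * s * τ 0 / τ r) *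
      (-(q * s * τ 0 / τ r)) ^ size μ * q ^ nStatConj μ * t ^ (-nStat μ)) *
  (∏ r ∈ (Finset.Ici (2 : Fin 6)).filter (fun r => α r = 1),
    c (s * τ 0 * τ r) * cN (q ^ (1 - (N : ℤ)) / (τ 1 * τ r)) / c (q * s * τ 0 / τ r) *
      (-(s * τ 0 * τ r)) ^ (-size μ) * q ^ (-nStatConj μ) * t ^ nStat μ) *
  (1 / pairProd n N α τ q t)

/-- The limiting weight for `-1/2 < α₀ < 0`. -/
def limWeightMid (n N : ℕ) (α : Fin 6 → ℝ) (τ : Fin 6 → ℂ) (q t : ℂ) (μ : Fin n → ℕ) : ℂ :=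
  let s := t ^ ((n : ℤ) - 1)
  let c := C0 oneSub q t μ
  let cN := C0 oneSub q t (rect n N)
  c (t ^ n) * c (q ^ (-(N : ℤ))) * (τ 0 ^ 2 * s ^ 2) ^ (-size μ) *
      q ^ (-2 * nStatConj μ) * t ^ (4 * nStat μ) /
    (Cm oneSub q t μ q * Cm oneSub q t μ t) *
  (∏ r ∈ (Finset.Ici (2 : Fin 6)).filter (fun r => α r = α 0),
    (q * s ^ 2 * τ 0 ^ 2) ^ size μ * q ^ (2 * nStatConj μ) * t ^ (-2 * nStat μ) /
      c (q * s * τ 0 / τ r) * cN (s * τ 1 * τ r)) *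
  (∏ r ∈ (Finset.Ici (2 : Fin 6)).filter (fun r => α 0 < α r ∧ α r < -α 0),
    (-(s * τ 0 * τ r)) ^ size μ * q ^ nStatConj μ * t ^ (-nStat μ)) *
  (∏ r ∈ (Finset.Ici (2 : Fin 6)).filter (fun r => α r = -α 0), c (s * τ 0 * τ r)) *
  (∏ r ∈ (Finset.Ici (2 : Fin 6)).filter (fun r => α r = 1 + α 0),
    cN (q * s * τ 0 / τ r) / c (q * s * τ 0 / τ r)) *
  (1 / pairProd n N α τ q t)

/-- The limiting weight for `α₀ = -1/2`. -/
def limWeightHalf (n N : ℕ) (α : Fin 6 → ℝ) (τ : Fin 6 → ℂ) (q t : ℂ) (μ : Fin n → ℕ) : ℂ :=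
  let s := t ^ ((n : ℤ) - 1)
  let c := C0 oneSub q t μ
  let cN := C0 oneSub q t (rect n N)
  C0 oneSub q t (twiceSq μ) (q * s ^ 2 * τ 0 ^ 2) * (c (t ^ n) * c (q ^ (-(N : ℤ)))) *
      (q * τ 0 / τ 1) ^ size μ * q ^ (2 * nStatConj μ) /
    (c (q * t ^ ((n : ℤ) - 2) * τ 0 ^ 2) * c (q * s * τ 0 / τ 1) *
      (Cm oneSub q t μ q * Cm oneSub q t μ t) *
      (Cp oneSub q t μ (s ^ 2 * τ 0 ^ 2) *
        Cp oneSub q t μ (q * t ^ (2 * (n : ℤ) - 3) * τ 0 ^ 2)) *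
      cN (q ^ (1 - (N : ℤ)) * s * τ 0 / τ 1)) *
  (∏ r ∈ (Finset.Ici (2 : Fin 6)).filter (fun r => α r = -(1 / 2)),
    c (s * τ 0 * τ r) * cN (s * τ 1 * τ r) *
      (-(q * s * τ 0 / τ r)) ^ size μ * q ^ nStatConj μ * t ^ (-nStat μ) /
      c (q * s * τ 0 / τ r)) *
  (∏ r ∈ (Finset.Ici (2 : Fin 6)).filter (fun r => α r = 1 / 2),
    c (s * τ 0 * τ r) * cN (q ^ (1 - (N : ℤ)) / (τ 1 * τ r)) / c (q * s * τ 0 / τ r) *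
      (-(s * τ 0 * τ r)) ^ (-size μ) * q ^ (-nStatConj μ) * t ^ nStat μ) *
  (1 / pairProd n N α τ q t)

/-- The limiting weight `w_{μ,α}(t_r)`. -/
def limWeight (n N : ℕ) (α : Fin 6 → ℝ) (τ : Fin 6 → ℂ) (q t : ℂ) (μ : Fin n → ℕ) : ℂ :=
  if α 0 = 0 then limWeightZero n N α τ q t μ
  else if -(1 / 2) < α 0 then limWeightMid n N α τ q t μ
  else limWeightHalf n N α τ q t μ

/-- None of the denominators in the formula for `w_{μ,α}(t_r)` vanishes. -/
def LimWeightRegular (n N : ℕ) (α : Fin 6 → ℝ) (τ : Fin 6 → ℂ) (q t : ℂ) (μ : Fin n → ℕ) :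
    Prop :=
  let s := t ^ ((n : ℤ) - 1)
  let c := C0 oneSub q t μ
  let cN := C0 oneSub q t (rect n N)
  Cm oneSub q t μ q ≠ 0 ∧ Cm oneSub q t μ t ≠ 0 ∧ pairProd n N α τ q t ≠ 0 ∧
  (∀ r : Fin 6, 2 ≤ r → (α r = α 0 ∨ α r = 1 + α 0) → c (q * s * τ 0 / τ r) ≠ 0) ∧
  ((α 0 = 0 ∨ α 0 = -(1 / 2)) →
    c (q * t ^ ((n : ℤ) - 2) * τ 0 ^ 2) ≠ 0 ∧ c (q * s * τ 0 / τ 1) ≠ 0 ∧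
    Cp oneSub q t μ (s ^ 2 * τ 0 ^ 2) ≠ 0 ∧
    Cp oneSub q t μ (q * t ^ (2 * (n : ℤ) - 3) * τ 0 ^ 2) ≠ 0) ∧
  (α 0 = 0 → cN (τ 1 / τ 0) ≠ 0) ∧
  (α 0 = -(1 / 2) → cN (q ^ (1 - (N : ℤ)) * s * τ 0 / τ 1) ≠ 0)

end EllipticSelberg

end

/-!
The theorem combines an expansion in powers of `p`, valid for all parameters, with the exact
evaluation of the sum of the elliptic weights.

**Leading terms.** `Lead F v φ` says that `F` has an expansion whose exponents are at least `v`,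
with coefficient `φ` at `p^v`. Leading terms can be added and multiplied, and `θ(x p^γ; p)` has one
for `-1 ≤ γ ≤ 1` (`Lead.theta`). All arguments in the weight are Laurent monomials times such powers
of `p`; the admissibility conditions make the exponents cancel, so that the weight has valuation `0`
and leading coefficient `w_{μ,α}` (`weight_leadPair`, `leadWeight_eq_limWeight`). The valuation is
`0` because `∑ min (α₀ + α_r) 0 = 2 α₀`.

The values of `f` and `g` at the nodes are harder: the denominators in the expansion of `f` are
powers of an unknown polynomial `P`, which might vanish at all nodes. Abelian functions are
holomorphic off their poles, and as `p → 0` the poles tend to the zeros of an explicit polynomial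
(`limPoles`). On a small circle in a line through a point outside of these zeros, Cauchy's theorem
shows that the coefficients of the expansion have no poles there (`num_eq_zero`), and the mean value
property extends normal convergence (`HoloLines.extend`). Thus `P` may be replaced by `limPoles`,
which does not vanish at generic nodes, and substituting the nodes, which are Laurent monomials, is
legitimate (`IsMonomial.gexp`, `lead_nodePoint`). That the value at a node is meromorphic in the
parameters is `mero_nodePoint`: a denominator that vanishes identically at the node is removed by
Taylor expansion in the directions of `z`, in which `f` is holomorphic (`exists_mero_comp`).

**The sum of the weights.** In product form (`Delta_eq_prodWeight`) the weights satisfy an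
adjointness relation between difference operators with parameters `τ` and `shiftPar Q τ`, `Q² = q`
(`sum_adjoint`). The operators map the constant function `1` to an explicit constant
(`sum_opCoeff`), which follows from interpolation by theta functions (`eq_zero_of_quasiperiodic`).
Hence the sums for `N + 1` and `N` are proportional, and induction gives `∑ w_μ = 1` for parameters
that are multiplicatively independent of `p` (`sum_weight`). At points outside a meagre set this
applies to `p = 1/2, 1/3, …` simultaneously, and the limit `p → 0` gives `∑ w_{μ,α} = 1`; by
density and continuity this holds wherever the limiting weights are regular (`sum_limWeight`).
-/

noncomputable section

namespace EllipticSelberg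

open Finset MvPolynomial Metric
open Sum (inl inr)

local notation "ℂ[" σ "]" => MvPolynomial σ ℂ

local notation "ℂ⁶" => Fin 6 → ℂ

/-! ### The theta function -/

lemma summable_qPoch_norm {p : ℂ} (hp1 : ‖p‖ < 1) (x : ℂ) :
    Summable fun r : ℕ => ‖-(x * p ^ r)‖ := by
  simpa [norm_mul, norm_pow] using
    (summable_geometric_of_lt_one (norm_nonneg p) hp1).mul_left ‖x‖

lemma qPochInf_eq_tsum {p : ℂ} (hp1 : ‖p‖ < 1) (x : ℂ) :
    qPochInf x p = ∑' s : Finset ℕ, ∏ i ∈ s, -(x * p ^ i) := by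
  have := tprod_one_add (summable_finsetProd_of_summable_norm (summable_qPoch_norm hp1 x))
  rw [← this, qPochInf]
  exact tprod_congr fun r => by ring

lemma qPochInf_step {p : ℂ} (hp1 : ‖p‖ < 1) (x : ℂ) :
    qPochInf x p = (1 - x) * qPochInf (x * p) p := by
  have h' : Multipliable fun r : ℕ => 1 + -(x * p * p ^ r) :=
    multipliable_one_add_of_summable (summable_qPoch_norm hp1 (x * p))
  have e : ∀ y : ℂ, qPochInf y p = ∏' r : ℕ, (1 + -(y * p ^ r)) := fun y =>
    tprod_congr fun r => by ring
  rw [e, e]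
  have h'' : Multipliable fun r : ℕ => 1 + -(x * p ^ (r + 1)) := h'.congr fun r => by ring
  rw [tprod_eq_zero_mul' (f := fun r : ℕ => 1 + -(x * p ^ r)) h'']
  congr 1
  · ring
  · exact tprod_congr fun r => by ring

lemma qPochInf_ne_zero {p : ℂ} (hp1 : ‖p‖ < 1) {x : ℂ} (h : ∀ r : ℕ, x * p ^ r ≠ 1) :
    qPochInf x p ≠ 0 := by
  have := tprod_one_add_ne_zero_of_summable (f := fun r : ℕ => -(x * p ^ r))
    (fun r hr => h r (by linear_combination -hr)) (summable_qPoch_norm hp1 x)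
  rwa [show qPochInf x p = ∏' r : ℕ, (1 + -(x * p ^ r)) from tprod_congr fun r => by ring]

lemma qPochInf_eq_zero {p : ℂ} (hp1 : ‖p‖ < 1) (r : ℕ) : ∀ {x : ℂ}, x * p ^ r = 1 →
    qPochInf x p = 0 := by
  induction r with
  | zero => intro x h; rw [qPochInf_step hp1]; simp at h; simp [h]
  | succ r ih =>
    intro x h
    rw [qPochInf_step hp1, ih (x := x * p) (by rw [← h]; ring), mul_zero]

lemma differentiable_qPochInf {p : ℂ} (hp1 : ‖p‖ < 1) :
    Differentiable ℂ fun x => qPochInf x p := by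
  intro x₀
  have hs : Summable fun r : ℕ => (‖x₀‖ + 1) * ‖p‖ ^ r :=
    (summable_geometric_of_lt_one (norm_nonneg p) hp1).mul_left _
  have h : DifferentiableOn ℂ (fun x => ∑' s : Finset ℕ, ∏ i ∈ s, -(x * p ^ i))
      (ball 0 (‖x₀‖ + 1)) := by
    refine Complex.differentiableOn_tsum_of_summable_norm
      (summable_finsetProd_of_summable_nonneg (fun r => by positivity) hs) ?_
      isOpen_ball ?_
    · intro s
      exact Differentiable.differentiableOn (by fun_prop)
    · intro s x hx
      rw [norm_prod]
      refine prod_le_prod (fun _ _ => norm_nonneg _) fun i _ => ?_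
      rw [norm_neg, norm_mul, norm_pow]
      have : ‖x‖ ≤ ‖x₀‖ + 1 := by simpa using (mem_ball_zero_iff.1 hx).le
      gcongr
  have := h.differentiableAt (isOpen_ball.mem_nhds
    (show x₀ ∈ ball 0 (‖x₀‖ + 1) by simp))
  simpa only [← qPochInf_eq_tsum hp1] using this

section Theta

variable {p : ℂ}

lemma theta_p_mul (hp : p ≠ 0) (hp1 : ‖p‖ < 1) {x : ℂ} (hx : x ≠ 0) :
    theta p (p * x) = -x⁻¹ * theta p x := by
  have e : p / (p * x) = x⁻¹ := by field_simp
  rw [theta, theta, e, qPochInf_step hp1 x⁻¹, qPochInf_step hp1 x, div_eq_inv_mul p x,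
    mul_comm p x]
  field_simp
  ring

lemma theta_p_div (hp : p ≠ 0) {x : ℂ} : theta p (p / x) = theta p x := by
  rw [theta, theta, div_div_cancel₀ hp, mul_comm]

lemma theta_inv (hp : p ≠ 0) (hp1 : ‖p‖ < 1) {x : ℂ} (hx : x ≠ 0) :
    theta p x⁻¹ = -x⁻¹ * theta p x := by
  rw [← theta_p_mul hp hp1 hx, ← theta_p_div hp]
  congr 1; field_simp

lemma theta_ne_zero (hp : p ≠ 0) (hp1 : ‖p‖ < 1) {x : ℂ} (hx : x ≠ 0)
    (h : ∀ l : ℤ, x ≠ p ^ l) : theta p x ≠ 0 := by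
  refine mul_ne_zero (qPochInf_ne_zero hp1 fun r hr => h (-r) ?_)
    (qPochInf_ne_zero hp1 fun r hr => h (r + 1) ?_)
  · rw [zpow_neg, zpow_natCast]; exact eq_inv_of_mul_eq_one_left hr
  · rw [div_mul_eq_mul_div, div_eq_one_iff_eq hx] at hr
    rw [← hr, zpow_add_one₀ hp, zpow_natCast, mul_comm]

lemma theta_eq_zero (hp : p ≠ 0) (hp1 : ‖p‖ < 1) (l : ℤ) : theta p (p ^ l) = 0 := by
  rcases le_or_gt l 0 with hl | hl
  · obtain ⟨r, rfl⟩ := Int.exists_eq_neg_ofNat hl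
    rw [theta, qPochInf_eq_zero hp1 r, zero_mul]
    rw [zpow_neg, zpow_natCast, inv_mul_cancel₀ (pow_ne_zero _ hp)]
  · obtain ⟨r, rfl⟩ : ∃ r : ℕ, l = r + 1 := ⟨(l - 1).toNat, by omega⟩
    rw [theta, qPochInf_eq_zero (x := p / _) hp1 r, mul_zero]
    rw [zpow_add_one₀ hp, zpow_natCast]
    have := pow_ne_zero r hp
    field_simp

lemma theta_one (hp : p ≠ 0) (hp1 : ‖p‖ < 1) : theta p 1 = 0 := by
  simpa using theta_eq_zero hp hp1 0

lemma differentiableAt_theta (hp1 : ‖p‖ < 1) {x : ℂ} (hx : x ≠ 0) :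
    DifferentiableAt ℂ (theta p) x := by
  have h := differentiable_qPochInf hp1
  refine DifferentiableAt.mul (h x) ?_
  exact (h (p / x)).comp x (by fun_prop (disch := exact hx))

lemma analyticAt_theta (hp1 : ‖p‖ < 1) {x : ℂ} (hx : x ≠ 0) : AnalyticAt ℂ (theta p) x :=
  DifferentiableOn.analyticAt (s := {0}ᶜ)
    (fun _ hy => (differentiableAt_theta hp1 hy).differentiableWithinAt)
    (isOpen_compl_singleton.mem_nhds hx)

end Theta

/-! ### Laurent coefficients and interpolation by theta functions -/

/-- The coefficient of `z ^ k` in the Laurent expansion of a function on `ℂ \ {0}`. -/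
def laurentCoeff (f : ℂ → ℂ) (k : ℤ) : ℂ := Real.circleAverage (fun z => f z * z ^ (-k)) 0 1

lemma circleAverage_eq_of_pos {f : ℂ → ℂ} (hf : ∀ z, z ≠ 0 → DifferentiableAt ℂ f z)
    {r : ℝ} (hr : 0 < r) : Real.circleAverage f 0 r = Real.circleAverage f 0 1 := by
  have key : ∀ r R : ℝ, 0 < r → r ≤ R →
      Real.circleAverage f 0 R = Real.circleAverage f 0 r := by
    intro r R h0 hle
    rw [Real.circleAverage_eq_circleIntegral (h0.trans_le hle).ne',
      Real.circleAverage_eq_circleIntegral h0.ne']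
    congr 1
    refine Complex.circleIntegral_sub_center_inv_smul_eq_of_differentiable_on_annulus_off_countable
      h0 hle Set.countable_empty (fun z hz => ?_) fun z hz => hf z ?_
    · refine (hf z ?_).continuousAt.continuousWithinAt
      rintro rfl
      exact hz.2 (mem_ball_self h0)
    · rintro rfl
      exact hz.1.2 (mem_closedBall_self h0.le)
  rcases le_total r 1 with h | h
  · exact (key r 1 hr h).symm
  · exact key 1 r one_pos h

lemma circleAverage_mul_left (f : ℂ → ℂ) (a : ℂ) :
    Real.circleAverage (fun z => f (a * z)) 0 1 = Real.circleAverage f 0 ‖a‖ := by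
  rw [Real.circleAverage_eq_integral_add (f := f) a.arg, Real.circleAverage]
  congr 1
  refine intervalIntegral.integral_congr fun θ _ => ?_
  simp only [circleMap, zero_add, Complex.ofReal_one, one_mul, Complex.ofReal_add]
  congr 1
  conv_lhs => rw [← Complex.norm_mul_exp_arg_mul_I a]
  rw [mul_assoc, ← Complex.exp_add]
  congr 2; ring

lemma laurentCoeff_dilate {f : ℂ → ℂ} (hf : ∀ z, z ≠ 0 → DifferentiableAt ℂ f z) {a : ℂ}
    (ha : a ≠ 0) (k : ℤ) : laurentCoeff (fun z => f (a * z)) k = a ^ k * laurentCoeff f k := by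
  have h1 : ∀ z : ℂ, z ≠ 0 → DifferentiableAt ℂ (fun z => f z * z ^ (-k)) z := fun z hz =>
    (hf z hz).mul (differentiableAt_zpow.2 (Or.inl hz))
  rw [laurentCoeff, laurentCoeff, ← circleAverage_eq_of_pos h1 (norm_pos_iff.2 ha),
    ← circleAverage_mul_left, ← smul_eq_mul, ← Real.circleAverage_fun_smul]
  refine Real.circleAverage_congr_sphere fun z _ => ?_
  simp only [smul_eq_mul, mul_zpow, zpow_neg]
  have := zpow_ne_zero k ha
  field_simp

/-- A holomorphic function on `ℂ \ {0}` is determined by its Laurent coefficients. -/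
lemma eq_zero_of_laurentCoeff {f : ℂ → ℂ} (hf : ∀ z, z ≠ 0 → DifferentiableAt ℂ f z)
    (h : ∀ k, laurentCoeff f k = 0) {a : ℂ} (ha : a ≠ 0) : f a = 0 := by
  have h' : ∀ k, laurentCoeff (fun z => f (a * z)) k = 0 := fun k => by
    rw [laurentCoeff_dilate hf ha, h, mul_zero]
  have : Fact (0 < 2 * Real.pi) := ⟨Real.two_pi_pos⟩
  let F : C(AddCircle (2 * Real.pi), ℂ) :=
    ⟨fun x => f (a * (AddCircle.toCircle x : ℂ)), by
      refine continuous_iff_continuousAt.2 fun x => ?_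
      refine ContinuousAt.comp (f := fun x => a * (AddCircle.toCircle x : ℂ))
        (hf _ (mul_ne_zero ha (Circle.coe_ne_zero _))).continuousAt ?_
      have := AddCircle.continuous_toCircle (T := 2 * Real.pi)
      fun_prop⟩
  have hF : ∀ n, fourierCoeff F n = 0 := by
    intro n
    rw [fourierCoeff_eq_intervalIntegral F n 0, zero_add]
    have := h' n
    rw [laurentCoeff, Real.circleAverage] at this
    rw [one_div, ← this]
    congr 1
    refine intervalIntegral.integral_congr fun θ _ => ?_
    have e1 : circleMap 0 1 θ = Complex.exp (θ * Complex.I) := by simp [circleMap]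
    have e2 : ((AddCircle.toCircle (θ : AddCircle (2 * Real.pi)) : Circle) : ℂ)
        = Complex.exp (θ * Complex.I) := by
      rw [AddCircle.toCircle_apply_mk, Circle.coe_exp]
      congr 2
      push_cast
      have : (Real.pi : ℂ) ≠ 0 := by exact_mod_cast Real.pi_ne_zero
      field_simp
    simp only [F, ContinuousMap.coe_mk, smul_eq_mul, e1, e2, fourier_coe_apply]
    rw [mul_comm, ← Complex.exp_int_mul]
    congr 2
    have : (Real.pi : ℂ) ≠ 0 := by exact_mod_cast Real.pi_ne_zero
    push_cast
    field_simp
  have hs : Summable (fourierCoeff F) := by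
    rw [show fourierCoeff (F : AddCircle (2 * Real.pi) → ℂ) = fun _ => 0 from funext hF]
    exact summable_zero
  have := has_pointwise_sum_fourier_series_of_summable hs 0
  simp only [hF, zero_smul] at this
  have := this.unique hasSum_zero
  simpa [F] using this

lemma laurentCoeff_sum {ι : Type*} (s : Finset ι) (c : ι → ℂ) (f : ι → ℂ → ℂ)
    (hf : ∀ i ∈ s, ∀ z, z ≠ 0 → DifferentiableAt ℂ (f i) z) (k : ℤ) :
    laurentCoeff (fun z => ∑ i ∈ s, c i * f i z) k = ∑ i ∈ s, c i * laurentCoeff (f i) k := by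
  simp only [laurentCoeff]
  have : ∀ i, c i * Real.circleAverage (fun z => f i z * z ^ (-k)) 0 1
      = Real.circleAverage (fun z => c i * (f i z * z ^ (-k))) 0 1 := fun i => by
    rw [← smul_eq_mul, ← Real.circleAverage_fun_smul]; rfl
  simp only [this]
  rw [← Real.circleAverage_fun_sum]
  · congr 1; ext z; rw [sum_mul]; exact sum_congr rfl fun i _ => by ring
  · intro i hi
    refine ContinuousOn.circleIntegrable zero_le_one fun z hz => ?_
    have hz : z ≠ 0 := by rintro rfl; simp at hz
    refine ContinuousAt.continuousWithinAt (DifferentiableAt.continuousAt (𝕜 := ℂ) ?_)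
    exact (differentiableAt_const _).mul
      ((hf i hi z hz).mul (differentiableAt_zpow.2 (Or.inl hz)))

/-- A quasi-periodic function with `m` prescribed zeros vanishes: its Laurent coefficients are
determined by `m` consecutive ones, so that the space of functions with this multiplier has
dimension at most `m`, and products of theta functions separate the `m` points. -/
lemma eq_zero_of_quasiperiodic {p : ℂ} (hp : p ≠ 0) (hp1 : ‖p‖ < 1) {ι : Type*} [Fintype ι]
    [DecidableEq ι] [Nonempty ι] {f : ℂ → ℂ} {K : ℂ} (hK : K ≠ 0)
    (hf : ∀ z, z ≠ 0 → DifferentiableAt ℂ f z)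
    (hper : ∀ a, a ≠ 0 → f (p * a) = K * (a ^ Fintype.card ι)⁻¹ * f a)
    (x : ι → ℂ) (hx : ∀ i, x i ≠ 0) (hxx : ∀ i j, i ≠ j → theta p (x i / x j) ≠ 0)
    (hgen : theta p ((-1) ^ Fintype.card ι * (∏ i, x i) / K) ≠ 0) (hfx : ∀ i, f (x i) = 0)
    {a : ℂ} (ha : a ≠ 0) : f a = 0 := by
  set m := Fintype.card ι with hm
  have hm0 : 0 < m := Fintype.card_pos
  have hX : ∏ i, x i ≠ 0 := prod_ne_zero_iff.2 fun i _ => hx i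
  have hs : ((-1 : ℂ) ^ m) ≠ 0 := pow_ne_zero _ (by norm_num)
  -- the products of theta functions that vanish at all points but one
  let y : ι → ℂ := fun i => (-1) ^ m * K * x i / ∏ i, x i
  have hy : ∀ i, y i ≠ 0 := fun i => div_ne_zero (mul_ne_zero (mul_ne_zero hs hK) (hx i)) hX
  let g : ι → ℂ → ℂ := fun i a =>
    (∏ k ∈ univ.erase i, theta p (a / x k)) * theta p (a / y i)
  let F : Option ι → ℂ → ℂ := fun o => o.elim f g
  have hFd : ∀ o z, z ≠ 0 → DifferentiableAt ℂ (F o) z := by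
    have hd : ∀ c : ℂ, c ≠ 0 → ∀ z : ℂ, z ≠ 0 →
        DifferentiableAt ℂ (fun z => theta p (z / c)) z := fun c hc z hz =>
      DifferentiableAt.comp (g := theta p) (f := fun z => z / c) z
        (differentiableAt_theta hp1 (div_ne_zero hz hc)) (by fun_prop)
    rintro (_ | i) z hz
    · exact hf z hz
    · refine DifferentiableAt.mul ?_ (hd _ (hy i) z hz)
      exact DifferentiableAt.fun_finsetProd fun k _ => hd _ (hx k) z hz
  have hFp : ∀ o z, z ≠ 0 → F o (p * z) = K * (z ^ m)⁻¹ * F o z := by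
    rintro (_ | i) z hz
    · exact hper z hz
    · have e : ∀ c : ℂ, c ≠ 0 → theta p (p * z / c) = (-c / z) * theta p (z / c) := by
        intro c hc
        rw [mul_div_assoc, theta_p_mul hp hp1 (div_ne_zero hz hc)]
        congr 1; field_simp
      change (∏ k ∈ univ.erase i, theta p (p * z / x k)) * theta p (p * z / y i)
        = K * (z ^ m)⁻¹ * ((∏ k ∈ univ.erase i, theta p (z / x k)) * theta p (z / y i))
      rw [prod_congr rfl fun k _ => e _ (hx k), e _ (hy i), prod_mul_distrib]
      have h1 : (∏ k ∈ univ.erase i, (-x k / z)) * (-y i / z) = K * (z ^ m)⁻¹ := by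
        have h2 : ∏ k, (-x k / z) = (-1) ^ m * (∏ k, x k) / z ^ m := by
          rw [prod_div_distrib, prod_const, card_univ, ← hm]
          congr 1
          rw [prod_congr rfl fun k _ => (neg_one_mul (x k)).symm,
            prod_mul_distrib, prod_const, card_univ, ← hm]
        have h3 := mul_prod_erase univ (fun k => -x k / z) (mem_univ i)
        have h4 : -y i / z = (-x i / z) * ((-1) ^ m * K / ∏ k, x k) := by
          simp only [y]; ring
        rw [h4, ← mul_assoc, mul_comm (∏ k ∈ _, _), h3, h2]
        have h5 : ((-1 : ℂ) ^ m) * (-1) ^ m = 1 := by rw [← mul_pow]; norm_num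
        field_simp
        linear_combination h5
      linear_combination (∏ k ∈ univ.erase i, theta p (z / x k)) * theta p (z / y i) * h1
  have hstep : ∀ G : ℂ → ℂ, (∀ z, z ≠ 0 → DifferentiableAt ℂ G z) →
      (∀ z, z ≠ 0 → G (p * z) = K * (z ^ m)⁻¹ * G z) → ∀ k : ℤ,
      p ^ k * laurentCoeff G k = K * laurentCoeff G (k + m) := by
    intro G hG hGp k
    rw [← laurentCoeff_dilate hG hp, laurentCoeff, laurentCoeff, ← smul_eq_mul (a := K),
      ← Real.circleAverage_fun_smul]
    refine Real.circleAverage_congr_sphere fun z hz => ?_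
    have hz : z ≠ 0 := by rintro rfl; simp at hz
    simp only [hGp z hz, smul_eq_mul]
    rw [neg_add, zpow_add₀ hz, zpow_neg z m, zpow_natCast]
    ring
  have hdep : ¬ LinearIndependent ℂ
      (fun (o : Option ι) (k : Fin m) => laurentCoeff (F o) (k : ℤ)) := by
    intro hli
    have := hli.fintype_card_le_finrank
    simp [← hm] at this
  obtain ⟨c, hc, o, ho⟩ := Fintype.not_linearIndependent_iff.1 hdep
  let G : ℂ → ℂ := fun z => ∑ o, c o * F o z
  have hGd : ∀ z, z ≠ 0 → DifferentiableAt ℂ G z := fun z hz =>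
    DifferentiableAt.fun_sum fun o _ => (differentiableAt_const _).mul (hFd o z hz)
  have hGp : ∀ z, z ≠ 0 → G (p * z) = K * (z ^ m)⁻¹ * G z := fun z hz => by
    simp only [G, mul_sum]
    exact sum_congr rfl fun o _ => by rw [hFp o z hz]; ring
  have hG0 : ∀ k : ℕ, k < m → laurentCoeff G k = 0 := fun k hk => by
    have := congrFun hc ⟨k, hk⟩
    simp only [G]
    rw [laurentCoeff_sum _ _ _ fun o _ => hFd o]
    simpa using this
  have hGk : ∀ (j : ℤ) (k : ℕ), k < m → laurentCoeff G (k + j * m) = 0 := by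
    intro j k hk
    induction j using Int.induction_on with
    | zero => simpa using hG0 k hk
    | succ j ih =>
      have := hstep G hGd hGp (k + j * m)
      rw [ih, mul_zero] at this
      rw [show (k : ℤ) + (j + 1) * m = k + j * m + m by ring]
      exact (mul_eq_zero.1 this.symm).resolve_left hK
    | pred j ih =>
      have := hstep G hGd hGp (k + (-(j : ℤ) - 1) * m)
      rw [show (k : ℤ) + (-(j : ℤ) - 1) * m + m = k + (-(j : ℤ)) * m by ring, ih, mul_zero] at this
      exact (mul_eq_zero.1 this).resolve_left (zpow_ne_zero _ hp)
  have hGall : ∀ k : ℤ, laurentCoeff G k = 0 := fun k => by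
    have hm' : (m : ℤ) ≠ 0 := by exact_mod_cast hm0.ne'
    have h1 := Int.emod_add_mul_ediv k m
    have h2 := Int.emod_nonneg k hm'
    have h3 := Int.emod_lt_of_pos k (show (0 : ℤ) < m by exact_mod_cast hm0)
    have := hGk (k / m) (k % m).toNat (by omega)
    rwa [Int.toNat_of_nonneg h2, mul_comm, h1] at this
  have hGz : ∀ z, z ≠ 0 → G z = 0 := fun z hz => eq_zero_of_laurentCoeff hGd hGall hz
  have hgi : ∀ i j, i ≠ j → g j (x i) = 0 := fun i j hij => by
    simp only [g]
    rw [prod_eq_zero (i := i) (by simp [hij]), zero_mul]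
    rw [div_self (hx i), theta_one hp hp1]
  have hgii : ∀ i, g i (x i) ≠ 0 := fun i => by
    refine mul_ne_zero (prod_ne_zero_iff.2 fun k hk => ?_) ?_
    · exact hxx i k (ne_of_mem_erase hk).symm
    · convert hgen using 2
      simp only [y]
      have h5 : ((-1 : ℂ) ^ m) * (-1) ^ m = 1 := by rw [← mul_pow]; norm_num
      have := hx i
      field_simp
      linear_combination -h5
  have hci : ∀ i, c (some i) = 0 := fun i => by
    have h1 := hGz (x i) (hx i)
    simp only [G, Fintype.sum_option, F, Option.elim, hfx, mul_zero, zero_add] at h1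
    rw [sum_eq_single i (fun j _ hj => by rw [hgi i j hj.symm, mul_zero]) (by simp)] at h1
    exact (mul_eq_zero.1 h1).resolve_right (hgii i)
  have hc0 : c none ≠ 0 := by
    cases o with
    | none => exact ho
    | some i => exact absurd (hci i) ho
  have h1 := hGz a ha
  simp only [G, Fintype.sum_option, F, Option.elim, hci, zero_mul, sum_const_zero,
    add_zero] at h1
  exact (mul_eq_zero.1 h1).resolve_left hc0

/-! ### The constant term of the elliptic difference operator -/

/-- `θ(t x; p) / θ(x; p)`, the interaction factor of the difference operators. -/
def thetaQuot (p t x : ℂ) : ℂ := theta p (t * x) / theta p x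

/-- The point obtained from `z` by inverting the coordinates outside `A`. -/
def signed {ι : Type*} [DecidableEq ι] (z : ι → ℂ) (A : Finset ι) (i : ι) : ℂ :=
  if i ∈ A then z i else (z i)⁻¹

/-- The coefficient
`∏_i (∏_r θ(u_r w_i)) / θ(w_i²) ∏_{i < k} θ(t w_i w_k) / θ(w_i w_k)` of the elliptic difference
operator with parameters `u₀, …, u₃` in the variables indexed by `s`. -/
def opCoeff (p t : ℂ) {ι : Type*} [LinearOrder ι] (u : Fin 4 → ℂ) (s : Finset ι) (w : ι → ℂ) : ℂ :=
  (∏ i ∈ s, (∏ r, theta p (u r * w i)) / theta p (w i ^ 2)) *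
    ∏ i ∈ s, ∏ k ∈ s with i < k, thetaQuot p t (w i * w k)

lemma prod_pairs_insert {ι M : Type*} [LinearOrder ι] [CommMonoid M] (g : ι → ι → M)
    (hg : ∀ i k, g i k = g k i) {j : ι} {s : Finset ι} (hj : j ∉ s) :
    ∏ i ∈ insert j s, ∏ k ∈ insert j s with i < k, g i k =
      (∏ i ∈ s, g j i) * ∏ i ∈ s, ∏ k ∈ s with i < k, g i k := by
  rw [prod_insert hj]
  have h1 : ∀ i ∈ s, ∏ k ∈ insert j s with i < k, g i k
      = (if i < j then g i j else 1) * ∏ k ∈ s with i < k, g i k := by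
    intro i _
    rw [filter_insert]
    split_ifs
    · rw [prod_insert (by simp [hj])]
    · rw [one_mul]
  rw [prod_congr rfl h1, prod_mul_distrib, ← mul_assoc]
  congr 1
  rw [filter_insert, if_neg (lt_irrefl j), prod_filter, ← prod_mul_distrib]
  refine prod_congr rfl fun i hi => ?_
  have hne : i ≠ j := fun h => hj (h ▸ hi)
  rcases lt_or_gt_of_ne hne with h | h
  · rw [if_neg (not_lt.2 h.le), if_pos h, one_mul, hg]
  · rw [if_pos h, if_neg (not_lt.2 h.le), mul_one]

section

variable {p t : ℂ} {ι : Type*} [LinearOrder ι]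

local notation "θ" => theta p

lemma opCoeff_congr {u : Fin 4 → ℂ} {s : Finset ι} {w w' : ι → ℂ} (h : ∀ i ∈ s, w i = w' i) :
    opCoeff p t u s w = opCoeff p t u s w' := by
  unfold opCoeff
  congr 1
  · exact prod_congr rfl fun i hi => by rw [h i hi]
  · refine prod_congr rfl fun i hi => prod_congr rfl fun k hk => ?_
    rw [h i hi, h k (mem_filter.1 hk).1]

lemma opCoeff_eq_zero {u : Fin 4 → ℂ} {s : Finset ι} {w : ι → ℂ} {i : ι} (hi : i ∈ s)
    {r : Fin 4} (h : θ (u r * w i) = 0) : opCoeff p t u s w = 0 := by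
  rw [opCoeff, prod_eq_zero hi, zero_mul]
  rw [prod_eq_zero (mem_univ r) h, zero_div]

/-- If `w j = a`, the factors of index `j` cancel against the parameter `a` and turn it into `t * a`
in the remaining factors. -/
lemma opCoeff_reduce {a b c d : ℂ} {s : Finset ι} {w : ι → ℂ} {j : ι} (hj : j ∉ s)
    (hw : w j = a) (ha : θ (a ^ 2) ≠ 0) (hs : ∀ i ∈ s, θ (a * w i) ≠ 0) :
    opCoeff p t ![a, b, c, d] (insert j s) w =
      θ (b * a) * θ (c * a) * θ (d * a) *
        opCoeff p t ![t * a, b, c, d] s w := by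
  unfold opCoeff
  rw [prod_pairs_insert _ (fun i k => by rw [mul_comm]) hj, prod_insert hj, hw]
  have h1 : (∏ i ∈ s, (∏ r, θ (![a, b, c, d] r * w i)) / θ (w i ^ 2)) *
      ∏ i ∈ s, thetaQuot p t (a * w i) =
      ∏ i ∈ s, (∏ r, θ (![t * a, b, c, d] r * w i)) / θ (w i ^ 2) := by
    rw [← prod_mul_distrib]
    refine prod_congr rfl fun i hi => ?_
    have := hs i hi
    simp only [thetaQuot, Fin.prod_univ_four, Matrix.cons_val, mul_assoc]
    field_simp
  have h2 : (∏ r, θ (![a, b, c, d] r * a)) / θ (a ^ 2)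
      = θ (b * a) * θ (c * a) * θ (d * a) := by
    simp only [Fin.prod_univ_four, Matrix.cons_val, ← pow_two]
    field_simp
  rw [h2, ← h1]
  ring

lemma theta_div_p (hp : p ≠ 0) (hp1 : ‖p‖ < 1) {x : ℂ} (hx : x ≠ 0) :
    θ (x / p) = -(x / p) * θ x := by
  have := theta_p_mul hp hp1 (div_ne_zero hx hp)
  rw [mul_div_cancel₀ _ hp] at this
  rw [this]; field_simp

lemma theta_inv_ne_zero (hp : p ≠ 0) (hp1 : ‖p‖ < 1) {x : ℂ} (hx : x ≠ 0)
    (h : θ x ≠ 0) : θ x⁻¹ ≠ 0 := by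
  rw [theta_inv hp hp1 hx]
  exact mul_ne_zero (neg_ne_zero.2 (inv_ne_zero hx)) h

lemma signed_ne_zero {z : ι → ℂ} (hz : ∀ i, z i ≠ 0) (A : Finset ι) (i : ι) :
    signed z A i ≠ 0 := by
  unfold signed; split_ifs
  · exact hz i
  · exact inv_ne_zero (hz i)

/-- The image of the constant function `1` under the elliptic difference operator. Both sides are
quasi-periodic in `u 0`, and they agree at the points `z_j^{±1}`, where the left side reduces to
the sum for one variable less. -/
lemma sum_opCoeff (hp : p ≠ 0) (hp1 : ‖p‖ < 1) (ht : t ≠ 0) {z : ι → ℂ} (hz : ∀ i, z i ≠ 0)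
    {b c : ℂ} (hb : b ≠ 0) (hc : c ≠ 0)
    (hbc : ∀ (m k : ℕ) (l : ℤ), (b * c * t ^ m) ^ (k + 1) ≠ p ^ l)
    (n : ℕ) : ∀ (s : Finset ι), s.card = n →
    (∀ i ∈ s, θ (z i ^ 2) ≠ 0) →
    (∀ i ∈ s, ∀ j ∈ s, i ≠ j → θ (z i * z j) ≠ 0 ∧ θ (z i / z j) ≠ 0) →
    ∀ a d : ℂ, a ≠ 0 → t ^ n * (a * b * c * d) = p * t →
    ∑ A ∈ s.powerset, opCoeff p t ![a, b, c, d] s (signed z A) =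
      ∏ i ∈ range n,
        (θ (t ^ i * (a * b)) * θ (t ^ i * (a * c)) * θ (t ^ i * (b * c))) := by
  induction n with
  | zero =>
    intro s hs _ _ a d _ _
    rw [card_eq_zero.1 hs]
    simp [opCoeff]
  | succ n ih =>
    intro s hs hz2 hzz
    -- the product `e` of the first and the last parameter is fixed
    set e : ℂ := p / (t ^ n * (b * c)) with he
    have htn : t ^ n ≠ 0 := pow_ne_zero _ ht
    have he0 : e ≠ 0 := by
      rw [he]; exact div_ne_zero hp (mul_ne_zero htn (mul_ne_zero hb hc))
    let f : ℂ → ℂ := fun a =>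
      ∑ A ∈ s.powerset, opCoeff p t ![a, b, c, e / a] s (signed z A) -
      ∏ i ∈ range (n + 1),
        (θ (t ^ i * (a * b)) * θ (t ^ i * (a * c)) * θ (t ^ i * (b * c)))
    suffices hf : ∀ a, a ≠ 0 → f a = 0 by
      intro a d ha had
      have hd : d = e / a := by
        rw [he]; field_simp
        rw [pow_succ] at had
        exact mul_right_cancel₀ ht (by linear_combination had)
      rw [hd]
      exact sub_eq_zero.1 (hf a ha)
    have hsne : s.Nonempty := card_pos.1 (by omega)
    have hne : Nonempty s := hsne.to_subtype
    let x : s × Bool → ℂ := fun q => if q.2 then z q.1 else (z q.1)⁻¹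
    have hx : ∀ q, x q ≠ 0 := fun q => by
      simp only [x]; split_ifs
      · exact hz _
      · exact inv_ne_zero (hz _)
    have hcard : Fintype.card (s × Bool) = 2 * (n + 1) := by
      simp [hs]; ring
    intro a ha
    refine eq_zero_of_quasiperiodic hp hp1 (K := (e / p) ^ (n + 1))
      (pow_ne_zero _ (div_ne_zero he0 hp)) ?_ ?_ x hx ?_ ?_ ?_ ha
    · intro a ha
      have hθ : ∀ g : ℂ → ℂ, DifferentiableAt ℂ g a → g a ≠ 0 →
          DifferentiableAt ℂ (fun a => θ (g a)) a := fun g hg h0 =>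
        DifferentiableAt.comp (g := θ) a (differentiableAt_theta hp1 h0) hg
      refine DifferentiableAt.sub (DifferentiableAt.fun_sum fun A _ => ?_) ?_
      · refine DifferentiableAt.mul_const (DifferentiableAt.fun_finsetProd fun i _ => ?_) _
        simp only [Fin.prod_univ_four, Matrix.cons_val]
        have hw := signed_ne_zero hz A i
        refine DifferentiableAt.div_const (DifferentiableAt.mul (DifferentiableAt.mul
          (DifferentiableAt.mul ?_ ?_) ?_) ?_) _
        · exact hθ _ (by fun_prop) (mul_ne_zero ha hw)
        · exact differentiableAt_const _
        · exact differentiableAt_const _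
        · exact hθ _ (by fun_prop (disch := exact ha)) (mul_ne_zero (div_ne_zero he0 ha) hw)
      · refine DifferentiableAt.fun_finsetProd fun i _ => ?_
        have := pow_ne_zero i ht
        exact ((hθ _ (by fun_prop) (by positivity)).mul (hθ _ (by fun_prop) (by positivity))).mul
          (differentiableAt_const _)
    · intro a ha
      rw [hcard]
      simp only [f]
      rw [mul_sub, mul_sum]
      have hpow : (e / p) ^ (n + 1) * (a ^ (2 * (n + 1)))⁻¹ = (e / p * (a ^ 2)⁻¹) ^ (n + 1) := by
        rw [mul_pow, inv_pow, ← pow_mul]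
      rw [hpow]
      congr 1
      · refine sum_congr rfl fun A _ => ?_
        rw [opCoeff, opCoeff, ← mul_assoc]
        congr 1
        rw [← hs, ← prod_const, ← prod_mul_distrib]
        refine prod_congr rfl fun i _ => ?_
        have hw := signed_ne_zero hz A i
        simp only [Fin.prod_univ_four, Matrix.cons_val]
        rw [show p * a * signed z A i = p * (a * signed z A i) by ring,
          theta_p_mul hp hp1 (mul_ne_zero ha hw),
          show e / (p * a) * signed z A i = (e / a * signed z A i) / p by field_simp,
          theta_div_p hp hp1 (mul_ne_zero (div_ne_zero he0 ha) hw)]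
        field_simp
      · -- the factors `i` and `n - i` are paired
        have hR : ∀ a : ℂ, ∏ i ∈ range (n + 1), (θ (t ^ i * (a * b)) *
            θ (t ^ i * (a * c)) * θ (t ^ i * (b * c))) =
            (∏ i ∈ range (n + 1), (θ (t ^ i * (a * b)) *
              θ (t ^ (n - i) * (a * c)))) *
              ∏ i ∈ range (n + 1), θ (t ^ i * (b * c)) := by
          intro a
          rw [prod_mul_distrib, prod_mul_distrib, prod_mul_distrib]
          congr 2
          rw [← prod_range_reflect]
          exact prod_congr rfl fun i _ => by rw [Nat.add_sub_cancel]
        rw [hR, hR, ← mul_assoc]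
        congr 1
        rw [← card_range (n + 1), ← prod_const, card_range,
          ← prod_mul_distrib]
        refine prod_congr rfl fun i hi => ?_
        have hi' : i ≤ n := by have := mem_range.1 hi; omega
        have h1 := pow_ne_zero i ht
        have h2 := pow_ne_zero (n - i) ht
        rw [show t ^ i * (p * a * b) = p * (t ^ i * (a * b)) by ring,
          show t ^ (n - i) * (p * a * c) = p * (t ^ (n - i) * (a * c)) by ring,
          theta_p_mul hp hp1 (by positivity), theta_p_mul hp hp1 (by positivity), he,
          ← pow_sub_mul_pow t hi']
        field_simp
    · rintro ⟨i, β⟩ ⟨j, γ⟩ hij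
      have hi := hz i
      have hj := hz j
      have hinv : ∀ y : ℂ, y ≠ 0 → θ y⁻¹ ≠ 0 → θ y ≠ 0 := fun y hy h => by
        simpa using theta_inv_ne_zero hp hp1 (inv_ne_zero hy) h
      by_cases hij' : i = j
      · subst hij'
        have h2 := hz2 i i.2
        have : β ≠ γ := fun h => hij (by rw [h])
        cases β <;> cases γ <;> simp only [x, ne_eq, not_true_eq_false, Bool.false_eq_true,
          if_true, if_false] at this ⊢
        · refine hinv _ (by positivity) ?_
          convert h2 using 2; field_simp
        · convert h2 using 2; field_simp
      · have h3 := hzz i i.2 j j.2 (fun h => hij' (Subtype.ext h))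
        have h4 := hzz j j.2 i i.2 (fun h => hij' (Subtype.ext h.symm))
        cases β <;> cases γ <;> simp only [x, Bool.false_eq_true, if_true, if_false]
        · convert h4.2 using 2; field_simp
        · refine hinv _ (by positivity) ?_
          convert h3.1 using 2; field_simp
        · convert h3.1 using 2; field_simp
        · exact h3.2
    · have h1 : ∏ q, x q = 1 := by
        rw [Fintype.prod_prod_type]
        refine prod_eq_one fun i _ => ?_
        simp [x, hz]
      rw [hcard, h1, mul_one, pow_mul]
      have h2 : ((-1 : ℂ) ^ 2) ^ (n + 1) / (e / p) ^ (n + 1) = (b * c * t ^ n) ^ (n + 1) := by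
        rw [← div_pow]
        congr 1
        rw [he]; field_simp
      rw [h2]
      exact theta_ne_zero hp hp1 (by positivity) (hbc n n)
    · rintro ⟨⟨j, hj⟩, β⟩
      -- only the terms with `w_j = a` survive
      set a := x (⟨j, hj⟩, β) with hax
      have ha : a ≠ 0 := hx _
      have hjs : j ∉ s.erase j := notMem_erase j s
      have hs' : (s.erase j).card = n := by rw [card_erase_of_mem hj, hs]; rfl
      have hdiv : e / a * a = e := div_mul_cancel₀ _ ha
      have haj : a = z j ∨ a = (z j)⁻¹ := by
        cases β
        · right; simp [hax, x]
        · left; simp [hax, x]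
      have hinv : ∀ y : ℂ, y ≠ 0 → θ y⁻¹ ≠ 0 → θ y ≠ 0 := fun y hy h => by
        simpa using theta_inv_ne_zero hp hp1 (inv_ne_zero hy) h
      have ha2 : θ (a ^ 2) ≠ 0 := by
        rcases haj with h | h
        · rw [h]; exact hz2 j hj
        · rw [h, inv_pow]
          exact theta_inv_ne_zero hp hp1 (pow_ne_zero _ (hz j)) (hz2 j hj)
      have haw : ∀ (A : Finset ι), ∀ i ∈ s.erase j, θ (a * signed z A i) ≠ 0 := by
        intro A i hi
        have hi' := mem_erase.1 hi
        have h3 := hzz i hi'.2 j hj hi'.1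
        have h4 := hzz j hj i hi'.2 hi'.1.symm
        have h5 := hz i
        have h6 := hz j
        unfold signed
        rcases haj with h | h <;> rw [h] <;> split_ifs
        · exact h4.1
        · exact h4.2
        · convert h3.2 using 2; field_simp
        · refine hinv _ (by positivity) ?_
          convert h4.1 using 2; field_simp
      have hred : ∀ A : Finset ι, signed z A j = a →
          opCoeff p t ![a, b, c, e / a] s (signed z A) =
          θ (b * a) * θ (c * a) * θ e *
            opCoeff p t ![t * a, b, c, e / a] (s.erase j) (signed z A) := by
        intro A hA
        have := opCoeff_reduce (p := p) (t := t) (b := b) (c := c) (d := e / a) hjs hA ha2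
          (haw A)
        rw [insert_erase hj, hdiv] at this
        exact this
      have hvan : ∀ A : Finset ι, signed z A j = a⁻¹ →
          opCoeff p t ![a, b, c, e / a] s (signed z A) = 0 := by
        intro A hA
        refine opCoeff_eq_zero hj (r := 0) ?_
        simp only [Matrix.cons_val, hA, mul_inv_cancel₀ ha]
        exact theta_one hp hp1
      have hsum : ∑ A ∈ s.powerset, opCoeff p t ![a, b, c, e / a] s (signed z A) =
          ∑ A ∈ (s.erase j).powerset, θ (b * a) * θ (c * a) * θ e *
            opCoeff p t ![t * a, b, c, e / a] (s.erase j) (signed z A) := by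
        conv_lhs => rw [← insert_erase hj]
        rw [sum_powerset_insert hjs, insert_erase hj, ← sum_add_distrib]
        refine sum_congr rfl fun A hA => ?_
        have hjA : j ∉ A := fun h => hjs (mem_powerset.1 hA h)
        have h1 : signed z A j = (z j)⁻¹ := by simp [signed, hjA]
        have h2 : signed z (insert j A) j = z j := by simp [signed]
        rcases haj with h | h
        · rw [hvan A (by rw [h1, h]), hred (insert j A) (by rw [h2, h]), zero_add]
          congr 1
          refine opCoeff_congr fun i hi => ?_
          have : i ≠ j := ne_of_mem_erase hi
          simp [signed, this]
        · rw [hvan (insert j A) (by rw [h2, h, inv_inv]), hred A (by rw [h1, h]), add_zero]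
      simp only [f]
      rw [hsum, ← mul_sum, ih (s.erase j) hs'
        (fun i hi => hz2 i (mem_of_mem_erase hi))
        (fun i hi k hk => hzz i (mem_of_mem_erase hi) k (mem_of_mem_erase hk))
        (t * a) (e / a) (by positivity) (by rw [he]; field_simp)]
      simp only [prod_mul_distrib]
      rw [prod_range_succ' (fun i => θ (t ^ i * (a * b))),
        prod_range_succ' (fun i => θ (t ^ i * (a * c))),
        prod_range_succ (fun i => θ (t ^ i * (b * c)))]
      have h1 : θ e = θ (t ^ n * (b * c)) := by rw [he, theta_p_div hp]
      rw [h1]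
      simp only [pow_succ, pow_zero, one_mul, mul_assoc, mul_comm a]
      ring

end

/-! ### Products over the boxes of a partition -/

/-- `∏_{r < m} φ(x q^r)`. -/
def poch (φ : ℂ → ℂ) (q x : ℂ) (m : ℕ) : ℂ := ∏ r ∈ range m, φ (x * q ^ r)

section poch

variable (φ : ℂ → ℂ) (q x : ℂ)

lemma poch_succ (m : ℕ) : poch φ q x (m + 1) = poch φ q x m * φ (x * q ^ m) :=
  prod_range_succ _ _

lemma poch_succ' (m : ℕ) : poch φ q x (m + 1) = φ x * poch φ q (q * x) m := by
  rw [poch, prod_range_succ', mul_comm]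
  simp only [pow_zero, mul_one, poch]
  congr 1
  exact prod_congr rfl fun r _ => by ring_nf

lemma poch_add (m k : ℕ) :
    poch φ q x (m + k) = poch φ q x m * ∏ j ∈ range k, φ (x * q ^ (m + j)) :=
  prod_range_add _ _ _

end poch

lemma lt_colLen_iff {n : ℕ} {l : Fin n → ℕ} (hl : Antitone l) (j : ℕ) (k : Fin n) :
    (k : ℕ) < colLen l j ↔ j < l k := by
  constructor
  · intro h
    by_contra hk
    have : (univ.filter fun i => j < l i) ⊆ Iio k := by
      intro i hi
      simp only [mem_filter, mem_univ, true_and, mem_Iio] at hi ⊢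
      by_contra hik
      exact hk (hi.trans_le (hl (not_lt.1 hik)))
    have := card_le_card this
    rw [Fin.card_Iio] at this
    simp only [colLen] at h
    omega
  · intro h
    have : Iic k ⊆ univ.filter fun i => j < l i := by
      intro i hi
      simp only [mem_filter, mem_univ, true_and, mem_Iic] at hi ⊢
      exact h.trans_le (hl hi)
    have := card_le_card this
    rw [Fin.card_Iic] at this
    simp only [colLen]
    omega

lemma colLen_le {n : ℕ} (l : Fin n → ℕ) (j : ℕ) : colLen l j ≤ n := by
  simpa [colLen] using card_filter_le (univ : Finset (Fin n)) fun i => j < l i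

/-- The basis of the row formulas below: a product over the rows `k ≥ c` telescopes. -/
lemma prod_telescope_Ici {M : Type*} [CommMonoid M] (g : ℕ → M) {c n : ℕ} (h : c ≤ n) :
    g c * ∏ k : Fin n, (if c ≤ k then g (k + 1) else 1) =
      g n * ∏ k : Fin n, (if c ≤ k then g k else 1) := by
  rw [Fin.prod_univ_eq_prod_range (fun k => if c ≤ k then g (k + 1) else 1),
    Fin.prod_univ_eq_prod_range (fun k => if c ≤ k then g k else 1)]
  induction n, h using Nat.le_induction with
  | base =>
    rw [prod_eq_one, prod_eq_one] <;> intro i hi <;>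
      rw [if_neg (by simpa using hi)]
  | succ n hn ih =>
    rw [prod_range_succ, prod_range_succ, if_pos hn, if_pos hn, ← mul_assoc, ih]
    ac_rfl

lemma prod_telescope_Ioo {M : Type*} [CommMonoid M] (g : ℕ → M) {i c n : ℕ} (hi : i < c)
    (h : c ≤ n) :
    g (c - 1) * ∏ k : Fin n, (if i < k ∧ (k : ℕ) < c then g (k - 1) else 1) =
      g i * ∏ k : Fin n, (if i < k ∧ (k : ℕ) < c then g k else 1) := by
  rw [Fin.prod_univ_eq_prod_range (fun k => if i < k ∧ k < c then g (k - 1) else 1),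
    Fin.prod_univ_eq_prod_range (fun k => if i < k ∧ k < c then g k else 1)]
  have key : ∀ m, i < m → m ≤ c →
      g (m - 1) * ∏ k ∈ range m, (if i < k ∧ k < c then g (k - 1) else 1) =
      g i * ∏ k ∈ range m, (if i < k ∧ k < c then g k else 1) := by
    intro m hm
    induction m, hm using Nat.le_induction with
    | base =>
      intro _
      rw [prod_eq_one, prod_eq_one, Nat.succ_sub_one] <;> intro k hk <;>
        rw [if_neg (by simp at hk; omega)]
    | succ m hm ih =>
      intro hmc
      have hm' : i < m := hm
      rw [prod_range_succ, prod_range_succ, if_pos ⟨hm', hmc⟩, if_pos ⟨hm', hmc⟩]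
      have := ih (by omega)
      rw [Nat.add_sub_cancel, mul_comm _ (g (m - 1)), this]
      ac_rfl
  have hsub : range c ⊆ range n := range_mono h
  rw [← prod_subset hsub, ← prod_subset hsub]
  · exact key c hi le_rfl
  · intro k _ hk; rw [if_neg (by simp at hk; omega)]
  · intro k _ hk; rw [if_neg (by simp at hk; omega)]

lemma prod_range_eq_ite {M : Type*} [CommMonoid M] (g : ℕ → M) {m n : ℕ} (h : m ≤ n) :
    ∏ j ∈ range m, g j = ∏ j ∈ range n, (if j < m then g j else 1) := by
  rw [← prod_filter]
  congr 1
  ext j; simp; omega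

section Symbols

variable (φ : ℂ → ℂ) {q t : ℂ} {n : ℕ} {l : Fin n → ℕ}

lemma C0_eq_poch (x : ℂ) : C0 φ q t l x = ∏ i : Fin n, poch φ q (t ^ (-(i : ℤ)) * x) (l i) := by
  refine prod_congr rfl fun i _ => prod_congr rfl fun j _ => ?_
  rw [zpow_natCast]; ring_nf

/-- The contribution of row `i` to `C⁻`: boxes whose columns end in the same row are collected into
a Pochhammer symbol. -/
lemma Cm_row (hl : Antitone l) (x : ℂ) (i : Fin n) :
    (∏ j ∈ range (l i),
      φ (q ^ ((l i : ℤ) - (j + 1)) * t ^ ((colLen l j : ℤ) - (i + 1)) * x)) *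
      ∏ k with i < k, poch φ q (t ^ ((k : ℤ) - i) * x) (l i - l k) =
    poch φ q (t ^ ((n : ℤ) - 1 - i) * x) (l i) *
      ∏ k with i < k, poch φ q (t ^ ((k : ℤ) - i - 1) * x) (l i - l k) := by
  let g : ℕ → ℕ → ℂ := fun j m => φ (q ^ ((l i : ℤ) - (j + 1)) * t ^ ((m : ℤ) - (i + 1)) * x)
  -- all factors are distributed over the boxes of row `i`, taken from right to left
  have hpoch : ∀ (m : ℕ), poch φ q (t ^ ((m : ℤ) - (i + 1)) * x) (l i) =
      ∏ j ∈ range (l i), g j m := by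
    intro m
    rw [poch, ← prod_range_reflect]
    refine prod_congr rfl fun j hj => ?_
    simp only [g]
    have hj := mem_range.1 hj
    rw [← zpow_natCast q, show ((l i - 1 - j : ℕ) : ℤ) = (l i : ℤ) - (j + 1) by omega]
    ring_nf
  have hpoch2 : ∀ (m : ℕ) (k : Fin n), i < k →
      poch φ q (t ^ ((m : ℤ) - (i + 1)) * x) (l i - l k) =
      ∏ j ∈ range (l i), (if colLen l j ≤ k then g j m else 1) := by
    intro m k hk
    rw [poch, prod_range_eq_ite _ (Nat.sub_le (l i) (l k)), ← prod_range_reflect]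
    refine prod_congr rfl fun j hj => ?_
    have hj := mem_range.1 hj
    have h1 : l i - 1 - j < l i - l k ↔ colLen l j ≤ k := by
      rw [← not_lt, lt_colLen_iff hl]; omega
    simp only [g, h1]
    split_ifs
    · rw [← zpow_natCast q, show ((l i - 1 - j : ℕ) : ℤ) = (l i : ℤ) - (j + 1) by omega]
      ring_nf
    · rfl
  have hn : poch φ q (t ^ ((n : ℤ) - 1 - i) * x) (l i) = ∏ j ∈ range (l i), g j n := by
    rw [← hpoch]; congr 3; ring
  have h1 : ∏ k with i < k, poch φ q (t ^ ((k : ℤ) - i) * x) (l i - l k) =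
      ∏ j ∈ range (l i), ∏ k : Fin n, (if colLen l j ≤ k then g j (k + 1) else 1) := by
    rw [Finset.prod_comm, prod_filter]
    refine prod_congr rfl fun k _ => ?_
    split_ifs with hk
    · rw [← hpoch2 _ k hk]; push_cast; congr 3; ring
    · refine (prod_eq_one fun j hj => ?_).symm
      rw [if_neg]
      rw [not_le, lt_colLen_iff hl]
      exact (mem_range.1 hj).trans_le (hl (not_lt.1 hk))
  have h2 : ∏ k with i < k, poch φ q (t ^ ((k : ℤ) - i - 1) * x) (l i - l k) =
      ∏ j ∈ range (l i), ∏ k : Fin n, (if colLen l j ≤ k then g j k else 1) := by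
    rw [Finset.prod_comm, prod_filter]
    refine prod_congr rfl fun k _ => ?_
    split_ifs with hk
    · rw [← hpoch2 _ k hk]; congr 3; ring
    · refine (prod_eq_one fun j hj => ?_).symm
      rw [if_neg]
      rw [not_le, lt_colLen_iff hl]
      exact (mem_range.1 hj).trans_le (hl (not_lt.1 hk))
  rw [hn, h1, h2, ← prod_mul_distrib, ← prod_mul_distrib]
  exact prod_congr rfl fun j _ => prod_telescope_Ici (g j) (colLen_le l j)

/-- The contribution of row `i` to `C⁺`, collected as for `C⁻`. -/
lemma Cp_row (hl : Antitone l) (x : ℂ) (i : Fin n) :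
    (∏ j ∈ range (l i),
      φ (q ^ ((l i : ℤ) + (j + 1) - 1) * t ^ (2 - (colLen l j : ℤ) - (i + 1)) * x)) *
      (poch φ q (t ^ (1 - (n : ℤ) - i) * x) (l i) *
        ∏ k with i < k, poch φ q (t ^ (1 - (k : ℤ) - i) * x) (l i + l k)) =
    poch φ q (t ^ (-2 * (i : ℤ)) * x) (2 * l i) *
      ∏ k with i < k, poch φ q (t ^ (-(k : ℤ) - i) * x) (l i + l k) := by
  let y : ℕ → ℂ := fun k => t ^ (-(k : ℤ) - i) * x
  let g : ℕ → ℕ → ℂ := fun j k => φ (y k * q ^ (l i + j))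
  have hi : (i : ℕ) < n := i.2
  have e1 : ∀ k : Fin n, i < k → t ^ (1 - (k : ℤ) - i) * x = y (k - 1) := by
    intro k hk
    have : 1 ≤ (k : ℕ) := by have : (i : ℕ) < k := hk; omega
    simp only [y]; push_cast [this]; ring_nf
  have e2 : t ^ (1 - (n : ℤ) - i) * x = y (n - 1) := by
    have : 1 ≤ n := by omega
    simp only [y]; push_cast [this]; ring_nf
  have e3 : t ^ (-2 * (i : ℤ)) * x = y i := by simp only [y]; ring_nf
  have hlk : ∀ k, i < k → ∀ (m : ℕ), poch φ q (y m) (l i + l k) =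
      poch φ q (y m) (l i) *
        ∏ j ∈ range (l i), (if i < k ∧ (k : ℕ) < colLen l j then g j m else 1) := by
    intro k hk m
    rw [poch_add, prod_range_eq_ite _ (hl hk.le)]
    congr 1
    refine prod_congr rfl fun j _ => ?_
    simp only [lt_colLen_iff hl, hk, true_and, g]
  have hite : ∀ f : ℕ → ℕ, ∏ k with i < k, poch φ q (y (f k)) (l i + l k) =
      (∏ k : Fin n, (if (i : ℕ) < k ∧ (k : ℕ) < n then poch φ q (y (f k)) (l i) else 1)) *
      ∏ j ∈ range (l i), ∏ k : Fin n,
        (if (i : ℕ) < k ∧ (k : ℕ) < colLen l j then g j (f k) else 1) := by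
    intro f
    rw [Finset.prod_comm (s := range (l i)), ← prod_mul_distrib, prod_filter]
    refine prod_congr rfl fun k _ => ?_
    by_cases hk : i < k
    · have hk' : (i : ℕ) < k := hk
      rw [if_pos hk, hlk k hk, if_pos ⟨hk', k.2⟩]
      rfl
    · have hk' : ¬ (i : ℕ) < k := hk
      rw [if_neg hk, if_neg (fun h => hk' h.1), one_mul]
      exact (prod_eq_one fun j _ => if_neg fun h => hk' h.1).symm
  have e4 : ∏ k with i < k, poch φ q (t ^ (1 - (k : ℤ) - i) * x) (l i + l k) =
      ∏ k with i < k, poch φ q (y (k - 1)) (l i + l k) :=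
    prod_congr rfl fun k hk => by rw [e1 k (mem_filter.1 hk).2]
  rw [e2, e3, e4, hite fun k => k - 1]
  change _ = _ * ∏ k with i < k, poch φ q (y k) (l i + l k)
  rw [hite fun k => k, two_mul, poch_add]
  have h1 := prod_telescope_Ioo (fun k => poch φ q (y k) (l i)) hi le_rfl
  have h2 : (∏ j ∈ range (l i),
      φ (q ^ ((l i : ℤ) + (j + 1) - 1) * t ^ (2 - (colLen l j : ℤ) - (i + 1)) * x)) *
      ∏ j ∈ range (l i), ∏ k : Fin n,
        (if (i : ℕ) < k ∧ (k : ℕ) < colLen l j then g j (k - 1) else 1) =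
      (∏ j ∈ range (l i), φ (y i * q ^ (l i + j))) *
      ∏ j ∈ range (l i), ∏ k : Fin n,
        (if (i : ℕ) < k ∧ (k : ℕ) < colLen l j then g j k else 1) := by
    rw [← prod_mul_distrib, ← prod_mul_distrib]
    refine prod_congr rfl fun j hj => ?_
    have hc : (i : ℕ) < colLen l j := (lt_colLen_iff hl j i).2 (mem_range.1 hj)
    have h3 := prod_telescope_Ioo (g j) hc (colLen_le l j)
    rw [← h3]
    congr 1
    simp only [g, y]
    rw [← zpow_natCast q]
    have : 1 ≤ colLen l j := by omega
    push_cast [this]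
    ring_nf
  linear_combination (poch φ q (y (n - 1)) (l i) *
    ∏ k : Fin n, (if (i : ℕ) < k ∧ (k : ℕ) < n then poch φ q (y (k - 1)) (l i) else 1)) * h2 +
    ((∏ j ∈ range (l i), φ (y i * q ^ (l i + j))) *
      ∏ j ∈ range (l i), ∏ k : Fin n,
        (if (i : ℕ) < k ∧ (k : ℕ) < colLen l j then g j k else 1)) * h1

lemma prod_fin_two_mul {M : Type*} [CommMonoid M] {m : ℕ} (f : Fin (2 * m) → M) :
    ∏ i, f i = ∏ i : Fin m, f ⟨2 * i, by omega⟩ * f ⟨2 * i + 1, by omega⟩ := by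
  let e : Fin m × Fin 2 ≃ Fin (2 * m) :=
    { toFun := fun a => ⟨2 * a.1 + a.2, by omega⟩
      invFun := fun k => (⟨k / 2, by omega⟩, ⟨k % 2, by omega⟩)
      left_inv := fun a => by
        ext <;> simp <;> omega
      right_inv := fun k => by ext; simp; omega }
  rw [← e.prod_comp, Fintype.prod_prod_type]
  exact prod_congr rfl fun i _ => by rw [Fin.prod_univ_two]; rfl

lemma C0_twiceSq (x : ℂ) : C0 φ q t (twiceSq l) x =
    ∏ i : Fin n, poch φ q (t ^ (-2 * (i : ℤ)) * x) (2 * l i) *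
      poch φ q (t ^ (-2 * (i : ℤ) - 1) * x) (2 * l i) := by
  rw [C0_eq_poch, prod_fin_two_mul]
  refine prod_congr rfl fun i _ => ?_
  have h1 : twiceSq l ⟨2 * i, by omega⟩ = 2 * l i := by simp [twiceSq]
  have h2 : twiceSq l ⟨2 * i + 1, by omega⟩ = 2 * l i := by
    simp only [twiceSq]
    congr 2
    ext; simp; omega
  rw [h1, h2]
  push_cast
  ring_nf

end Symbols

/-! ### Generic parameters and the product form of the weights -/

/-- The numbers `v₀, …, v₅` and `p` are multiplicatively independent, in the sense that no
nontrivial Laurent monomial in `v` is an integral power of `p`. -/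
structure Generic (v : ℂ⁶) (p : ℂ) : Prop where
  ne_zero : ∀ i, v i ≠ 0
  indep : ∀ k : Fin 6 → ℤ, k ≠ 0 → ∀ l : ℤ, ∏ i, v i ^ k i ≠ p ^ l

/-- `z` is the product of a power of `p` and a Laurent monomial in `v` of degree `d` in `v i`. -/
def HasDeg (v : ℂ⁶) (p : ℂ) (i : Fin 6) (d : ℤ) (z : ℂ) : Prop :=
  ∃ (k : Fin 6 → ℤ) (l : ℤ), k i = d ∧ z = p ^ l * ∏ j, v j ^ k j

section HasDeg

variable {v : ℂ⁶} {p : ℂ} {i : Fin 6} {d e : ℤ} {x y : ℂ}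

lemma HasDeg.mul (hv : ∀ i, v i ≠ 0) (hp : p ≠ 0) (hx : HasDeg v p i d x)
    (hy : HasDeg v p i e y) : HasDeg v p i (d + e) (x * y) := by
  obtain ⟨k, l, hk, rfl⟩ := hx
  obtain ⟨k', l', hk', rfl⟩ := hy
  refine ⟨k + k', l + l', by simp [hk, hk'], ?_⟩
  simp only [Pi.add_apply, zpow_add₀ hp, zpow_add₀ (hv _), prod_mul_distrib]
  ring

lemma HasDeg.inv (hx : HasDeg v p i d x) : HasDeg v p i (-d) x⁻¹ := by
  obtain ⟨k, l, hk, rfl⟩ := hx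
  refine ⟨-k, -l, by simp [hk], ?_⟩
  simp only [Pi.neg_apply, zpow_neg, mul_inv, prod_inv_distrib]

lemma HasDeg.div (hv : ∀ i, v i ≠ 0) (hp : p ≠ 0) (hx : HasDeg v p i d x)
    (hy : HasDeg v p i e y) : HasDeg v p i (d - e) (x / y) := by
  rw [div_eq_mul_inv, sub_eq_add_neg]; exact hx.mul hv hp hy.inv

lemma HasDeg.zpow (hx : HasDeg v p i d x) (m : ℤ) : HasDeg v p i (m * d) (x ^ m) := by
  obtain ⟨k, l, hk, rfl⟩ := hx
  refine ⟨fun j => m * k j, m * l, by simp [hk], ?_⟩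
  rw [mul_zpow, ← prod_zpow, ← zpow_mul, mul_comm l]
  congr 1
  exact prod_congr rfl fun j _ => by rw [← zpow_mul, mul_comm]

lemma HasDeg.pow (hx : HasDeg v p i d x) (m : ℕ) : HasDeg v p i (m * d) (x ^ m) := by
  simpa using hx.zpow m

lemma hasDeg_p : HasDeg v p i 0 p := ⟨0, 1, rfl, by simp⟩

lemma hasDeg_coord (i j : Fin 6) : HasDeg v p i (if i = j then 1 else 0) (v j) := by
  refine ⟨Pi.single j 1, 0, by simp [Pi.single_apply], ?_⟩
  rw [zpow_zero, one_mul, prod_eq_single j]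
  · simp
  · intro b _ hb; simp [hb]
  · simp

lemma HasDeg.congr (hx : HasDeg v p i d x) (hd : d = e) (hxy : x = y) : HasDeg v p i e y :=
  hd ▸ hxy ▸ hx

lemma HasDeg.ne_zero (hv : ∀ i, v i ≠ 0) (hp : p ≠ 0) (hx : HasDeg v p i d x) : x ≠ 0 := by
  obtain ⟨k, l, hk, rfl⟩ := hx
  exact mul_ne_zero (zpow_ne_zero _ hp)
    (prod_ne_zero_iff.2 fun j _ => zpow_ne_zero _ (hv j))

lemma HasDeg.ne_zpow (hG : Generic v p) (hp : p ≠ 0) (hx : HasDeg v p i d x) (hd : d ≠ 0)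
    (l : ℤ) : x ≠ p ^ l := by
  obtain ⟨k, l', rfl, rfl⟩ := hx
  intro h
  refine hG.indep k (fun h0 => hd (by rw [h0]; rfl)) (l - l') ?_
  rw [zpow_sub₀ hp, ← h]
  have := zpow_ne_zero l' hp
  field_simp

lemma HasDeg.theta_ne_zero (hG : Generic v p) (hp : p ≠ 0) (hp1 : ‖p‖ < 1)
    (hx : HasDeg v p i d x) (hd : d ≠ 0) : theta p x ≠ 0 :=
  EllipticSelberg.theta_ne_zero hp hp1 (hx.ne_zero hG.ne_zero hp) fun l => hx.ne_zpow hG hp hd l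

lemma HasDeg.poch_ne_zero (hG : Generic v p) (hp : p ≠ 0) (hp1 : ‖p‖ < 1) {q : ℂ}
    (hx : HasDeg v p i d x) (hq : HasDeg v p i e q) (m : ℕ) (hd : ∀ r : ℕ, d + r * e ≠ 0) :
    poch (theta p) q x m ≠ 0 :=
  prod_ne_zero_iff.2 fun r _ =>
    (hx.mul hG.ne_zero hp (hq.pow r)).theta_ne_zero hG hp hp1 (hd r)

end HasDeg

/-- Generic parameters of the terminating elliptic sum. The square root `Q` of `q` occurs in the
half-integral shifts of the difference operators. -/
structure EllParams (n N : ℕ) (τ : ℂ⁶) (Q t p : ℂ) : Prop where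
  hp : p ≠ 0
  hp1 : ‖p‖ < 1
  bal₁ : t ^ ((n : ℤ) - 1) * τ 0 * τ 1 = (Q ^ 2) ^ (-(N : ℤ))
  bal₂ : t ^ ((n : ℤ) - 1) * τ 2 * τ 3 * τ 4 * τ 5 = p * (Q ^ 2) ^ ((N : ℤ) + 1)
  gen : Generic ![τ 0, τ 2, τ 3, τ 4, Q, t] p

/-- The points `t₀ t^{n-1}, …, t₀` at which the summation starts. -/
def startPt (n : ℕ) (t₀ t : ℂ) (i : Fin n) : ℂ := t₀ * t ^ (n - 1 - (i : ℕ))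

/-- The factor of the elliptic weight that belongs to one row of length `m`. -/
def rowWeight (q p : ℂ) (τ : ℂ⁶) (z : ℂ) (m : ℕ) : ℂ :=
  (∏ r, poch (theta p) q (z * τ r) m / poch (theta p) q (p * q * z / τ r) m) *
    (poch (theta p) q (p * q * z ^ 2) (2 * m) / poch (theta p) q (z ^ 2) (2 * m))

/-- The interaction factor of the elliptic weight. -/
def interWeight (q t p x : ℂ) (d : ℕ) : ℂ :=
  poch (theta p) q (t * x) d * poch (theta p) q (p * q * x) d /
    (poch (theta p) q x d * poch (theta p) q (p * q * x / t) d)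

/-- The elliptic weight as a product over rows and pairs of rows. -/
def prodWeight (q t p : ℂ) {n : ℕ} (τ : ℂ⁶) (μ : Fin n → ℕ) : ℂ :=
  (∏ i, rowWeight q p τ (startPt n (τ 0) t i) (μ i)) *
    ∏ i, ∏ k with i < k,
      interWeight q t p (startPt n (τ 0) t i / startPt n (τ 0) t k) (μ i - μ k) *
        interWeight q t p (startPt n (τ 0) t i * startPt n (τ 0) t k) (μ i + μ k)

namespace EllParams

variable {n N : ℕ} {τ : ℂ⁶} {Q t p : ℂ}

local notation "𝐯" => ![τ 0, τ 2, τ 3, τ 4, Q, t]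

lemma coord_ne_zero (h : EllParams n N τ Q t p) :
    τ 0 ≠ 0 ∧ τ 2 ≠ 0 ∧ τ 3 ≠ 0 ∧ τ 4 ≠ 0 ∧ Q ≠ 0 ∧ t ≠ 0 :=
  ⟨h.gen.ne_zero 0, h.gen.ne_zero 1, h.gen.ne_zero 2, h.gen.ne_zero 3, h.gen.ne_zero 4,
    h.gen.ne_zero 5⟩

lemma tau_one (h : EllParams n N τ Q t p) :
    τ 1 = (Q ^ 2) ^ (-(N : ℤ)) / (t ^ ((n : ℤ) - 1) * τ 0) := by
  obtain ⟨h0, h2, h3, h4, hQ, ht⟩ := h.coord_ne_zero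
  rw [← h.bal₁]
  have := zpow_ne_zero ((n : ℤ) - 1) ht
  field_simp

lemma tau_five (h : EllParams n N τ Q t p) :
    τ 5 = p * (Q ^ 2) ^ ((N : ℤ) + 1) / (t ^ ((n : ℤ) - 1) * τ 2 * τ 3 * τ 4) := by
  obtain ⟨h0, h2, h3, h4, hQ, ht⟩ := h.coord_ne_zero
  rw [← h.bal₂]
  have := zpow_ne_zero ((n : ℤ) - 1) ht
  field_simp

lemma deg_t (_ : EllParams n N τ Q t p) (i : Fin 6) :
    HasDeg 𝐯 p i (if i = 5 then 1 else 0) t :=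
  hasDeg_coord i 5

lemma deg_q (_ : EllParams n N τ Q t p) (i : Fin 6) :
    HasDeg 𝐯 p i (if i = 4 then 2 else 0) (Q ^ 2) :=
  ((hasDeg_coord i 4).pow 2).congr (by split_ifs <;> rfl) rfl

lemma deg_tau_zero (h : EllParams n N τ Q t p) (r : Fin 6) :
    HasDeg 𝐯 p 0 (if r = 0 then 1 else if r = 1 then -1 else 0)
      (τ r) := by
  have hv := h.gen.ne_zero
  have hp := h.hp
  have d0 : HasDeg 𝐯 p 0 1 (τ 0) := hasDeg_coord 0 0
  have d2 : HasDeg 𝐯 p 0 0 (τ 2) := hasDeg_coord 0 1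
  have d3 : HasDeg 𝐯 p 0 0 (τ 3) := hasDeg_coord 0 2
  have d4 : HasDeg 𝐯 p 0 0 (τ 4) := hasDeg_coord 0 3
  have dq := h.deg_q 0
  have dt := h.deg_t 0
  fin_cases r
  · exact d0
  · exact ((dq.zpow _).div hv hp ((dt.zpow _).mul hv hp d0)).congr (by simp) h.tau_one.symm
  · exact d2
  · exact d3
  · exact d4
  · exact ((hasDeg_p.mul hv hp (dq.zpow _)).div hv hp
      ((((dt.zpow _).mul hv hp d2).mul hv hp d3).mul hv hp d4)).congr (by simp) h.tau_five.symm

lemma tau_ne_zero (h : EllParams n N τ Q t p) (r : Fin 6) : τ r ≠ 0 :=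
  (h.deg_tau_zero r).ne_zero h.gen.ne_zero h.hp

lemma deg_startPt (h : EllParams n N τ Q t p) (i : Fin n) :
    HasDeg 𝐯 p 0 1 (startPt n (τ 0) t i) :=
  ((h.deg_tau_zero 0).mul h.gen.ne_zero h.hp ((h.deg_t 0).pow _)).congr (by simp) rfl

lemma startPt_ne_zero (h : EllParams n N τ Q t p) (i : Fin n) : startPt n (τ 0) t i ≠ 0 :=
  (h.deg_startPt i).ne_zero h.gen.ne_zero h.hp

end EllParams

lemma zpow_mul_startPt {t : ℂ} (ht : t ≠ 0) (t₀ : ℂ) {n : ℕ} (i : Fin n) :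
    t ^ (-(i : ℤ)) * (t ^ ((n : ℤ) - 1) * t₀) = startPt n t₀ t i := by
  have : (i : ℕ) < n := i.2
  rw [startPt, ← zpow_natCast t (n - 1 - i), show ((n - 1 - i : ℕ) : ℤ) = -(i : ℤ) + ((n : ℤ) - 1)
    by omega, zpow_add₀ ht]
  ring

lemma startPt_div {t t₀ : ℂ} (ht : t ≠ 0) (h0 : t₀ ≠ 0) {n : ℕ} (i k : Fin n) :
    startPt n t₀ t i / startPt n t₀ t k = t ^ ((k : ℤ) - i) := by
  rw [← zpow_mul_startPt ht, ← zpow_mul_startPt ht, zpow_sub₀ ht (k : ℤ), zpow_neg, zpow_neg]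
  have h1 := zpow_ne_zero (i : ℤ) ht
  have h2 := zpow_ne_zero (k : ℤ) ht
  have h3 := zpow_ne_zero ((n : ℤ) - 1) ht
  field_simp

lemma row_algebra {T U W V₀ V₁ X₀ X₁ X₂ X₃ X₄ X₅ Y₀ Y₁ Y₂ Y₃ Y₄ Y₅ A₁ A₂ A₃ A₄ B₁ B₂ B₃ B₄ : ℂ}
    (hT : T ≠ 0) (hU : U ≠ 0) (hW : W ≠ 0) :
    T / U * (X₁ / Y₁) * (X₂ / Y₂) * (X₃ / Y₃) * (X₄ / Y₄) * (X₅ / Y₅) *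
      (V₁ * W / (Y₀ * A₁ / B₁ * (T * A₂ / B₂) *
        (V₀ * A₃ / (X₀ * B₃) * (W * A₄ / (U * B₄))))) =
    X₀ * X₁ * X₂ * X₃ * X₄ * X₅ / (Y₀ * Y₁ * Y₂ * Y₃ * Y₄ * Y₅) * (V₁ / V₀) *
      (B₂ * B₁ / (A₂ * A₁) * (B₃ * B₄ / (A₃ * A₄))) := by
  calc
    _ = (T * T⁻¹) * (U * U⁻¹) * (W * W⁻¹) *
        (X₀ * X₁ * X₂ * X₃ * X₄ * X₅ / (Y₀ * Y₁ * Y₂ * Y₃ * Y₄ * Y₅) * (V₁ / V₀) *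
          (B₂ * B₁ / (A₂ * A₁) * (B₃ * B₄ / (A₃ * A₄)))) := by
      simp only [div_eq_mul_inv, mul_inv, inv_inv]
      ring
    _ = _ := by
      rw [mul_inv_cancel₀ hT, mul_inv_cancel₀ hU, mul_inv_cancel₀ hW]
      ring

/-- The elliptic weight is given by its product form. -/
lemma Delta_eq_prodWeight {n N : ℕ} {τ : ℂ⁶} {Q t p : ℂ} (h : EllParams n N τ Q t p)
    {μ : Fin n → ℕ} (hμ : Antitone μ) :
    Delta (Q ^ 2) t p μ ((t ^ ((n : ℤ) - 1)) ^ 2 * τ 0 ^ 2)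
      ![t ^ n, t ^ ((n : ℤ) - 1) * τ 0 * τ 1, t ^ ((n : ℤ) - 1) * τ 0 * τ 2,
        t ^ ((n : ℤ) - 1) * τ 0 * τ 3, t ^ ((n : ℤ) - 1) * τ 0 * τ 4,
        t ^ ((n : ℤ) - 1) * τ 0 * τ 5] =
    prodWeight (Q ^ 2) t p τ μ := by
  have hG := h.gen
  have hv := h.gen.ne_zero
  have hp := h.hp
  have hp1 := h.hp1
  obtain ⟨h0, -, -, -, hQ, ht⟩ := h.coord_ne_zero
  have hτ := h.tau_ne_zero
  set q := Q ^ 2 with hq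
  have hq0 : q ≠ 0 := pow_ne_zero _ hQ
  set s := t ^ ((n : ℤ) - 1) with hs
  have hs0 : s ≠ 0 := zpow_ne_zero _ ht
  set a := s ^ 2 * τ 0 ^ 2 with ha
  have ha0 : a ≠ 0 := mul_ne_zero (pow_ne_zero _ hs0) (pow_ne_zero _ h0)
  let P : ℂ → ℕ → ℂ := poch (theta p) q
  let z : Fin n → ℂ := startPt n (τ 0) t
  have hz : ∀ i, z i ≠ 0 := h.startPt_ne_zero
  have hzs : ∀ i : Fin n, z i = t ^ (-(i : ℤ)) * (s * τ 0) := fun i =>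
    (zpow_mul_startPt ht _ i).symm
  unfold Delta Delta0
  rw [C0_twiceSq]
  simp only [C0_eq_poch, ← prod_div_distrib, Cm, Cp]
  rw [Finset.prod_comm, ← prod_mul_distrib, ← prod_mul_distrib,
    ← prod_mul_distrib, ← prod_div_distrib, ← prod_mul_distrib,
    prodWeight, ← prod_mul_distrib]
  refine prod_congr rfl fun i _ => ?_
  have hti : t ^ (-(i : ℤ)) ≠ 0 := zpow_ne_zero _ ht
  have hin : (i : ℕ) < n := i.2
  have hin' : (i : ℤ) < n := by exact_mod_cast hin
  -- the arguments in terms of the starting points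
  have m1 := Cm_row (theta p) (q := q) (t := t) hμ (p * q) i
  have m2 := Cm_row (theta p) (q := q) (t := t) hμ t i
  have m3 := Cp_row (theta p) (q := q) (t := t) hμ a i
  have m4 := Cp_row (theta p) (q := q) (t := t) hμ (p * q * a / t) i
  have tz : ∀ m : ℤ, t ^ m ≠ 0 := fun m => zpow_ne_zero m ht
  have a1 : t ^ ((n : ℤ) - 1 - i) * (p * q) = p * q * z i / τ 0 := by
    rw [hzs, hs, sub_eq_add_neg _ (i : ℤ), zpow_add₀ ht]; field_simp
  have a2 : t ^ ((n : ℤ) - 1 - i) * t = t ^ (-(i : ℤ)) * t ^ n := by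
    rw [← zpow_natCast, ← zpow_add₀ ht, ← zpow_add_one₀ ht]; congr 1; ring
  have a3 : t ^ (1 - (n : ℤ) - i) * a = z i * τ 0 := by
    rw [hzs, ha, hs, show (1 - (n : ℤ) - i) = -(i : ℤ) + -((n : ℤ) - 1) by ring, zpow_add₀ ht,
      zpow_neg t ((n : ℤ) - 1)]
    have := tz ((n : ℤ) - 1)
    field_simp
  have a4 : t ^ (1 - (n : ℤ) - i) * (p * q * a / t) = t ^ (-(i : ℤ)) * (p * q * a / t ^ n) := by
    rw [show (1 - (n : ℤ) - i) = -(i : ℤ) + -(n : ℤ) + 1 by ring, zpow_add_one₀ ht, zpow_add₀ ht,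
      zpow_neg t n, zpow_natCast]
    field_simp
  have a5 : t ^ (-2 * (i : ℤ)) * a = z i ^ 2 := by
    rw [hzs, ha, mul_pow, ← zpow_natCast (t ^ (-(i : ℤ))), ← zpow_mul]; push_cast; ring_nf
  have a6 : t ^ (-2 * (i : ℤ)) * (p * q * a / t) = t ^ (-2 * (i : ℤ) - 1) * (p * q * a) := by
    rw [zpow_sub_one₀ ht]; field_simp
  have a7 : t ^ (-2 * (i : ℤ)) * (p * q * a) = p * q * z i ^ 2 := by
    rw [← a5]; ring
  have b1 : ∀ k : Fin n, t ^ ((k : ℤ) - i) * (p * q) = p * q * (z i / z k) := fun k => by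
    rw [startPt_div ht h0]; ring
  have b2 : ∀ k : Fin n, t ^ ((k : ℤ) - i) * t = t * (z i / z k) := fun k => by
    rw [startPt_div ht h0]; ring
  have b3 : ∀ k : Fin n, t ^ ((k : ℤ) - i - 1) * (p * q) = p * q * (z i / z k) / t := fun k => by
    rw [startPt_div ht h0, zpow_sub_one₀ ht]; ring
  have b4 : ∀ k : Fin n, t ^ ((k : ℤ) - i - 1) * t = z i / z k := fun k => by
    rw [startPt_div ht h0, zpow_sub_one₀ ht]; field_simp
  have c1 : ∀ k : Fin n, t ^ (-(k : ℤ) - i) * a = z i * z k := fun k => by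
    rw [hzs, hzs, ha, sub_eq_add_neg, zpow_add₀ ht]; ring
  have c2 : ∀ k : Fin n, t ^ (1 - (k : ℤ) - i) * a = t * (z i * z k) := fun k => by
    rw [← c1, show (1 - (k : ℤ) - i) = -(k : ℤ) - i + 1 by ring, zpow_add_one₀ ht]; ring
  have c3 : ∀ k : Fin n, t ^ (-(k : ℤ) - i) * (p * q * a / t) = p * q * (z i * z k) / t :=
    fun k => by rw [← c1]; ring
  have c4 : ∀ k : Fin n, t ^ (1 - (k : ℤ) - i) * (p * q * a / t) = p * q * (z i * z k) :=
    fun k => by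
      rw [← c1, show (1 - (k : ℤ) - i) = -(k : ℤ) - i + 1 by ring, zpow_add_one₀ ht]; field_simp
  simp only [a1, a2, b1, b2, b3, b4] at m1 m2
  simp only [a3, a4, a5, a6, c1, c2, c3, c4] at m3 m4
  have e1 : ∀ r, t ^ (-(i : ℤ)) * (s * τ 0 * τ r) = z i * τ r := fun r => by
    rw [hzs]; ring
  have e2 : ∀ r, t ^ (-(i : ℤ)) * (p * q * a / (s * τ 0 * τ r)) = p * q * z i / τ r := fun r => by
    have := hτ r
    rw [hzs, ha]; field_simp
  simp only [Fin.prod_univ_six, Matrix.cons_val, e1, e2, a7]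
  -- nonvanishing of the factors that cancel
  have dz := h.deg_startPt i
  have dq0 := h.deg_q 0
  have dt0 := h.deg_t 0
  have hpq : ∀ j, HasDeg ![τ 0, τ 2, τ 3, τ 4, Q, t] p j (if j = 4 then 2 else 0) (p * q) :=
    fun j => (hasDeg_p.mul hv hp (h.deg_q j)).congr (by simp) rfl
  have hT : P (t ^ (-(i : ℤ)) * t ^ n) (μ i) ≠ 0 :=
    ((((h.deg_t 5).zpow _).mul hv hp ((h.deg_t 5).pow n)).poch_ne_zero hG hp hp1 (h.deg_q 5) _
      fun r => by simp; omega)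
  have hU : P (t ^ (-(i : ℤ)) * (p * q * a / t ^ n)) (μ i) ≠ 0 := by
    have hx : HasDeg ![τ 0, τ 2, τ 3, τ 4, Q, t] p 0 2 (t ^ (-(i : ℤ)) * (p * q * a / t ^ n)) := by
      refine ((dt0.zpow (-(i : ℤ))).mul hv hp (((hpq 0).mul hv hp
        (((dt0.zpow ((n : ℤ) - 1)).pow 2).mul hv hp ((h.deg_tau_zero 0).pow 2))).div hv hp
          (dt0.pow n))).congr (by simp) rfl
    exact hx.poch_ne_zero hG hp hp1 dq0 _ fun r => by simp
  have hX : P (z i * τ 0) (μ i) ≠ 0 :=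
    (dz.mul hv hp (h.deg_tau_zero 0)).poch_ne_zero hG hp hp1 dq0 _ fun r => by simp
  have hW : P (t ^ (-2 * (i : ℤ) - 1) * (p * q * a)) (2 * μ i) ≠ 0 := by
    have hx : HasDeg ![τ 0, τ 2, τ 3, τ 4, Q, t] p 0 2 (t ^ (-2 * (i : ℤ) - 1) * (p * q * a)) := by
      refine ((dt0.zpow _).mul hv hp ((hpq 0).mul hv hp
        (((dt0.zpow ((n : ℤ) - 1)).pow 2).mul hv hp ((h.deg_tau_zero 0).pow 2)))).congr
          (by simp) rfl
    exact hx.poch_ne_zero hG hp hp1 dq0 _ fun r => by simp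
  have hB1 : ∏ k with i < k, P (p * q * (z i / z k)) (μ i - μ k) ≠ 0 := by
    refine prod_ne_zero_iff.2 fun k _ => ?_
    rw [startPt_div ht h0]
    refine ((hpq 4).mul hv hp ((h.deg_t 4).zpow _)).poch_ne_zero hG hp hp1 (h.deg_q 4) _
      fun r => by simp; omega
  have hB2 : ∏ k with i < k, P (t * (z i / z k)) (μ i - μ k) ≠ 0 := by
    refine prod_ne_zero_iff.2 fun k hk => ?_
    have hk' : (i : ℕ) < k := (mem_filter.1 hk).2
    rw [startPt_div ht h0]
    refine ((h.deg_t 5).mul hv hp ((h.deg_t 5).zpow _)).poch_ne_zero hG hp hp1 (h.deg_q 5) _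
      fun r => by simp; omega
  have hB3 : ∏ k with i < k, P (t * (z i * z k)) (μ i + μ k) ≠ 0 :=
    prod_ne_zero_iff.2 fun k _ =>
      (dt0.mul hv hp (dz.mul hv hp (h.deg_startPt k))).poch_ne_zero hG hp hp1 dq0 _
        fun r => by simp
  have hB4 : ∏ k with i < k, P (p * q * (z i * z k)) (μ i + μ k) ≠ 0 :=
    prod_ne_zero_iff.2 fun k _ =>
      ((hpq 0).mul hv hp (dz.mul hv hp (h.deg_startPt k))).poch_ne_zero hG hp hp1 dq0 _
        fun r => by simp
  have n1 := eq_div_of_mul_eq hB1 m1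
  have n2 := eq_div_of_mul_eq hB2 m2
  have n3 := eq_div_of_mul_eq (mul_ne_zero hX hB3) m3
  have n4 := eq_div_of_mul_eq (mul_ne_zero hU hB4) m4
  rw [n1, n2, n3, n4]
  simp only [rowWeight, interWeight, Fin.prod_univ_six, prod_mul_distrib,
    prod_div_distrib]
  exact row_algebra hT hU hW

/-! ### Adjointness of the difference operators -/

lemma theta_inv_eq {p : ℂ} (hp : p ≠ 0) {x y : ℂ} (h : x * y = p) : theta p x = theta p y := by
  have hy : y ≠ 0 := by rintro rfl; simp at h; exact hp h.symm
  rw [← theta_p_div hp (x := y)]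
  congr 1
  rw [eq_div_iff hy, h]

lemma poch_shift (φ : ℂ → ℂ) (q x : ℂ) (m : ℕ) :
    poch φ q x m * φ (x * q ^ m) = φ x * poch φ q (q * x) m := by
  rw [← poch_succ, poch_succ']

section Steps

variable {p q t : ℂ}

lemma interWeight_succ' (x : ℂ) (m : ℕ) :
    interWeight q t p x (m + 1) = interWeight q t p x 1 * interWeight q t p (q * x) m := by
  have key : ∀ y, poch (theta p) q y (m + 1) = poch (theta p) q y 1 * poch (theta p) q (q * y) m :=
    fun y => by rw [poch_succ' _ _ y]; simp [poch]
  simp only [interWeight, key]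
  rw [show q * (t * x) = t * (q * x) by ring, show q * (p * q * x) = p * q * (q * x) by ring,
    show q * (p * q * x / t) = p * q * (q * x) / t by ring, div_mul_div_comm]
  congr 1 <;> ring

lemma interWeight_step (hp : p ≠ 0) (hq : q ≠ 0) (ht : t ≠ 0) {x X : ℂ} (hx : x ≠ 0) (d : ℕ)
    (hX : X = x * q ^ d) (h1 : theta p (p * q * X) ≠ 0) (h2 : theta p (p * q * X / t) ≠ 0) :
    interWeight q t p x (d + 1) * thetaQuot p t (q * X)⁻¹ =
      interWeight q t p x d * thetaQuot p t X := by
  have hX0 : X ≠ 0 := by rw [hX]; exact mul_ne_zero hx (pow_ne_zero _ hq)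
  have e1 : theta p (t * (q * X)⁻¹) = theta p (p * q * X / t) :=
    theta_inv_eq hp (by field_simp)
  have e2 : theta p (q * X)⁻¹ = theta p (p * q * X) := theta_inv_eq hp (by field_simp)
  simp only [interWeight, poch_succ, thetaQuot, e1, e2]
  rw [show t * x * q ^ d = t * X by rw [hX]; ring,
    show p * q * x * q ^ d = p * q * X by rw [hX]; ring,
    show p * q * x / t * q ^ d = p * q * X / t by rw [hX]; ring, ← hX]
  generalize theta p (p * q * X) = Y₁ at *
  generalize theta p (p * q * X / t) = Y₂ at *
  generalize theta p (t * X) = Y₃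
  generalize theta p X = Y₄
  field_simp

end Steps

/-- How the identities for single parameters combine in `rowWeight_plus` and `rowWeight_minus`. -/
lemma row_combine {ρ₀ ρ₁ ρ₂ ρ₃ ρ₄ ρ₅ σ T₀ T₁ T₂ T W a₀ a₁ a₂ b c h₃ h₄ h₅ π₀ π₁ π₂ π₃ π₄ π₅ σ'
    U₃ U₄ U₅ W' : ℂ} (l₀ : ρ₀ * T₀ = a₀ * π₀) (l₁ : ρ₁ * T₁ = a₁ * π₁) (l₂ : ρ₂ * T₂ = a₂ * π₂)
    (e₃ : ρ₃ = h₃⁻¹ * (π₃ * U₃)) (e₄ : ρ₄ = h₄⁻¹ * (π₄ * U₄)) (e₅ : ρ₅ = h₅⁻¹ * (π₅ * U₅))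
    (s : σ / W = b / c * (σ' / W')) :
    ρ₀ * ρ₁ * ρ₂ * ρ₃ * ρ₄ * ρ₅ * σ * (T₀ * T₁ * T₂ * T / W) =
      a₀ * a₁ * a₂ * b / (h₃ * h₄ * h₅ * c) *
        (π₀ * π₁ * π₂ * π₃ * π₄ * π₅ * σ' * (U₃ * U₄ * U₅ * T / W')) := by
  calc _ = (ρ₀ * T₀) * (ρ₁ * T₁) * (ρ₂ * T₂) * ρ₃ * ρ₄ * ρ₅ * T * (σ / W) := by ring
    _ = _ := by
      rw [l₀, l₁, l₂, e₃, e₄, e₅, s]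
      simp only [div_eq_mul_inv, mul_inv]
      ring

/-- The parameters `(t₀ Q, t₁ Q, t₂ Q, t₃ / Q, t₄ / Q, t₅ / Q)`. -/
def shiftPar (Q : ℂ) (τ : ℂ⁶) : ℂ⁶ :=
  ![τ 0 * Q, τ 1 * Q, τ 2 * Q, τ 3 / Q, τ 4 / Q, τ 5 / Q]

/-- The ratio of the row factors of the weights for the parameters `τ` and `shiftPar Q τ`,
corrected by the coefficients of the difference operators. -/
def rowRatio (q p : ℂ) (τ : ℂ⁶) (z : ℂ) : ℂ :=
  theta p (z * τ 0) * theta p (z * τ 1) * theta p (z * τ 2) * theta p (p * q * z ^ 2) /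
    (theta p (p * q * z / τ 3) * theta p (p * q * z / τ 4) * theta p (p * q * z / τ 5) *
      theta p (z ^ 2))

section Rows

variable {p Q d : ℂ} {τ : ℂ⁶} {z : ℂ}

local notation "θ" => theta p
local notation "Θ" => poch (theta p) (Q ^ 2)

/-- The row factor of the adjointness relation for a row from which no box is removed. -/
lemma rowWeight_plus (hp : p ≠ 0) (hQ : Q ≠ 0) (hτ : ∀ r, τ r ≠ 0) (hz : z ≠ 0) (hd : d ≠ 0)
    (c : ℕ) (h1 : ∀ r, θ (p * Q ^ 2 * z / τ r * (Q ^ 2) ^ c) ≠ 0)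
    (h2 : θ (p * Q ^ 2 * z ^ 2 * (Q ^ 2) ^ (2 * c)) ≠ 0) :
    rowWeight (Q ^ 2) p τ z c *
      ((∏ r, θ (![τ 0, τ 1, τ 2, d] r * (z * (Q ^ 2) ^ c))) /
        θ ((z * (Q ^ 2) ^ c) ^ 2)) =
    rowRatio (Q ^ 2) p τ z * (rowWeight (Q ^ 2) p (shiftPar Q τ) (z * Q) c *
      ((∏ r, θ (![τ 3 / Q, τ 4 / Q, τ 5 / Q, p * Q / d] r * (z * Q * (Q ^ 2) ^ c)⁻¹)) /
        θ ((z * Q * (Q ^ 2) ^ c)⁻¹ ^ 2))) := by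
  have hqc : (Q ^ 2) ^ c ≠ 0 := pow_ne_zero _ (pow_ne_zero _ hQ)
  have low : ∀ r, Θ (z * τ r) c * θ (τ r * (z * (Q ^ 2) ^ c)) =
      θ (z * τ r) * Θ (z * Q * (τ r * Q)) c := fun r => by
    have := poch_shift θ (Q ^ 2) (z * τ r) c
    rw [show z * τ r * (Q ^ 2) ^ c = τ r * (z * (Q ^ 2) ^ c) by ring] at this
    rw [this, show Q ^ 2 * (z * τ r) = z * Q * (τ r * Q) by ring]
  have lowD : ∀ r, p * Q ^ 2 * (z * Q) / (τ r * Q) = p * Q ^ 2 * z / τ r := fun r => by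
    have := hτ r
    field_simp
  have highN : ∀ r, z * Q * (τ r / Q) = z * τ r := fun r => by field_simp
  have high : ∀ r, θ (p * Q ^ 2 * z / τ r) *
      Θ (p * Q ^ 2 * (z * Q) / (τ r / Q)) c =
      Θ (p * Q ^ 2 * z / τ r) c *
        θ (p * Q ^ 2 * z / τ r * (Q ^ 2) ^ c) := fun r => by
    rw [poch_shift]; congr 2
    have := hτ r
    field_simp
  have highT : ∀ r, θ (τ r / Q * (z * Q * (Q ^ 2) ^ c)⁻¹) =
      θ (p * Q ^ 2 * z / τ r * (Q ^ 2) ^ c) := fun r => by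
    have := hτ r
    exact theta_inv_eq hp (by field_simp)
  have sq1 := poch_shift θ (Q ^ 2) (p * Q ^ 2 * z ^ 2) (2 * c)
  have sq2 := poch_shift θ (Q ^ 2) (z ^ 2) (2 * c)
  have dT : θ (p * Q / d * (z * Q * (Q ^ 2) ^ c)⁻¹) = θ (d * (z * (Q ^ 2) ^ c)) :=
    theta_inv_eq hp (by field_simp)
  have wT : θ ((z * Q * (Q ^ 2) ^ c)⁻¹ ^ 2) =
      θ (p * Q ^ 2 * z ^ 2 * (Q ^ 2) ^ (2 * c)) :=
    theta_inv_eq hp (by rw [mul_comm 2 c, pow_mul _ c 2]; field_simp)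
  have zT : (z * (Q ^ 2) ^ c) ^ 2 = z ^ 2 * (Q ^ 2) ^ (2 * c) := by ring
  have lowE : ∀ r, Θ (z * τ r) c /
      Θ (p * Q ^ 2 * z / τ r) c * θ (τ r * (z * (Q ^ 2) ^ c)) =
      θ (z * τ r) * (Θ (z * Q * (τ r * Q)) c /
        Θ (p * Q ^ 2 * (z * Q) / (τ r * Q)) c) := fun r => by
    rw [lowD, div_mul_eq_mul_div, low, mul_div_assoc]
  have highE : ∀ r, Θ (z * τ r) c /
      Θ (p * Q ^ 2 * z / τ r) c =
      (θ (p * Q ^ 2 * z / τ r))⁻¹ * (Θ (z * Q * (τ r / Q)) c /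
        Θ (p * Q ^ 2 * (z * Q) / (τ r / Q)) c *
          θ (τ r / Q * (z * Q * (Q ^ 2) ^ c)⁻¹)) := fun r => by
    rw [highT, highN, div_mul_eq_mul_div, inv_mul_eq_div, div_div,
      mul_comm (poch _ _ (p * Q ^ 2 * (z * Q) / (τ r / Q)) c), high, mul_div_mul_right _ _ (h1 r)]
  have sqE : Θ (p * Q ^ 2 * z ^ 2) (2 * c) /
      Θ (z ^ 2) (2 * c) / θ ((z * (Q ^ 2) ^ c) ^ 2) =
      θ (p * Q ^ 2 * z ^ 2) / θ (z ^ 2) *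
      (Θ (p * Q ^ 2 * (z * Q) ^ 2) (2 * c) /
        Θ ((z * Q) ^ 2) (2 * c) /
          θ ((z * Q * (Q ^ 2) ^ c)⁻¹ ^ 2)) := by
    rw [wT, zT, show (z * Q) ^ 2 = Q ^ 2 * z ^ 2 by ring,
      show p * Q ^ 2 * (Q ^ 2 * z ^ 2) = Q ^ 2 * (p * Q ^ 2 * z ^ 2) by ring, div_div, sq2]
    calc _ = Θ (p * Q ^ 2 * z ^ 2) (2 * c) *
          θ (p * Q ^ 2 * z ^ 2 * (Q ^ 2) ^ (2 * c)) /
          (θ (z ^ 2) * Θ (Q ^ 2 * z ^ 2) (2 * c) *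
          θ (p * Q ^ 2 * z ^ 2 * (Q ^ 2) ^ (2 * c))) :=
          (mul_div_mul_right _ _ h2).symm
      _ = _ := by
        rw [sq1]
        simp only [div_eq_mul_inv, mul_inv]
        ring
  simp only [rowWeight, rowRatio, shiftPar, Fin.prod_univ_six, Fin.prod_univ_four,
    Matrix.cons_val, dT]
  exact row_combine (lowE 0) (lowE 1) (lowE 2) (highE 3) (highE 4) (highE 5) sqE

/-- The row factor of the adjointness relation for a row from which a box is removed. -/
lemma rowWeight_minus (hp : p ≠ 0) (hQ : Q ≠ 0) (hτ : ∀ r, τ r ≠ 0) (hz : z ≠ 0) (hd : d ≠ 0)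
    (c : ℕ) (h1 : ∀ r, θ (p * Q ^ 2 * z / τ r * (Q ^ 2) ^ c) ≠ 0)
    (h2 : θ (p * (Q ^ 2) ^ 2 * z ^ 2 * (Q ^ 2) ^ (2 * c)) ≠ 0) :
    rowWeight (Q ^ 2) p τ z (c + 1) *
      ((∏ r, θ (![τ 0, τ 1, τ 2, d] r * (z * (Q ^ 2) ^ (c + 1))⁻¹)) /
        θ ((z * (Q ^ 2) ^ (c + 1))⁻¹ ^ 2)) =
    rowRatio (Q ^ 2) p τ z * (rowWeight (Q ^ 2) p (shiftPar Q τ) (z * Q) c *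
      ((∏ r, θ (![τ 3 / Q, τ 4 / Q, τ 5 / Q, p * Q / d] r * (z * Q * (Q ^ 2) ^ c))) /
        θ ((z * Q * (Q ^ 2) ^ c) ^ 2))) := by
  have hqc : (Q ^ 2) ^ c ≠ 0 := pow_ne_zero _ (pow_ne_zero _ hQ)
  have lowT : ∀ r, θ (τ r * (z * (Q ^ 2) ^ (c + 1))⁻¹) =
      θ (p * Q ^ 2 * z / τ r * (Q ^ 2) ^ c) := fun r => by
    have := hτ r
    exact theta_inv_eq hp (by rw [pow_succ _ c]; field_simp)
  have lowD : ∀ r, p * Q ^ 2 * (z * Q) / (τ r * Q) = p * Q ^ 2 * z / τ r := fun r => by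
    have := hτ r
    field_simp
  have highN : ∀ r, z * Q * (τ r / Q) = z * τ r := fun r => by field_simp
  have dT : θ (d * (z * (Q ^ 2) ^ (c + 1))⁻¹) =
      θ (p * Q / d * (z * Q * (Q ^ 2) ^ c)) :=
    theta_inv_eq hp (by rw [pow_succ _ c]; field_simp)
  have wT : θ ((z * (Q ^ 2) ^ (c + 1))⁻¹ ^ 2) =
      θ (p * (Q ^ 2) ^ 2 * z ^ 2 * (Q ^ 2) ^ (2 * c)) :=
    theta_inv_eq hp (by rw [pow_succ _ c, mul_comm 2 c, pow_mul _ c 2]; field_simp)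
  have zT : (z * Q * (Q ^ 2) ^ c) ^ 2 = Q ^ 2 * z ^ 2 * (Q ^ 2) ^ (2 * c) := by ring
  have lowE : ∀ r, Θ (z * τ r) (c + 1) /
      Θ (p * Q ^ 2 * z / τ r) (c + 1) *
        θ (τ r * (z * (Q ^ 2) ^ (c + 1))⁻¹) =
      θ (z * τ r) * (Θ (z * Q * (τ r * Q)) c /
        Θ (p * Q ^ 2 * (z * Q) / (τ r * Q)) c) := fun r => by
    rw [lowT, lowD, poch_succ' _ _ (z * τ r), poch_succ, ← div_div, div_mul_cancel₀ _ (h1 r),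
      mul_div_assoc, show Q ^ 2 * (z * τ r) = z * Q * (τ r * Q) by ring]
  have highE : ∀ r, Θ (z * τ r) (c + 1) /
      Θ (p * Q ^ 2 * z / τ r) (c + 1) =
      (θ (p * Q ^ 2 * z / τ r))⁻¹ * (Θ (z * Q * (τ r / Q)) c /
        Θ (p * Q ^ 2 * (z * Q) / (τ r / Q)) c *
          θ (τ r / Q * (z * Q * (Q ^ 2) ^ c))) := fun r => by
    have := hτ r
    rw [poch_succ, poch_succ', highN,
      show τ r / Q * (z * Q * (Q ^ 2) ^ c) = z * τ r * (Q ^ 2) ^ c by field_simp,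
      show Q ^ 2 * (p * Q ^ 2 * z / τ r) = p * Q ^ 2 * (z * Q) / (τ r / Q) by field_simp]
    simp only [div_eq_mul_inv, mul_inv]
    ring
  have sqE : Θ (p * Q ^ 2 * z ^ 2) (2 * (c + 1)) /
      Θ (z ^ 2) (2 * (c + 1)) / θ ((z * (Q ^ 2) ^ (c + 1))⁻¹ ^ 2) =
      θ (p * Q ^ 2 * z ^ 2) / θ (z ^ 2) *
      (Θ (p * Q ^ 2 * (z * Q) ^ 2) (2 * c) /
        Θ ((z * Q) ^ 2) (2 * c) /
          θ ((z * Q * (Q ^ 2) ^ c) ^ 2)) := by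
    have hs : ∀ y, Θ y (2 * (c + 1)) = θ y *
        (Θ (Q ^ 2 * y) (2 * c) * θ (Q ^ 2 * y * (Q ^ 2) ^ (2 * c))) :=
      fun y => by rw [show 2 * (c + 1) = 2 * c + 1 + 1 by ring, poch_succ', poch_succ]
    rw [wT, zT, hs, hs, show (z * Q) ^ 2 = Q ^ 2 * z ^ 2 by ring,
      show Q ^ 2 * (p * Q ^ 2 * z ^ 2) = p * Q ^ 2 * (Q ^ 2 * z ^ 2) by ring,
      show p * Q ^ 2 * (Q ^ 2 * z ^ 2) * (Q ^ 2) ^ (2 * c) =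
        p * (Q ^ 2) ^ 2 * z ^ 2 * (Q ^ 2) ^ (2 * c) by ring]
    generalize θ (p * (Q ^ 2) ^ 2 * z ^ 2 * (Q ^ 2) ^ (2 * c)) = Y at *
    generalize θ (p * Q ^ 2 * z ^ 2) = A₁
    generalize θ (z ^ 2) = A₂
    generalize θ (Q ^ 2 * z ^ 2 * (Q ^ 2) ^ (2 * c)) = A₃
    generalize Θ (p * Q ^ 2 * (Q ^ 2 * z ^ 2)) (2 * c) = A₄
    generalize Θ (Q ^ 2 * z ^ 2) (2 * c) = A₅
    field_simp
  simp only [rowWeight, rowRatio, shiftPar, Fin.prod_univ_six, Fin.prod_univ_four,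
    Matrix.cons_val, dT]
  exact row_combine (lowE 0) (lowE 1) (lowE 2) (highE 3) (highE 4) (highE 5) sqE

end Rows

section Pairs

variable {p q t : ℂ}

/-- The number of boxes removed from row `i` by the shift belonging to the set `A`. -/
def drop {ι : Type*} [DecidableEq ι] (A : Finset ι) (i : ι) : ℕ := if i ∈ A then 0 else 1

/-- The factor of the adjointness relation that belongs to a pair of rows. -/
lemma interWeight_pair (hp : p ≠ 0) (hq : q ≠ 0) (ht : t ≠ 0) {ι : Type*} [DecidableEq ι]
    (A : Finset ι) {i k : ι} {zi zk Q : ℂ} (hQ : Q ^ 2 = q) (hzi : zi ≠ 0) (hzk : zk ≠ 0)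
    {a b : ℕ} {w w' : ι → ℂ}
    (hab : b ≤ a) (hab' : b + drop A k ≤ a + drop A i)
    (wi : w i = if i ∈ A then zi * q ^ (a + drop A i) else (zi * q ^ (a + drop A i))⁻¹)
    (wk : w k = if k ∈ A then zk * q ^ (b + drop A k) else (zk * q ^ (b + drop A k))⁻¹)
    (wi' : w' i = if i ∈ A then (zi * Q * q ^ a)⁻¹ else zi * Q * q ^ a)
    (wk' : w' k = if k ∈ A then (zk * Q * q ^ b)⁻¹ else zk * Q * q ^ b)
    (h1 : ∀ d : ℕ, theta p (p * q * (zi / zk * q ^ d)) ≠ 0)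
    (h2 : ∀ d : ℕ, theta p (p * q * (zi / zk * q ^ d) / t) ≠ 0)
    (h3 : ∀ d : ℕ, theta p (p * q * (zi * zk * q ^ d)) ≠ 0)
    (h4 : ∀ d : ℕ, theta p (p * q * (zi * zk * q ^ d) / t) ≠ 0) :
    interWeight q t p (zi / zk) (a + drop A i - (b + drop A k)) *
        interWeight q t p (zi * zk) (a + drop A i + (b + drop A k)) * thetaQuot p t (w i * w k) =
      interWeight q t p (zi * zk) 1 *
        (interWeight q t p (zi * Q / (zk * Q)) (a - b) *
          interWeight q t p (zi * Q * (zk * Q)) (a + b) * thetaQuot p t (w' i * w' k)) := by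
  have hQ0 : Q ≠ 0 := by rintro rfl; exact hq (by rw [← hQ]; simp)
  have ex : zi * Q / (zk * Q) = zi / zk := mul_div_mul_right _ _ hQ0
  have ey : zi * Q * (zk * Q) = q * (zi * zk) := by rw [← hQ]; ring
  have hx : zi / zk ≠ 0 := div_ne_zero hzi hzk
  have hy : zi * zk ≠ 0 := mul_ne_zero hzi hzk
  rw [ex, ey, wi, wk, wi', wk']
  have sx := fun d => interWeight_step (q := q) (t := t) hp hq ht hx d rfl (h1 d) (h2 d)
  have sy := fun d => interWeight_step (q := q) (t := t) hp hq ht hy d rfl (h3 d) (h4 d)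
  have sy' := interWeight_succ' (p := p) (q := q) (t := t) (zi * zk) (a + b)
  by_cases hi : i ∈ A <;> by_cases hk : k ∈ A <;>
    simp only [hi, hk, drop, if_true, if_false, add_zero] at hab' ⊢
  · rw [show (zi * Q * q ^ a)⁻¹ * (zk * Q * q ^ b)⁻¹ = (q * (zi * zk * q ^ (a + b)))⁻¹ by
      rw [← mul_inv, pow_add, ← hQ]; ring,
      show zi * q ^ a * (zk * q ^ b) = zi * zk * q ^ (a + b) by ring, mul_assoc, ← sy, sy']
    ring
  · obtain ⟨d, rfl⟩ : ∃ d, a = b + 1 + d := ⟨a - (b + 1), by omega⟩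
    rw [show b + 1 + d - (b + 1) = d by omega, show b + 1 + d - b = d + 1 by omega,
      show zi * q ^ (b + 1 + d) * (zk * q ^ (b + 1))⁻¹ = zi / zk * q ^ d by
        rw [pow_add _ (b + 1)]; field_simp,
      show (zi * Q * q ^ (b + 1 + d))⁻¹ * (zk * Q * q ^ b) = (q * (zi / zk * q ^ d))⁻¹ by
        rw [pow_add _ (b + 1), pow_succ]; field_simp,
      show b + 1 + d + (b + 1) = b + 1 + d + b + 1 by omega, sy']
    linear_combination -(interWeight q t p (zi * zk) 1 *
      interWeight q t p (q * (zi * zk)) (b + 1 + d + b)) * sx d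
  · obtain ⟨d, rfl⟩ : ∃ d, a = b + d := ⟨a - b, by omega⟩
    rw [show b + d + 1 - b = d + 1 by omega, show b + d - b = d by omega,
      show (zi * q ^ (b + d + 1))⁻¹ * (zk * q ^ b) = (q * (zi / zk * q ^ d))⁻¹ by
        rw [pow_succ, pow_add _ b]; field_simp,
      show zi * Q * q ^ (b + d) * (zk * Q * q ^ b)⁻¹ = zi / zk * q ^ d by
        rw [pow_add _ b]; field_simp,
      show b + d + 1 + b = b + d + b + 1 by omega, sy']
    linear_combination (interWeight q t p (zi * zk) 1 *
      interWeight q t p (q * (zi * zk)) (b + d + b)) * sx d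
  · rw [show a + 1 - (b + 1) = a - b by omega, show a + 1 + (b + 1) = a + b + 1 + 1 by omega,
      show (zi * q ^ (a + 1))⁻¹ * (zk * q ^ (b + 1))⁻¹ = (q * (zi * zk * q ^ (a + b + 1)))⁻¹ by
        rw [← mul_inv]; ring,
      show zi * Q * q ^ a * (zk * Q * q ^ b) = zi * zk * q ^ (a + b + 1) by
        rw [pow_succ, pow_add, ← hQ]; ring]
    linear_combination interWeight q t p (zi / zk) (a - b) * sy (a + b + 1) +
      interWeight q t p (zi / zk) (a - b) * thetaQuot p t (zi * zk * q ^ (a + b + 1)) * sy'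

end Pairs

lemma node_eq {n : ℕ} (t₀ q t : ℂ) (μ : Fin n → ℕ) (i : Fin n) :
    node t₀ q t μ i = startPt n t₀ t i * q ^ μ i := rfl

lemma startPt_mul (n : ℕ) (t₀ t Q : ℂ) (i : Fin n) :
    startPt n (t₀ * Q) t i = startPt n t₀ t i * Q := by
  simp only [startPt]; ring

/-- The operator does not leave the set of partitions: the coefficient contains the factor
`θ(t w_i w_k)` with `t w_i w_k = 1`. -/
lemma opCoeff_eq_zero_of_adjacent {p t q t₀ : ℂ} (hp : p ≠ 0) (hp1 : ‖p‖ < 1) (hq : q ≠ 0)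
    (ht : t ≠ 0) (h0 : t₀ ≠ 0) {n : ℕ} {μ : Fin n → ℕ} (u : Fin 4 → ℂ) {A : Finset (Fin n)}
    {i k : Fin n} (hik : (k : ℕ) = i + 1) (hi : i ∉ A) (hk : k ∈ A) (h : μ i = μ k) :
    opCoeff p t u univ (signed (node t₀ q t μ) A) = 0 := by
  unfold opCoeff
  refine mul_eq_zero_of_right _ (prod_eq_zero (mem_univ i)
    (prod_eq_zero (i := k) ?_ ?_))
  · exact mem_filter.2 ⟨mem_univ _, Fin.lt_def.2 (by omega)⟩
  · have : signed (node t₀ q t μ) A i * signed (node t₀ q t μ) A k = t⁻¹ := by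
      simp only [signed, hi, hk, if_true, if_false, node, h]
      have : n - 1 - (i : ℕ) = n - 1 - k + 1 := by omega
      rw [this, pow_succ]
      have := pow_ne_zero (μ k) hq
      field_simp
    rw [this, thetaQuot, mul_inv_cancel₀ ht, theta_one hp hp1, zero_div]

/-- Between `i ∉ A` and `k ∈ A` in rows of equal length there are adjacent rows of this kind. -/
lemma exists_adjacent {n : ℕ} {μ : Fin n → ℕ} (hμ : Antitone μ) {A : Finset (Fin n)} (d : ℕ) :
    ∀ {i k : Fin n}, (k : ℕ) = i + d → i ∉ A → k ∈ A → μ i = μ k →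
    ∃ i' k' : Fin n, (k' : ℕ) = i' + 1 ∧ i' ∉ A ∧ k' ∈ A ∧ μ i' = μ k' := by
  induction d with
  | zero =>
    intro i k hik hi hk _
    exact absurd (Fin.ext (by omega : (i : ℕ) = k) ▸ hk) hi
  | succ d ih =>
    intro i k hik hi hk h
    let j : Fin n := ⟨i + 1, by omega⟩
    have h1 : μ j ≤ μ i := hμ (Fin.le_def.2 (by simp [j]))
    have h2 : μ k ≤ μ j := hμ (Fin.le_def.2 (by simp [j]; omega))
    by_cases hj : j ∈ A
    · exact ⟨i, j, rfl, hi, hj, by omega⟩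
    · exact ih (i := j) (by simp [j]; omega) hj hk (by omega)

lemma antitone_of_opCoeff_ne_zero {p t q t₀ : ℂ} (hp : p ≠ 0) (hp1 : ‖p‖ < 1) (hq : q ≠ 0)
    (ht : t ≠ 0) (h0 : t₀ ≠ 0) {n : ℕ} {μ : Fin n → ℕ} (hμ : Antitone μ) {u : Fin 4 → ℂ}
    {A : Finset (Fin n)}
    (h : opCoeff p t u univ (signed (node t₀ q t μ) A) ≠ 0) {i k : Fin n} (hik : i ≤ k)
    (hi : i ∉ A) (hk : k ∈ A) : μ k < μ i := by
  by_contra hlt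
  obtain ⟨i', k', h1, h2, h3, h4⟩ := exists_adjacent hμ (A := A) (k - i) (i := i) (k := k)
    (by have := Fin.le_def.1 hik; omega) hi hk (le_antisymm (not_lt.1 hlt) (hμ hik))
  exact h (opCoeff_eq_zero_of_adjacent hp hp1 hq ht h0 u h1 h2 h3 h4)

namespace EllParams

variable {n N : ℕ} {τ : ℂ⁶} {Q t p : ℂ}

local notation "ξ" => startPt n (τ 0) t

lemma shift (h : EllParams n (N + 1) τ Q t p) : EllParams n N (shiftPar Q τ) Q t p := by
  obtain ⟨h0, h2, h3, h4, hQ, ht⟩ := h.coord_ne_zero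
  have hq : Q ^ 2 ≠ 0 := pow_ne_zero _ hQ
  refine ⟨h.hp, h.hp1, ?_, ?_, ?_, ?_⟩
  · have := h.bal₁
    simp only [shiftPar, Matrix.cons_val]
    rw [show t ^ ((n : ℤ) - 1) * (τ 0 * Q) * (τ 1 * Q) =
      t ^ ((n : ℤ) - 1) * τ 0 * τ 1 * Q ^ 2 by ring, this, ← zpow_add_one₀ hq]
    congr 1; push_cast; ring
  · have := h.bal₂
    simp only [shiftPar, Matrix.cons_val]
    rw [show t ^ ((n : ℤ) - 1) * (τ 2 * Q) * (τ 3 / Q) * (τ 4 / Q) * (τ 5 / Q) =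
      t ^ ((n : ℤ) - 1) * τ 2 * τ 3 * τ 4 * τ 5 / Q ^ 2 by field_simp, this, mul_div_assoc,
      div_eq_mul_inv, ← zpow_sub_one₀ hq]
    congr 2; push_cast; ring
  · intro i
    fin_cases i <;> simp [shiftPar, h0, h2, h3, h4, hQ, ht]
  · intro k hk l hl
    refine h.gen.indep ![k 0, k 1, k 2, k 3, k 4 + k 0 + k 1 - k 2 - k 3, k 5] (fun hk' => hk ?_)
      l ?_
    · have e := fun i => congrFun hk' i
      have e0 := e 0
      have e1 := e 1
      have e2 := e 2
      have e3 := e 3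
      have e4 := e 4
      have e5 := e 5
      simp only [Matrix.cons_val, Pi.zero_apply] at e0 e1 e2 e3 e4 e5
      funext i
      fin_cases i <;> simp <;> omega
    · rw [← hl]
      simp only [Fin.prod_univ_six, Matrix.cons_val, shiftPar, zpow_add₀ hQ, zpow_sub₀ hQ, mul_zpow,
        div_zpow]
      have := zpow_ne_zero (k 2) hQ
      have := zpow_ne_zero (k 3) hQ
      field_simp

/-- The factor in the adjointness relation of the difference operators. -/
def _root_.EllipticSelberg.adjFactor (n : ℕ) (τ : ℂ⁶) (q t p : ℂ) : ℂ :=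
  (∏ i : Fin n, rowRatio q p τ (startPt n (τ 0) t i)) *
    ∏ i : Fin n, ∏ k with i < k, interWeight q t p (startPt n (τ 0) t i * startPt n (τ 0) t k) 1

lemma deg_startPt_div (h : EllParams n N τ Q t p) (j : Fin 6) (a b : Fin n) (hj : j ≠ 5) :
    HasDeg ![τ 0, τ 2, τ 3, τ 4, Q, t] p j 0 (ξ a / ξ b) := by
  rw [startPt_div h.coord_ne_zero.2.2.2.2.2 h.coord_ne_zero.1]
  exact ((h.deg_t j).zpow _).congr (by simp [hj]) rfl

/-- The weights for `τ` and `shiftPar Q τ` make the difference operators with parameters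
`τ₀, τ₁, τ₂, d` and `τ₃/Q, τ₄/Q, τ₅/Q, pQ/d` adjoint to each other, termwise. -/
lemma adjoint_term (h : EllParams n (N + 1) τ Q t p) {d : ℂ} (hd : d ≠ 0) {μ ν : Fin n → ℕ}
    (hμ : Antitone μ) (hν : Antitone ν) (A : Finset (Fin n)) (hA : ∀ i, μ i = ν i + drop A i) :
    prodWeight (Q ^ 2) t p τ μ *
        opCoeff p t ![τ 0, τ 1, τ 2, d] univ (signed (node (τ 0) (Q ^ 2) t μ) A) =
      adjFactor n τ (Q ^ 2) t p * (prodWeight (Q ^ 2) t p (shiftPar Q τ) ν *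
        opCoeff p t ![τ 3 / Q, τ 4 / Q, τ 5 / Q, p * Q / d] univ
          (signed (node (τ 0 * Q) (Q ^ 2) t ν) Aᶜ)) := by
  have hG := h.gen
  have hv := h.gen.ne_zero
  have hp := h.hp
  have hp1 := h.hp1
  obtain ⟨h0, -, -, -, hQ, ht⟩ := h.coord_ne_zero
  have hq : Q ^ 2 ≠ 0 := pow_ne_zero _ hQ
  have hτ := h.tau_ne_zero
  have hz := h.startPt_ne_zero
  have dz := h.deg_startPt
  have dq := h.deg_q
  have dt := h.deg_t
  set w := signed (node (τ 0) (Q ^ 2) t μ) A with hw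
  set w' := signed (node (τ 0 * Q) (Q ^ 2) t ν) Aᶜ with hw'
  have wi : ∀ i, w i = if i ∈ A then ξ i * (Q ^ 2) ^ (ν i + drop A i)
      else (ξ i * (Q ^ 2) ^ (ν i + drop A i))⁻¹ := fun i => by
    rw [hw, signed, node_eq, hA]
  have wi' : ∀ i, w' i = if i ∈ A then (ξ i * Q * (Q ^ 2) ^ ν i)⁻¹
      else ξ i * Q * (Q ^ 2) ^ ν i := fun i => by
    rw [hw', signed, node_eq, startPt_mul]
    simp only [mem_compl]
    split_ifs <;> rfl
  have rows : ∀ i, rowWeight (Q ^ 2) p τ (ξ i) (μ i) *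
      ((∏ r, theta p (![τ 0, τ 1, τ 2, d] r * w i)) / theta p (w i ^ 2)) =
      rowRatio (Q ^ 2) p τ (ξ i) *
        (rowWeight (Q ^ 2) p (shiftPar Q τ) (ξ i * Q) (ν i) *
        ((∏ r, theta p (![τ 3 / Q, τ 4 / Q, τ 5 / Q, p * Q / d] r * w' i)) /
          theta p (w' i ^ 2))) := fun i => by
    have h1 : ∀ r, theta p (p * Q ^ 2 * ξ i / τ r * (Q ^ 2) ^ ν i) ≠ 0 := by
      intro r
      by_cases hr : r = 0
      · have : HasDeg ![τ 0, τ 2, τ 3, τ 4, Q, t] p 4 (2 + ν i * 2)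
            (p * Q ^ 2 * ξ i / τ 0 * (Q ^ 2) ^ ν i) := by
          refine (((((hasDeg_p.mul hv hp (dq 4)).mul hv hp ((dt 4).pow (n - 1 - i)))).mul hv hp
            ((dq 4).pow (ν i)))).congr (by simp) ?_
          rw [startPt]; field_simp
        rw [hr]
        exact this.theta_ne_zero hG hp hp1 (by omega)
      · refine ((((hasDeg_p.mul hv hp (dq 0)).mul hv hp (dz i)).div hv hp
          (h.deg_tau_zero r)).mul hv hp ((dq 0).pow (ν i))).theta_ne_zero hG hp hp1 ?_
        simp [hr]
        split_ifs <;> simp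
    by_cases hi : i ∈ A
    · rw [wi, wi', hA, drop, if_pos hi, if_pos hi, if_pos hi, add_zero]
      refine rowWeight_plus hp hQ hτ (hz i) hd _ h1 ?_
      exact (((hasDeg_p.mul hv hp (dq 0)).mul hv hp ((dz i).pow 2)).mul hv hp
        ((dq 0).pow _)).theta_ne_zero hG hp hp1 (by simp)
    · rw [wi, wi', hA, drop, if_neg hi, if_neg hi, if_neg hi]
      refine rowWeight_minus hp hQ hτ (hz i) hd _ h1 ?_
      exact (((hasDeg_p.mul hv hp ((dq 0).pow 2)).mul hv hp ((dz i).pow 2)).mul hv hp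
        ((dq 0).pow _)).theta_ne_zero hG hp hp1 (by simp)
  have pairs : ∀ i k, i < k →
      interWeight (Q ^ 2) t p (ξ i / ξ k) (μ i - μ k) *
        interWeight (Q ^ 2) t p (ξ i * ξ k) (μ i + μ k) *
          thetaQuot p t (w i * w k) =
      interWeight (Q ^ 2) t p (ξ i * ξ k) 1 *
        (interWeight (Q ^ 2) t p (ξ i * Q / (ξ k * Q)) (ν i - ν k) *
          interWeight (Q ^ 2) t p (ξ i * Q * (ξ k * Q))
            (ν i + ν k) * thetaQuot p t (w' i * w' k)) := by
    intro i k hik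
    have hab' := hμ hik.le
    rw [hA, hA] at hab' ⊢
    refine interWeight_pair hp hq ht A rfl (hz i) (hz k) (hν hik.le) hab' (wi i) (wi k) (wi' i)
      (wi' k) ?_ ?_ ?_ ?_ <;> intro e
    · exact ((hasDeg_p.mul hv hp (dq 4)).mul hv hp ((h.deg_startPt_div 4 i k (by decide)).mul
        hv hp ((dq 4).pow e))).theta_ne_zero hG hp hp1 (by simp; omega)
    · exact (((hasDeg_p.mul hv hp (dq 4)).mul hv hp ((h.deg_startPt_div 4 i k (by decide)).mul
        hv hp ((dq 4).pow e))).div hv hp (dt 4)).theta_ne_zero hG hp hp1 (by simp; omega)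
    · exact ((hasDeg_p.mul hv hp (dq 0)).mul hv hp (((dz i).mul hv hp (dz k)).mul
        hv hp ((dq 0).pow e))).theta_ne_zero hG hp hp1 (by simp)
    · exact (((hasDeg_p.mul hv hp (dq 0)).mul hv hp (((dz i).mul hv hp (dz k)).mul
        hv hp ((dq 0).pow e))).div hv hp (dt 0)).theta_ne_zero hG hp hp1 (by simp)
  have e0 : shiftPar Q τ 0 = τ 0 * Q := rfl
  have R := prod_congr rfl fun i (_ : i ∈ (univ : Finset (Fin n))) => rows i
  have P := prod_congr rfl fun i (_ : i ∈ (univ : Finset (Fin n))) =>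
    prod_congr rfl fun k (hk : k ∈ univ.filter fun k => i < k) =>
      pairs i k (mem_filter.1 hk).2
  simp only [prod_mul_distrib] at R P
  simp only [prodWeight, opCoeff, adjFactor, prod_mul_distrib, e0, startPt_mul]
  rw [mul_mul_mul_comm, R, P]
  ring

end EllParams

lemma mem_boxPartitions {n N : ℕ} {μ : Fin n → ℕ} :
    μ ∈ boxPartitions n N ↔ (∀ i, μ i ≤ N) ∧ Antitone μ := by
  simp [boxPartitions, Fintype.mem_piFinset]

namespace EllParams

variable {n N : ℕ} {τ : ℂ⁶} {Q t p : ℂ}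

local notation "𝐯" => ![τ 0, τ 2, τ 3, τ 4, Q, t]

/-- Nonvanishing terms of the adjointness relation correspond to each other. -/
lemma sum_adjoint (h : EllParams n (N + 1) τ Q t p) {d : ℂ} (hd : d ≠ 0) (A : Finset (Fin n)) :
    ∑ μ ∈ boxPartitions n (N + 1), prodWeight (Q ^ 2) t p τ μ *
        opCoeff p t ![τ 0, τ 1, τ 2, d] univ (signed (node (τ 0) (Q ^ 2) t μ) A) =
      ∑ ν ∈ boxPartitions n N, adjFactor n τ (Q ^ 2) t p *
        (prodWeight (Q ^ 2) t p (shiftPar Q τ) ν *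
        opCoeff p t ![τ 3 / Q, τ 4 / Q, τ 5 / Q, p * Q / d] univ
          (signed (node (τ 0 * Q) (Q ^ 2) t ν) Aᶜ)) := by
  have hp := h.hp
  have hp1 := h.hp1
  obtain ⟨h0, -, -, -, hQ, ht⟩ := h.coord_ne_zero
  have hq : Q ^ 2 ≠ 0 := pow_ne_zero _ hQ
  -- a nonvanishing term survives the removal of the boxes
  have key : ∀ μ ∈ boxPartitions n (N + 1), prodWeight (Q ^ 2) t p τ μ *
      opCoeff p t ![τ 0, τ 1, τ 2, d] univ (signed (node (τ 0) (Q ^ 2) t μ) A) ≠ 0 →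
      (∀ i, drop A i ≤ μ i) ∧ (fun i => μ i - drop A i) ∈ boxPartitions n N := by
    intro μ hμ hne
    obtain ⟨hN, hμ⟩ := mem_boxPartitions.1 hμ
    have hop := right_ne_zero_of_mul hne
    have hanti : ∀ {i k : Fin n}, i ≤ k → i ∉ A → k ∈ A → μ k < μ i := fun hik hi hk =>
      antitone_of_opCoeff_ne_zero hp hp1 hq ht h0 hμ hop hik hi hk
    have hle : ∀ i, drop A i ≤ μ i := by
      intro i
      by_cases hi : i ∈ A
      · simp [drop, hi]
      · simp only [drop, hi, if_false]
        by_contra hlt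
        have hi0 : μ i = 0 := by omega
        let l : Fin n := ⟨n - 1, by have := i.2; omega⟩
        have hil : i ≤ l := Fin.le_def.2 (by have := i.2; simp [l]; omega)
        have hl0 : μ l = 0 := by have := hμ hil; omega
        by_cases hl : l ∈ A
        · have := hanti hil hi hl; omega
        · refine hop (opCoeff_eq_zero (mem_univ l) (r := 0) ?_)
          simp only [Matrix.cons_val, signed, hl, if_false, node, hl0, l]
          rw [show n - 1 - (n - 1) = 0 by omega, pow_zero, pow_zero, mul_one, mul_one,
            mul_inv_cancel₀ h0, theta_one hp hp1]
    refine ⟨hle, mem_boxPartitions.2 ⟨fun i => ?_, fun i k hik => ?_⟩⟩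
    · by_cases hi : i ∈ A
      · simp only [drop, hi, if_true, Nat.sub_zero]
        by_contra hlt
        have hi0 : μ i = N + 1 := by have := hN i; omega
        let l : Fin n := ⟨0, by have := i.2; omega⟩
        have hil : l ≤ i := Fin.le_def.2 (by simp [l])
        have hl0 : μ l = N + 1 := by have := hμ hil; have := hN l; omega
        by_cases hl : l ∈ A
        · refine hop (opCoeff_eq_zero (mem_univ l) (r := 1) ?_)
          have e : τ 1 * (τ 0 * t ^ (n - 1) * (Q ^ 2) ^ (N + 1)) = 1 := by
            have hb := h.bal₁
            rw [zpow_neg, zpow_natCast] at hb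
            have hn : t ^ ((n : ℤ) - 1) = t ^ (n - 1) := by
              rw [← zpow_natCast]; congr 1; have := i.2; omega
            rw [hn] at hb
            have : (Q ^ 2) ^ (N + 1) ≠ 0 := pow_ne_zero _ hq
            rw [show τ 1 * (τ 0 * t ^ (n - 1) * (Q ^ 2) ^ (N + 1)) =
              t ^ (n - 1) * τ 0 * τ 1 * (Q ^ 2) ^ (N + 1) by ring, hb, inv_mul_cancel₀ this]
          simp only [Matrix.cons_val, signed, hl, if_true, node, hl0, l, Nat.sub_zero]
          rw [e, theta_one hp hp1]
        · have := hanti hil hl hi; omega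
      · have := hN i
        simp only [drop, hi, if_false]; omega
    · have := hμ hik
      simp only [drop]
      split_ifs with hk hi hi
      · exact this
      · have := hanti hik hi hk; omega
      · omega
      · omega
  refine sum_bij_ne_zero (fun μ _ _ i => μ i - drop A i) (fun μ hμ hne => (key μ hμ hne).2)
    ?_ ?_ ?_
  · intro μ hμ hne μ' hμ' hne' he
    funext i
    have := congrFun he i
    have := (key μ hμ hne).1 i
    have := (key μ' hμ' hne').1 i
    omega
  · intro ν hν hne
    obtain ⟨hN, hν⟩ := mem_boxPartitions.1 hν
    have hop := right_ne_zero_of_mul (right_ne_zero_of_mul hne)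
    have hμ : Antitone fun i => ν i + drop A i := by
      intro i k hik
      have := hν hik
      simp only [drop]
      split_ifs with hk hi hi
      · exact this
      · omega
      · have := antitone_of_opCoeff_ne_zero hp hp1 hq ht (mul_ne_zero h0 hQ) hν hop hik
          (by simpa using hi) (by simpa using hk)
        omega
      · omega
    refine ⟨fun i => ν i + drop A i, mem_boxPartitions.2 ⟨fun i => ?_, hμ⟩, ?_, ?_⟩
    · have := hN i
      simp only [drop]; split_ifs <;> omega
    · rw [h.adjoint_term hd hμ hν A fun i => rfl]
      exact hne
    · funext i; simp
  · intro μ hμ hne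
    obtain ⟨h1, h2⟩ := key μ hμ hne
    exact h.adjoint_term hd (mem_boxPartitions.1 hμ).2 (mem_boxPartitions.1 h2).2 A
      fun i => (Nat.sub_add_cancel (h1 i)).symm

lemma node_deg (h : EllParams n N τ Q t p) (μ : Fin n → ℕ) (i : Fin n) :
    HasDeg 𝐯 p 0 1 (node (τ 0) (Q ^ 2) t μ i) :=
  ((h.deg_startPt i).mul h.gen.ne_zero h.hp ((h.deg_q 0).pow _)).congr (by simp) rfl

lemma sum_opCoeff_node (h : EllParams n N τ Q t p) (μ : Fin n → ℕ) {a b c d : ℂ}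
    (ha : a ≠ 0) (hb : b ≠ 0) (hc : c ≠ 0)
    (hbc : ∀ (m k : ℕ) (l : ℤ), (b * c * t ^ m) ^ (k + 1) ≠ p ^ l)
    (habcd : t ^ n * (a * b * c * d) = p * t) :
    ∑ A : Finset (Fin n), opCoeff p t ![a, b, c, d] univ
        (signed (node (τ 0) (Q ^ 2) t μ) A) =
      ∏ i ∈ range n,
        (theta p (t ^ i * (a * b)) * theta p (t ^ i * (a * c)) * theta p (t ^ i * (b * c))) := by
  have hv := h.gen.ne_zero
  have hp := h.hp
  obtain ⟨h0, -, -, -, hQ, ht⟩ := h.coord_ne_zero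
  rw [← powerset_univ]
  refine sum_opCoeff hp h.hp1 ht (fun i => (h.node_deg μ i).ne_zero hv hp) hb hc hbc n
    univ (by simp) (fun i _ => ?_) (fun i _ j _ hij => ⟨?_, ?_⟩) a d ha habcd
  · exact ((h.node_deg μ i).pow 2).theta_ne_zero h.gen hp h.hp1 (by simp)
  · exact ((h.node_deg μ i).mul hv hp (h.node_deg μ j)).theta_ne_zero h.gen hp h.hp1 (by simp)
  · have : HasDeg 𝐯 p 5 ((j : ℤ) - i)
        (node (τ 0) (Q ^ 2) t μ i / node (τ 0) (Q ^ 2) t μ j) := by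
      rw [node_eq, node_eq, mul_div_mul_comm, startPt_div ht h0]
      exact (((h.deg_t 5).zpow _).mul hv hp (((h.deg_q 5).pow _).div hv hp ((h.deg_q 5).pow _))).congr
        (by simp) rfl
    refine this.theta_ne_zero h.gen hp h.hp1 fun e => hij (Fin.ext ?_)
    omega

/-- The recursion in `N` for the sum of the elliptic weights. -/
lemma sum_prodWeight_succ (h : EllParams n (N + 1) τ Q t p) :
    (∏ i ∈ range n, (theta p (t ^ i * (τ 0 * τ 1)) * theta p (t ^ i * (τ 0 * τ 2)) *
        theta p (t ^ i * (τ 1 * τ 2)))) *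
      ∑ μ ∈ boxPartitions n (N + 1), prodWeight (Q ^ 2) t p τ μ =
    adjFactor n τ (Q ^ 2) t p *
      (∏ i ∈ range n, (theta p (t ^ i * (τ 3 / Q * (τ 4 / Q))) *
        theta p (t ^ i * (τ 3 / Q * (τ 5 / Q))) * theta p (t ^ i * (τ 4 / Q * (τ 5 / Q))))) *
      ∑ ν ∈ boxPartitions n N, prodWeight (Q ^ 2) t p (shiftPar Q τ) ν := by
  have hv := h.gen.ne_zero
  have hp := h.hp
  obtain ⟨h0, h2, -, -, hQ, ht⟩ := h.coord_ne_zero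
  have hq : Q ^ 2 ≠ 0 := pow_ne_zero _ hQ
  have hτ := h.tau_ne_zero
  have htn : t ^ n ≠ 0 := pow_ne_zero _ ht
  have htn' : t ^ ((n : ℤ) - 1) * t = t ^ n := by
    rw [← zpow_add_one₀ ht, sub_add_cancel, zpow_natCast]
  set d := p * t / (t ^ n * (τ 0 * τ 1 * τ 2)) with hd
  have hd0 : d ≠ 0 := div_ne_zero (mul_ne_zero hp ht)
    (mul_ne_zero htn (mul_ne_zero (mul_ne_zero (hτ 0) (hτ 1)) (hτ 2)))
  have bal : t ^ n * (τ 0 * τ 1 * τ 2 * d) = p * t := by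
    have := hτ 1
    rw [hd]; field_simp
  have bal' : t ^ n * (τ 3 / Q * (τ 4 / Q) * (τ 5 / Q) * (p * Q / d)) = p * t := by
    have e : (t ^ ((n : ℤ) - 1) * τ 0 * τ 1) * (t ^ ((n : ℤ) - 1) * τ 2 * τ 3 * τ 4 * τ 5) =
        p * Q ^ 2 := by
      rw [h.bal₁, h.bal₂, mul_left_comm, ← zpow_add₀ hq]
      congr 1
      rw [show -((N + 1 : ℕ) : ℤ) + (((N + 1 : ℕ) : ℤ) + 1) = 1 by ring, zpow_one]
    have := hτ 1
    rw [hd]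
    field_simp
    rw [← htn']
    have h3 : (t ^ ((n : ℤ) - 1) * t) ^ 2 * τ 3 * τ 4 * τ 5 * τ 0 * τ 1 * τ 2 =
        (t ^ ((n : ℤ) - 1) * τ 0 * τ 1) * (t ^ ((n : ℤ) - 1) * τ 2 * τ 3 * τ 4 * τ 5) * t ^ 2 := by
      ring
    linear_combination h3 + t ^ 2 * e
  have d1 := h.deg_tau_zero 1
  have d2 := h.deg_tau_zero 2
  have hbc : ∀ (m k : ℕ) (l : ℤ), (τ 1 * τ 2 * t ^ m) ^ (k + 1) ≠ p ^ l := fun m k l =>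
    (((d1.mul hv hp d2).mul hv hp ((h.deg_t 0).pow m)).pow (k + 1)).ne_zpow h.gen hp
      (by simp; omega) l
  have hbc' : ∀ (m k : ℕ) (l : ℤ), (τ 4 / Q * (τ 5 / Q) * t ^ m) ^ (k + 1) ≠ p ^ l := by
    intro m k l
    have c2 : HasDeg 𝐯 p 1 1 (τ 2) := hasDeg_coord 1 1
    have c3 : HasDeg 𝐯 p 1 0 (τ 3) := hasDeg_coord 1 2
    have cQ : HasDeg 𝐯 p 1 0 Q := hasDeg_coord 1 4
    have ct := h.deg_t 1
    have h4 := hτ 4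
    have h3 := hτ 3
    have : HasDeg 𝐯 p 1 (-1) (τ 4 / Q * (τ 5 / Q) * t ^ m) := by
      refine ((((hasDeg_p.mul hv hp ((h.deg_q 1).zpow (((N + 1 : ℕ) : ℤ) + 1))).div hv hp
        (((ct.zpow ((n : ℤ) - 1)).mul hv hp c2).mul hv hp c3)).div hv hp (cQ.pow 2)).mul hv hp
          (ct.pow m)).congr (by simp) ?_
      rw [h.tau_five]
      have := zpow_ne_zero ((n : ℤ) - 1) ht
      field_simp
    exact (this.pow (k + 1)).ne_zpow h.gen hp (by simp; omega) l
  have L := sum_congr rfl fun A (_ : A ∈ (univ : Finset (Finset (Fin n)))) =>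
    h.sum_adjoint hd0 A
  rw [sum_comm, sum_comm (s := univ)] at L
  simp only [← mul_sum] at L
  have L1 : ∀ μ : Fin n → ℕ, _ := fun μ => h.sum_opCoeff_node μ (hτ 0) (hτ 1) (hτ 2) hbc bal
  have L2 : ∀ ν : Fin n → ℕ, ∑ A : Finset (Fin n),
      opCoeff p t ![τ 3 / Q, τ 4 / Q, τ 5 / Q, p * Q / d] univ
        (signed (node (τ 0 * Q) (Q ^ 2) t ν) Aᶜ) =
      ∏ i ∈ range n, (theta p (t ^ i * (τ 3 / Q * (τ 4 / Q))) *
        theta p (t ^ i * (τ 3 / Q * (τ 5 / Q))) * theta p (t ^ i * (τ 4 / Q * (τ 5 / Q)))) :=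
    fun ν => (Equiv.sum_comp (compl_involutive (α := Finset (Fin n))).toPerm fun A =>
      opCoeff p t ![τ 3 / Q, τ 4 / Q, τ 5 / Q, p * Q / d] univ
        (signed (node (τ 0 * Q) (Q ^ 2) t ν) A)).trans
      (h.shift.sum_opCoeff_node ν (div_ne_zero (hτ 3) hQ) (div_ne_zero (hτ 4) hQ)
        (div_ne_zero (hτ 5) hQ) hbc' bal')
  simp only [L1, L2] at L
  rw [← sum_mul, ← sum_mul] at L
  linear_combination L

end EllParams

/-! ### Evaluation of the elliptic sum -/

lemma prod_pairs_telescope {K : Type*} [Field K] (G G' : ℕ → K) (hG : ∀ m, G m ≠ 0)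
    (hG' : ∀ m, G' m ≠ 0) (n : ℕ) :
    (∏ i : Fin n, G' (2 * i) / G (2 * i)) *
      ∏ i : Fin n, ∏ k with i < k,
        G (i + k - 1) * G' (i + k) / (G (i + k) * G' (i + k + 1)) =
    ∏ i : Fin n, G' i / G (n - 1 + i) := by
  have inner : ∀ i : Fin n, ∏ k with i < k,
        G (i + k - 1) * G' (i + k) / (G (i + k) * G' (i + k + 1)) =
      G (2 * i) * G' (2 * i + 1) / (G (n - 1 + i) * G' (n + i)) := by
    intro i
    have e : ∏ k with i < k, G (i + k - 1) * G' (i + k) / (G (i + k) * G' (i + k + 1)) =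
        ∏ k ∈ Ico (i + 1 : ℕ) n,
          G (i + k - 1) * G' (i + k) / (G (i + k) * G' (i + k + 1)) := by
      refine prod_bij (fun k _ => (k : ℕ)) (fun k hk => ?_) (fun _ _ _ _ h => Fin.ext h)
        (fun b hb => ?_) fun _ _ => rfl
      · have := Fin.lt_def.1 (mem_filter.1 hk).2
        have := k.2
        simp; omega
      · obtain ⟨h1, h2⟩ := mem_Ico.1 hb
        exact ⟨⟨b, h2⟩, mem_filter.2 ⟨mem_univ _, Fin.lt_def.2 h1⟩, rfl⟩
    rw [e]
    have hi : (i : ℕ) + 1 ≤ n := i.2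
    clear e
    generalize (i : ℕ) = a at hi ⊢
    clear i
    induction n, hi using Nat.le_induction with
    | base =>
      rw [Ico_self, prod_empty, show a + 1 - 1 + a = 2 * a by omega,
        show a + 1 + a = 2 * a + 1 by omega,
        div_self (mul_ne_zero (hG _) (hG' _))]
    | succ m hm ih =>
      rw [prod_Ico_succ_top hm, ih, show m + 1 - 1 + a = a + m by omega,
        show m - 1 + a = a + m - 1 by omega, show m + 1 + a = a + m + 1 by omega,
        show m + a = a + m by omega]
      have := hG (a + m - 1)
      have := hG (a + m)
      have := hG' (a + m)
      have := hG' (a + m + 1)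
      field_simp
  rw [prod_congr rfl fun i _ => inner i, ← prod_mul_distrib]
  have e2 : ∀ i : Fin n, G' (2 * i) / G (2 * i) *
      (G (2 * i) * G' (2 * i + 1) / (G (n - 1 + i) * G' (n + i))) =
      (G' (2 * i) * G' (2 * i + 1)) / (G (n - 1 + i) * G' (n + i)) := fun i => by
    have := hG (2 * i)
    field_simp
  rw [prod_congr rfl fun i _ => e2 i]
  simp only [prod_div_distrib]
  have e3 : ∏ i : Fin n, G' (2 * i) * G' (2 * i + 1) =
      (∏ i : Fin n, G' i) * ∏ i : Fin n, G' (n + i) := by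
    have h := prod_fin_two_mul (m := n) fun j => G' j
    rw [← h, Fin.prod_univ_eq_prod_range G', Fin.prod_univ_eq_prod_range G', two_mul,
      prod_range_add, Fin.prod_univ_eq_prod_range fun j => G' (n + j)]
  rw [e3, prod_mul_distrib]
  have := prod_ne_zero_iff.2 fun (i : Fin n) (_ : i ∈ univ) => hG' (n + i)
  exact mul_div_mul_right _ _ this

lemma prod_fin_reflect {M : Type*} [CommMonoid M] (n : ℕ) (f : ℕ → M) :
    ∏ i : Fin n, f i = ∏ i : Fin n, f (n - 1 - i) := by
  rw [Fin.prod_univ_eq_prod_range f, Fin.prod_univ_eq_prod_range fun i => f (n - 1 - i),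
    prod_range_reflect]

/-- One row of the normalizing factor of the weights. -/
def rectRow (q t p : ℂ) (n N : ℕ) (τ : ℂ⁶) (i : ℕ) : ℂ :=
  poch (theta p) q (t ^ (-(i : ℤ)) * (τ 1 / τ 0)) N *
    poch (theta p) q (t ^ (-(i : ℤ)) * (p * q / (τ 4 * τ 2))) N *
    poch (theta p) q (t ^ (-(i : ℤ)) * (p * q / (τ 4 * τ 3))) N *
    poch (theta p) q (t ^ (-(i : ℤ)) * (p * q / (τ 4 * τ 5))) N /
  (poch (theta p) q (t ^ (-(i : ℤ)) * (p * q * (t ^ ((n : ℤ) - 1) * τ 0 / τ 4))) N *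
    poch (theta p) q (t ^ (-(i : ℤ)) * (t ^ ((n : ℤ) - 1) * τ 1 * τ 2)) N *
    poch (theta p) q (t ^ (-(i : ℤ)) * (t ^ ((n : ℤ) - 1) * τ 1 * τ 3)) N *
    poch (theta p) q (t ^ (-(i : ℤ)) * (t ^ ((n : ℤ) - 1) * τ 1 * τ 5)) N)

lemma Delta0_eq_prod_rectRow {p q t : ℂ} (hp : p ≠ 0) (hq : q ≠ 0) (ht : t ≠ 0)
    {τ : ℂ⁶} (hτ : ∀ r, τ r ≠ 0) (n N : ℕ) :
    Delta0 q t p (rect n N) (t ^ ((n : ℤ) - 1) * τ 1 / τ 4)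
        ![τ 1 / τ 0, p * q / (τ 4 * τ 2), p * q / (τ 4 * τ 3), p * q / (τ 4 * τ 5)] =
      ∏ i : Fin n, rectRow q t p n N τ i := by
  have h0 := hτ 0
  have h1 := hτ 1
  have h2 := hτ 2
  have h3 := hτ 3
  have h4 := hτ 4
  have h5 := hτ 5
  have hs := zpow_ne_zero ((n : ℤ) - 1) ht
  simp only [Delta0, Fin.prod_univ_four, Matrix.cons_val, C0_eq_poch, rect, rectRow]
  generalize t ^ ((n : ℤ) - 1) = s at hs ⊢
  rw [show p * q * (s * τ 1 / τ 4) / (τ 1 / τ 0) = p * q * (s * τ 0 / τ 4) by field_simp,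
    show p * q * (s * τ 1 / τ 4) / (p * q / (τ 4 * τ 2)) = s * τ 1 * τ 2 by field_simp,
    show p * q * (s * τ 1 / τ 4) / (p * q / (τ 4 * τ 3)) = s * τ 1 * τ 3 by field_simp,
    show p * q * (s * τ 1 / τ 4) / (p * q / (τ 4 * τ 5)) = s * τ 1 * τ 5 by field_simp]
  simp only [prod_div_distrib, prod_mul_distrib]
  simp only [div_eq_mul_inv, mul_inv]
  ring

namespace EllParams

variable {n N : ℕ} {τ : ℂ⁶} {Q t p : ℂ}

local notation "θ" => theta p
local notation "ξ" => startPt n (τ 0) t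
local notation "𝐯" => ![τ 0, τ 2, τ 3, τ 4, Q, t]

/-- The product form of the adjointness factor. -/
lemma adjFactor_eq (h : EllParams n (N + 1) τ Q t p) :
    adjFactor n τ (Q ^ 2) t p =
      ∏ i : Fin n, θ (ξ i * τ 1) * θ (ξ i * τ 2) *
        θ (p * Q ^ 2 * τ 0 ^ 2 * t ^ (2 * (n : ℤ) - 2 - (i : ℕ))) /
        (θ (p * Q ^ 2 * ξ i / τ 3) *
          θ (p * Q ^ 2 * ξ i / τ 4) *
          θ (p * Q ^ 2 * ξ i / τ 5)) := by
  have hv := h.gen.ne_zero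
  have hp := h.hp
  obtain ⟨h0, -, -, -, hQ, ht⟩ := h.coord_ne_zero
  let G : ℕ → ℂ := fun m => θ (τ 0 ^ 2 * t ^ (2 * (n : ℤ) - 2 - m))
  let G' : ℕ → ℂ := fun m => θ (p * Q ^ 2 * τ 0 ^ 2 * t ^ (2 * (n : ℤ) - 2 - m))
  have hG : ∀ m, G m ≠ 0 := fun m => (((h.deg_tau_zero 0).pow 2).mul hv hp
    ((h.deg_t 0).zpow _)).theta_ne_zero h.gen hp h.hp1 (by simp)
  have hG' : ∀ m, G' m ≠ 0 := fun m => (((hasDeg_p.mul hv hp (h.deg_q 0)).mul hv hp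
    ((h.deg_tau_zero 0).pow 2)).mul hv hp ((h.deg_t 0).zpow _)).theta_ne_zero h.gen hp h.hp1
      (by simp)
  have zz : ∀ i k : Fin n, ξ i * ξ k =
      τ 0 ^ 2 * t ^ (2 * (n : ℤ) - 2 - ((i + k : ℕ) : ℤ)) := fun i k => by
    rw [← zpow_mul_startPt ht, ← zpow_mul_startPt ht, show 2 * (n : ℤ) - 2 - ((i + k : ℕ) : ℤ) =
      (-(i : ℤ) + ((n : ℤ) - 1)) + (-(k : ℤ) + ((n : ℤ) - 1)) by push_cast; ring,
      zpow_add₀ ht, zpow_add₀ ht, zpow_add₀ ht]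
    ring
  have tel := prod_pairs_telescope G G' hG hG' n
  have pairs : ∀ i k : Fin n, i < k →
      interWeight (Q ^ 2) t p (ξ i * ξ k) 1 =
      G (i + k - 1) * G' (i + k) / (G (i + k) * G' (i + k + 1)) := by
    intro i k hik
    have hik' : (i : ℕ) < k := Fin.lt_def.1 hik
    have hP : ∀ y, poch θ (Q ^ 2) y 1 = θ y := fun y => by simp [poch]
    simp only [interWeight, hP, zz, G, G']
    rw [show t * (τ 0 ^ 2 * t ^ (2 * (n : ℤ) - 2 - ((i + k : ℕ) : ℤ))) =
      τ 0 ^ 2 * t ^ (2 * (n : ℤ) - 2 - ((i + k - 1 : ℕ) : ℤ)) by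
        rw [show 2 * (n : ℤ) - 2 - ((i + k - 1 : ℕ) : ℤ) =
          2 * (n : ℤ) - 2 - ((i + k : ℕ) : ℤ) + 1 by omega, zpow_add_one₀ ht]; ring,
      show p * Q ^ 2 * (τ 0 ^ 2 * t ^ (2 * (n : ℤ) - 2 - ((i + k : ℕ) : ℤ))) / t =
      p * Q ^ 2 * τ 0 ^ 2 * t ^ (2 * (n : ℤ) - 2 - ((i + k + 1 : ℕ) : ℤ)) by
        rw [show 2 * (n : ℤ) - 2 - ((i + k + 1 : ℕ) : ℤ) =
          2 * (n : ℤ) - 2 - ((i + k : ℕ) : ℤ) - 1 by push_cast; ring, zpow_sub_one₀ ht]; ring,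
      show p * Q ^ 2 * (τ 0 ^ 2 * t ^ (2 * (n : ℤ) - 2 - ((i + k : ℕ) : ℤ))) =
      p * Q ^ 2 * τ 0 ^ 2 * t ^ (2 * (n : ℤ) - 2 - ((i + k : ℕ) : ℤ)) by ring]
  have rows : ∀ i : Fin n, rowRatio (Q ^ 2) p τ (ξ i) =
      θ (ξ i * τ 0) * (θ (ξ i * τ 1) *
        θ (ξ i * τ 2) /
        (θ (p * Q ^ 2 * ξ i / τ 3) *
          θ (p * Q ^ 2 * ξ i / τ 4) *
          θ (p * Q ^ 2 * ξ i / τ 5))) * (G' (2 * i) / G (2 * i)) := by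
    intro i
    have e : ξ i ^ 2 = τ 0 ^ 2 * t ^ (2 * (n : ℤ) - 2 - ((2 * i : ℕ) : ℤ)) := by
      rw [two_mul (i : ℕ), ← zz, sq]
    simp only [rowRatio, G, G', e, ← mul_assoc]
    simp only [div_eq_mul_inv, mul_inv]
    ring
  rw [adjFactor, prod_congr rfl fun i _ => rows i, prod_congr rfl fun i _ =>
    prod_congr rfl fun k hk => pairs i k (mem_filter.1 hk).2,
    prod_mul_distrib, mul_assoc, tel, ← prod_mul_distrib]
  refine prod_congr rfl fun i _ => ?_
  have e : ξ i * τ 0 =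
      τ 0 ^ 2 * t ^ (2 * (n : ℤ) - 2 - ((n - 1 + i : ℕ) : ℤ)) := by
    have hi := i.2
    rw [← zpow_mul_startPt ht, show 2 * (n : ℤ) - 2 - ((n - 1 + i : ℕ) : ℤ) =
      -(i : ℤ) + ((n : ℤ) - 1) by omega, zpow_add₀ ht]; ring
  have hne := hG (n - 1 + i)
  rw [e]
  change G (n - 1 + i) * _ * (G' i / G (n - 1 + i)) = _
  change _ = _ * G' i / _
  generalize G (n - 1 + i) = g at hne ⊢
  calc _ = (g * g⁻¹) * (θ (ξ i * τ 1) * θ (ξ i * τ 2) /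
        (θ (p * Q ^ 2 * ξ i / τ 3) *
          θ (p * Q ^ 2 * ξ i / τ 4) *
          θ (p * Q ^ 2 * ξ i / τ 5)) * G' i) := by
        simp only [div_eq_mul_inv]; ring
    _ = _ := by rw [mul_inv_cancel₀ hne]; simp only [div_eq_mul_inv]; ring

/-- The factor by which the normalizing factor changes under the shift of the parameters. -/
lemma rectRow_succ (h : EllParams n (N + 1) τ Q t p) (i : ℕ) :
    rectRow (Q ^ 2) t p n (N + 1) τ i = rectRow (Q ^ 2) t p n N (shiftPar Q τ) i *
      (θ (t ^ (-(i : ℤ)) * (τ 1 / τ 0) * (Q ^ 2) ^ N) *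
        θ (t ^ (-(i : ℤ)) * (p * Q ^ 2 / (τ 4 * τ 2)) * (Q ^ 2) ^ N) *
        θ (t ^ (-(i : ℤ)) * (p * Q ^ 2 / (τ 4 * τ 3))) *
        θ (t ^ (-(i : ℤ)) * (p * Q ^ 2 / (τ 4 * τ 5))) /
      (θ (t ^ (-(i : ℤ)) * (p * Q ^ 2 * (t ^ ((n : ℤ) - 1) * τ 0 / τ 4))) *
        θ (t ^ (-(i : ℤ)) * (t ^ ((n : ℤ) - 1) * τ 1 * τ 2)) *
        θ (t ^ (-(i : ℤ)) * (t ^ ((n : ℤ) - 1) * τ 1 * τ 3) * (Q ^ 2) ^ N) *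
        θ (t ^ (-(i : ℤ)) * (t ^ ((n : ℤ) - 1) * τ 1 * τ 5) * (Q ^ 2) ^ N))) := by
  obtain ⟨h0, -, h3, h4, hQ, ht⟩ := h.coord_ne_zero
  have h5 := h.tau_ne_zero 5
  have h2 := h.tau_ne_zero 2
  simp only [rectRow, shiftPar, Matrix.cons_val]
  generalize t ^ ((n : ℤ) - 1) = s
  generalize t ^ (-(i : ℤ)) = u
  let P := poch θ (Q ^ 2)
  have f1 : ∀ y, P y (N + 1) = P y N * θ (y * (Q ^ 2) ^ N) := fun y => poch_succ _ _ _ _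
  have f2 : ∀ y, P y (N + 1) = θ y * P (Q ^ 2 * y) N := fun y => poch_succ' _ _ _ _
  have r1 : u * (τ 1 * Q / (τ 0 * Q)) = u * (τ 1 / τ 0) := by rw [mul_div_mul_right _ _ hQ]
  have r2 : u * (p * Q ^ 2 / (τ 4 / Q * (τ 2 * Q))) = u * (p * Q ^ 2 / (τ 4 * τ 2)) := by
    field_simp
  have r3 : u * (p * Q ^ 2 / (τ 4 / Q * (τ 3 / Q))) = Q ^ 2 * (u * (p * Q ^ 2 / (τ 4 * τ 3))) := by
    field_simp
  have r4 : u * (p * Q ^ 2 / (τ 4 / Q * (τ 5 / Q))) = Q ^ 2 * (u * (p * Q ^ 2 / (τ 4 * τ 5))) := by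
    field_simp
  have r5 : u * (p * Q ^ 2 * (s * (τ 0 * Q) / (τ 4 / Q))) =
      Q ^ 2 * (u * (p * Q ^ 2 * (s * τ 0 / τ 4))) := by field_simp
  have r6 : u * (s * (τ 1 * Q) * (τ 2 * Q)) = Q ^ 2 * (u * (s * τ 1 * τ 2)) := by ring
  have r7 : u * (s * (τ 1 * Q) * (τ 3 / Q)) = u * (s * τ 1 * τ 3) := by field_simp
  have r8 : u * (s * (τ 1 * Q) * (τ 5 / Q)) = u * (s * τ 1 * τ 5) := by field_simp
  rw [r1, r2, r3, r4, r5, r6, r7, r8]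
  change P _ (N + 1) * P _ (N + 1) * P _ (N + 1) * P _ (N + 1) /
    (P _ (N + 1) * P _ (N + 1) * P _ (N + 1) * P _ (N + 1)) = _
  rw [f1 (u * (τ 1 / τ 0)), f1 (u * (p * Q ^ 2 / (τ 4 * τ 2))), f2 (u * (p * Q ^ 2 / (τ 4 * τ 3))),
    f2 (u * (p * Q ^ 2 / (τ 4 * τ 5))), f2 (u * (p * Q ^ 2 * (s * τ 0 / τ 4))),
    f2 (u * (s * τ 1 * τ 2)), f1 (u * (s * τ 1 * τ 3)), f1 (u * (s * τ 1 * τ 5))]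
  simp only [P, div_eq_mul_inv, mul_inv]
  ring

/-- The recursion in `N` changes the sum by the same factor as the product on the right. -/
lemma sum_prodWeight (h : EllParams n N τ Q t p) :
    ∑ μ ∈ boxPartitions n N, prodWeight (Q ^ 2) t p τ μ =
      ∏ i : Fin n, rectRow (Q ^ 2) t p n N τ i := by
  induction N generalizing τ with
  | zero =>
    have : boxPartitions n 0 = {0} := by
      ext μ
      rw [mem_boxPartitions, mem_singleton]
      constructor
      · rintro ⟨h1, -⟩; funext i; have := h1 i; simp; omega
      · rintro rfl; exact ⟨fun i => le_rfl, fun _ _ _ => le_rfl⟩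
    rw [this, sum_singleton]
    simp [prodWeight, rowWeight, interWeight, rectRow, poch]
  | succ N ih =>
    have hv := h.gen.ne_zero
    have hp := h.hp
    obtain ⟨h0, h2, h3, h4, hQ, ht⟩ := h.coord_ne_zero
    have h5 := h.tau_ne_zero 5
    have hq : Q ^ 2 ≠ 0 := pow_ne_zero _ hQ
    have hrec := h.sum_prodWeight_succ
    rw [ih h.shift, h.adjFactor_eq, prod_range, prod_range] at hrec
    rw [prod_congr rfl fun (i : Fin n) _ => h.rectRow_succ i]
    have hs := zpow_ne_zero ((n : ℤ) - 1) ht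
    have tn : ∀ i : Fin n, t ^ (n - 1 - (i : ℕ)) = t ^ (-(i : ℤ)) * t ^ ((n : ℤ) - 1) := fun i => by
      rw [← zpow_natCast, ← zpow_add₀ ht]; congr 1; have := i.2; omega
    have hqN : (Q ^ 2) ^ (N + 1) ≠ 0 := pow_ne_zero _ hq
    have b1 : t ^ ((n : ℤ) - 1) * τ 1 = ((Q ^ 2) ^ (N + 1))⁻¹ / τ 0 := by
      rw [eq_div_iff h0, mul_right_comm, h.bal₁, zpow_neg, zpow_natCast]
    have b2 : p * Q ^ 2 / (τ 4 * τ 2) * (Q ^ 2) ^ N =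
        t ^ ((n : ℤ) - 1) * (τ 3 / Q * (τ 5 / Q)) := by
      have e := h.bal₂
      rw [← Nat.cast_succ, zpow_natCast, Nat.succ_eq_add_one] at e
      field_simp
      linear_combination -e
    have hz : ∀ i : Fin n, startPt n (τ 0) t i = t ^ (-(i : ℤ)) * (t ^ ((n : ℤ) - 1) * τ 0) :=
      fun i => (zpow_mul_startPt ht _ i).symm
    have ti : ∀ i : Fin n, t ^ (-(i : ℤ)) = (t ^ (i : ℕ))⁻¹ := fun i => by
      rw [zpow_neg, zpow_natCast]
    -- the factors on both sides are matched by `x ↦ p / x` and by reversing the rows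
    have m1 : ∏ i : Fin n, θ (t ^ (i : ℕ) * (τ 0 * τ 1)) =
        ∏ i : Fin n, θ (startPt n (τ 0) t i * τ 1) := by
      rw [prod_fin_reflect n fun i => θ (t ^ i * (τ 0 * τ 1))]
      exact prod_congr rfl fun i _ => by rw [startPt]; ring_nf
    have m2 : ∏ i : Fin n, θ (t ^ (i : ℕ) * (τ 0 * τ 2)) =
        ∏ i : Fin n, θ (startPt n (τ 0) t i * τ 2) := by
      rw [prod_fin_reflect n fun i => θ (t ^ i * (τ 0 * τ 2))]
      exact prod_congr rfl fun i _ => by rw [startPt]; ring_nf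
    have m3 : ∏ i : Fin n, θ (t ^ (-(i : ℤ)) * (τ 1 / τ 0) * (Q ^ 2) ^ N) =
        ∏ i : Fin n, θ (p * Q ^ 2 * τ 0 ^ 2 * t ^ (2 * (n : ℤ) - 2 - (i : ℕ))) := by
      rw [prod_fin_reflect n fun i => θ (p * Q ^ 2 * τ 0 ^ 2 * t ^ (2 * (n : ℤ) - 2 - i))]
      refine prod_congr rfl fun i _ => theta_inv_eq hp ?_
      have e1 : τ 1 = ((Q ^ 2) ^ (N + 1))⁻¹ / τ 0 / t ^ ((n : ℤ) - 1) := by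
        rw [← b1]; field_simp
      have e2 : 2 * (n : ℤ) - 2 - ((n - 1 - i : ℕ) : ℤ) = (i : ℤ) + ((n : ℤ) - 1) := by
        have := i.2; omega
      rw [e1, e2, zpow_add₀ ht, ti, zpow_natCast]
      have := pow_ne_zero (i : ℕ) ht
      rw [pow_succ _ N] at hqN ⊢
      field_simp
    have m4 : ∏ i : Fin n, θ (t ^ (-(i : ℤ)) * (p * Q ^ 2 / (τ 4 * τ 2)) * (Q ^ 2) ^ N) =
        ∏ i : Fin n, θ (t ^ (i : ℕ) * (τ 3 / Q * (τ 5 / Q))) := by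
      rw [prod_fin_reflect n fun i => θ (t ^ i * (τ 3 / Q * (τ 5 / Q)))]
      exact prod_congr rfl fun i _ => by rw [mul_assoc, b2, tn]; ring_nf
    have m5 : ∀ i : Fin n, θ (t ^ (-(i : ℤ)) * (p * Q ^ 2 / (τ 4 * τ 3))) =
        θ (t ^ (i : ℕ) * (τ 3 / Q * (τ 4 / Q))) := fun i => theta_inv_eq hp (by
      rw [ti]; have := pow_ne_zero (i : ℕ) ht; field_simp)
    have m6 : ∀ i : Fin n, θ (t ^ (-(i : ℤ)) * (p * Q ^ 2 / (τ 4 * τ 5))) =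
        θ (t ^ (i : ℕ) * (τ 4 / Q * (τ 5 / Q))) := fun i => theta_inv_eq hp (by
      rw [ti]; have := pow_ne_zero (i : ℕ) ht; field_simp)
    have m7 : ∀ i : Fin n, θ (t ^ (-(i : ℤ)) * (p * Q ^ 2 * (t ^ ((n : ℤ) - 1) * τ 0 / τ 4))) =
        θ (p * Q ^ 2 * startPt n (τ 0) t i / τ 4) := fun i => by
      rw [hz]; congr 1; ring
    have m8 : ∏ i : Fin n, θ (t ^ (-(i : ℤ)) * (t ^ ((n : ℤ) - 1) * τ 1 * τ 2)) =
        ∏ i : Fin n, θ (t ^ (i : ℕ) * (τ 1 * τ 2)) := by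
      rw [prod_fin_reflect n fun i => θ (t ^ i * (τ 1 * τ 2))]
      exact prod_congr rfl fun i _ => by rw [tn]; ring_nf
    have m9 : ∀ r : Fin 6, ∏ i : Fin n,
        θ (t ^ (-(i : ℤ)) * (t ^ ((n : ℤ) - 1) * τ 1 * τ r) * (Q ^ 2) ^ N) =
        ∏ i : Fin n, θ (p * Q ^ 2 * startPt n (τ 0) t i / τ r) := fun r => by
      have hr := h.tau_ne_zero r
      have := prod_fin_reflect n fun i =>
        θ (p * Q ^ 2 * (τ 0 * t ^ (n - 1 - i)) / τ r)
      simp only [startPt]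
      rw [this]
      refine prod_congr rfl fun i _ => theta_inv_eq hp ?_
      have e : n - 1 - (n - 1 - (i : ℕ)) = i := by have := i.2; omega
      rw [b1, ti, e]
      have := pow_ne_zero (i : ℕ) ht
      rw [pow_succ _ N] at hqN ⊢
      field_simp
    have hX : ∀ x : ℂ, HasDeg ![τ 0, τ 2, τ 3, τ 4, Q, t] p 0 1 x ∨
        HasDeg ![τ 0, τ 2, τ 3, τ 4, Q, t] p 0 (-1) x → θ x ≠ 0 := by
      rintro x (hx | hx)
      · exact hx.theta_ne_zero h.gen hp h.hp1 (by decide)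
      · exact hx.theta_ne_zero h.gen hp h.hp1 (by decide)
    have n1 : ∏ i : Fin n, θ (startPt n (τ 0) t i * τ 1) ≠ 0 := by
      rw [← m1]
      refine prod_ne_zero_iff.2 fun i _ => ?_
      have e : τ 0 * τ 1 = ((Q ^ 2) ^ (N + 1))⁻¹ / t ^ ((n : ℤ) - 1) := by
        rw [eq_div_iff hs, mul_comm, ← mul_assoc, h.bal₁, zpow_neg, zpow_natCast]
      have : HasDeg ![τ 0, τ 2, τ 3, τ 4, Q, t] p 4 (-(2 * (N + 1 : ℕ)))
          (t ^ (i : ℕ) * (τ 0 * τ 1)) :=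
        (((h.deg_t 4).pow i).mul hv hp ((((h.deg_q 4).pow (N + 1)).inv).div hv hp
          ((h.deg_t 4).zpow ((n : ℤ) - 1)))).congr (by simp; ring) (by rw [e])
      exact this.theta_ne_zero h.gen hp h.hp1 (by push_cast; omega)
    have n2 : ∏ i : Fin n, θ (startPt n (τ 0) t i * τ 2) ≠ 0 :=
      prod_ne_zero_iff.2 fun i _ => hX _ (Or.inl
        (((h.deg_startPt i).mul hv hp (h.deg_tau_zero 2)).congr (by simp) rfl))
    have n3 : ∏ i : Fin n, θ (t ^ (i : ℕ) * (τ 1 * τ 2)) ≠ 0 :=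
      prod_ne_zero_iff.2 fun i _ => hX _ (Or.inr
        ((((h.deg_t 0).pow i).mul hv hp ((h.deg_tau_zero 1).mul hv hp (h.deg_tau_zero 2))).congr
          (by simp) rfl))
    simp only [prod_mul_distrib, prod_div_distrib, m5, m6, m7] at hrec ⊢
    rw [m1, m2] at hrec
    rw [m3, m4, m8, m9 3, m9 5]
    refine mul_left_cancel₀ (mul_ne_zero (mul_ne_zero n1 n2) n3) (hrec.trans ?_)
    generalize ∏ i : Fin n, θ (startPt n (τ 0) t i * τ 1) = A₁
    generalize ∏ i : Fin n, θ (startPt n (τ 0) t i * τ 2) = A₂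
    generalize ∏ i : Fin n, θ (t ^ (i : ℕ) * (τ 1 * τ 2)) = A₃ at n3 ⊢
    simp only [div_eq_mul_inv, mul_inv]
    have := mul_inv_cancel₀ n3
    generalize ∏ i : Fin n, rectRow (Q ^ 2) t p n N (shiftPar Q τ) i = R
    generalize A₃⁻¹ = A₃' at this ⊢
    generalize (∏ i : Fin n, θ (p * Q ^ 2 * startPt n (τ 0) t i * (τ 3)⁻¹))⁻¹ = X₃
    generalize (∏ i : Fin n, θ (p * Q ^ 2 * startPt n (τ 0) t i * (τ 4)⁻¹))⁻¹ = X₄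
    generalize (∏ i : Fin n, θ (p * Q ^ 2 * startPt n (τ 0) t i * (τ 5)⁻¹))⁻¹ = X₅
    generalize (∏ i : Fin n, θ (p * Q ^ 2 * τ 0 ^ 2 * t ^ (2 * (n : ℤ) - 2 - (i : ℕ)))) = X₆
    generalize (∏ i : Fin n, θ (t ^ (i : ℕ) * (τ 3 * Q⁻¹ * (τ 4 * Q⁻¹)))) = X₇
    generalize (∏ i : Fin n, θ (t ^ (i : ℕ) * (τ 3 * Q⁻¹ * (τ 5 * Q⁻¹)))) = X₈
    generalize (∏ i : Fin n, θ (t ^ (i : ℕ) * (τ 4 * Q⁻¹ * (τ 5 * Q⁻¹)))) = X₉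
    linear_combination -(A₁ * A₂ * R * X₃ * X₄ * X₅ * X₆ * X₇ * X₈ * X₉) * this

/-- The elliptic weights sum to `1`. -/
lemma sum_weight (h : EllParams n N τ Q t p)
    (hR : Delta0 (Q ^ 2) t p (rect n N) (t ^ ((n : ℤ) - 1) * τ 1 / τ 4)
      ![τ 1 / τ 0, p * Q ^ 2 / (τ 4 * τ 2), p * Q ^ 2 / (τ 4 * τ 3), p * Q ^ 2 / (τ 4 * τ 5)] ≠ 0) :
    ∑ μ ∈ boxPartitions n N, weight n N τ (Q ^ 2) t p μ = 1 := by
  obtain ⟨h0, -, -, -, hQ, ht⟩ := h.coord_ne_zero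
  have hq : Q ^ 2 ≠ 0 := pow_ne_zero _ hQ
  have e := sum_congr rfl fun μ (hμ : μ ∈ boxPartitions n N) =>
    Delta_eq_prodWeight h (mem_boxPartitions.1 hμ).2
  simp only [weight]
  rw [← sum_div, e, h.sum_prodWeight, ← Delta0_eq_prod_rectRow h.hp hq ht h.tau_ne_zero,
    div_self hR]

end EllParams

/-! ### Values of rational functions -/

section RatEval

variable {σ : Type} {x : σ → ℂ} {a b : Rat σ}

/-- `x` is not a zero of the reduced denominator of `a`. -/
def RegAt (a : Rat σ) (x : σ → ℂ) : Prop :=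
  eval x (IsFractionRing.den (ℂ[σ]) a : ℂ[σ]) ≠ 0

lemma mul_den_eq_num (a : Rat σ) :
    a * algebraMap (ℂ[σ]) (Rat σ) (IsFractionRing.den (ℂ[σ]) a) =
      algebraMap (ℂ[σ]) (Rat σ) (IsFractionRing.num (ℂ[σ]) a) :=
  (IsFractionRing.num_mul_den_eq_num_iff_eq (A := ℂ[σ])).2 rfl

lemma num_mul_eq {D N : ℂ[σ]}
    (h : a * algebraMap (ℂ[σ]) (Rat σ) D = algebraMap (ℂ[σ]) (Rat σ) N) :
    IsFractionRing.num (ℂ[σ]) a * D =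
      N * (IsFractionRing.den (ℂ[σ]) a : ℂ[σ]) := by
  apply IsFractionRing.injective (ℂ[σ]) (Rat σ)
  rw [map_mul, map_mul, ← mul_den_eq_num, ← h]
  ring

lemma den_dvd {D N : ℂ[σ]}
    (h : a * algebraMap (ℂ[σ]) (Rat σ) D = algebraMap (ℂ[σ]) (Rat σ) N) :
    (IsFractionRing.den (ℂ[σ]) a : ℂ[σ]) ∣ D := by
  have hr := (IsFractionRing.num_den_reduced (ℂ[σ]) a).symm
  exact hr.dvd_of_dvd_mul_left ⟨N, by rw [num_mul_eq h, mul_comm]⟩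

lemma ratEval_of_mul_eq {D N : ℂ[σ]}
    (h : a * algebraMap (ℂ[σ]) (Rat σ) D = algebraMap (ℂ[σ]) (Rat σ) N)
    (hx : eval x D ≠ 0) :
    RegAt a x ∧ ratEval a x = eval x N / eval x D := by
  have hreg : RegAt a x := by
    obtain ⟨E, hE⟩ := den_dvd h
    intro h0
    rw [hE, map_mul, h0, zero_mul] at hx
    exact hx rfl
  refine ⟨hreg, ?_⟩
  rw [ratEval, div_eq_div_iff hreg hx, ← map_mul, ← map_mul, num_mul_eq h]

lemma ratEval_mul (ha : RegAt a x) (hb : RegAt b x) :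
    RegAt (a * b) x ∧ ratEval (a * b) x = ratEval a x * ratEval b x := by
  have h : a * b * algebraMap (ℂ[σ]) (Rat σ)
      (IsFractionRing.den (ℂ[σ]) a * IsFractionRing.den (ℂ[σ]) b) =
      algebraMap (ℂ[σ]) (Rat σ)
        (IsFractionRing.num (ℂ[σ]) a * IsFractionRing.num (ℂ[σ]) b) := by
    rw [map_mul, map_mul, ← mul_den_eq_num, ← mul_den_eq_num]; ring
  have h2 := ratEval_of_mul_eq (x := x) h (by rw [map_mul]; exact mul_ne_zero ha hb)
  refine ⟨h2.1, h2.2.trans ?_⟩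
  rw [map_mul, map_mul, mul_div_mul_comm]; rfl

lemma ratEval_add (ha : RegAt a x) (hb : RegAt b x) :
    RegAt (a + b) x ∧ ratEval (a + b) x = ratEval a x + ratEval b x := by
  have h : (a + b) * algebraMap (ℂ[σ]) (Rat σ)
      (IsFractionRing.den (ℂ[σ]) a * IsFractionRing.den (ℂ[σ]) b) =
      algebraMap (ℂ[σ]) (Rat σ)
        (IsFractionRing.num (ℂ[σ]) a * IsFractionRing.den (ℂ[σ]) b +
          IsFractionRing.den (ℂ[σ]) a * IsFractionRing.num (ℂ[σ]) b) := by
    rw [map_mul, map_add, map_mul, map_mul, ← mul_den_eq_num, ← mul_den_eq_num]; ring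
  have h2 := ratEval_of_mul_eq (x := x) h (by rw [map_mul]; exact mul_ne_zero ha hb)
  refine ⟨h2.1, h2.2.trans ?_⟩
  rw [map_mul, map_add, map_mul, map_mul, ← div_add_div _ _ ha hb]; rfl

lemma ratEval_algebraMap (N : ℂ[σ]) (x : σ → ℂ) :
    RegAt (algebraMap (ℂ[σ]) (Rat σ) N) x ∧
      ratEval (algebraMap (ℂ[σ]) (Rat σ) N) x = eval x N := by
  have := ratEval_of_mul_eq (x := x) (a := algebraMap (ℂ[σ]) (Rat σ) N) (D := 1) (N := N)
    (by simp) (by simp)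
  simpa using this

lemma ratEval_one (x : σ → ℂ) : RegAt (1 : Rat σ) x ∧ ratEval (1 : Rat σ) x = 1 := by
  simpa using ratEval_algebraMap (1 : ℂ[σ]) x

lemma ratEval_zero (x : σ → ℂ) : RegAt (0 : Rat σ) x ∧ ratEval (0 : Rat σ) x = 0 := by
  simpa using ratEval_algebraMap (0 : ℂ[σ]) x

lemma ratEval_sum {ι : Type*} (s : Finset ι) (A : ι → Rat σ) (h : ∀ i ∈ s, RegAt (A i) x) :
    RegAt (∑ i ∈ s, A i) x ∧ ratEval (∑ i ∈ s, A i) x = ∑ i ∈ s, ratEval (A i) x := by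
  classical
  induction s using Finset.induction_on with
  | empty => simpa using ratEval_zero x
  | insert i s hi ih =>
    have h1 := ih fun j hj => h j (mem_insert_of_mem hj)
    have h2 := ratEval_add (h i (mem_insert_self i s)) h1.1
    rw [sum_insert hi, sum_insert hi, ← h1.2]
    exact h2

lemma ratEval_prod {ι : Type*} (s : Finset ι) (A : ι → Rat σ) (h : ∀ i ∈ s, RegAt (A i) x) :
    RegAt (∏ i ∈ s, A i) x ∧ ratEval (∏ i ∈ s, A i) x = ∏ i ∈ s, ratEval (A i) x := by
  classical
  induction s using Finset.induction_on with
  | empty => simpa using ratEval_one x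
  | insert i s hi ih =>
    have h1 := ih fun j hj => h j (mem_insert_of_mem hj)
    have h2 := ratEval_mul (h i (mem_insert_self i s)) h1.1
    rw [prod_insert hi, prod_insert hi, ← h1.2]
    exact h2

end RatEval

/-! ### Series indexed by arbitrary types -/

lemma norm_ppow {p : ℂ} (hp : p ≠ 0) (e : ℝ) : ‖ppow p e‖ = ‖p‖ ^ e := by
  rw [ppow, Complex.norm_cpow_of_ne_zero hp]; simp

lemma ppow_add {p : ℂ} (hp : p ≠ 0) (a b : ℝ) : ppow p (a + b) = ppow p a * ppow p b := by
  rw [ppow, Complex.ofReal_add, Complex.cpow_add _ _ hp]; rfl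

lemma ppow_ne_zero {p : ℂ} (hp : p ≠ 0) (a : ℝ) : ppow p a ≠ 0 := by
  rw [ppow, Complex.cpow_ne_zero_iff]; exact Or.inl hp

lemma ppow_zero (p : ℂ) : ppow p 0 = 1 := by simp [ppow]

lemma ppow_one (p : ℂ) : ppow p 1 = p := by simp [ppow]

lemma ppow_neg (p : ℂ) (a : ℝ) : ppow p (-a) = (ppow p a)⁻¹ := by
  rw [ppow, Complex.ofReal_neg, Complex.cpow_neg]; rfl

lemma ppow_sub {p : ℂ} (hp : p ≠ 0) (a b : ℝ) : ppow p (a - b) = ppow p a / ppow p b := by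
  rw [sub_eq_add_neg, ppow_add hp, ppow_neg, div_eq_mul_inv]

lemma ppow_sum {p : ℂ} (hp : p ≠ 0) {ι : Type*} (s : Finset ι) (w : ι → ℝ) :
    ppow p (∑ i ∈ s, w i) = ∏ i ∈ s, ppow p (w i) := by
  classical
  induction s using Finset.induction_on with
  | empty => simp [ppow_zero]
  | insert i s hi ih => rw [sum_insert hi, prod_insert hi, ppow_add hp, ih]

lemma ppow_add_natCast {p : ℂ} (hp : p ≠ 0) (a : ℝ) (r : ℕ) :
    ppow p (a + r) = ppow p a * p ^ r := by
  rw [ppow_add hp]; congr 1; simp [ppow]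

section GExp

variable {σ : Type}

/-- Denominators are powers of `P`, and degrees grow at most linearly. -/
def LinearGrowth {ι : Type} (P : ℂ[σ]) (A : ι → Rat σ) (w : ι → ℝ) : Prop :=
  ∃ c : ℝ, ∀ i, ∃ (N : ℂ[σ]) (m : ℕ),
    (m : ℝ) ≤ c * (1 + |w i|) ∧ (N.totalDegree : ℝ) ≤ c * (1 + |w i|) ∧
    A i * algebraMap (ℂ[σ]) (Rat σ) (P ^ m) =
      algebraMap (ℂ[σ]) (Rat σ) N

/-- Normal convergence on `K` for small `p`. -/
def NormalConv {ι : Type} (F : (σ → ℂ) → ℂ → ℂ) (A : ι → Rat σ) (w : ι → ℝ)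
    (K : Set (σ → ℂ)) : Prop :=
  ∃ ε : ℝ, 0 < ε ∧ ∃ b : ι → ℝ,
    (∀ i, ∀ x ∈ K, ‖ratEval (A i) x‖ ≤ b i) ∧
    Summable (fun i => b i * ε ^ w i) ∧
    ∀ x ∈ K, ∀ p : ℂ, 0 < ‖p‖ → ‖p‖ < ε →
      HasSum (fun i => ratEval (A i) x * ppow p (w i)) (F x p)

/-- The points outside the coordinate hyperplanes and the zero set of `P`. -/
def goodSet (P : ℂ[σ]) : Set (σ → ℂ) := {x | (∀ i, x i ≠ 0) ∧ eval x P ≠ 0}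

/-- The expansion `F = ∑_i A_i p^{w_i}` with terms indexed by an arbitrary type, so that different
terms may have the same exponent. -/
structure GExp {ι : Type} (F : (σ → ℂ) → ℂ → ℂ) (A : ι → Rat σ) (w : ι → ℝ) : Prop where
  finite_le : ∀ B : ℝ, {i | w i ≤ B}.Finite
  converges : ∃ P : ℂ[σ], P ≠ 0 ∧ LinearGrowth P A w ∧
    ∀ K : Set (σ → ℂ), IsCompact K → K ⊆ goodSet P → NormalConv F A w K

variable {ι κ : Type} {F G : (σ → ℂ) → ℂ → ℂ} {A : ι → Rat σ} {A' : κ → Rat σ} {w : ι → ℝ}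
  {w' : κ → ℝ} {P : ℂ[σ]}

lemma goodSet_mul (P R : ℂ[σ]) : goodSet (P * R) = goodSet P ∩ goodSet R := by
  ext x
  simp only [goodSet, Set.mem_ofPred_eq, Set.mem_inter_iff, map_mul, mul_ne_zero_iff]
  tauto

lemma LinearGrowth.nonneg (h : LinearGrowth P A w) : ∃ c : ℝ, 0 ≤ c ∧ ∀ i,
    ∃ (N : ℂ[σ]) (m : ℕ),
    (m : ℝ) ≤ c * (1 + |w i|) ∧ (N.totalDegree : ℝ) ≤ c * (1 + |w i|) ∧
    A i * algebraMap (ℂ[σ]) (Rat σ) (P ^ m) =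
      algebraMap (ℂ[σ]) (Rat σ) N := by
  obtain ⟨c, hc⟩ := h
  refine ⟨max c 0, le_max_right _ _, fun i => ?_⟩
  obtain ⟨N, m, h1, h2, h3⟩ := hc i
  have : c * (1 + |w i|) ≤ max c 0 * (1 + |w i|) :=
    mul_le_mul_of_nonneg_right (le_max_left _ _) (by positivity)
  exact ⟨N, m, h1.trans this, h2.trans this, h3⟩

lemma LinearGrowth.mul_right (h : LinearGrowth P A w) (R : ℂ[σ]) :
    LinearGrowth (P * R) A w := by
  obtain ⟨c, hc0, hc⟩ := h.nonneg
  refine ⟨c * (1 + R.totalDegree), fun i => ?_⟩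
  obtain ⟨N, m, h1, h2, h3⟩ := hc i
  have hw : 0 ≤ c * (1 + |w i|) := by positivity
  refine ⟨N * R ^ m, m, ?_, ?_, ?_⟩
  · have : (0 : ℝ) ≤ R.totalDegree := Nat.cast_nonneg _
    nlinarith
  · have h4 : ((N * R ^ m).totalDegree : ℝ) ≤ N.totalDegree + m * R.totalDegree := by
      exact_mod_cast (totalDegree_mul _ _).trans
        (Nat.add_le_add_left (totalDegree_pow _ _) _)
    have : (m : ℝ) * R.totalDegree ≤ c * (1 + |w i|) * R.totalDegree :=
      mul_le_mul_of_nonneg_right h1 (Nat.cast_nonneg _)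
    nlinarith
  · rw [mul_pow, map_mul, map_mul, ← h3]; ring

lemma LinearGrowth.mul_left (h : LinearGrowth P A w) (R : ℂ[σ]) :
    LinearGrowth (R * P) A w := by rw [mul_comm]; exact h.mul_right R

lemma LinearGrowth.regAt (h : LinearGrowth P A w) (i : ι) {x : σ → ℂ} (hx : x ∈ goodSet P) :
    RegAt (A i) x := by
  obtain ⟨c, hc⟩ := h
  obtain ⟨N, m, -, -, h3⟩ := hc i
  exact (ratEval_of_mul_eq h3 (by rw [map_pow]; exact pow_ne_zero _ hx.2)).1

lemma GExp.enlarge (h : GExp F A w) (R : ℂ[σ]) (hR : R ≠ 0) :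
    ∃ P : ℂ[σ], P ≠ 0 ∧ goodSet P ⊆ goodSet R ∧ LinearGrowth P A w ∧
    ∀ K : Set (σ → ℂ), IsCompact K → K ⊆ goodSet P → NormalConv F A w K := by
  obtain ⟨P, hP, h1, h2⟩ := h.converges
  refine ⟨P * R, mul_ne_zero hP hR, ?_, h1.mul_right R, fun K hK hKP => h2 K hK ?_⟩
  · rw [goodSet_mul]; exact Set.inter_subset_right
  · rw [goodSet_mul] at hKP; exact fun x hx => (hKP hx).1

lemma bddBelow_of_finite_le (hw : ∀ B : ℝ, {i | w i ≤ B}.Finite) : ∃ L : ℝ, 0 ≤ L ∧ ∀ i, -L ≤ w i := by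
  obtain ⟨L, hL⟩ := ((hw 0).image w).bddBelow
  refine ⟨max (-L) 0, le_max_right _ _, fun i => ?_⟩
  rcases le_or_gt (w i) 0 with h | h
  · have := hL ⟨i, h, rfl⟩
    have := le_max_left (-L) 0
    linarith
  · have := le_max_right (-L) 0
    linarith

lemma rpow_le_scaled {ε δ L v : ℝ} (hε : 0 < ε) (hδ : 0 < δ) (hδε : δ ≤ ε) (hv : L ≤ v) :
    δ ^ v ≤ (δ / ε) ^ L * ε ^ v := by
  have h1 : δ ^ v = (δ / ε) ^ v * ε ^ v := by
    rw [← Real.mul_rpow (by positivity) hε.le, div_mul_cancel₀ _ hε.ne']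
  rw [h1]
  refine mul_le_mul_of_nonneg_right ?_ (by positivity)
  exact Real.rpow_le_rpow_of_exponent_ge (by positivity) ((div_le_one hε).2 hδε) hv

lemma summable_shrink (hw : ∀ B : ℝ, {i | w i ≤ B}.Finite) {b : ι → ℝ} (hb : ∀ i, 0 ≤ b i)
    {ε δ : ℝ} (hε : 0 < ε) (hδ : 0 < δ) (hδε : δ ≤ ε) (h : Summable fun i => b i * ε ^ w i) :
    Summable fun i => b i * δ ^ w i := by
  obtain ⟨L, -, hL⟩ := bddBelow_of_finite_le hw
  refine Summable.of_nonneg_of_le (fun i => mul_nonneg (hb i) (by positivity)) (fun i => ?_)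
    (h.mul_left ((δ / ε) ^ (-L)))
  calc b i * δ ^ w i ≤ b i * ((δ / ε) ^ (-L) * ε ^ w i) :=
        mul_le_mul_of_nonneg_left (rpow_le_scaled hε hδ hδε (hL i)) (hb i)
    _ = _ := by ring

/-- Normal convergence with a nonnegative majorant and with a prescribed bound for `p`. -/
lemma NormalConv.shrink (hw : ∀ B : ℝ, {i | w i ≤ B}.Finite) {K : Set (σ → ℂ)}
    (h : NormalConv F A w K) : ∃ ε₀ : ℝ, 0 < ε₀ ∧ ∃ b : ι → ℝ, (∀ i, 0 ≤ b i) ∧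
    (∀ i, ∀ x ∈ K, ‖ratEval (A i) x‖ ≤ b i) ∧
    (∀ ε, 0 < ε → ε ≤ ε₀ → Summable (fun i => b i * ε ^ w i)) ∧
    ∀ x ∈ K, ∀ p : ℂ, 0 < ‖p‖ → ‖p‖ < ε₀ →
      HasSum (fun i => ratEval (A i) x * ppow p (w i)) (F x p) := by
  obtain ⟨ε, hε, b, h1, h2, h3⟩ := h
  rcases K.eq_empty_or_nonempty with rfl | ⟨x₀, hx₀⟩
  · exact ⟨1, one_pos, 0, fun i => le_rfl, by simp, by simp, by simp⟩
  have hb : ∀ i, 0 ≤ b i := fun i => (norm_nonneg _).trans (h1 i x₀ hx₀)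
  exact ⟨ε, hε, b, hb, h1, fun δ hδ hδε => summable_shrink hw hb hε hδ hδε h2, h3⟩

lemma GExp.congr (h : GExp F A w) (R : ℂ[σ]) (hR : R ≠ 0)
    (hFG : ∀ x ∈ goodSet R, ∀ p : ℂ, 0 < ‖p‖ → ‖p‖ < 1 → F x p = G x p) : GExp G A w := by
  refine ⟨h.finite_le, ?_⟩
  obtain ⟨P, hP, hPR, h1, h2⟩ := h.enlarge R hR
  refine ⟨P, hP, h1, fun K hK hKP => ?_⟩
  obtain ⟨ε, hε, b, -, h3, h4, h5⟩ := (h2 K hK hKP).shrink h.finite_le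
  refine ⟨min ε 1, by positivity, b, h3, h4 _ (by positivity) (min_le_left _ _),
    fun x hx p hp hp1 => ?_⟩
  rw [← hFG x (hPR (hKP hx)) p hp (hp1.trans_le (min_le_right _ _))]
  exact h5 x hx p hp (hp1.trans_le (min_le_left _ _))

lemma GExp.add (hF : GExp F A w) (hG : GExp G A' w') :
    GExp (fun x p => F x p + G x p) (Sum.elim A A') (Sum.elim w w') := by
  refine ⟨fun B => ?_, ?_⟩
  · refine (((hF.finite_le B).image inl).union ((hG.finite_le B).image inr)).subset ?_
    rintro (i | j) h
    · exact Or.inl ⟨i, h, rfl⟩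
    · exact Or.inr ⟨j, h, rfl⟩
  obtain ⟨P, hP, h1, h2⟩ := hF.converges
  obtain ⟨R, hR, g1, g2⟩ := hG.converges
  refine ⟨P * R, mul_ne_zero hP hR, ?_, fun K hK hKP => ?_⟩
  · obtain ⟨c, hc0, hc⟩ := (h1.mul_right R).nonneg
    obtain ⟨d, hd0, hd⟩ := (g1.mul_left P).nonneg
    refine ⟨c + d, ?_⟩
    rintro (i | j)
    · obtain ⟨N, m, e1, e2, e3⟩ := hc i
      refine ⟨N, m, ?_, ?_, e3⟩ <;> simp only [Sum.elim_inl] <;>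
        nlinarith [mul_nonneg hd0 (by positivity : 0 ≤ 1 + |w i|)]
    · obtain ⟨N, m, e1, e2, e3⟩ := hd j
      refine ⟨N, m, ?_, ?_, e3⟩ <;> simp only [Sum.elim_inr] <;>
        nlinarith [mul_nonneg hc0 (by positivity : 0 ≤ 1 + |w' j|)]
  · rw [goodSet_mul] at hKP
    obtain ⟨ε, hε, b, -, h3, h4, h5⟩ := (h2 K hK fun x hx => (hKP hx).1).shrink hF.finite_le
    obtain ⟨δ, hδ, d, -, g3, g4, g5⟩ := (g2 K hK fun x hx => (hKP hx).2).shrink hG.finite_le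
    refine ⟨min ε δ, by positivity, Sum.elim b d, ?_, ?_, ?_⟩
    · rintro (i | j) x hx
      exacts [h3 i x hx, g3 j x hx]
    · exact ((h4 _ (by positivity) (min_le_left _ _)).hasSum.sum (f := fun i : ι ⊕ κ =>
        Sum.elim b d i * min ε δ ^ Sum.elim w w' i)
        (g4 _ (by positivity) (min_le_right _ _)).hasSum).summable
    · intro x hx p hp hp1
      have e1 := h5 x hx p hp (hp1.trans_le (min_le_left _ _))
      have e2 := g5 x hx p hp (hp1.trans_le (min_le_right _ _))
      exact HasSum.sum (f := fun i : ι ⊕ κ => ratEval (Sum.elim A A' i) x * ppow p (Sum.elim w w' i))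
        e1 e2

lemma GExp.mul (hF : GExp F A w) (hG : GExp G A' w') :
    GExp (fun x p => F x p * G x p) (fun i : ι × κ => A i.1 * A' i.2)
      (fun i : ι × κ => w i.1 + w' i.2) := by
  obtain ⟨L, hL0, hL⟩ := bddBelow_of_finite_le hF.finite_le
  obtain ⟨M, hM0, hM⟩ := bddBelow_of_finite_le hG.finite_le
  refine ⟨fun B => ?_, ?_⟩
  · refine ((hF.finite_le (B + M)).prod (hG.finite_le (B + L))).subset ?_
    rintro ⟨i, j⟩ h
    have h' : w i + w' j ≤ B := h
    have := hL i
    have := hM j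
    exact ⟨by simp; linarith, by simp; linarith⟩
  obtain ⟨P, hP, h1, h2⟩ := hF.converges
  obtain ⟨R, hR, g1, g2⟩ := hG.converges
  refine ⟨P * R, mul_ne_zero hP hR, ?_, fun K hK hKP => ?_⟩
  · obtain ⟨c, hc0, hc⟩ := (h1.mul_right R).nonneg
    obtain ⟨d, hd0, hd⟩ := (g1.mul_left P).nonneg
    refine ⟨(c + d) * (2 + 2 * (L + M)), ?_⟩
    rintro ⟨i, j⟩
    obtain ⟨N, m, e1, e2, e3⟩ := hc i
    obtain ⟨N', m', f1, f2, f3⟩ := hd j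
    have a1 : |w i| ≤ w i + 2 * L := abs_le.2 ⟨by linarith [hL i], by linarith⟩
    have a2 : |w' j| ≤ w' j + 2 * M := abs_le.2 ⟨by linarith [hM j], by linarith⟩
    have a3 : w i + w' j ≤ |w i + w' j| := le_abs_self _
    have a4 : c * (1 + |w i|) + d * (1 + |w' j|) ≤
        (c + d) * (2 + 2 * (L + M)) * (1 + |w i + w' j|) := by
      have b1 : 1 + |w i| ≤ (2 + 2 * (L + M)) * (1 + |w i + w' j|) := by
        have : |w i| ≤ |w i + w' j| + 2 * L + M := by linarith [hM j]
        nlinarith [abs_nonneg (w i + w' j)]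
      have b2 : 1 + |w' j| ≤ (2 + 2 * (L + M)) * (1 + |w i + w' j|) := by
        have : |w' j| ≤ |w i + w' j| + 2 * M + L := by linarith [hL i]
        nlinarith [abs_nonneg (w i + w' j)]
      have := mul_le_mul_of_nonneg_left b1 hc0
      have := mul_le_mul_of_nonneg_left b2 hd0
      linarith
    refine ⟨N * N', m + m', ?_, ?_, ?_⟩
    · push_cast; linarith
    · have : ((N * N').totalDegree : ℝ) ≤ N.totalDegree + N'.totalDegree := by
        exact_mod_cast totalDegree_mul _ _
      linarith
    · rw [pow_add, map_mul, map_mul, ← e3, ← f3]; ring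
  · rw [goodSet_mul] at hKP
    obtain ⟨ε, hε, b, hb, h3, h4, h5⟩ := (h2 K hK fun x hx => (hKP hx).1).shrink hF.finite_le
    obtain ⟨δ, hδ, d, hd, g3, g4, g5⟩ := (g2 K hK fun x hx => (hKP hx).2).shrink hG.finite_le
    have hm : 0 < min ε δ := by positivity
    have ev : ∀ i j, ∀ x ∈ K, ratEval (A i * A' j) x = ratEval (A i) x * ratEval (A' j) x :=
      fun i j x hx => (ratEval_mul (h1.regAt i (hKP hx).1) (g1.regAt j (hKP hx).2)).2
    have sm : ∀ η, 0 < η → η ≤ min ε δ →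
        Summable fun i : ι × κ => b i.1 * d i.2 * η ^ (w i.1 + w' i.2) := by
      intro η hη hle
      have := Summable.mul_of_nonneg (h4 η hη (hle.trans (min_le_left _ _)))
        (g4 η hη (hle.trans (min_le_right _ _)))
        (fun i => mul_nonneg (hb i) (by positivity)) (fun j => mul_nonneg (hd j) (by positivity))
      refine this.congr fun i => ?_
      rw [Real.rpow_add hη]; ring
    refine ⟨min ε δ, hm, fun i => b i.1 * d i.2, ?_, sm _ hm le_rfl, ?_⟩
    · rintro ⟨i, j⟩ x hx
      rw [ev i j x hx, norm_mul]
      exact mul_le_mul (h3 i x hx) (g3 j x hx) (norm_nonneg _) (hb i)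
    · intro x hx p hp hp1
      have hp0 : p ≠ 0 := norm_pos_iff.1 hp
      have e1 := h5 x hx p hp (hp1.trans_le (min_le_left _ _))
      have e2 := g5 x hx p hp (hp1.trans_le (min_le_right _ _))
      have e3 : Summable fun i : ι × κ => (ratEval (A i.1) x * ppow p (w i.1)) *
          (ratEval (A' i.2) x * ppow p (w' i.2)) := by
        refine Summable.of_norm_bounded (sm ‖p‖ hp hp1.le) ?_
        rintro ⟨i, j⟩
        rw [norm_mul, norm_mul, norm_mul, norm_ppow hp0, norm_ppow hp0, Real.rpow_add hp]
        calc _ = (‖ratEval (A i) x‖ * ‖ratEval (A' j) x‖) * (‖p‖ ^ w i * ‖p‖ ^ w' j) := by ring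
          _ ≤ _ := mul_le_mul_of_nonneg_right
            (mul_le_mul (h3 i x hx) (g3 j x hx) (norm_nonneg _) (hb i)) (by positivity)
      refine (e1.mul e2 e3).congr_fun fun i => ?_
      rw [ev i.1 i.2 x hx, ppow_add hp0]; ring

/-- Terms of equal exponent are collected. -/
def collect (A : ι → Rat σ) (w : ι → ℝ) (hw : ∀ B : ℝ, {i | w i ≤ B}.Finite) (e : ℝ) : Rat σ :=
  ∑ i ∈ (hw e).toFinset with w i = e, A i

/-- Expansions with repeated exponents give expansions in the sense of `HasPExpansion`; the
numerators of terms with equal exponents have to be brought to a common denominator. -/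
lemma GExp.hasPExpansion (h : GExp F A w) : HasPExpansion F (collect A w h.finite_le) := by
  have hw := h.finite_le
  have mem : ∀ e i, i ∈ (hw e).toFinset.filter (fun i => w i = e) ↔ w i = e := fun e i => by
    simp only [mem_filter, Set.Finite.mem_toFinset, Set.mem_ofPred_eq]
    exact ⟨fun h => h.2, fun h => ⟨h.le, h⟩⟩
  refine ⟨fun B => ?_, ?_⟩
  · refine ((hw B).image w).subset ?_
    rintro e ⟨he, heB⟩
    obtain ⟨i, hi, -⟩ := exists_ne_zero_of_sum_ne_zero he
    have := (mem e i).1 hi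
    exact ⟨i, by simp [this, heB], this⟩
  obtain ⟨P, hP, h1, h2⟩ := h.converges
  refine ⟨P, hP, ?_, fun K hK hKP => ?_⟩
  · obtain ⟨c, hc0, hc⟩ := h1.nonneg
    choose N m e1 e2 e3 using hc
    refine ⟨c * (1 + P.totalDegree) , fun e => ?_⟩
    -- the numerators are brought to the common denominator `P ^ M`
    set s := (hw e).toFinset.filter (fun i => w i = e) with hs
    set M := s.sup m with hM
    have hMle : ∀ i ∈ s, m i ≤ M := fun i hi => le_sup (f := m) hi
    have hMb : (M : ℝ) ≤ c * (1 + |e|) := by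
      rcases s.eq_empty_or_nonempty with h0 | hne
      · rw [hM, h0]; simp; positivity
      · obtain ⟨i, hi, hiM⟩ := exists_mem_eq_sup s hne m
        rw [hM, hiM]
        have := e1 i
        rwa [(mem e i).1 hi] at this
    have hPd : (0 : ℝ) ≤ P.totalDegree := Nat.cast_nonneg _
    have hce : 0 ≤ c * (1 + |e|) := by positivity
    refine ⟨∑ i ∈ s, N i * P ^ (M - m i), M, ?_, ?_, ?_⟩
    · nlinarith
    · have hdeg : ((∑ i ∈ s, N i * P ^ (M - m i)).totalDegree : ℝ) ≤
          c * (1 + |e|) + c * (1 + |e|) * P.totalDegree := by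
        have hb : ∀ i ∈ s, (N i * P ^ (M - m i)).totalDegree ≤
            s.sup (fun i => (N i).totalDegree) + M * P.totalDegree := fun i hi =>
          (totalDegree_mul _ _).trans (Nat.add_le_add
            (le_sup (f := fun i => (N i).totalDegree) hi)
            ((totalDegree_pow _ _).trans (Nat.mul_le_mul_right _ (Nat.sub_le _ _))))
        have h3 : ((∑ i ∈ s, N i * P ^ (M - m i)).totalDegree : ℝ) ≤
            ((s.sup (fun i => (N i).totalDegree) : ℕ) : ℝ) + M * P.totalDegree := by
          exact_mod_cast totalDegree_finsetSum_le hb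
        have h4 : ((s.sup (fun i => (N i).totalDegree) : ℕ) : ℝ) ≤ c * (1 + |e|) := by
          rcases s.eq_empty_or_nonempty with h0 | hne
          · rw [h0]; simp; positivity
          · obtain ⟨i, hi, hiM⟩ := exists_mem_eq_sup s hne fun i => (N i).totalDegree
            rw [hiM]
            have := e2 i
            rwa [(mem e i).1 hi] at this
        have := mul_le_mul_of_nonneg_right hMb hPd
        linarith
      linarith
    · rw [collect, sum_mul, map_sum]
      refine sum_congr rfl fun i hi => ?_
      rw [map_mul, ← e3 i, mul_assoc, ← map_mul, ← pow_add, Nat.add_sub_cancel' (hMle i hi)]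
  · obtain ⟨ε, hε, b, hb, h3, h4, h5⟩ := (h2 K hK hKP).shrink hw
    have ev : ∀ e, ∀ x ∈ K, ratEval (collect A w hw e) x =
        ∑ i ∈ (hw e).toFinset with w i = e, ratEval (A i) x := fun e x hx =>
      (ratEval_sum _ _ fun i _ => h1.regAt i (hKP x hx)).2
    have fib : ∀ {M : Type} [AddCommMonoid M] [TopologicalSpace M] (f : ι → M) (e : ℝ),
        HasSum (fun i : w ⁻¹' {e} => f i) (∑ i ∈ (hw e).toFinset with w i = e, f i) := by
      intro M _ _ f e
      have : w ⁻¹' {e} = ↑((hw e).toFinset.filter fun i => w i = e) := by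
        ext i; rw [mem_coe, mem]; rfl
      rw [this]
      exact Finset.hasSum _ f
    refine ⟨ε, hε, fun e => ∑ i ∈ (hw e).toFinset with w i = e, b i, ?_, ?_, ?_⟩
    · intro e x hx
      rw [ev e x hx]
      exact (norm_sum_le _ _).trans (sum_le_sum fun i _ => h3 i x hx)
    · have hs := (h4 ε hε le_rfl).hasSum
      have hs' := ((Equiv.sigmaFiberEquiv w).hasSum_iff.2 hs).sigma fun e =>
        fib (fun i => b i * ε ^ w i) e
      refine hs'.summable.congr fun e => ?_
      rw [sum_mul]
      exact sum_congr rfl fun i hi => by rw [(mem e i).1 hi]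
    · intro x hx p hp hp1
      have hs' := ((Equiv.sigmaFiberEquiv w).hasSum_iff.2 (h5 x hx p hp hp1)).sigma fun e =>
        fib (fun i => ratEval (A i) x * ppow p (w i)) e
      refine hs'.congr_fun fun e => ?_
      rw [ev e x hx, sum_mul]
      exact sum_congr rfl fun i hi => by rw [(mem e i).1 hi]

/-- An expansion in the sense of `HasPExpansion`, restricted to the exponents that occur. -/
lemma GExp.of_hasPExpansion {a : ℝ → Rat σ} (h : HasPExpansion F a) :
    GExp F (fun e : {e // a e ≠ 0} => a e) (fun e => (e : ℝ)) := by
  refine ⟨fun B => ?_, ?_⟩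
  · refine Set.Finite.of_finite_image ((h.finite_le B).subset ?_) Subtype.val_injective.injOn
    rintro _ ⟨e, he, rfl⟩
    exact ⟨e.2, he⟩
  obtain ⟨P, hP, ⟨c, hc⟩, h2⟩ := h.converges
  refine ⟨P, hP, ⟨c, fun e => hc e⟩, fun K hK hKP => ?_⟩
  obtain ⟨ε, hε, b, h3, h4, h5⟩ := h2 K hK hKP
  refine ⟨ε, hε, fun e => b e, fun e => h3 e, h4.subtype _, fun x hx p hp hp1 => ?_⟩
  have := h5 x hx p hp hp1
  refine (hasSum_subtype_iff_of_support_subset (s := {e | a e ≠ 0}) ?_).2 this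
  intro e he h0
  exact he (by simp [h0, (ratEval_zero x).2])

end GExp

section Inverse

lemma hasSum_prod_pow {R ι : Type} [NormedField R] [CompleteSpace R] {f : ι → R}
    (hf : Summable fun i => ‖f i‖) (k : ℕ) :
    (Summable fun s : Fin k → ι => ‖∏ j, f (s j)‖) ∧
      HasSum (fun s : Fin k → ι => ∏ j, f (s j)) ((∑' i, f i) ^ k) := by
  induction k with
  | zero =>
    have h : HasSum (fun s : Fin 0 → ι => ∏ j, f (s j)) 1 := by
      simp
    exact ⟨(hasSum_unique fun s : Fin 0 → ι => ‖∏ j, f (s j)‖).summable, by simp⟩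
  | succ k ih =>
    obtain ⟨h1, h2⟩ := ih
    let e : ι × (Fin k → ι) ≃ (Fin (k + 1) → ι) := Fin.consEquiv fun _ => ι
    have he : ∀ a, ∏ j, f (e a j) = f a.1 * ∏ j, f (a.2 j) := fun a => by
      rw [Fin.prod_univ_succ]; rfl
    have hn : Summable fun a : ι × (Fin k → ι) => ‖f a.1 * ∏ j, f (a.2 j)‖ :=
      Summable.mul_norm (f := f) (g := fun s : Fin k → ι => ∏ j, f (s j)) hf h1
    constructor
    · refine e.summable_iff.1 (hn.congr fun a => ?_)
      rw [Function.comp_apply, he]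
    · refine e.hasSum_iff.1 ?_
      have := hf.of_norm.hasSum.mul h2 hn.of_norm
      rw [pow_succ']
      exact this.congr_fun he

lemma hasSum_geometric_list {R ι : Type} [NormedField R] [CompleteSpace R] {f : ι → R}
    {g : ι → ℝ} (hg : Summable g) (hfg : ∀ i, ‖f i‖ ≤ g i) (hg1 : ∑' i, g i < 1) :
    (Summable fun s : Σ k, Fin k → ι => ∏ j, g (s.2 j)) ∧
      HasSum (fun s : Σ k, Fin k → ι => ∏ j, f (s.2 j)) (1 - ∑' i, f i)⁻¹ := by
  have hg0 : ∀ i, 0 ≤ g i := fun i => (norm_nonneg _).trans (hfg i)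
  have hgn : Summable fun i => ‖g i‖ := hg.abs
  have hfn : Summable fun i => ‖f i‖ := Summable.of_nonneg_of_le (fun i => norm_nonneg _) hfg hg
  have h1 : Summable fun s : Σ k, Fin k → ι => ∏ j, g (s.2 j) := by
    refine (summable_sigma_of_nonneg fun s => prod_nonneg fun j _ => hg0 _).2
      ⟨fun k => (hasSum_prod_pow hgn k).2.summable, ?_⟩
    refine (summable_geometric_of_lt_one (tsum_nonneg hg0) hg1).congr fun k => ?_
    exact (hasSum_prod_pow hgn k).2.tsum_eq.symm
  refine ⟨h1, ?_⟩
  have h2 : Summable fun s : Σ k, Fin k → ι => ∏ j, f (s.2 j) := by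
    refine Summable.of_norm_bounded h1 fun s => ?_
    rw [norm_prod]
    exact prod_le_prod (fun _ _ => norm_nonneg _) fun j _ => hfg _
  have h3 := h2.hasSum.sigma fun k => (hasSum_prod_pow hfn k).2
  have h4 : ‖∑' i, f i‖ < 1 :=
    ((norm_tsum_le_tsum_norm hfn).trans (hfn.tsum_le_tsum hfg hg)).trans_lt hg1
  rw [(hasSum_geometric_of_norm_lt_one h4).unique h3]
  exact h2.hasSum

variable {σ ι : Type} {F : (σ → ℂ) → ℂ → ℂ} {A : ι → Rat σ} {w : ι → ℝ}

/-- The geometric series, indexed by lists of exponents. -/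
lemma GExp.one_sub_inv (h : GExp F A w) {δ : ℝ} (hδ : 0 < δ) (hw : ∀ i, δ ≤ w i) :
    GExp (fun x p => (1 - F x p)⁻¹) (fun s : Σ k, Fin k → ι => ∏ j, A (s.2 j))
      (fun s => ∑ j, w (s.2 j)) := by
  have hk : ∀ s : Σ k, Fin k → ι, δ * s.1 ≤ ∑ j, w (s.2 j) := fun s => by
    have := card_nsmul_le_sum univ (fun j => w (s.2 j)) δ fun j _ => hw _
    simpa [mul_comm] using this
  have hw0 : ∀ i, 0 ≤ w i := fun i => hδ.le.trans (hw i)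
  refine ⟨fun B => ?_, ?_⟩
  · refine ((Set.finite_Iic ⌊B / δ⌋₊).biUnion fun k _ => (Set.Finite.pi (t := fun _ : Fin k =>
      {i | w i ≤ B}) fun _ => h.finite_le B).image (Sigma.mk (β := fun k => Fin k → ι) k)).subset ?_
    rintro ⟨k, s⟩ hs
    have hs' : ∑ j, w (s j) ≤ B := hs
    refine Set.mem_iUnion₂.2 ⟨k, ?_, s, fun j _ => ?_, rfl⟩
    · exact Nat.le_floor ((le_div_iff₀ hδ).2 (by have := hk ⟨k, s⟩; simp at this; linarith))
    · exact (single_le_sum (fun i _ => hw0 (s i)) (mem_univ j)).trans hs'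
  obtain ⟨P, hP, h1, h2⟩ := h.converges
  refine ⟨P, hP, ?_, fun K hK hKP => ?_⟩
  · obtain ⟨c, hc0, hc⟩ := h1.nonneg
    choose N m e1 e2 e3 using hc
    have sb : ∀ s : Σ k, Fin k → ι, ∑ j, c * (1 + |w (s.2 j)|) ≤
        c * (1 / δ + 1) * (1 + |∑ j, w (s.2 j)|) := fun s => by
      have a1 : |∑ j, w (s.2 j)| = ∑ j, w (s.2 j) := abs_of_nonneg (sum_nonneg fun j _ => hw0 _)
      have a2 : ∑ j, c * (1 + |w (s.2 j)|) = c * (s.1 + ∑ j, w (s.2 j)) := by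
        rw [← mul_sum, sum_add_distrib]
        congr 1
        simp [abs_of_nonneg (hw0 _)]
      have a3 : (s.1 : ℝ) ≤ 1 / δ * ∑ j, w (s.2 j) := by
        rw [one_div, inv_mul_eq_div, le_div_iff₀ hδ, mul_comm]; exact hk s
      have a4 : 0 ≤ ∑ j, w (s.2 j) := sum_nonneg fun j _ => hw0 _
      rw [a1, a2, mul_assoc]
      refine mul_le_mul_of_nonneg_left ?_ hc0
      have : 0 < 1 / δ := by positivity
      nlinarith
    refine ⟨c * (1 / δ + 1), fun s => ⟨∏ j, N (s.2 j), ∑ j, m (s.2 j), ?_, ?_, ?_⟩⟩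
    · push_cast
      exact (sum_le_sum fun j _ => e1 (s.2 j)).trans (sb s)
    · refine le_trans ?_ ((sum_le_sum fun j _ => e2 (s.2 j)).trans (sb s))
      exact_mod_cast totalDegree_finsetProd _ _
    · rw [← prod_pow_eq_pow_sum, map_prod, map_prod, ← prod_mul_distrib]
      exact prod_congr rfl fun j _ => e3 _
  · obtain ⟨ε, hε, b, hb, h3, h4, h5⟩ := (h2 K hK hKP).shrink h.finite_le
    set S := ∑' i, b i * ε ^ w i with hS
    have hS0 : 0 ≤ S := tsum_nonneg fun i => mul_nonneg (hb i) (by positivity)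
    -- the bound for `p` is chosen so that the series is dominated by a geometric series
    set η : ℝ := (1 / (2 * (S + 1))) ^ δ⁻¹ with hη
    have hη0 : 0 < η := by positivity
    have hη1 : η ≤ 1 := Real.rpow_le_one (by positivity)
      (by rw [div_le_one (by positivity)]; linarith) (by positivity)
    have hηδ : η ^ δ = 1 / (2 * (S + 1)) := Real.rpow_inv_rpow (by positivity) hδ.ne'
    set ε' := η * ε with hε'
    have hε'0 : 0 < ε' := by positivity
    have hε'ε : ε' ≤ ε := by nlinarith
    have hbound : ∀ i, b i * ε' ^ w i ≤ 1 / (2 * (S + 1)) * (b i * ε ^ w i) := fun i => by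
      have := rpow_le_scaled hε hε'0 hε'ε (hw i)
      rw [hε', mul_div_cancel_right₀ _ hε.ne', hηδ] at this
      calc _ ≤ b i * (1 / (2 * (S + 1)) * ε ^ w i) := mul_le_mul_of_nonneg_left this (hb i)
        _ = _ := by ring
    have hg : Summable fun i => b i * ε' ^ w i := h4 ε' hε'0 hε'ε
    have hg1 : ∑' i, b i * ε' ^ w i < 1 := by
      have h6 := hg.tsum_le_tsum hbound ((h4 ε hε le_rfl).mul_left _)
      rw [tsum_mul_left, ← hS] at h6
      refine h6.trans_lt ?_
      rw [one_div_mul_eq_div, div_lt_one (by positivity)]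
      linarith
    have reg : ∀ s : Σ k, Fin k → ι, ∀ x ∈ K,
        ratEval (∏ j, A (s.2 j)) x = ∏ j, ratEval (A (s.2 j)) x := fun s x hx =>
      (ratEval_prod _ _ fun j _ => h1.regAt _ (hKP hx)).2
    refine ⟨ε', hε'0, fun s => ∏ j, b (s.2 j), ?_, ?_, ?_⟩
    · intro s x hx
      rw [reg s x hx, norm_prod]
      exact prod_le_prod (fun _ _ => norm_nonneg _) fun j _ => h3 _ x hx
    · have := (hasSum_geometric_list (f := fun i => b i * ε' ^ w i) hg (fun i => by
        rw [Real.norm_of_nonneg (mul_nonneg (hb i) (by positivity))]) hg1).1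
      refine this.congr fun s => ?_
      rw [prod_mul_distrib, Real.rpow_sum_of_pos hε'0]
    · intro x hx p hp hp1
      have hp0 : p ≠ 0 := norm_pos_iff.1 hp
      have h6 := h5 x hx p hp (hp1.trans_le hε'ε)
      have := (hasSum_geometric_list (f := fun i => ratEval (A i) x * ppow p (w i)) hg (fun i => by
        rw [norm_mul, norm_ppow hp0]
        exact mul_le_mul (h3 i x hx) (Real.rpow_le_rpow hp.le hp1.le (hw0 i)) (by positivity)
          (hb i)) hg1).2
      rw [h6.tsum_eq] at this
      refine this.congr_fun fun s => ?_
      rw [reg s x hx, prod_mul_distrib, ppow_sum hp0]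

/-- The inverse of a series that starts with `1`. -/
lemma GExp.inv_of_one (h : GExp F A w) {i₀ : ι} (hA : A i₀ = 1) (h0 : w i₀ = 0) {δ : ℝ}
    (hδ : 0 < δ) (hw : ∀ i, i ≠ i₀ → δ ≤ w i) :
    GExp (fun x p => (F x p)⁻¹) (fun s : Σ k, Fin k → {i // i ≠ i₀} => ∏ j, -A (s.2 j))
      (fun s => ∑ j, w (s.2 j)) := by
  classical
  have hB : GExp (fun x p => 1 - F x p) (fun i : {i // i ≠ i₀} => -A i) (fun i => w i) := by
    refine ⟨fun B => ?_, ?_⟩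
    · exact (h.finite_le B).preimage Subtype.val_injective.injOn
    obtain ⟨P, hP, h1, h2⟩ := h.converges
    refine ⟨P, hP, ?_, fun K hK hKP => ?_⟩
    · obtain ⟨c, hc⟩ := h1
      refine ⟨c, fun i => ?_⟩
      obtain ⟨N, m, e1, e2, e3⟩ := hc i
      exact ⟨-N, m, e1, by rwa [totalDegree_neg], by rw [neg_mul, e3, map_neg]⟩
    · obtain ⟨ε, hε, b, h3, h4, h5⟩ := h2 K hK hKP
      have reg : ∀ i, ∀ x ∈ K, ratEval (-A i) x = -ratEval (A i) x := fun i x hx => by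
        have e := ratEval_mul (a := algebraMap (ℂ[σ]) (Rat σ) (C (-1)))
          (ratEval_algebraMap _ x).1 (h1.regAt i (hKP hx))
        rw [(ratEval_algebraMap _ x).2] at e
        simpa using e.2
      refine ⟨ε, hε, fun i => b i, fun i x hx => ?_, h4.subtype _, fun x hx p hp hp1 => ?_⟩
      · rw [reg i x hx, norm_neg]; exact h3 i x hx
      · have h6 := (hasSum_ite_sub_hasSum (h5 x hx p hp hp1) i₀).neg
        rw [hA, h0, ppow_zero, (ratEval_one x).2, mul_one, neg_sub] at h6
        refine ((hasSum_subtype_iff_of_support_subset (s := {i | i ≠ i₀}) ?_).2 h6).congr_fun ?_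
        · intro i hi h'
          exact hi (by simp [h'])
        · rintro ⟨i, hi⟩
          have hi' : i ≠ i₀ := hi
          simp [hi', reg i x hx]
  exact (hB.one_sub_inv hδ fun i => hw i i.2).congr 1 one_ne_zero fun x _ p _ _ => by
    rw [sub_sub_cancel]

end Inverse

/-! ### Leading terms -/

section Lead

variable {σ : Type} {F G : (σ → ℂ) → ℂ → ℂ} {v v' : ℝ} {φ ψ : (σ → ℂ) → ℂ}

/-- `F` has an expansion with exponents `≥ v` in which `p^v` has the coefficient `φ`, at generic
points. -/
def Lead (F : (σ → ℂ) → ℂ → ℂ) (v : ℝ) (φ : (σ → ℂ) → ℂ) : Prop :=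
  ∃ (ι : Type) (A : ι → Rat σ) (w : ι → ℝ) (h : GExp F A w), (∀ i, v ≤ w i) ∧
    ∃ R : ℂ[σ], R ≠ 0 ∧ ∀ x ∈ goodSet R,
      φ x = ∑ i ∈ (h.finite_le v).toFinset, ratEval (A i) x

lemma Lead.exists_hasPExpansion (h : Lead F v φ) : ∃ a, HasPExpansion F a := by
  obtain ⟨ι, A, w, h, -⟩ := h
  exact ⟨_, h.hasPExpansion⟩

lemma Lead.congr (h : Lead F v φ) (R : ℂ[σ]) (hR : R ≠ 0)
    (hF : ∀ x ∈ goodSet R, ∀ p : ℂ, 0 < ‖p‖ → ‖p‖ < 1 → F x p = G x p)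
    (hφ : ∀ x ∈ goodSet R, φ x = ψ x) (hv : v = v') : Lead G v' ψ := by
  subst hv
  obtain ⟨ι, A, w, h, h1, S, hS, h2⟩ := h
  refine ⟨ι, A, w, h.congr R hR hF, h1, R * S, mul_ne_zero hR hS, fun x hx => ?_⟩
  rw [goodSet_mul] at hx
  rw [← hφ x hx.1, h2 x hx.2]

lemma Lead.mul (hF : Lead F v φ) (hG : Lead G v' ψ) :
    Lead (fun x p => F x p * G x p) (v + v') (fun x => φ x * ψ x) := by
  obtain ⟨ι, A, w, h, h1, S, hS, h2⟩ := hF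
  obtain ⟨κ, A', w', g, g1, T, hT, g2⟩ := hG
  obtain ⟨P, hP, hPS, hlP, -⟩ := h.enlarge S hS
  obtain ⟨Q, hQ, hQT, hlQ, -⟩ := g.enlarge T hT
  refine ⟨ι × κ, _, _, h.mul g, fun i => add_le_add (h1 _) (g1 _), P * Q, mul_ne_zero hP hQ,
    fun x hx => ?_⟩
  rw [goodSet_mul] at hx
  have e : ((h.mul g).finite_le (v + v')).toFinset =
      (h.finite_le v).toFinset ×ˢ (g.finite_le v').toFinset := by
    ext ⟨i, j⟩
    simp only [Set.Finite.mem_toFinset, Set.mem_ofPred_eq, mem_product]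
    have := h1 i
    have := g1 j
    exact ⟨fun _ => ⟨by linarith, by linarith⟩, fun ⟨_, _⟩ => by linarith⟩
  beta_reduce
  rw [e, sum_product, h2 x (hPS hx.1), g2 x (hQT hx.2), sum_mul_sum]
  exact sum_congr rfl fun i _ => sum_congr rfl fun j _ =>
    (ratEval_mul (hlP.regAt i hx.1) (hlQ.regAt j hx.2)).2.symm

lemma Lead.add (hF : Lead F v φ) (hG : Lead G v ψ) :
    Lead (fun x p => F x p + G x p) v (fun x => φ x + ψ x) := by
  obtain ⟨ι, A, w, h, h1, S, hS, h2⟩ := hF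
  obtain ⟨κ, A', w', g, g1, T, hT, g2⟩ := hG
  refine ⟨ι ⊕ κ, _, _, h.add g, ?_, S * T, mul_ne_zero hS hT, fun x hx => ?_⟩
  · rintro (i | j)
    exacts [h1 i, g1 j]
  rw [goodSet_mul] at hx
  have e : ((h.add g).finite_le v).toFinset =
      (h.finite_le v).toFinset.disjSum (g.finite_le v).toFinset := by
    ext (i | j) <;> simp
  beta_reduce
  rw [e, sum_disjSum, h2 x hx.1, g2 x hx.2]
  rfl

/-- The leading coefficient is a locally uniform limit. -/
lemma Lead.tendsto (h : Lead F v φ) : ∃ R : ℂ[σ], R ≠ 0 ∧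
    ∀ K : Set (σ → ℂ), IsCompact K → K ⊆ goodSet R →
      TendstoUniformlyOn (fun (p : ℂ) (x : σ → ℂ) => ppow p (-v) * F x p) φ (𝓝[≠] 0) K := by
  classical
  obtain ⟨ι, A, w, h, h1, S, hS, h2⟩ := h
  obtain ⟨P, hP, hPS, hlP, hconv⟩ := h.enlarge S hS
  refine ⟨P, hP, fun K hK hKP => ?_⟩
  obtain ⟨ε, hε, b, hb, h3, h4, h5⟩ := (hconv K hK hKP).shrink h.finite_le
  set s := (h.finite_le v).toFinset with hs
  have hws : ∀ i, i ∈ s ↔ w i = v := fun i => by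
    simp only [hs, Set.Finite.mem_toFinset, Set.mem_ofPred_eq]
    exact ⟨fun h => le_antisymm h (h1 i), fun h => h.le⟩
  -- a gap between `v` and the other exponents
  obtain ⟨δ, hδ, hgap⟩ : ∃ δ : ℝ, 0 < δ ∧ ∀ i, i ∉ s → v + δ ≤ w i := by
    set u := (h.finite_le (v + 1)).toFinset.filter (fun i => i ∉ s) with hu
    rcases u.eq_empty_or_nonempty with h0 | hne
    · refine ⟨1, one_pos, fun i hi => ?_⟩
      by_contra hlt
      have : i ∈ u := by
        rw [hu, mem_filter]; exact ⟨by simp; linarith, hi⟩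
      rw [h0] at this
      simp at this
    · obtain ⟨i₀, hi₀, hmin⟩ := u.exists_min_image w hne
      have hlt : v < w i₀ := lt_of_le_of_ne (h1 i₀) fun e =>
        (mem_filter.1 hi₀).2 ((hws i₀).2 e.symm)
      refine ⟨min 1 (w i₀ - v), lt_min one_pos (by linarith), fun i hi => ?_⟩
      by_cases hi1 : w i ≤ v + 1
      · have := hmin i (by rw [hu, mem_filter]; exact ⟨by simpa using hi1, hi⟩)
        have := min_le_right 1 (w i₀ - v)
        linarith
      · have := min_le_left 1 (w i₀ - v)
        linarith
  set S := ∑' i, b i * ε ^ w i with hSdef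
  have key : ∀ x ∈ K, ∀ p : ℂ, 0 < ‖p‖ → ‖p‖ < ε →
      ‖ppow p (-v) * F x p - φ x‖ ≤ ε ^ (-v) * S * (‖p‖ / ε) ^ δ := by
    intro x hx p hp hpε
    have hp0 : p ≠ 0 := norm_pos_iff.1 hp
    have e1 := (h5 x hx p hp hpε).mul_left (ppow p (-v))
    have e2 : HasSum (fun i => if i ∈ s then ratEval (A i) x else 0) (φ x) := by
      rw [h2 x (hPS (hKP hx)), sum_congr rfl fun i hi => (if_pos hi).symm]
      exact hasSum_sum_of_ne_finset_zero fun i hi => if_neg hi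
    have e3 := e1.sub e2
    have e4 : ∀ i, ‖ppow p (-v) * (ratEval (A i) x * ppow p (w i)) -
        (if i ∈ s then ratEval (A i) x else 0)‖ ≤
        ε ^ (-v) * (‖p‖ / ε) ^ δ * (b i * ε ^ w i) := by
      intro i
      split_ifs with hi
      · rw [(hws i).1 hi, mul_left_comm, ← ppow_add hp0, neg_add_cancel, ppow_zero, mul_one,
          sub_self, norm_zero]
        exact mul_nonneg (by positivity) (mul_nonneg (hb i) (by positivity))
      · rw [sub_zero, mul_left_comm, ← ppow_add hp0, norm_mul, norm_ppow hp0]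
        have a1 : ‖p‖ ^ (-v + w i) ≤ (‖p‖ / ε) ^ δ * ε ^ (-v + w i) :=
          rpow_le_scaled hε hp hpε.le (by linarith [hgap i hi])
        have a2 : ε ^ (-v + w i) = ε ^ (-v) * ε ^ w i := Real.rpow_add hε _ _
        calc _ ≤ b i * ((‖p‖ / ε) ^ δ * ε ^ (-v + w i)) :=
              mul_le_mul (h3 i x hx) a1 (by positivity) (hb i)
          _ = _ := by rw [a2]; ring
    have e5 : Summable fun i => ε ^ (-v) * (‖p‖ / ε) ^ δ * (b i * ε ^ w i) :=
      (h4 ε hε le_rfl).mul_left _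
    have e6 := e3.tsum_eq
    have e7 := tsum_of_norm_bounded e5.hasSum e4
    rw [e6, tsum_mul_left] at e7
    calc _ ≤ _ := e7
      _ = _ := by ring
  rw [tendstoUniformlyOn_iff]
  intro η hη
  have lim : Tendsto (fun p : ℂ => ε ^ (-v) * S * (‖p‖ / ε) ^ δ) (𝓝[≠] 0) (𝓝 0) := by
    have c : ContinuousAt (fun p : ℂ => ε ^ (-v) * S * (‖p‖ / ε) ^ δ) 0 := by
      refine continuousAt_const.mul (ContinuousAt.rpow_const ?_ (Or.inr hδ.le))
      exact (continuous_norm.div_const ε).continuousAt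
    have := c.tendsto
    simp only [norm_zero, zero_div, Real.zero_rpow hδ.ne', mul_zero] at this
    exact this.mono_left nhdsWithin_le_nhds
  have ev1 : ∀ᶠ p : ℂ in 𝓝[≠] 0, ε ^ (-v) * S * (‖p‖ / ε) ^ δ < η := lim.eventually_lt_const hη
  have ev2 : ∀ᶠ p : ℂ in 𝓝[≠] 0, ‖p‖ < ε := by
    refine nhdsWithin_le_nhds ?_
    filter_upwards [ball_mem_nhds (0 : ℂ) hε] with p hp
    simpa using hp
  filter_upwards [ev1, ev2, self_mem_nhdsWithin] with p h6 h7 h8 x hx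
  rw [dist_comm, dist_eq_norm]
  exact (key x hx p (norm_pos_iff.2 h8) h7).trans_lt h6

/-- `φ` is, at generic points, given by a nonzero rational function. -/
def RatFun (φ : (σ → ℂ) → ℂ) : Prop :=
  ∃ N D : ℂ[σ], N ≠ 0 ∧ D ≠ 0 ∧
    ∀ x ∈ goodSet D, φ x = eval x N / eval x D

lemma RatFun.mul (hφ : RatFun φ) (hψ : RatFun ψ) : RatFun fun x => φ x * ψ x := by
  obtain ⟨N, D, hN, hD, h⟩ := hφ
  obtain ⟨N', D', hN', hD', h'⟩ := hψ
  refine ⟨N * N', D * D', mul_ne_zero hN hN', mul_ne_zero hD hD', fun x hx => ?_⟩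
  rw [goodSet_mul] at hx
  beta_reduce
  rw [h x hx.1, h' x hx.2, map_mul, map_mul, mul_div_mul_comm]

lemma RatFun.inv (hφ : RatFun φ) : RatFun fun x => (φ x)⁻¹ := by
  obtain ⟨N, D, hN, hD, h⟩ := hφ
  refine ⟨D * D, N * D, mul_ne_zero hD hD, mul_ne_zero hN hD, fun x hx => ?_⟩
  rw [goodSet_mul] at hx
  beta_reduce
  rw [h x hx.2, map_mul, map_mul, inv_div, mul_div_mul_right _ _ hx.2.2]

lemma RatFun.neg (hφ : RatFun φ) : RatFun fun x => -φ x := by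
  obtain ⟨N, D, hN, hD, h⟩ := hφ
  exact ⟨-N, D, neg_ne_zero.2 hN, hD, fun x hx => by beta_reduce; rw [h x hx, map_neg, neg_div]⟩

/-- A rational function times a power of `p`. -/
lemma RatFun.lead (hφ : RatFun φ) (v : ℝ) : Lead (fun x p => φ x * ppow p v) v φ := by
  obtain ⟨N, D, hN, hD, h⟩ := hφ
  have hD' : algebraMap (ℂ[σ]) (Rat σ) D ≠ 0 := by
    simpa using (map_ne_zero_iff _ (IsFractionRing.injective (ℂ[σ]) (Rat σ))).2 hD
  set a : Rat σ := algebraMap (ℂ[σ]) (Rat σ) N / algebraMap (ℂ[σ]) (Rat σ) D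
    with ha
  have haD : a * algebraMap (ℂ[σ]) (Rat σ) D = algebraMap (ℂ[σ]) (Rat σ) N :=
    div_mul_cancel₀ _ hD'
  have ev : ∀ x ∈ goodSet D, ratEval a x = φ x := fun x hx => by
    rw [(ratEval_of_mul_eq haD hx.2).2, h x hx]
  have hG : GExp (fun x p => φ x * ppow p v) (fun _ : Unit => a) (fun _ => v) := by
    refine ⟨fun B => Set.toFinite _, D, hD, ?_, fun K hK hKD => ?_⟩
    · refine ⟨1 + N.totalDegree, fun _ => ⟨N, 1, ?_, ?_, by rw [pow_one, haD]⟩⟩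
      · have : (0 : ℝ) ≤ N.totalDegree := Nat.cast_nonneg _
        push_cast
        nlinarith [abs_nonneg v]
      · have : (0 : ℝ) ≤ N.totalDegree := Nat.cast_nonneg _
        nlinarith [abs_nonneg v]
    · have hc : ContinuousOn (fun x => ratEval a x) K := by
        refine ContinuousOn.congr (f := fun x => eval x N / eval x D) ?_
          fun x hx => (ratEval_of_mul_eq haD (hKD hx).2).2
        exact (continuous_eval N).continuousOn.div
          (continuous_eval D).continuousOn fun x hx => (hKD hx).2
      obtain ⟨M, hM⟩ := hK.exists_bound_of_continuousOn hc
      refine ⟨1, one_pos, fun _ => M, fun _ x hx => hM x hx, (hasSum_fintype _).summable,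
        fun x hx p hp hp1 => ?_⟩
      beta_reduce
      rw [← ev x (hKD hx)]
      exact hasSum_unique fun _ : Unit => ratEval a x * ppow p v
  refine ⟨Unit, _, _, hG, fun _ => le_rfl, D, hD, fun x hx => ?_⟩
  have : (hG.finite_le v).toFinset = univ := by ext; simp
  rw [this, univ_unique, sum_singleton, ev x hx]

lemma RatFun.one : RatFun fun _ : σ → ℂ => 1 :=
  ⟨1, 1, one_ne_zero, one_ne_zero, fun x _ => by simp⟩

lemma Lead.one : Lead (fun (_ : σ → ℂ) _ => 1) 0 fun _ => 1 :=
  (RatFun.one.lead 0).congr 1 one_ne_zero (fun x _ p _ _ => by simp [ppow_zero]) (fun _ _ => rfl) rfl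

lemma Lead.prod {κ : Type*} (s : Finset κ) {F : κ → (σ → ℂ) → ℂ → ℂ} {v : κ → ℝ}
    {φ : κ → (σ → ℂ) → ℂ} (h : ∀ k ∈ s, Lead (F k) (v k) (φ k)) :
    Lead (fun x p => ∏ k ∈ s, F k x p) (∑ k ∈ s, v k) (fun x => ∏ k ∈ s, φ k x) := by
  classical
  induction s using Finset.induction_on with
  | empty => simpa using Lead.one
  | insert i s hi ih =>
    simp only [prod_insert hi, sum_insert hi]
    exact (h i (mem_insert_self i s)).mul
      (ih fun j hj => h j (mem_insert_of_mem hj))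

lemma Lead.sum {κ : Type*} {s : Finset κ} (hs : s.Nonempty) {F : κ → (σ → ℂ) → ℂ → ℂ} {v : ℝ}
    {φ : κ → (σ → ℂ) → ℂ} (h : ∀ k ∈ s, Lead (F k) v (φ k)) :
    Lead (fun x p => ∑ k ∈ s, F k x p) v (fun x => ∑ k ∈ s, φ k x) := by
  classical
  induction hs using Nonempty.cons_induction with
  | singleton a => simpa using h a (by simp)
  | cons a s ha hs ih =>
    simp only [sum_cons]
    exact (h a (mem_cons_self a s)).add (ih fun j hj => h j (mem_cons_of_mem hj))

/-- The expansion of `(φ p^{w₀}; p)_∞`. -/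
lemma RatFun.gexp_qPochInf (hφ : RatFun φ) {w₀ : ℝ} (hw₀ : 0 < w₀) :
    ∃ A : Finset ℕ → Rat σ, A ∅ = 1 ∧
      GExp (fun x p => qPochInf (φ x * ppow p w₀) p) A fun S => ∑ r ∈ S, (w₀ + r) := by
  obtain ⟨N, D, hN, hD, h⟩ := hφ
  have hD' : algebraMap (ℂ[σ]) (Rat σ) D ≠ 0 := by
    simpa using (map_ne_zero_iff _ (IsFractionRing.injective (ℂ[σ]) (Rat σ))).2 hD
  set a : Rat σ := algebraMap (ℂ[σ]) (Rat σ) (-N) /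
    algebraMap (ℂ[σ]) (Rat σ) D with ha
  have haD : a * algebraMap (ℂ[σ]) (Rat σ) D =
      algebraMap (ℂ[σ]) (Rat σ) (-N) := div_mul_cancel₀ _ hD'
  have ev : ∀ x ∈ goodSet D, RegAt a x ∧ ratEval a x = -φ x := fun x hx => by
    refine ⟨(ratEval_of_mul_eq haD hx.2).1, ?_⟩
    rw [(ratEval_of_mul_eq haD hx.2).2, h x hx, map_neg, neg_div]
  have evp : ∀ x ∈ goodSet D, ∀ k : ℕ, ratEval (a ^ k) x = (-φ x) ^ k := fun x hx k => by
    have := ratEval_prod (x := x) (range k) (fun _ => a) fun _ _ => (ev x hx).1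
    simpa [(ev x hx).2] using this.2
  have wk : ∀ S : Finset ℕ, w₀ * S.card ≤ ∑ r ∈ S, (w₀ + r) := fun S => by
    have : ∑ r ∈ S, (w₀ + r) = S.card * w₀ + ∑ r ∈ S, (r : ℝ) := by
      rw [sum_add_distrib]; simp
    have : (0 : ℝ) ≤ ∑ r ∈ S, (r : ℝ) := sum_nonneg fun r _ => Nat.cast_nonneg r
    linarith
  have w0 : ∀ S : Finset ℕ, 0 ≤ ∑ r ∈ S, (w₀ + r) := fun S =>
    sum_nonneg fun r _ => by positivity
  refine ⟨fun S => a ^ S.card, by simp, fun B => ?_, D, hD, ?_, fun K hK hKD => ?_⟩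
  · refine (finite_toSet (range (⌊B⌋₊ + 1)).powerset).subset ?_
    intro S hS
    have hS' : ∑ r ∈ S, (w₀ + r) ≤ B := hS
    refine mem_coe.2 (mem_powerset.2 fun r hr => ?_)
    have : w₀ + r ≤ ∑ r ∈ S, (w₀ + (r : ℝ)) :=
      single_le_sum (f := fun r : ℕ => w₀ + (r : ℝ)) (fun i _ => by positivity) hr
    rw [mem_range, Nat.lt_succ_iff]
    exact Nat.le_floor (by linarith)
  · refine ⟨1 / w₀ * (1 + N.totalDegree), fun S => ⟨(-N) ^ S.card, S.card, ?_, ?_, ?_⟩⟩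
    · have h1 : (S.card : ℝ) ≤ 1 / w₀ * ∑ r ∈ S, (w₀ + r) := by
        rw [one_div, inv_mul_eq_div, le_div_iff₀ hw₀, mul_comm]; exact wk S
      rw [abs_of_nonneg (w0 S)]
      have h2 : 0 < 1 / w₀ := by positivity
      have h3 : (0 : ℝ) ≤ N.totalDegree := Nat.cast_nonneg _
      have h4 := w0 S
      have h5 : 0 ≤ 1 / w₀ * N.totalDegree * (1 + ∑ r ∈ S, (w₀ + (r : ℝ))) := by positivity
      linarith
    · have h1 : (S.card : ℝ) ≤ 1 / w₀ * ∑ r ∈ S, (w₀ + r) := by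
        rw [one_div, inv_mul_eq_div, le_div_iff₀ hw₀, mul_comm]; exact wk S
      have h0 : (((-N) ^ S.card).totalDegree : ℝ) ≤ S.card * N.totalDegree := by
        exact_mod_cast (totalDegree_pow _ _).trans (by rw [totalDegree_neg])
      rw [abs_of_nonneg (w0 S)]
      have h2 : 0 < 1 / w₀ := by positivity
      have h3 : (0 : ℝ) ≤ N.totalDegree := Nat.cast_nonneg _
      have h4 := w0 S
      have h5 := mul_le_mul_of_nonneg_right h1 h3
      have h6 : 0 ≤ 1 / w₀ * (1 + ∑ r ∈ S, (w₀ + (r : ℝ))) := by positivity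
      have h7 : 0 ≤ 1 / w₀ * N.totalDegree := by positivity
      nlinarith
    · rw [map_pow, map_pow, ← mul_pow, haD]
  · have hc : ContinuousOn φ K := by
      refine ContinuousOn.congr (f := fun x => eval x N / eval x D) ?_
        fun x hx => h x (hKD hx)
      exact (continuous_eval N).continuousOn.div
        (continuous_eval D).continuousOn fun x hx => (hKD hx).2
    obtain ⟨M, hM⟩ := hK.exists_bound_of_continuousOn hc
    refine ⟨1 / 2, by norm_num, fun S => |M| ^ S.card, fun S x hx => ?_, ?_, fun x hx p hp hp1 => ?_⟩
    · rw [evp x (hKD hx), norm_pow, norm_neg]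
      exact pow_le_pow_left₀ (norm_nonneg _) ((hM x hx).trans (le_abs_self M)) _
    · have hs : Summable fun r : ℕ => ‖|M| * (1 / 2 : ℝ) ^ (w₀ + (r : ℝ))‖ := by
        have : Summable fun r : ℕ => |M| * (1 / 2 : ℝ) ^ w₀ * (1 / 2 : ℝ) ^ r :=
          (summable_geometric_of_lt_one (by norm_num) (by norm_num)).mul_left _
        refine this.congr fun r => ?_
        rw [Real.norm_of_nonneg (by positivity), Real.rpow_add (by norm_num), Real.rpow_natCast]
        ring
      refine (summable_finsetProd_of_summable_norm hs).congr fun S => ?_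
      rw [prod_mul_distrib, prod_const, Real.rpow_sum_of_pos (by norm_num)]
    · have hp0 : p ≠ 0 := norm_pos_iff.1 hp
      have hp1' : ‖p‖ < 1 := hp1.trans (by norm_num)
      beta_reduce
      rw [qPochInf_eq_tsum hp1']
      have hs := summable_finsetProd_of_summable_norm
        (summable_qPoch_norm hp1' (φ x * ppow p w₀))
      refine hs.hasSum.congr_fun fun S => ?_
      rw [evp x (hKD hx), ppow_sum hp0, ← prod_const, ← prod_mul_distrib]
      exact prod_congr rfl fun r _ => by rw [ppow_add_natCast hp0]; ring

lemma RatFun.lead_qPochInf (hφ : RatFun φ) {w₀ : ℝ} (hw₀ : 0 < w₀) :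
    Lead (fun x p => qPochInf (φ x * ppow p w₀) p) 0 (fun _ => 1) ∧
      Lead (fun x p => (qPochInf (φ x * ppow p w₀) p)⁻¹) 0 (fun _ => 1) := by
  obtain ⟨A, hA, h⟩ := hφ.gexp_qPochInf hw₀
  have hw : ∀ S : Finset ℕ, S ≠ ∅ → w₀ ≤ ∑ r ∈ S, (w₀ + r) := fun S hS => by
    obtain ⟨r, hr⟩ := nonempty_iff_ne_empty.2 hS
    have : w₀ + r ≤ ∑ r ∈ S, (w₀ + (r : ℝ)) :=
      single_le_sum (f := fun r : ℕ => w₀ + (r : ℝ)) (fun i _ => by positivity) hr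
    have : (0 : ℝ) ≤ r := Nat.cast_nonneg r
    linarith
  constructor
  · refine ⟨_, A, _, h, fun S => sum_nonneg fun r _ => by positivity, 1, one_ne_zero,
      fun x _ => ?_⟩
    have : (h.finite_le 0).toFinset = {∅} := by
      ext S
      simp only [Set.Finite.mem_toFinset, Set.mem_ofPred_eq, mem_singleton]
      refine ⟨fun hS => ?_, fun hS => by simp [hS]⟩
      by_contra hne
      have := hw S hne
      linarith
    rw [this, sum_singleton, hA, (ratEval_one x).2]
  · have h' := h.inv_of_one hA (by simp) hw₀ hw
    refine ⟨_, _, _, h', fun s => sum_nonneg fun j _ => sum_nonneg fun r _ => by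
      positivity, 1, one_ne_zero, fun x _ => ?_⟩
    have : (h'.finite_le 0).toFinset = {⟨0, Fin.elim0⟩} := by
      ext ⟨k, s⟩
      simp only [Set.Finite.mem_toFinset, Set.mem_ofPred_eq, mem_singleton]
      constructor
      · intro hs
        rcases Nat.eq_zero_or_pos k with rfl | hk
        · congr; funext j; exact j.elim0
        · have h1 := hw (s ⟨0, hk⟩) (s ⟨0, hk⟩).2
          have h2 := single_le_sum (f := fun j => ∑ r ∈ (s j : Finset ℕ), (w₀ + (r : ℝ)))
            (fun j _ => sum_nonneg fun r _ => by positivity) (mem_univ ⟨0, hk⟩)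
          linarith
      · intro hs
        obtain rfl : k = 0 := congrArg Sigma.fst hs
        simp
    rw [this, sum_singleton]
    simp [(ratEval_one x).2]

/-- The leading coefficient of `θ(x p^γ; p)` for `-1 ≤ γ ≤ 1`. -/
def leadFac (γ : ℝ) (x : ℂ) : ℂ :=
  if γ = -1 then -x * (1 - x) else if γ < 0 then -x else if γ = 0 then 1 - x
  else if γ < 1 then 1 else 1 - x⁻¹

lemma Lead.theta_nonneg (hφ : RatFun φ) (hφ1 : RatFun fun x => 1 - φ x) {γ : ℝ} (h0 : 0 ≤ γ)
    (h1 : γ < 1) : ∃ ψ : (σ → ℂ) → ℂ, RatFun ψ ∧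
    ψ = (if γ = 0 then fun x => 1 - φ x else fun _ => 1) ∧
    Lead (fun x p => theta p (φ x * ppow p γ)) 0 ψ ∧
    Lead (fun x p => (theta p (φ x * ppow p γ))⁻¹) 0 fun x => (ψ x)⁻¹ := by
  have b := hφ.inv.lead_qPochInf (w₀ := 1 - γ) (by linarith)
  have hb : ∀ x p, 0 < ‖p‖ → p / (φ x * ppow p γ) = (φ x)⁻¹ * ppow p (1 - γ) := fun x p hp => by
    rw [ppow_sub (norm_pos_iff.1 hp), ppow_one]
    simp only [div_eq_mul_inv, mul_inv]; ring
  rcases h0.eq_or_lt with rfl | hγ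
  · refine ⟨fun x => 1 - φ x, hφ1, by simp, ?_, ?_⟩
    · refine (((hφ1.lead 0).mul ((hφ.lead_qPochInf one_pos).1)).mul b.1).congr 1 one_ne_zero
        (fun x _ p hp hp1 => ?_) (fun x _ => by simp) (by simp)
      rw [theta, hb x p hp, ppow_zero, mul_one, mul_one, qPochInf_step hp1 (φ x), ppow_one]
    · refine (((hφ1.inv.lead 0).mul ((hφ.lead_qPochInf one_pos).2)).mul b.2).congr 1 one_ne_zero
        (fun x _ p hp hp1 => ?_) (fun x _ => by simp) (by simp)
      rw [theta, hb x p hp, ppow_zero, mul_one, mul_one, qPochInf_step hp1 (φ x), ppow_one, mul_inv,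
        mul_inv]
  · have a := hφ.lead_qPochInf hγ
    refine ⟨fun _ => 1, RatFun.one, by simp [hγ.ne'], ?_, ?_⟩
    · refine (a.1.mul b.1).congr 1 one_ne_zero (fun x _ p hp hp1 => ?_) (fun x _ => by simp) (by simp)
      rw [theta, hb x p hp]
    · refine (a.2.mul b.2).congr 1 one_ne_zero (fun x _ p hp hp1 => ?_) (fun x _ => by simp) (by simp)
      rw [theta, hb x p hp, mul_inv]

/-- Negative `γ` are reduced to `γ ≥ 0` by `θ(x; p) = -x θ(p x; p)`. -/
lemma Lead.theta (hφ : RatFun φ) (hφ1 : RatFun fun x => 1 - φ x) {γ : ℝ} (h0 : -1 ≤ γ)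
    (h1 : γ ≤ 1) :
    Lead (fun x p => theta p (φ x * ppow p γ)) (min γ 0) (fun x => leadFac γ (φ x)) ∧
    Lead (fun x p => (EllipticSelberg.theta p (φ x * ppow p γ))⁻¹) (-min γ 0)
      (fun x => (leadFac γ (φ x))⁻¹) := by
  obtain ⟨N, D, hN, hD, hND⟩ := id hφ
  have hne : ∀ x ∈ goodSet (N * D), φ x ≠ 0 := fun x hx => by
    rw [goodSet_mul] at hx
    rw [hND x hx.2]
    exact div_ne_zero hx.1.2 hx.2.2
  have hNDne : N * D ≠ 0 := mul_ne_zero hN hD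
  rcases lt_or_ge γ 0 with hγ | hγ
  · obtain ⟨ψ, hψ, hψe, l1, l2⟩ := Lead.theta_nonneg hφ hφ1 (γ := γ + 1) (by linarith) (by linarith)
    have hlf : ∀ x, leadFac γ (φ x) = -φ x * ψ x := fun x => by
      rw [leadFac, hψe]
      by_cases h : γ = -1
      · simp [h]
      · have : γ + 1 ≠ 0 := fun h' => h (by linarith)
        simp [h, hγ, this]
    have hth : ∀ x ∈ goodSet (N * D), ∀ p : ℂ, 0 < ‖p‖ → ‖p‖ < 1 →
        -φ x * ppow p γ * EllipticSelberg.theta p (φ x * ppow p (γ + 1)) =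
          EllipticSelberg.theta p (φ x * ppow p γ) := fun x hx p hp hp1 => by
      have hp0 : p ≠ 0 := norm_pos_iff.1 hp
      have hφp : φ x * ppow p γ ≠ 0 := mul_ne_zero (hne x hx) (ppow_ne_zero hp0 _)
      rw [ppow_add hp0, ppow_one, ← mul_assoc, mul_comm _ p, theta_p_mul hp0 hp1 hφp]
      calc _ = (φ x * ppow p γ) * (φ x * ppow p γ)⁻¹ *
            EllipticSelberg.theta p (φ x * ppow p γ) := by ring
        _ = _ := by rw [mul_inv_cancel₀ hφp, one_mul]
    rw [min_eq_left hγ.le]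
    constructor
    · exact ((hφ.neg.lead γ).mul l1).congr (N * D) hNDne hth (fun x _ => (hlf x).symm) (by simp)
    · refine ((hφ.neg.inv.lead (-γ)).mul l2).congr (N * D) hNDne (fun x hx p hp hp1 => ?_)
        (fun x _ => by rw [hlf, mul_inv]) (by simp)
      rw [← hth x hx p hp hp1, mul_inv, mul_inv, ppow_neg]
  · rw [min_eq_right hγ, neg_zero]
    rcases h1.eq_or_lt with rfl | hγ1
    · -- the substitution `x ↦ p / x` reduces `γ = 1` to `γ = 0`
      have hφ1' : RatFun fun x => 1 - (φ x)⁻¹ := by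
        obtain ⟨N', D', hN', hD', hND'⟩ := (hφ1.mul hφ.inv).neg
        refine ⟨N' * (N * D), D' * (N * D), mul_ne_zero hN' hNDne, mul_ne_zero hD' hNDne,
          fun x hx => ?_⟩
        rw [goodSet_mul] at hx
        have := hND' x hx.1
        have h3 := hne x hx.2
        rw [map_mul _ N', map_mul _ D', mul_div_mul_right _ _ hx.2.2, ← this]
        beta_reduce
        field_simp
        ring
      obtain ⟨ψ, hψ, hψe, l1, l2⟩ := Lead.theta_nonneg hφ.inv hφ1' (γ := 0) le_rfl one_pos
      have hlf : ∀ x, leadFac 1 (φ x) = ψ x := fun x => by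
        rw [leadFac, hψe]; norm_num
      have hth : ∀ x, ∀ p : ℂ, 0 < ‖p‖ → EllipticSelberg.theta p ((φ x)⁻¹ * ppow p 0) =
          EllipticSelberg.theta p (φ x * ppow p 1) := fun x p hp => by
        have hp0 : p ≠ 0 := norm_pos_iff.1 hp
        rw [← theta_p_div hp0 (x := φ x * ppow p 1), ppow_one, ppow_zero, mul_one,
          mul_comm (φ x), div_mul_eq_div_div, div_self hp0, one_div]
      exact ⟨l1.congr 1 one_ne_zero (fun x _ p hp _ => hth x p hp) (fun x _ => (hlf x).symm) rfl,
        l2.congr 1 one_ne_zero (fun x _ p hp _ => by rw [hth x p hp]) (fun x _ => by rw [hlf]) rfl⟩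
    · obtain ⟨ψ, hψ, hψe, l1, l2⟩ := Lead.theta_nonneg hφ hφ1 hγ hγ1
      have hlf : ∀ x, leadFac γ (φ x) = ψ x := fun x => by
        rw [leadFac, hψe]
        have h2 : γ ≠ -1 := by linarith
        by_cases h : γ = 0
        · simp [h]
        · simp [h, h2, hγ1, not_lt.2 hγ]
      exact ⟨l1.congr 1 one_ne_zero (fun _ _ _ _ _ => rfl) (fun x _ => (hlf x).symm) rfl,
        l2.congr 1 one_ne_zero (fun _ _ _ _ _ => rfl) (fun x _ => by rw [hlf]) rfl⟩

end Lead

/-! ### Generic points and meromorphic functions -/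

section Generic

lemma isOpen_eval_ne_zero {σ : Type} (Q : ℂ[σ]) :
    IsOpen {x : σ → ℂ | eval x Q ≠ 0} :=
  isOpen_ne_fun (continuous_eval Q) continuous_const

variable {σ : Type} [Fintype σ]

lemma dense_eval_ne_zero {Q : ℂ[σ]} (hQ : Q ≠ 0) :
    Dense {x : σ → ℂ | eval x Q ≠ 0} := by
  intro x₀
  rw [mem_closure_iff_frequently]
  by_contra hx
  rw [not_frequently] at hx
  have h0 : (fun x => eval x Q) =ᶠ[𝓝 x₀] 0 :=
    hx.mono fun x hx => not_not.1 hx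
  have := (AnalyticOnNhd.eval_mvPolynomial Q).eqOn_zero_of_preconnected_of_eventuallyEq_zero
    isPreconnected_univ (Set.mem_univ x₀) h0
  exact hQ (funext fun x => by simpa using this (Set.mem_univ x))

/-- The torus `(ℂ*)^σ`. -/
def torus (σ : Type) : Set (σ → ℂ) := {x | ∀ i, x i ≠ 0}

lemma isOpen_torus : IsOpen (torus σ) := by
  have : torus σ = ⋂ i, {x : σ → ℂ | x i ≠ 0} := by ext; simp [torus]
  rw [this]
  exact isOpen_iInter_of_finite fun i => isOpen_ne_fun (continuous_apply i) continuous_const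

lemma torus_mem_residual : ∀ᶠ x in residual (σ → ℂ), ∀ i, x i ≠ 0 :=
  eventually_countable_forall.2 fun i => by
    simpa using! residual_of_dense_open (isOpen_eval_ne_zero _)
      (dense_eval_ne_zero (X_ne_zero (R := ℂ) i))

/-- A nonzero rational function does not vanish at generic points in the sense of Baire. -/
lemma RatFun.residual_ne_zero {φ : (σ → ℂ) → ℂ} (hφ : RatFun φ) :
    ∀ᶠ x in residual (σ → ℂ), φ x ≠ 0 := by
  obtain ⟨N, D, hN, hD, h⟩ := hφ
  filter_upwards [residual_of_dense_open (isOpen_eval_ne_zero _) (dense_eval_ne_zero hN),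
    residual_of_dense_open (isOpen_eval_ne_zero _) (dense_eval_ne_zero hD), torus_mem_residual]
    with x h1 h2 h3
  rw [h x ⟨h3, h2⟩]
  exact div_ne_zero h1 h2

/-- Baire's theorem: properties of generic points hold on a dense set. -/
lemma frequently_of_residual {P : (σ → ℂ) → Prop} (h : ∀ᶠ x in residual (σ → ℂ), P x)
    (x₀ : σ → ℂ) : ∃ᶠ x in 𝓝 x₀, P x :=
  mem_closure_iff_frequently.1 (dense_of_mem_residual h x₀)

end Generic

/-- Germs of analytic functions form an integral domain. -/
lemma frequently_mul_ne_zero {E : Type*} [NormedAddCommGroup E] [NormedSpace ℂ E] {x₀ : E}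
    {f g : E → ℂ} (hf : AnalyticAt ℂ f x₀) (hg : AnalyticAt ℂ g x₀) (hf0 : ∃ᶠ x in 𝓝 x₀, f x ≠ 0)
    (hg0 : ∃ᶠ x in 𝓝 x₀, g x ≠ 0) : ∃ᶠ x in 𝓝 x₀, f x * g x ≠ 0 := by
  intro h
  have h' : ∀ᶠ x in 𝓝 x₀, f x * g x = 0 := h.mono fun x hx => not_not.1 hx
  obtain ⟨r, hr, hB⟩ := eventually_nhds_iff_ball.1
    (h'.and (hf.eventually_analyticAt.and hg.eventually_analyticAt))
  have hball := ball_mem_nhds x₀ hr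
  obtain ⟨x₁, hx₁, hx₁B⟩ := (hf0.and_eventually hball).exists
  have e : ∀ᶠ x in 𝓝 x₁, g x = 0 := by
    filter_upwards [(hB x₁ hx₁B).2.1.continuousAt.eventually_ne hx₁,
      isOpen_ball.mem_nhds hx₁B] with x h1 h2
    exact (mul_eq_zero.1 (hB x h2).1).resolve_left h1
  have := AnalyticOnNhd.eqOn_zero_of_preconnected_of_eventuallyEq_zero
    (fun x hx => (hB x hx).2.2) (convex_ball x₀ r).isPreconnected hx₁B e
  exact hg0 (mem_of_superset hball fun x hx => not_not.2 (this hx))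

section Mero

variable {σ : Type} [Fintype σ] {F G : (σ → ℂ) → ℂ} {U : Set (σ → ℂ)}

lemma IsMeroOn.of_analytic (hF : AnalyticOnNhd ℂ F U) : IsMeroOn F U := fun x hx =>
  ⟨F, fun _ => 1, hF x hx, analyticAt_const, (Eventually.of_forall fun _ => one_ne_zero).frequently,
    Eventually.of_forall fun _ _ => (div_one _).symm⟩

lemma IsMeroOn.inv_of_analytic (hF : AnalyticOnNhd ℂ F U)
    (h0 : ∀ x ∈ U, ∃ᶠ y in 𝓝 x, F y ≠ 0) : IsMeroOn (fun x => (F x)⁻¹) U := fun x hx =>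
  ⟨fun _ => 1, F, analyticAt_const, hF x hx, h0 x hx,
    Eventually.of_forall fun _ _ => (one_div _).symm⟩

lemma IsMeroOn.mul (hF : IsMeroOn F U) (hG : IsMeroOn G U) :
    IsMeroOn (fun x => F x * G x) U := fun x hx => by
  obtain ⟨A, B, hA, hB, hB0, h⟩ := hF x hx
  obtain ⟨A', B', hA', hB', hB0', h'⟩ := hG x hx
  refine ⟨fun x => A x * A' x, fun x => B x * B' x, hA.fun_mul hA', hB.fun_mul hB',
    frequently_mul_ne_zero hB hB' hB0 hB0', ?_⟩
  filter_upwards [h, h'] with y h1 h2 h3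
  rw [h1 (left_ne_zero_of_mul h3), h2 (right_ne_zero_of_mul h3), div_mul_div_comm]

lemma IsMeroOn.add (hF : IsMeroOn F U) (hG : IsMeroOn G U) :
    IsMeroOn (fun x => F x + G x) U := fun x hx => by
  obtain ⟨A, B, hA, hB, hB0, h⟩ := hF x hx
  obtain ⟨A', B', hA', hB', hB0', h'⟩ := hG x hx
  refine ⟨fun x => A x * B' x + B x * A' x, fun x => B x * B' x,
    (hA.fun_mul hB').fun_add (hB.fun_mul hA'), hB.fun_mul hB',
    frequently_mul_ne_zero hB hB' hB0 hB0', ?_⟩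
  filter_upwards [h, h'] with y h1 h2 h3
  rw [h1 (left_ne_zero_of_mul h3), h2 (right_ne_zero_of_mul h3),
    div_add_div _ _ (left_ne_zero_of_mul h3) (right_ne_zero_of_mul h3)]

lemma IsMeroOn.one : IsMeroOn (fun _ : σ → ℂ => 1) U := .of_analytic fun _ _ => analyticAt_const

lemma IsMeroOn.zero : IsMeroOn (fun _ : σ → ℂ => 0) U := .of_analytic fun _ _ => analyticAt_const

lemma IsMeroOn.prod {κ : Type*} (s : Finset κ) {F : κ → (σ → ℂ) → ℂ}
    (h : ∀ k ∈ s, IsMeroOn (F k) U) : IsMeroOn (fun x => ∏ k ∈ s, F k x) U := by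
  classical
  induction s using Finset.induction_on with
  | empty => simpa using IsMeroOn.one
  | insert i s hi ih =>
    simp only [prod_insert hi]
    exact (h i (mem_insert_self i s)).mul
      (ih fun j hj => h j (mem_insert_of_mem hj))

lemma IsMeroOn.sum {κ : Type*} (s : Finset κ) {F : κ → (σ → ℂ) → ℂ}
    (h : ∀ k ∈ s, IsMeroOn (F k) U) : IsMeroOn (fun x => ∑ k ∈ s, F k x) U := by
  classical
  induction s using Finset.induction_on with
  | empty => simpa using IsMeroOn.zero
  | insert i s hi ih =>
    simp only [sum_insert hi]
    exact (h i (mem_insert_self i s)).add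
      (ih fun j hj => h j (mem_insert_of_mem hj))

lemma IsMeroOn.congr (hU : IsOpen U) (hF : IsMeroOn F U) (h : ∀ x ∈ U, F x = G x) :
    IsMeroOn G U := fun x hx => by
  obtain ⟨A, B, hA, hB, hB0, h'⟩ := hF x hx
  refine ⟨A, B, hA, hB, hB0, ?_⟩
  filter_upwards [h', hU.mem_nhds hx] with y h1 h2 h3
  rw [← h y h2, h1 h3]

end Mero

/-! ### Expansion of the weights -/

section LeadPair

variable {σ : Type} [Fintype σ] {F G : (σ → ℂ) → ℂ → ℂ} {v v' : ℝ} {φ ψ : (σ → ℂ) → ℂ}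

/-- `F` and `F⁻¹` are meromorphic on the torus and have leading terms, and `F` does not vanish at
generic points. -/
structure LeadPair (F : (σ → ℂ) → ℂ → ℂ) (v : ℝ) (φ : (σ → ℂ) → ℂ) : Prop where
  lead : Lead F v φ
  lead_inv : Lead (fun x p => (F x p)⁻¹) (-v) (fun x => (φ x)⁻¹)
  mero : ∀ p : ℂ, 0 < ‖p‖ → ‖p‖ < 1 → IsMeroOn (fun x => F x p) (torus σ)
  mero_inv : ∀ p : ℂ, 0 < ‖p‖ → ‖p‖ < 1 → IsMeroOn (fun x => (F x p)⁻¹) (torus σ)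
  ne_zero : ∀ p : ℂ, 0 < ‖p‖ → ‖p‖ < 1 → ∀ᶠ x in residual (σ → ℂ), F x p ≠ 0

lemma LeadPair.mul (hF : LeadPair F v φ) (hG : LeadPair G v' ψ) :
    LeadPair (fun x p => F x p * G x p) (v + v') (fun x => φ x * ψ x) :=
  ⟨hF.1.mul hG.1, (hF.2.mul hG.2).congr 1 one_ne_zero (fun _ _ _ _ _ => (mul_inv _ _).symm)
    (fun _ _ => (mul_inv _ _).symm) (neg_add _ _).symm,
    fun p hp hp1 => (hF.mero p hp hp1).mul (hG.mero p hp hp1), fun p hp hp1 => by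
      simp only [mul_inv]
      exact (hF.mero_inv p hp hp1).mul (hG.mero_inv p hp hp1), fun p hp hp1 => by
      filter_upwards [hF.ne_zero p hp hp1, hG.ne_zero p hp hp1] with x using mul_ne_zero⟩

lemma LeadPair.inv (hF : LeadPair F v φ) :
    LeadPair (fun x p => (F x p)⁻¹) (-v) (fun x => (φ x)⁻¹) :=
  ⟨hF.2, hF.1.congr 1 one_ne_zero (fun _ _ _ _ _ => (inv_inv _).symm)
    (fun _ _ => (inv_inv _).symm) (neg_neg _).symm, hF.mero_inv, by simpa using hF.mero,
    by simpa using hF.ne_zero⟩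

lemma LeadPair.div (hF : LeadPair F v φ) (hG : LeadPair G v' ψ) :
    LeadPair (fun x p => F x p / G x p) (v - v') (fun x => φ x / ψ x) := by
  simp only [div_eq_mul_inv, sub_eq_add_neg]
  exact hF.mul hG.inv

lemma LeadPair.prod {κ : Type*} (s : Finset κ) {F : κ → (σ → ℂ) → ℂ → ℂ} {v : κ → ℝ}
    {φ : κ → (σ → ℂ) → ℂ} (h : ∀ k ∈ s, LeadPair (F k) (v k) (φ k)) :
    LeadPair (fun x p => ∏ k ∈ s, F k x p) (∑ k ∈ s, v k) (fun x => ∏ k ∈ s, φ k x) := by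
  refine ⟨Lead.prod s fun k hk => (h k hk).1, ?_,
    fun p hp hp1 => IsMeroOn.prod s fun k hk => (h k hk).mero p hp hp1, fun p hp hp1 => ?_,
    fun p hp hp1 => ?_⟩
  · simp only [← prod_inv_distrib, ← sum_neg_distrib]
    exact Lead.prod s fun k hk => (h k hk).2
  · simp only [← prod_inv_distrib]
    exact IsMeroOn.prod s fun k hk => (h k hk).mero_inv p hp hp1
  · filter_upwards [(eventually_all_finset s).2 fun k hk => (h k hk).ne_zero p hp hp1] with x hx
    exact prod_ne_zero_iff.2 hx

end LeadPair

/-- `φ` is a Laurent monomial of degree `d` in the `c`-th coordinate. -/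
def MDeg (c : Fin 6) (d : ℤ) (φ : ℂ⁶ → ℂ) : Prop :=
  ∃ k : Fin 6 → ℤ, k c = d ∧ ∀ x : ℂ⁶, (∀ i, x i ≠ 0) → φ x = ∏ i, x i ^ k i

section MDeg

variable {c : Fin 6} {d e : ℤ} {φ ψ : ℂ⁶ → ℂ}

lemma MDeg.mul (hφ : MDeg c d φ) (hψ : MDeg c e ψ) : MDeg c (d + e) fun x => φ x * ψ x := by
  obtain ⟨k, rfl, h⟩ := hφ
  obtain ⟨l, rfl, h'⟩ := hψ
  refine ⟨k + l, rfl, fun x hx => ?_⟩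
  beta_reduce
  rw [h x hx, h' x hx, ← prod_mul_distrib]
  exact prod_congr rfl fun i _ => (zpow_add₀ (hx i) _ _).symm

lemma MDeg.inv (hφ : MDeg c d φ) : MDeg c (-d) fun x => (φ x)⁻¹ := by
  obtain ⟨k, rfl, h⟩ := hφ
  refine ⟨-k, rfl, fun x hx => ?_⟩
  beta_reduce
  rw [h x hx, ← prod_inv_distrib]
  exact prod_congr rfl fun i _ => (zpow_neg _ _).symm

lemma MDeg.div (hφ : MDeg c d φ) (hψ : MDeg c e ψ) : MDeg c (d - e) fun x => φ x / ψ x := by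
  simp only [div_eq_mul_inv, sub_eq_add_neg]
  exact hφ.mul hψ.inv

lemma MDeg.zpow (hφ : MDeg c d φ) (m : ℤ) : MDeg c (m * d) fun x => φ x ^ m := by
  obtain ⟨k, rfl, h⟩ := hφ
  refine ⟨fun i => m * k i, rfl, fun x hx => ?_⟩
  beta_reduce
  rw [h x hx, ← prod_zpow]
  exact prod_congr rfl fun i _ => by rw [← zpow_mul, mul_comm]

lemma MDeg.pow (hφ : MDeg c d φ) (m : ℕ) : MDeg c (m * d) fun x => φ x ^ m := by
  simpa using hφ.zpow m

lemma mdeg_coord (c j : Fin 6) : MDeg c (if c = j then 1 else 0) fun x => x j := by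
  refine ⟨Pi.single j 1, by simp [Pi.single_apply], fun x _ => ?_⟩
  beta_reduce
  rw [prod_eq_single j]
  · simp
  · intro b _ hb; simp [hb]
  · simp

lemma MDeg.congr (h : MDeg c d φ) (hd : d = e) (hφ : ∀ x : ℂ⁶, (∀ i, x i ≠ 0) → φ x = ψ x) :
    MDeg c e ψ := by
  obtain ⟨k, hk, h'⟩ := h
  exact ⟨k, hk.trans hd, fun x hx => (hφ x hx).symm.trans (h' x hx)⟩

lemma prod_zpow_split (k : Fin 6 → ℤ) {x : ℂ⁶} (hx : ∀ i, x i ≠ 0) :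
    ∏ i, x i ^ k i = (∏ i, x i ^ (k i).toNat) / ∏ i, x i ^ (-k i).toNat := by
  rw [← prod_div_distrib]
  refine prod_congr rfl fun i _ => ?_
  have : k i = ((k i).toNat : ℤ) - ((-k i).toNat : ℤ) := by omega
  conv_lhs => rw [this]
  rw [zpow_sub₀ (hx i), zpow_natCast, zpow_natCast]

lemma eval_monomial (m : Fin 6 → ℕ) (x : ℂ⁶) :
    eval x (∏ i, X i ^ m i) = ∏ i, x i ^ m i := by
  simp

lemma prod_X_pow_ne_zero (m : Fin 6 → ℕ) :
    (∏ i, X i ^ m i : ℂ[Fin 6]) ≠ 0 :=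
  prod_ne_zero_iff.2 fun i _ => pow_ne_zero _ (X_ne_zero i)

lemma MDeg.ratFun (h : MDeg c d φ) : RatFun φ := by
  obtain ⟨k, -, h⟩ := h
  refine ⟨∏ i, X i ^ (k i).toNat, ∏ i, X i ^ (-k i).toNat,
    prod_X_pow_ne_zero _, prod_X_pow_ne_zero _, fun x hx => ?_⟩
  rw [h x hx.1, prod_zpow_split k hx.1, eval_monomial, eval_monomial]

/-- A nontrivial monomial is not constant. -/
lemma MDeg.ratFun_const_sub (h : MDeg c d φ) (hd : d ≠ 0) (a : ℂ) : RatFun fun x => a - φ x := by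
  obtain ⟨k, rfl, h⟩ := h
  refine ⟨C a * (∏ i, X i ^ (-k i).toNat) -
    ∏ i, X i ^ (k i).toNat,
    ∏ i, X i ^ (-k i).toNat, ?_, prod_X_pow_ne_zero _, fun x hx => ?_⟩
  · intro h0
    have h1 := congrArg (eval fun _ => (1 : ℂ)) h0
    rw [map_sub, map_mul, eval_monomial, eval_monomial, map_zero, sub_eq_zero,
      eval_C] at h1
    have h2 := congrArg (eval fun i => if i = c then (2 : ℂ) else 1) h0
    rw [map_sub, map_mul, eval_monomial, eval_monomial, map_zero, sub_eq_zero,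
      eval_C] at h2
    have e : ∀ m : Fin 6 → ℕ, ∏ i, (if i = c then (2 : ℂ) else 1) ^ m i = 2 ^ m c := fun m => by
      rw [prod_eq_single c]
      · simp
      · intro b _ hb; simp [hb]
      · simp
    simp only [one_pow, prod_const_one, mul_one] at h1
    rw [e, e, h1, one_mul] at h2
    have := Nat.pow_right_injective (le_refl 2) (by exact_mod_cast h2 : 2 ^ _ = 2 ^ _)
    omega
  · beta_reduce
    rw [h x hx.1, prod_zpow_split k hx.1, map_sub, map_mul, eval_monomial, eval_monomial, sub_div,
      mul_div_cancel_right₀, eval_C]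
    exact prod_ne_zero_iff.2 fun i _ => pow_ne_zero _ (hx.1 i)

lemma MDeg.ne_zero (h : MDeg c d φ) {x : ℂ⁶} (hx : ∀ i, x i ≠ 0) : φ x ≠ 0 := by
  obtain ⟨k, -, h⟩ := h
  rw [h x hx]
  exact prod_ne_zero_iff.2 fun i _ => zpow_ne_zero _ (hx i)

lemma MDeg.analyticOnNhd (h : MDeg c d φ) : AnalyticOnNhd ℂ φ (torus (Fin 6)) := by
  obtain ⟨k, -, h⟩ := h
  intro x hx
  have h1 : AnalyticAt ℂ (fun x : ℂ⁶ => ∏ i, x i ^ k i) x := by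
    refine analyticAt_fun_prod _ fun i _ => AnalyticAt.zpow ?_ (hx i)
    exact (ContinuousLinearMap.proj (R := ℂ) (φ := fun _ : Fin 6 => ℂ) i).analyticAt x
  refine h1.congr ?_
  filter_upwards [isOpen_torus.mem_nhds hx] with y hy
  exact (h y hy).symm

lemma MDeg.theta_ne_zero (h : MDeg c d φ) (hd : d ≠ 0) {a p : ℂ} (ha : a ≠ 0) (hp : p ≠ 0)
    (hp1 : ‖p‖ < 1) : ∀ᶠ x in residual ℂ⁶, theta p (φ x * a) ≠ 0 := by
  filter_upwards [torus_mem_residual, eventually_countable_forall.2 fun l : ℤ =>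
    (h.ratFun_const_sub hd (p ^ l / a)).residual_ne_zero] with y hy hl
  refine EllipticSelberg.theta_ne_zero hp hp1 (mul_ne_zero (h.ne_zero hy) ha) fun l h' => hl l ?_
  rw [sub_eq_zero, div_eq_iff ha, h']

lemma MDeg.mero_theta (h : MDeg c d φ) (hd : d ≠ 0) {a p : ℂ} (ha : a ≠ 0) (hp : 0 < ‖p‖)
    (hp1 : ‖p‖ < 1) : IsMeroOn (fun x => theta p (φ x * a)) (torus (Fin 6)) ∧
      IsMeroOn (fun x => (theta p (φ x * a))⁻¹) (torus (Fin 6)) := by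
  have hp0 := norm_pos_iff.1 hp
  have han : AnalyticOnNhd ℂ (fun x => theta p (φ x * a)) (torus (Fin 6)) := fun x hx =>
    (analyticAt_theta hp1 (mul_ne_zero (h.ne_zero hx) ha)).comp
      (f := fun x => φ x * a) ((h.analyticOnNhd x hx).fun_mul analyticAt_const)
  exact ⟨.of_analytic han, .inv_of_analytic han fun x _ =>
    frequently_of_residual (h.theta_ne_zero hd ha hp0 hp1) x⟩

end MDeg

/-- The common form of the symbols `C⁰`, `C⁻` and `C⁺`. -/
def boxProd (φ : ℂ → ℂ) (q t : ℂ) {m : ℕ} (l : Fin m → ℕ) (a b : Fin m → ℕ → ℤ) (x : ℂ) : ℂ :=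
  ∏ i : Fin m, ∏ j ∈ range (l i), φ (q ^ a i j * t ^ b i j * x)

lemma leadPair_boxProd {m : ℕ} (l : Fin m → ℕ) (a b : Fin m → ℕ → ℤ)
    {X : ℂ⁶ → ℂ → ℂ} {φ : ℂ⁶ → ℂ} {γ : ℝ}
    (hX : ∀ x : ℂ⁶, (∀ i, x i ≠ 0) → ∀ p : ℂ, p ≠ 0 → X x p = φ x * ppow p γ)
    (h0 : -1 ≤ γ) (h1 : γ ≤ 1)
    (hk : ∀ i, ∀ j < l i, ∃ c d, d ≠ 0 ∧ MDeg c d fun x => x 4 ^ a i j * x 5 ^ b i j * φ x) :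
    LeadPair (fun x p => boxProd (theta p) (x 4) (x 5) l a b (X x p)) (size l * min γ 0)
      (fun x => boxProd (leadFac γ) (x 4) (x 5) l a b (φ x)) := by
  have key : ∀ i, ∀ j ∈ range (l i),
      LeadPair (fun x p => theta p (x 4 ^ a i j * x 5 ^ b i j * X x p)) (min γ 0)
        (fun x => leadFac γ (x 4 ^ a i j * x 5 ^ b i j * φ x)) := by
    intro i j hj
    obtain ⟨c, d, hd, hm⟩ := hk i j (mem_range.1 hj)
    obtain ⟨l1, l2⟩ := Lead.theta hm.ratFun (hm.ratFun_const_sub hd 1) h0 h1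
    have e : ∀ x ∈ goodSet (1 : ℂ[Fin 6]), ∀ p : ℂ, 0 < ‖p‖ → ‖p‖ < 1 →
        x 4 ^ a i j * x 5 ^ b i j * φ x * ppow p γ = x 4 ^ a i j * x 5 ^ b i j * X x p :=
      fun x hx p hp _ => by rw [hX x hx.1 p (norm_pos_iff.1 hp)]; ring
    have e' : ∀ x ∈ torus (Fin 6), ∀ p : ℂ, 0 < ‖p‖ → ‖p‖ < 1 →
        x 4 ^ a i j * x 5 ^ b i j * φ x * ppow p γ = x 4 ^ a i j * x 5 ^ b i j * X x p :=
      fun x hx p hp _ => by rw [hX x hx p (norm_pos_iff.1 hp)]; ring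
    refine ⟨l1.congr 1 one_ne_zero (fun x hx p hp hp1 => by rw [e x hx p hp hp1]) (fun _ _ => rfl) rfl,
      l2.congr 1 one_ne_zero (fun x hx p hp hp1 => by rw [e x hx p hp hp1]) (fun _ _ => rfl) rfl,
      fun p hp hp1 => ?_, fun p hp hp1 => ?_, fun p hp hp1 => ?_⟩
    · refine (hm.mero_theta hd (ppow_ne_zero (norm_pos_iff.1 hp) γ) hp hp1).1.congr isOpen_torus
        fun x hx => ?_
      rw [e' x hx p hp hp1]
    · refine (hm.mero_theta hd (ppow_ne_zero (norm_pos_iff.1 hp) γ) hp hp1).2.congr isOpen_torus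
        fun x hx => ?_
      rw [e' x hx p hp hp1]
    · filter_upwards [torus_mem_residual, hm.theta_ne_zero hd
        (ppow_ne_zero (norm_pos_iff.1 hp) γ) (norm_pos_iff.1 hp) hp1] with x hx h
      rwa [← e' x hx p hp hp1]
  have := LeadPair.prod univ fun i _ => LeadPair.prod (range (l i)) (key i)
  have hv : ∑ i, ∑ _j ∈ range (l i), min γ 0 = size l * min γ 0 := by
    simp [size, sum_mul]
  rw [hv] at this
  exact this

section Weight

variable {n N : ℕ} {α : Fin 6 → ℝ}

/-- The degrees of `t₀, …, t₅` in the free coordinates `t₀, t₂, t₃`. -/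
lemma balanced_mdeg (n N : ℕ) (c r : Fin 6) : ∃ d, MDeg c d (fun x => balanced n N x r) ∧
    (c = 0 → d = if r = 0 then 1 else if r = 1 then -1 else 0) ∧
    (c = 1 → d = if r = 2 then 1 else if r = 5 then -1 else 0) ∧
    (c = 2 → d = if r = 3 then 1 else if r = 5 then -1 else 0) := by
  have h := fun j => mdeg_coord c j
  fin_cases r
  · exact ⟨_, h 0, by simp, by rintro rfl; simp, by rintro rfl; simp⟩
  · refine ⟨_, (((h 4).zpow (-(N : ℤ))).mul ((h 5).zpow (1 - (n : ℤ)))).div (h 0), ?_, ?_, ?_⟩ <;>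
      rintro rfl <;> simp
  · exact ⟨_, h 1, by rintro rfl; simp, by rintro rfl; simp, by rintro rfl; simp⟩
  · exact ⟨_, h 2, by rintro rfl; simp, by rintro rfl; simp, by rintro rfl; simp⟩
  · exact ⟨_, h 3, by rintro rfl; simp, by rintro rfl; simp, by rintro rfl; simp⟩
  · refine ⟨_, (((h 4).zpow ((N : ℤ) + 1)).mul ((h 5).zpow (1 - (n : ℤ)))).div
      (((h 1).mul (h 2)).mul (h 3)), ?_, ?_, ?_⟩ <;> rintro rfl <;> simp

lemma balanced_ne_zero (n N : ℕ) {x : ℂ⁶} (hx : ∀ i, x i ≠ 0) (r : Fin 6) :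
    balanced n N x r ≠ 0 := by
  obtain ⟨d, h, -⟩ := balanced_mdeg n N 0 r
  exact h.ne_zero hx

lemma balanced_bal₁ (n N : ℕ) {x : ℂ⁶} (hx : ∀ i, x i ≠ 0) :
    x 5 ^ ((n : ℤ) - 1) * balanced n N x 0 * balanced n N x 1 = x 4 ^ (-(N : ℤ)) := by
  have h0 := hx 0
  have h5 := zpow_ne_zero ((n : ℤ) - 1) (hx 5)
  simp only [balanced, Matrix.cons_val]
  rw [show (1 - (n : ℤ)) = -((n : ℤ) - 1) by ring, zpow_neg (x 5)]
  field_simp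

lemma balanced_bal₂ (n N : ℕ) {x : ℂ⁶} (hx : ∀ i, x i ≠ 0) :
    x 5 ^ ((n : ℤ) - 1) * balanced n N x 2 * balanced n N x 3 * balanced n N x 4 *
      balanced n N x 5 = x 4 ^ ((N : ℤ) + 1) := by
  have h1 := hx 1
  have h2 := hx 2
  have h3 := hx 3
  have h5 := zpow_ne_zero ((n : ℤ) - 1) (hx 5)
  simp only [balanced, Matrix.cons_val]
  rw [show (1 - (n : ℤ)) = -((n : ℤ) - 1) by ring, zpow_neg (x 5)]
  field_simp

/-- Bounds for the exponents that occur in the weights. -/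
structure ExpBounds (α : Fin 6 → ℝ) : Prop where
  lower : -1 ≤ 2 * α 0
  upper : α 0 ≤ 0
  one : α 1 = -α 0
  ge : ∀ r : Fin 6, 2 ≤ r → α 0 ≤ α r
  le : ∀ r : Fin 6, 2 ≤ r → α r ≤ α 0 + 1
  pair_le : ∀ r : Fin 6, r = 2 ∨ r = 3 ∨ r = 5 → α 4 + α r ≤ 1
  pair_ge : ∀ r : Fin 6, r = 2 ∨ r = 3 ∨ r = 5 → 0 ≤ α 4 + α r

lemma Admissible.expBounds (h : Admissible α) : ExpBounds α := by
  have h23 := h.pairs 2 3 (by decide) (by decide)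
  have h24 := h.pairs 2 4 (by decide) (by decide)
  have h25 := h.pairs 2 5 (by decide) (by decide)
  have h34 := h.pairs 3 4 (by decide) (by decide)
  have h35 := h.pairs 3 5 (by decide) (by decide)
  have h45 := h.pairs 4 5 (by decide) (by decide)
  have hs := h.sum_eq
  refine ⟨by linarith [h.lower], h.upper, h.one, fun r hr => (h.between r hr).1,
    fun r hr => (h.between r hr).2, ?_, ?_⟩ <;> rintro r (rfl | rfl | rfl) <;> linarith

/-- The leading coefficient of the weight. -/
def leadWeight (n N : ℕ) (α : Fin 6 → ℝ) (τ : ℂ⁶) (q t : ℂ) (μ : Fin n → ℕ) : ℂ :=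
  let s := t ^ ((n : ℤ) - 1)
  let c := fun γ => C0 (leadFac γ) q t μ
  let cN := fun γ => C0 (leadFac γ) q t (rect n N)
  (c 0 (t ^ n) / c (1 + 2 * α 0) (q * (s ^ 2 * τ 0 ^ 2) / t ^ n) *
    (c 0 (s * τ 0 * τ 1) / c (1 + 2 * α 0) (q * s * τ 0 / τ 1)) *
    (c (α 0 + α 2) (s * τ 0 * τ 2) / c (1 + α 0 - α 2) (q * s * τ 0 / τ 2)) *
    (c (α 0 + α 3) (s * τ 0 * τ 3) / c (1 + α 0 - α 3) (q * s * τ 0 / τ 3)) *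
    (c (α 0 + α 4) (s * τ 0 * τ 4) / c (1 + α 0 - α 4) (q * s * τ 0 / τ 4)) *
    (c (α 0 + α 5) (s * τ 0 * τ 5) / c (1 + α 0 - α 5) (q * s * τ 0 / τ 5)) *
    (C0 (leadFac (1 + 2 * α 0)) q t (twiceSq μ) (q * (s ^ 2 * τ 0 ^ 2)) /
      (Cm (leadFac 1) q t μ q * Cm (leadFac 0) q t μ t *
        (Cp (leadFac (2 * α 0)) q t μ (s ^ 2 * τ 0 ^ 2) *
          Cp (leadFac (1 + 2 * α 0)) q t μ (q * (s ^ 2 * τ 0 ^ 2) / t))))) /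
  (cN (-2 * α 0) (τ 1 / τ 0) / cN (1 + α 0 - α 4) (q * s * τ 0 / τ 4) *
    (cN (1 - α 4 - α 2) (q / (τ 4 * τ 2)) / cN (α 2 - α 0) (s * τ 1 * τ 2)) *
    (cN (1 - α 4 - α 3) (q / (τ 4 * τ 3)) / cN (α 3 - α 0) (s * τ 1 * τ 3)) *
    (cN (1 - α 4 - α 5) (q / (τ 4 * τ 5)) / cN (α 5 - α 0) (s * τ 1 * τ 5)))

lemma leadPair_C0 {m : ℕ} (l : Fin m → ℕ) {X : ℂ⁶ → ℂ → ℂ} {φ : ℂ⁶ → ℂ} {γ : ℝ}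
    {c : Fin 6} {d : ℤ} (hm : MDeg c d φ) (hd : d ≠ 0) (hc : c ≠ 4 ∧ c ≠ 5)
    (hX : ∀ x : ℂ⁶, (∀ i, x i ≠ 0) → ∀ p : ℂ, p ≠ 0 → X x p = φ x * ppow p γ)
    (h0 : -1 ≤ γ) (h1 : γ ≤ 1) :
    LeadPair (fun x p => C0 (theta p) (x 4) (x 5) l (X x p)) (size l * min γ 0)
      (fun x => C0 (leadFac γ) (x 4) (x 5) l (φ x)) :=
  leadPair_boxProd l (fun _ j => (j : ℤ)) (fun i _ => -(i : ℤ)) hX h0 h1 fun i j _ => ⟨c, d, hd,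
    ((((mdeg_coord c 4).zpow j).mul ((mdeg_coord c 5).zpow (-(i : ℤ)))).mul hm).congr
      (by simp [hc.1, hc.2]) fun _ _ => rfl⟩

lemma leadPair_Cp {m : ℕ} (l : Fin m → ℕ) {X : ℂ⁶ → ℂ → ℂ} {φ : ℂ⁶ → ℂ} {γ : ℝ}
    {c : Fin 6} {d : ℤ} (hm : MDeg c d φ) (hd : d ≠ 0) (hc : c ≠ 4 ∧ c ≠ 5)
    (hX : ∀ x : ℂ⁶, (∀ i, x i ≠ 0) → ∀ p : ℂ, p ≠ 0 → X x p = φ x * ppow p γ)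
    (h0 : -1 ≤ γ) (h1 : γ ≤ 1) :
    LeadPair (fun x p => Cp (theta p) (x 4) (x 5) l (X x p)) (size l * min γ 0)
      (fun x => Cp (leadFac γ) (x 4) (x 5) l (φ x)) :=
  leadPair_boxProd l (fun i j => (l i : ℤ) + (j + 1) - 1)
    (fun i j => 2 - (colLen l j : ℤ) - (i + 1)) hX h0 h1 fun i j _ => ⟨c, d, hd,
    ((((mdeg_coord c 4).zpow _).mul ((mdeg_coord c 5).zpow _)).mul hm).congr
      (by simp [hc.1, hc.2]) fun _ _ => rfl⟩

lemma LeadPair.congr_val {σ : Type} [Fintype σ] {F : (σ → ℂ) → ℂ → ℂ} {v v' : ℝ} {φ : (σ → ℂ) → ℂ}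
    (h : LeadPair F v φ) (hv : v = v') : LeadPair F v' φ := hv ▸ h

lemma balanced_mdeg_zero (n N : ℕ) (r : Fin 6) :
    MDeg 0 (if r = 0 then 1 else if r = 1 then -1 else 0) (fun x => balanced n N x r) := by
  obtain ⟨d, hd, h1, -⟩ := balanced_mdeg n N 0 r
  exact h1 rfl ▸ hd

lemma balanced_mdeg_one (n N : ℕ) (r : Fin 6) :
    MDeg 1 (if r = 2 then 1 else if r = 5 then -1 else 0) (fun x => balanced n N x r) := by
  obtain ⟨d, hd, -, h1, -⟩ := balanced_mdeg n N 1 r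
  exact h1 rfl ▸ hd

lemma balanced_mdeg_two (n N : ℕ) (r : Fin 6) :
    MDeg 2 (if r = 3 then 1 else if r = 5 then -1 else 0) (fun x => balanced n N x r) := by
  obtain ⟨d, hd, -, -, h1⟩ := balanced_mdeg n N 2 r
  exact h1 rfl ▸ hd

lemma mdeg_q {c : Fin 6} (hc : c ≠ 4) : MDeg c 0 fun x => x 4 :=
  (mdeg_coord c 4).congr (by simp [hc]) fun _ _ => rfl

lemma mdeg_t_zpow {c : Fin 6} (hc : c ≠ 5) (k : ℤ) : MDeg c 0 fun x => x 5 ^ k :=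
  ((mdeg_coord c 5).zpow _).congr (by simp [hc]) fun _ _ => rfl

section Symbols

variable {m : ℕ} (l : Fin m → ℕ)

lemma leadPair_up (h : ExpBounds α) {r : Fin 6} (hr : 2 ≤ r) :
    LeadPair (fun x p => C0 (theta p) (x 4) (x 5) l (x 5 ^ ((n : ℤ) - 1) *
        scaled α (balanced n N x) p 0 * scaled α (balanced n N x) p r))
      (size l * min (α 0 + α r) 0)
      (fun x => C0 (leadFac (α 0 + α r)) (x 4) (x 5) l
        (x 5 ^ ((n : ℤ) - 1) * balanced n N x 0 * balanced n N x r)) := by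
  have := h.ge r hr
  have := h.le r hr
  have := h.lower
  have := h.upper
  refine leadPair_C0 (c := 0) l (((mdeg_t_zpow (by decide) _).mul (balanced_mdeg_zero n N 0)).mul
    (balanced_mdeg_zero n N r)) ?_ (by decide) (fun x hx p hp => ?_) (by linarith) (by linarith)
  · have h0 : r ≠ 0 := by rintro rfl; exact absurd hr (by decide)
    have h1 : r ≠ 1 := by rintro rfl; exact absurd hr (by decide)
    simp [h0, h1]
  · simp only [scaled, ppow_add hp]; ring

lemma leadPair_down (h : ExpBounds α) {r : Fin 6} (hr : r ≠ 0) :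
    LeadPair (fun x p => C0 (theta p) (x 4) (x 5) l (p * x 4 * ((x 5 ^ ((n : ℤ) - 1)) ^ 2 *
        scaled α (balanced n N x) p 0 ^ 2) / (x 5 ^ ((n : ℤ) - 1) *
        scaled α (balanced n N x) p 0 * scaled α (balanced n N x) p r)))
      (size l * min (1 + α 0 - α r) 0)
      (fun x => C0 (leadFac (1 + α 0 - α r)) (x 4) (x 5) l
        (x 4 * x 5 ^ ((n : ℤ) - 1) * balanced n N x 0 / balanced n N x r)) := by
  have hb : -1 ≤ 1 + α 0 - α r ∧ 1 + α 0 - α r ≤ 1 := by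
    rcases eq_or_ne r 1 with rfl | h1
    · rw [h.one]
      constructor <;> linarith [h.lower, h.upper]
    · have hr2 : 2 ≤ r := by revert r; decide
      constructor <;> linarith [h.ge r hr2, h.le r hr2]
  refine leadPair_C0 (c := 0) l ((((mdeg_q (by decide)).mul (mdeg_t_zpow (by decide) _)).mul
    (balanced_mdeg_zero n N 0)).div
    (balanced_mdeg_zero n N r)) ?_ (by decide) (fun x hx p hp => ?_) hb.1 hb.2
  · simp only [hr, if_false]
    split_ifs <;> norm_num
  · have h0 := balanced_ne_zero n N hx 0
    have h1 := balanced_ne_zero n N hx r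
    have h2 := ppow_ne_zero hp (α 0)
    have h3 := ppow_ne_zero hp (α r)
    have h4 := zpow_ne_zero ((n : ℤ) - 1) (hx 5)
    simp only [scaled, ppow_add hp, ppow_sub hp, ppow_one]
    generalize ppow p (α 0) = P at *
    generalize ppow p (α r) = P' at *
    generalize x 5 ^ ((n : ℤ) - 1) = s at *
    generalize balanced n N x 0 = b at *
    generalize balanced n N x r = b' at *
    field_simp

lemma leadPair_rect_down (h : ExpBounds α) {r : Fin 6} (hr : r = 2 ∨ r = 3 ∨ r = 5) :
    LeadPair (fun x p => C0 (theta p) (x 4) (x 5) l (p * x 4 *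
        (x 5 ^ ((n : ℤ) - 1) * scaled α (balanced n N x) p 1 / scaled α (balanced n N x) p 4) /
        (p * x 4 / (scaled α (balanced n N x) p 4 * scaled α (balanced n N x) p r))))
      (size l * min (α r - α 0) 0)
      (fun x => C0 (leadFac (α r - α 0)) (x 4) (x 5) l
        (x 5 ^ ((n : ℤ) - 1) * balanced n N x 1 * balanced n N x r)) := by
  have hr' : 2 ≤ r := by rcases hr with rfl | rfl | rfl <;> decide
  have := h.ge r hr'
  have := h.le r hr'
  refine leadPair_C0 (c := 0) l (((mdeg_t_zpow (by decide) _).mul (balanced_mdeg_zero n N 1)).mul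
    (balanced_mdeg_zero n N r)) ?_ (by decide) (fun x hx p hp => ?_) (by linarith) (by linarith)
  · rcases hr with rfl | rfl | rfl <;> simp
  · have h0 := balanced_ne_zero n N hx 4
    have h1 := balanced_ne_zero n N hx r
    have h2 := ppow_ne_zero hp (α 4)
    have h3 := ppow_ne_zero hp (α r)
    have h4 := zpow_ne_zero ((n : ℤ) - 1) (hx 5)
    have h5 := ppow_ne_zero hp (α 0)
    have h6 := hx 4
    simp only [scaled, ppow_sub hp, h.one, ppow_neg]
    generalize ppow p (α 0) = P at *
    generalize ppow p (α 4) = P'' at *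
    generalize ppow p (α r) = P' at *
    generalize x 5 ^ ((n : ℤ) - 1) = s at *
    generalize balanced n N x 4 = b at *
    generalize balanced n N x 1 = b'' at *
    generalize balanced n N x r = b' at *
    field_simp

lemma leadPair_rect_up (h : ExpBounds α) {r : Fin 6} (hr : r = 2 ∨ r = 3 ∨ r = 5) :
    LeadPair (fun x p => C0 (theta p) (x 4) (x 5) l
        (p * x 4 / (scaled α (balanced n N x) p 4 * scaled α (balanced n N x) p r)))
      (size l * min (1 - α 4 - α r) 0)
      (fun x => C0 (leadFac (1 - α 4 - α r)) (x 4) (x 5) l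
        (x 4 / (balanced n N x 4 * balanced n N x r))) := by
  have := h.pair_ge r hr
  have := h.pair_le r hr
  have hX : ∀ x : ℂ⁶, (∀ i, x i ≠ 0) → ∀ p : ℂ, p ≠ 0 →
      p * x 4 / (scaled α (balanced n N x) p 4 * scaled α (balanced n N x) p r) =
        x 4 / (balanced n N x 4 * balanced n N x r) * ppow p (1 - α 4 - α r) := by
    intro x hx p hp
    simp only [scaled, ppow_sub hp, ppow_one, div_eq_mul_inv, mul_inv]
    ring
  rcases eq_or_ne r 3 with rfl | h3
  · exact leadPair_C0 (c := 2) l ((mdeg_q (by decide)).div ((balanced_mdeg_two n N 4).mul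
      (balanced_mdeg_two n N 3))) (by simp) (by decide) hX (by linarith) (by linarith)
  · refine leadPair_C0 (c := 1) l ((mdeg_q (by decide)).div ((balanced_mdeg_one n N 4).mul
      (balanced_mdeg_one n N r))) ?_ (by decide) hX (by linarith) (by linarith)
    rcases hr with rfl | rfl | rfl
    exacts [by simp, absurd rfl h3, by simp]

end Symbols

/-- The leading term of the weight, for exponents in the range where all theta functions have
arguments `x p^γ` with `-1 ≤ γ ≤ 1`. -/
lemma weight_leadPair (h : ExpBounds α) {μ : Fin n → ℕ} (hμ : μ ∈ boxPartitions n N) :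
    LeadPair (fun x p => weight n N (scaled α (balanced n N x) p) (x 4) (x 5) p μ)
      (size μ * (min (α 0 + α 2) 0 + min (α 0 + α 3) 0 + min (α 0 + α 4) 0 + min (α 0 + α 5) 0 -
        2 * α 0))
      (fun x => leadWeight n N α (balanced n N x) (x 4) (x 5) μ) := by
  obtain ⟨hN, hanti⟩ := mem_boxPartitions.1 hμ
  have u0 := h.upper
  have u1 := h.lower
  have hc0 : (0 : Fin 6) ≠ 4 ∧ (0 : Fin 6) ≠ 5 := by decide
  have m0 := balanced_mdeg_zero n N 0
  have m1 := balanced_mdeg_zero n N 1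
  have m4 := balanced_mdeg_zero n N 4
  have ms : MDeg 0 0 fun x => x 5 ^ ((n : ℤ) - 1) := mdeg_t_zpow (by decide) _
  have mq : MDeg 0 0 fun x => x 4 := mdeg_q (by decide)
  have mtn : MDeg 0 0 fun x => x 5 ^ n :=
    (mdeg_t_zpow (c := 0) (by decide) n).congr rfl fun x _ => zpow_natCast _ _
  have mt : MDeg 0 0 fun x => x 5 :=
    (mdeg_t_zpow (c := 0) (by decide) 1).congr rfl fun x _ => zpow_one _
  have ma := (ms.pow 2).mul (m0.pow 2)
  have e2 : ∀ p : ℂ, p ≠ 0 → ppow p (2 * α 0) = ppow p (α 0) ^ 2 := fun p hp => by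
    rw [two_mul, ppow_add hp, sq]
  have c1 : LeadPair (fun (x : ℂ⁶) p => C0 (theta p) (x 4) (x 5) μ (x 5 ^ n)) (size μ * min 0 0)
      (fun x => C0 (leadFac 0) (x 4) (x 5) μ (x 5 ^ n)) :=
    leadPair_boxProd μ (fun _ j => (j : ℤ)) (fun i _ => -(i : ℤ))
      (fun x _ p _ => by rw [ppow_zero, mul_one]) (by norm_num) (by norm_num) fun i j _ =>
      ⟨5, -(i : ℤ) + n, by omega, (((mdeg_q (c := 5) (by decide)).zpow j).mul
        ((mdeg_coord 5 5).zpow (-(i : ℤ)))).mul ((mdeg_coord 5 5).pow n) |>.congr (by simp)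
          fun _ _ => rfl⟩
  have c2 := leadPair_C0 μ (X := fun x p => p * x 4 * ((x 5 ^ ((n : ℤ) - 1)) ^ 2 *
      scaled α (balanced n N x) p 0 ^ 2) / x 5 ^ n)
    (γ := 1 + 2 * α 0) ((mq.mul ma).div mtn) (by simp) hc0
    (fun x hx p hp => by simp only [scaled, ppow_add hp, ppow_one, e2 p hp]; ring)
    (by linarith) (by linarith)
  have c3 : LeadPair (fun (x : ℂ⁶) p => C0 (theta p) (x 4) (x 5) μ (x 5 ^ ((n : ℤ) - 1) *
        scaled α (balanced n N x) p 0 * scaled α (balanced n N x) p 1)) (size μ * min 0 0)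
      (fun x => C0 (leadFac 0) (x 4) (x 5) μ
        (x 5 ^ ((n : ℤ) - 1) * balanced n N x 0 * balanced n N x 1)) := by
    refine leadPair_boxProd μ (fun _ j => (j : ℤ)) (fun i _ => -(i : ℤ)) (fun x _ p hp => ?_)
      (by norm_num) (by norm_num) fun i j hj => ⟨4, (j : ℤ) - N, ?_,
      (((mdeg_coord 4 4).zpow j).mul ((mdeg_coord 4 5).zpow (-(i : ℤ)))).mul
        ((mdeg_coord 4 4).zpow (-(N : ℤ))) |>.congr ?_ fun x hx => ?_⟩
    · have h5 := ppow_ne_zero hp (α 0)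
      simp only [scaled, h.one, ppow_neg, ppow_zero]
      field_simp
    · have := hN i
      omega
    · simp; ring
    · rw [← balanced_bal₁ n N hx]
  have c4 := leadPair_down (n := n) (N := N) μ h (r := 1) (by decide)
  rw [h.one, sub_neg_eq_add, add_assoc, ← two_mul] at c4
  have c5 := leadPair_C0 (twiceSq μ) (X := fun x p => p * x 4 * ((x 5 ^ ((n : ℤ) - 1)) ^ 2 *
      scaled α (balanced n N x) p 0 ^ 2))
    (γ := 1 + 2 * α 0) (mq.mul ma) (by simp) hc0
    (fun x hx p hp => by simp only [scaled, ppow_add hp, ppow_one, e2 p hp]; ring)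
    (by linarith) (by linarith)
  have c6 : LeadPair (fun (x : ℂ⁶) p => Cm (theta p) (x 4) (x 5) μ (p * x 4)) (size μ * min 1 0)
      (fun x => Cm (leadFac 1) (x 4) (x 5) μ (x 4)) :=
    leadPair_boxProd μ (fun i j => (μ i : ℤ) - (j + 1)) (fun i j => (colLen μ j : ℤ) - (i + 1))
      (fun x _ p hp => by rw [ppow_one, mul_comm]) (by norm_num) (by norm_num) fun i j hj =>
      ⟨4, (μ i : ℤ) - (j + 1) + 1, by omega, (((mdeg_coord 4 4).zpow _).mul
        ((mdeg_coord 4 5).zpow _)).mul (mdeg_coord 4 4) |>.congr (by simp) fun _ _ => rfl⟩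
  have c7 : LeadPair (fun (x : ℂ⁶) p => Cm (theta p) (x 4) (x 5) μ (x 5)) (size μ * min 0 0)
      (fun x => Cm (leadFac 0) (x 4) (x 5) μ (x 5)) :=
    leadPair_boxProd μ (fun i j => (μ i : ℤ) - (j + 1)) (fun i j => (colLen μ j : ℤ) - (i + 1))
      (fun x _ p hp => by rw [ppow_zero, mul_one]) (by norm_num) (by norm_num) fun i j hj =>
      ⟨5, (colLen μ j : ℤ) - (i + 1) + 1, by
        have := (lt_colLen_iff hanti j i).2 hj
        omega, (((mdeg_coord 5 4).zpow _).mul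
        ((mdeg_coord 5 5).zpow _)).mul (mdeg_coord 5 5) |>.congr (by simp) fun _ _ => rfl⟩
  have c8 := leadPair_Cp μ (X := fun x p => ((x 5 ^ ((n : ℤ) - 1)) ^ 2 *
      scaled α (balanced n N x) p 0 ^ 2))
    (γ := 2 * α 0) ma (by simp) hc0
    (fun x hx p hp => by simp only [scaled, e2 p hp]; ring) (by linarith) (by linarith)
  have c9 := leadPair_Cp μ (X := fun x p => p * x 4 * ((x 5 ^ ((n : ℤ) - 1)) ^ 2 *
      scaled α (balanced n N x) p 0 ^ 2) / x 5)
    (γ := 1 + 2 * α 0) ((mq.mul ma).div mt) (by simp) hc0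
    (fun x hx p hp => by simp only [scaled, ppow_add hp, ppow_one, e2 p hp]; ring)
    (by linarith) (by linarith)
  have r1 := leadPair_C0 (rect n N)
    (X := fun x p => scaled α (balanced n N x) p 1 / scaled α (balanced n N x) p 0)
    (γ := -2 * α 0) (m1.div m0) (by simp) hc0
    (fun x hx p hp => by
      have := ppow_ne_zero hp (α 0)
      simp only [scaled, neg_mul, ppow_neg, e2 p hp, h.one]
      field_simp)
    (by linarith) (by linarith)
  have g4 := h.ge 4 (by decide)
  have l4 := h.le 4 (by decide)
  have r2 : LeadPair (fun (x : ℂ⁶) p => C0 (theta p) (x 4) (x 5) (rect n N) (p * x 4 *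
        (x 5 ^ ((n : ℤ) - 1) * scaled α (balanced n N x) p 1 / scaled α (balanced n N x) p 4) /
        (scaled α (balanced n N x) p 1 / scaled α (balanced n N x) p 0)))
      (size (rect n N) * min (1 + α 0 - α 4) 0)
      (fun x => C0 (leadFac (1 + α 0 - α 4)) (x 4) (x 5) (rect n N)
        (x 4 * x 5 ^ ((n : ℤ) - 1) * balanced n N x 0 / balanced n N x 4)) := by
    refine leadPair_C0 _ (((mq.mul ms).mul m0).div m4) (by simp) hc0 (fun x hx p hp => ?_)
      (by linarith) (by linarith)
    have h0 := balanced_ne_zero n N hx 0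
    have h1 := balanced_ne_zero n N hx 1
    have h1' := balanced_ne_zero n N hx 4
    have h2 := ppow_ne_zero hp (α 0)
    have h2' := ppow_ne_zero hp (α 4)
    simp only [scaled, ppow_add hp, ppow_sub hp, ppow_one, h.one, ppow_neg]
    generalize ppow p (α 0) = P at *
    generalize ppow p (α 4) = P' at *
    generalize x 5 ^ ((n : ℤ) - 1) = s at *
    generalize balanced n N x 0 = b at *
    generalize balanced n N x 1 = b' at *
    generalize balanced n N x 4 = b'' at *
    field_simp
  have U := fun (r : Fin 6) (hr : 2 ≤ r) => leadPair_up (n := n) (N := N) μ h hr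
  have V := fun (r : Fin 6) (hr : r ≠ 0) => leadPair_down (n := n) (N := N) μ h hr
  have RU := fun (r : Fin 6) (hr : r = 2 ∨ r = 3 ∨ r = 5) =>
    leadPair_rect_up (n := n) (N := N) (rect n N) h hr
  have RD := fun (r : Fin 6) (hr : r = 2 ∨ r = 3 ∨ r = 5) =>
    leadPair_rect_down (n := n) (N := N) (rect n N) h hr
  have E := (((((((c1.div c2).mul (c3.div c4)).mul ((U 2 (by decide)).div (V 2 (by decide)))).mul
    ((U 3 (by decide)).div (V 3 (by decide)))).mul ((U 4 (by decide)).div (V 4 (by decide)))).mul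
    ((U 5 (by decide)).div (V 5 (by decide)))).mul (c5.div ((c6.mul c7).mul (c8.mul c9)))).div
    ((((r1.div r2).mul ((RU 2 (by simp)).div (RD 2 (by simp)))).mul
      ((RU 3 (by simp)).div (RD 3 (by simp)))).mul ((RU 5 (by simp)).div (RD 5 (by simp))))
  simp only [weight, Delta, Delta0, Fin.prod_univ_six, Fin.prod_univ_four, Matrix.cons_val]
  refine E.congr_val ?_
  have z : ∀ r : Fin 6, 2 ≤ r → min (1 + α 0 - α r) 0 = 0 := fun r hr =>
    min_eq_right (by linarith [h.le r hr])
  have z' : ∀ r : Fin 6, 2 ≤ r → min (α r - α 0) 0 = 0 := fun r hr =>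
    min_eq_right (by linarith [h.ge r hr])
  have z'' : ∀ r : Fin 6, r = 2 ∨ r = 3 ∨ r = 5 → min (1 - α 4 - α r) 0 = 0 := fun r hr =>
    min_eq_right (by linarith [h.pair_le r hr])
  rw [z 2 (by decide), z 3 (by decide), z 4 (by decide), z 5 (by decide), z' 2 (by decide),
    z' 3 (by decide), z' 5 (by decide), z'' 2 (by simp), z'' 3 (by simp), z'' 5 (by simp),
    min_self, min_eq_right (by linarith : (0 : ℝ) ≤ 1 + 2 * α 0),
    min_eq_right (by norm_num : (0 : ℝ) ≤ 1), min_eq_right (by linarith : (0 : ℝ) ≤ -2 * α 0),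
    min_eq_left (by linarith : 2 * α 0 ≤ 0)]
  ring

end Weight

/-! ### Monomial factors of the symbols -/

lemma prod_zpow_eq_zpow_sum {κ : Type*} (s : Finset κ) {a : ℂ} (ha : a ≠ 0) (f : κ → ℤ) :
    ∏ k ∈ s, a ^ f k = a ^ ∑ k ∈ s, f k := by
  classical
  induction s using Finset.induction_on with
  | empty => simp
  | insert i s hi ih => rw [prod_insert hi, sum_insert hi, ih, zpow_add₀ ha]

section Monomial

variable {m : ℕ} {q t : ℂ}

/-- The product of all arguments of a symbol, up to sign. -/
lemma boxProd_neg (hq : q ≠ 0) (ht : t ≠ 0) (l : Fin m → ℕ) (a b : Fin m → ℕ → ℤ) {x : ℂ}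
    (hx : x ≠ 0) : boxProd (fun y => -y) q t l a b x =
      (-x) ^ size l * q ^ (∑ i, ∑ j ∈ range (l i), a i j) *
        t ^ (∑ i, ∑ j ∈ range (l i), b i j) := by
  have h1 : ∀ i, ∏ j ∈ range (l i), -(q ^ a i j * t ^ b i j * x) =
      (-x) ^ (l i : ℤ) * q ^ (∑ j ∈ range (l i), a i j) *
        t ^ (∑ j ∈ range (l i), b i j) := fun i => by
    rw [← prod_zpow_eq_zpow_sum _ hq, ← prod_zpow_eq_zpow_sum _ ht, zpow_natCast]
    have : ∀ j, -(q ^ a i j * t ^ b i j * x) = (-x) * q ^ a i j * t ^ b i j := fun j => by ring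
    simp only [this, prod_mul_distrib, prod_const, card_range]
  rw [boxProd, prod_congr rfl fun i _ => h1 i]
  simp only [prod_mul_distrib, prod_zpow_eq_zpow_sum _ hq, prod_zpow_eq_zpow_sum _ ht,
    prod_zpow_eq_zpow_sum _ (neg_ne_zero.2 hx), size]

lemma sum_range_cast (k : ℕ) : ∑ j ∈ range k, (j : ℤ) = (k.choose 2 : ℤ) := by
  rw [← Nat.cast_sum, sum_range_id, Nat.choose_two_right]

lemma sq_eq_choose (k : ℕ) : (k : ℤ) * k = k + 2 * (k.choose 2 : ℤ) := by
  rw [← sum_range_cast]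
  induction k with
  | zero => simp
  | succ k ih => rw [sum_range_succ]; push_cast; linarith

/-- In each column, legs and coarms have the same sum. -/
lemma sum_colLen {l : Fin m → ℕ} (hl : Antitone l) :
    ∑ i, ∑ j ∈ range (l i), ((colLen l j : ℤ) - 1 - 2 * (i : ℕ)) = 0 := by
  obtain ⟨M, hM⟩ : ∃ M, ∀ i, l i ≤ M := ⟨∑ i, l i, fun i =>
    single_le_sum (f := l) (fun _ _ => Nat.zero_le _) (mem_univ i)⟩
  have e : ∀ i, ∑ j ∈ range (l i), ((colLen l j : ℤ) - 1 - 2 * (i : ℕ)) =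
      ∑ j ∈ range M, if (i : ℕ) < colLen l j then (colLen l j : ℤ) - 1 - 2 * (i : ℕ)
        else 0 := fun i => by
    simp only [lt_colLen_iff hl]
    rw [← sum_filter]
    refine sum_congr ?_ fun _ _ => rfl
    ext j
    have := hM i
    simp only [mem_range, mem_filter]
    omega
  rw [sum_congr rfl fun i _ => e i, sum_comm]
  refine sum_eq_zero fun j _ => ?_
  have hc : colLen l j ≤ m := (card_le_univ _).trans (by simp)
  generalize colLen l j = c at hc
  rw [Fin.sum_univ_eq_sum_range (fun i : ℕ => if i < c then (c : ℤ) - 1 - 2 * i else 0) m,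
    ← sum_filter]
  have : (range m).filter (· < c) = range c := by
    ext; simp only [mem_filter, mem_range]; omega
  rw [this]
  have g : ∀ k : ℤ, ∀ c : ℕ, ∑ i ∈ range c, (k - 1 - 2 * (i : ℤ)) = c * (k - c) := by
    intro k c
    induction c with
    | zero => simp
    | succ c ih => rw [sum_range_succ, ih]; push_cast; ring
  rw [g]; simp

lemma C0_neg (hq : q ≠ 0) (ht : t ≠ 0) (l : Fin m → ℕ) {x : ℂ} (hx : x ≠ 0) :
    C0 (fun y => -y) q t l x = (-x) ^ size l * q ^ nStatConj l * (t ^ nStat l)⁻¹ := by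
  refine (boxProd_neg hq ht l (fun _ j => (j : ℤ)) (fun i _ => -(i : ℤ)) hx).trans ?_
  rw [← zpow_neg]
  congr 3
  · simp only [sum_range_cast, nStatConj]
  · simp only [sum_const, card_range, nStat, nsmul_eq_mul, ← sum_neg_distrib]
    exact sum_congr rfl fun i _ => by ring

lemma Cm_neg (hq : q ≠ 0) (ht : t ≠ 0) {l : Fin m → ℕ} (hl : Antitone l) {x : ℂ} (hx : x ≠ 0) :
    Cm (fun y => -y) q t l x = (-x) ^ size l * q ^ nStatConj l * t ^ nStat l := by
  refine (boxProd_neg hq ht l (fun i j => (l i : ℤ) - (j + 1))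
    (fun i j => (colLen l j : ℤ) - (i + 1)) hx).trans ?_
  have e1 : ∑ i, ∑ j ∈ range (l i), ((l i : ℤ) - (j + 1)) = nStatConj l := by
    refine sum_congr rfl fun i _ => ?_
    rw [← sum_range_cast, ← sum_range_reflect]
    refine sum_congr rfl fun j hj => ?_
    have := mem_range.1 hj
    omega
  have e2 : ∑ i, ∑ j ∈ range (l i), ((colLen l j : ℤ) - ((i : ℕ) + 1)) = nStat l := by
    have := sum_colLen hl
    have h2 : ∑ i, ∑ j ∈ range (l i), ((colLen l j : ℤ) - ((i : ℕ) + 1)) =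
        ∑ i, ∑ j ∈ range (l i), ((colLen l j : ℤ) - 1 - 2 * (i : ℕ)) + nStat l := by
      rw [nStat, ← sum_add_distrib]
      refine sum_congr rfl fun i _ => ?_
      have : ((i : ℕ) : ℤ) * (l i : ℤ) = ∑ _j ∈ range (l i), ((i : ℕ) : ℤ) := by simp; ring
      rw [this, ← sum_add_distrib]
      exact sum_congr rfl fun j _ => by ring
    rw [h2, this, zero_add]
  rw [e1, e2]

lemma Cp_neg (hq : q ≠ 0) (ht : t ≠ 0) {l : Fin m → ℕ} (hl : Antitone l) {x : ℂ} (hx : x ≠ 0) :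
    Cp (fun y => -y) q t l x =
      (-x) ^ size l * (q ^ size l * (q ^ nStatConj l) ^ 3) * ((t ^ nStat l) ^ 3)⁻¹ := by
  refine (boxProd_neg hq ht l (fun i j => (l i : ℤ) + (j + 1) - 1)
    (fun i j => 2 - (colLen l j : ℤ) - (i + 1)) hx).trans ?_
  have e1 : q ^ size l * (q ^ nStatConj l) ^ 3 = q ^ (size l + 3 * nStatConj l) := by
    rw [zpow_add₀ hq, mul_comm 3, zpow_mul]; rfl
  have e2 : ((t ^ nStat l) ^ 3)⁻¹ = t ^ (-(3 * nStat l)) := by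
    rw [zpow_neg, mul_comm 3, zpow_mul]; rfl
  rw [e1, e2]
  congr 3
  · rw [size, nStatConj, mul_sum, ← sum_add_distrib]
    refine sum_congr rfl fun i _ => ?_
    have : ∀ j : ℕ, (l i : ℤ) + (j + 1) - 1 = l i + j := fun j => by ring
    simp only [this, sum_add_distrib, sum_range_cast, sum_const, card_range,
      nsmul_eq_mul]
    have := sq_eq_choose (l i)
    linarith
  · have := sum_colLen hl
    have h2 : ∑ i, ∑ j ∈ range (l i), (2 - (colLen l j : ℤ) - ((i : ℕ) + 1)) =
        -∑ i, ∑ j ∈ range (l i), ((colLen l j : ℤ) - 1 - 2 * (i : ℕ)) - 3 * nStat l := by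
      rw [nStat, mul_sum, ← sum_neg_distrib, ← sum_sub_distrib]
      refine sum_congr rfl fun i _ => ?_
      have : 3 * (((i : ℕ) : ℤ) * (l i : ℤ)) = ∑ _j ∈ range (l i), 3 * ((i : ℕ) : ℤ) := by
        simp; ring
      rw [this, ← sum_neg_distrib, ← sum_sub_distrib]
      exact sum_congr rfl fun j _ => by ring
    rw [h2, this]; ring

lemma poch_neg_eq (hq : q ≠ 0) {x : ℂ} (k : ℕ) :
    poch (fun y => -y) q x k = (-x) ^ k * q ^ ((k.choose 2 : ℕ) : ℤ) := by
  rw [poch, ← sum_range_cast, ← prod_zpow_eq_zpow_sum _ hq]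
  have : ∀ j : ℕ, -(x * q ^ j) = (-x) * q ^ (j : ℤ) := fun j => by rw [zpow_natCast]; ring
  rw [prod_congr rfl fun j _ => this j, prod_mul_distrib, prod_const,
    card_range]

lemma C0_neg_twiceSq (hq : q ≠ 0) (ht : t ≠ 0) (l : Fin m → ℕ) {x : ℂ} (hx : x ≠ 0) :
    C0 (fun y => -y) q t (twiceSq l) x = (x ^ size l) ^ 4 * (q ^ nStatConj l) ^ 8 *
      (q ^ size l) ^ 2 * ((t ^ nStat l) ^ 8)⁻¹ * ((t ^ size l) ^ 2)⁻¹ := by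
  rw [C0_twiceSq]
  have h1 : ∀ i : Fin m, poch (fun y => -y) q (t ^ (-2 * (i : ℤ)) * x) (2 * l i) *
      poch (fun y => -y) q (t ^ (-2 * (i : ℤ) - 1) * x) (2 * l i) =
      (x ^ (l i : ℤ)) ^ 4 * (q ^ ((l i).choose 2 : ℤ)) ^ 8 * (q ^ (l i : ℤ)) ^ 2 *
        ((t ^ ((i : ℤ) * (l i : ℤ))) ^ 8)⁻¹ * ((t ^ (l i : ℤ)) ^ 2)⁻¹ := fun i => by
    rw [poch_neg_eq hq, poch_neg_eq hq]
    have hc : (((2 * l i).choose 2 : ℕ) : ℤ) = 4 * ((l i).choose 2 : ℤ) + l i := by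
      have h1 := sq_eq_choose (2 * l i)
      have h2 := sq_eq_choose (l i)
      push_cast at h1
      linarith
    rw [hc, zpow_sub₀ ht, zpow_one, zpow_add₀ hq, mul_comm (4 : ℤ), zpow_mul q,
      show (-2 * (i : ℤ)) = -((i : ℤ) * 2) by ring, zpow_neg, zpow_mul t, zpow_mul t, zpow_natCast,
      zpow_natCast, zpow_natCast, zpow_natCast, pow_mul, pow_mul, neg_sq, neg_sq]
    have h3 : t ^ (i : ℕ) ≠ 0 := pow_ne_zero _ ht
    generalize q ^ (((l i).choose 2 : ℕ) : ℤ) = A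
    simp only [zpow_ofNat, zpow_natCast]
    simp only [mul_pow, div_pow, inv_pow, ← pow_mul]
    field_simp
    simp only [← pow_mul]
    have h4 := pow_ne_zero (l i) ht
    field_simp
    ring_nf
  rw [prod_congr rfl fun i _ => h1 i]
  simp only [prod_mul_distrib, prod_pow, prod_inv_distrib,
    prod_zpow_eq_zpow_sum _ hq, prod_zpow_eq_zpow_sum _ ht, prod_zpow_eq_zpow_sum _ hx, size, nStat,
    nStatConj]

end Monomial

/-! ### Evaluating the leading coefficients -/

lemma leadFac_zero (x : ℂ) : leadFac 0 x = oneSub x := by simp [leadFac, oneSub]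

lemma leadFac_one {x : ℂ} (hx : x ≠ 0) : leadFac 1 x = oneSub x / -x := by
  rw [leadFac, oneSub]; norm_num; field_simp; ring

lemma leadFac_neg_one (x : ℂ) : leadFac (-1) x = -x * oneSub x := by simp [leadFac, oneSub]

lemma leadFac_neg {γ : ℝ} (h : -1 < γ) (h' : γ < 0) (x : ℂ) : leadFac γ x = -x := by
  simp [leadFac, h.ne', h']

lemma leadFac_pos {γ : ℝ} (h : 0 < γ) (h' : γ < 1) (x : ℂ) : leadFac γ x = 1 := by
  have : γ ≠ -1 := by linarith
  simp [leadFac, this, h.ne', not_lt.2 h.le, h']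

lemma leadFac_inv {γ : ℝ} (h : 0 ≤ γ) (h' : γ ≤ 1) (x : ℂ) :
    leadFac γ x⁻¹ = leadFac (1 - γ) x := by
  rcases h.eq_or_lt with rfl | h0
  · rw [sub_zero, leadFac, leadFac]; norm_num
  · rcases h'.eq_or_lt with rfl | h1
    · rw [sub_self, leadFac, leadFac]; norm_num
    · rw [leadFac_pos h0 h1, leadFac_pos (by linarith) (by linarith)]

section BoxProd

variable {m : ℕ} {q t : ℂ}

lemma boxProd_congr {φ ψ : ℂ → ℂ} (hq : q ≠ 0) (ht : t ≠ 0) {l : Fin m → ℕ}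
    {a b : Fin m → ℕ → ℤ} {x : ℂ} (hx : x ≠ 0) (h : ∀ y, y ≠ 0 → φ y = ψ y) :
    boxProd φ q t l a b x = boxProd ψ q t l a b x :=
  prod_congr rfl fun _ _ => prod_congr rfl fun _ _ =>
    h _ (mul_ne_zero (mul_ne_zero (zpow_ne_zero _ hq) (zpow_ne_zero _ ht)) hx)

lemma boxProd_leadFac_one (hq : q ≠ 0) (ht : t ≠ 0) {l : Fin m → ℕ}
    {a b : Fin m → ℕ → ℤ} {x : ℂ} (hx : x ≠ 0) : boxProd (leadFac 1) q t l a b x =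
      boxProd oneSub q t l a b x / boxProd (fun y => -y) q t l a b x := by
  rw [boxProd_congr hq ht hx (fun y hy => leadFac_one hy)]
  simp only [boxProd, prod_div_distrib]

lemma boxProd_leadFac_neg_one {l : Fin m → ℕ}
    {a b : Fin m → ℕ → ℤ} {x : ℂ} : boxProd (leadFac (-1)) q t l a b x =
      boxProd (fun y => -y) q t l a b x * boxProd oneSub q t l a b x := by
  simp only [boxProd, leadFac_neg_one, prod_mul_distrib]

lemma boxProd_leadFac_zero {l : Fin m → ℕ}
    {a b : Fin m → ℕ → ℤ} {x : ℂ} : boxProd (leadFac 0) q t l a b x =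
      boxProd oneSub q t l a b x := by
  simp only [boxProd, leadFac_zero]

lemma boxProd_leadFac_neg {γ : ℝ} (h : -1 < γ) (h' : γ < 0) {l : Fin m → ℕ}
    {a b : Fin m → ℕ → ℤ} {x : ℂ} : boxProd (leadFac γ) q t l a b x =
      boxProd (fun y => -y) q t l a b x := by
  simp only [boxProd, leadFac_neg h h']

lemma boxProd_leadFac_pos {γ : ℝ} (h : 0 < γ) (h' : γ < 1) {l : Fin m → ℕ}
    {a b : Fin m → ℕ → ℤ} {x : ℂ} : boxProd (leadFac γ) q t l a b x = 1 := by
  simp only [boxProd, leadFac_pos h h', prod_const_one]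

lemma C0_leadFac_nonneg (hq : q ≠ 0) (ht : t ≠ 0) (l : Fin m → ℕ) {x : ℂ} (hx : x ≠ 0) {γ : ℝ}
    (h : 0 ≤ γ) (h' : γ ≤ 1) : C0 (leadFac γ) q t l x =
      (if γ = 0 then C0 oneSub q t l x else 1) *
        (if γ = 1 then C0 oneSub q t l x / C0 (fun y => -y) q t l x else 1) := by
  rcases h.eq_or_lt with rfl | h0
  · rw [if_pos rfl, if_neg zero_ne_one, mul_one]
    exact boxProd_leadFac_zero
  · rcases h'.eq_or_lt with rfl | h1
    · rw [if_pos rfl, if_neg one_ne_zero, one_mul]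
      exact boxProd_leadFac_one hq ht hx
    · rw [if_neg h0.ne', if_neg h1.ne, mul_one]
      exact boxProd_leadFac_pos h0 h1

lemma C0_leadFac_nonpos (q t : ℂ) (l : Fin m → ℕ) (x : ℂ) {γ : ℝ}
    (h : -1 ≤ γ) (h' : γ ≤ 0) : C0 (leadFac γ) q t l x =
      (if γ = -1 then C0 oneSub q t l x else 1) * (if γ = 0 then C0 oneSub q t l x else 1) *
        (if γ < 0 then C0 (fun y => -y) q t l x else 1) := by
  rcases h'.eq_or_lt with rfl | h0
  · rw [if_pos rfl, if_neg (by norm_num), if_neg (lt_irrefl _), mul_one, one_mul]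
    exact boxProd_leadFac_zero
  · rcases h.eq_or_lt with rfl | h1
    · rw [if_pos rfl, if_neg (by norm_num), if_pos (by norm_num), mul_one, mul_comm]
      exact boxProd_leadFac_neg_one
    · rw [if_neg h0.ne, if_neg h1.ne', if_pos h0, mul_one, one_mul]
      exact boxProd_leadFac_neg h1 h0

/-- Rotating the rectangle by a half turn inverts the arguments. -/
lemma C0_rect_reflect (φ : ℂ → ℂ) {n N : ℕ} (hq : q ≠ 0) (ht : t ≠ 0) (x : ℂ) :
    C0 φ q t (rect n N) x = C0 (fun y => φ y⁻¹) q t (rect n N)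
      (q ^ (1 - (N : ℤ)) * t ^ ((n : ℤ) - 1) / x) := by
  simp only [C0, rect]
  rw [prod_fin_reflect n fun i => ∏ j ∈ range N, φ (q ^ (j : ℤ) * t ^ (-(i : ℤ)) * x)]
  refine prod_congr rfl fun i _ => ?_
  rw [← prod_range_reflect]
  refine prod_congr rfl fun j hj => ?_
  have hj := mem_range.1 hj
  have hi := i.2
  congr 1
  rw [show ((N - 1 - j : ℕ) : ℤ) = -((j : ℤ) + (1 - N)) by omega,
    show -((n - 1 - (i : ℕ) : ℕ) : ℤ) = -(-(i : ℤ) + (n - 1)) by omega, zpow_neg, zpow_neg,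
    zpow_add₀ hq, zpow_add₀ ht]
  simp only [div_eq_mul_inv, mul_inv, inv_inv]
  ring

lemma C0_rect_leadFac {n N : ℕ} (hq : q ≠ 0) (ht : t ≠ 0) (x : ℂ) {γ : ℝ}
    (h : 0 ≤ γ) (h' : γ ≤ 1) : C0 (leadFac γ) q t (rect n N) x =
      C0 (leadFac (1 - γ)) q t (rect n N) (q ^ (1 - (N : ℤ)) * t ^ ((n : ℤ) - 1) / x) := by
  rw [C0_rect_reflect _ hq ht]
  simp only [leadFac_inv h h']

lemma C0_rect_eval {n N : ℕ} (hq : q ≠ 0) (ht : t ≠ 0) {x : ℂ} (hx : x ≠ 0) {γ : ℝ}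
    (h : 0 ≤ γ) (h' : γ ≤ 1) : C0 (leadFac γ) q t (rect n N) x =
      (if γ = 0 then C0 oneSub q t (rect n N) x else 1) * (if γ = 1 then C0 oneSub q t (rect n N)
        (q ^ (1 - (N : ℤ)) * t ^ ((n : ℤ) - 1) / x) else 1) := by
  rcases h'.eq_or_lt with rfl | h1
  · rw [C0_rect_leadFac hq ht x h h', sub_self, if_neg one_ne_zero, if_pos rfl, one_mul]
    exact boxProd_leadFac_zero
  · rw [C0_leadFac_nonneg hq ht _ hx h h', if_neg h1.ne, if_neg h1.ne]

end BoxProd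

/-! ### The limiting weights -/

section LimWeight

variable {n N : ℕ} {α : Fin 6 → ℝ} {τ : ℂ⁶} {q t : ℂ}

/-- Parameters with the balancing conditions of the limit. -/
structure LimParams (n N : ℕ) (τ : ℂ⁶) (q t : ℂ) : Prop where
  ne : ∀ r, τ r ≠ 0
  q_ne : q ≠ 0
  t_ne : t ≠ 0
  bal₁ : t ^ ((n : ℤ) - 1) * τ 0 * τ 1 = q ^ (-(N : ℤ))
  bal₂ : t ^ ((n : ℤ) - 1) * τ 2 * τ 3 * τ 4 * τ 5 = q ^ ((N : ℤ) + 1)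

lemma prod_Ici_two {M : Type*} [CommMonoid M] (f : Fin 6 → M) :
    ∏ r ∈ Ici (2 : Fin 6), f r = f 2 * f 3 * f 4 * f 5 := by
  rw [show Ici (2 : Fin 6) = {2, 3, 4, 5} by decide]
  rw [prod_insert (by decide), prod_insert (by decide),
    prod_insert (by decide), prod_singleton]
  simp only [mul_assoc]

lemma pairProd_expand (n N : ℕ) (α : Fin 6 → ℝ) (τ : ℂ⁶) (q t : ℂ) :
    pairProd n N α τ q t =
      let h := fun r s : Fin 6 => if α r + α s = 1 then C0 oneSub q t (rect n N) (q / (τ r * τ s))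
        else 1
      h 2 3 * h 2 4 * h 2 5 * h 3 4 * h 3 5 * h 4 5 := by
  rw [pairProd, prod_Ici_two]
  simp only [prod_filter]
  rw [show Ioi (2 : Fin 6) = {3, 4, 5} by decide,
    show Ioi (3 : Fin 6) = {4, 5} by decide, show Ioi (4 : Fin 6) = {5} by decide,
    show Ioi (5 : Fin 6) = ∅ by decide]
  rw [prod_insert (by decide), prod_insert (by decide),
    prod_insert (by decide)]
  simp only [prod_singleton, prod_empty, mul_one, mul_assoc]

/-- The symbols for the pairs `{4, r}` comprise those of the complementary pairs. -/
lemma pairProd_eq (hP : LimParams n N τ q t) (hα : Admissible α) : pairProd n N α τ q t =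
    C0 (leadFac (1 - α 4 - α 2)) q t (rect n N) (q / (τ 4 * τ 2)) *
      C0 (leadFac (1 - α 4 - α 3)) q t (rect n N) (q / (τ 4 * τ 3)) *
      C0 (leadFac (1 - α 4 - α 5)) q t (rect n N) (q / (τ 4 * τ 5)) := by
  have hb := hα.expBounds
  have hs := hα.sum_eq
  have key : ∀ r k l : Fin 6, r = 2 ∨ r = 3 ∨ r = 5 → α 4 + α r + (α k + α l) = 1 →
      t ^ ((n : ℤ) - 1) * (τ 4 * τ r) * (τ k * τ l) = q ^ ((N : ℤ) + 1) →
      C0 (leadFac (1 - α 4 - α r)) q t (rect n N) (q / (τ 4 * τ r)) =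
        (if α 4 + α r = 1 then C0 oneSub q t (rect n N) (q / (τ 4 * τ r)) else 1) *
        (if α k + α l = 1 then C0 oneSub q t (rect n N) (q / (τ k * τ l)) else 1) := by
    intro r k l hr h1 h2
    have p1 := hb.pair_le r hr
    have p2 := hb.pair_ge r hr
    have n4 := hP.ne 4
    have nr := hP.ne r
    have nk := hP.ne k
    have nl := hP.ne l
    rw [C0_rect_eval hP.q_ne hP.t_ne (div_ne_zero hP.q_ne (mul_ne_zero n4 nr)) (by linarith)
      (by linarith)]
    have e : q ^ (1 - (N : ℤ)) * t ^ ((n : ℤ) - 1) / (q / (τ 4 * τ r)) = q / (τ k * τ l) := by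
      have hq := hP.q_ne
      have hqN : q ^ (1 - (N : ℤ)) * q ^ ((N : ℤ) + 1) = q ^ 2 := by
        rw [← zpow_add₀ hq]; ring_nf; rfl
      rw [← h2] at hqN
      field_simp
      linear_combination hqN
    rw [e]
    congr 1
    · exact if_congr ⟨fun h => by linarith, fun h => by linarith⟩ rfl rfl
    · exact if_congr ⟨fun h => by linarith, fun h => by linarith⟩ rfl rfl
  have b := hP.bal₂
  rw [key 2 3 5 (by simp) (by linarith) (by linear_combination b),
    key 3 2 5 (by simp) (by linarith) (by linear_combination b),
    key 5 2 3 (by simp) (by linarith) (by linear_combination b), pairProd_expand]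
  simp only [mul_comm (τ 4), add_comm (α 4)]
  rw [mul_comm (τ 5), add_comm (α 5)]
  ring

/-- The part of the leading coefficient that does not involve `τ₂, …, τ₅`. -/
def leadBase (n N : ℕ) (α : Fin 6 → ℝ) (τ : ℂ⁶) (q t : ℂ) (μ : Fin n → ℕ) : ℂ :=
  let s := t ^ ((n : ℤ) - 1)
  let c := fun γ => C0 (leadFac γ) q t μ
  C0 (leadFac (1 + 2 * α 0)) q t (twiceSq μ) (q * s ^ 2 * τ 0 ^ 2) *
      (c 0 (t ^ n) * c 0 (q ^ (-(N : ℤ)))) /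
    (c (1 + 2 * α 0) (q * t ^ ((n : ℤ) - 2) * τ 0 ^ 2) * c (1 + 2 * α 0) (q * s * τ 0 / τ 1) *
      (Cm (leadFac 1) q t μ q * Cm (leadFac 0) q t μ t) *
      (Cp (leadFac (2 * α 0)) q t μ (s ^ 2 * τ 0 ^ 2) *
        Cp (leadFac (1 + 2 * α 0)) q t μ (q * t ^ (2 * (n : ℤ) - 3) * τ 0 ^ 2)) *
      C0 (leadFac (-2 * α 0)) q t (rect n N) (τ 1 / τ 0))

/-- The part of the leading coefficient that involves `τ_r`. -/
def leadPart (n N : ℕ) (α : Fin 6 → ℝ) (τ : ℂ⁶) (q t : ℂ) (μ : Fin n → ℕ) (r : Fin 6) : ℂ :=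
  let s := t ^ ((n : ℤ) - 1)
  C0 (leadFac (α 0 + α r)) q t μ (s * τ 0 * τ r) *
    C0 (leadFac (α r - α 0)) q t (rect n N) (s * τ 1 * τ r) /
    C0 (leadFac (1 + α 0 - α r)) q t μ (q * s * τ 0 / τ r)

lemma LimParams.tpow₂ (hP : LimParams n N τ q t) :
    q * ((t ^ ((n : ℤ) - 1)) ^ 2 * τ 0 ^ 2) / t ^ n = q * t ^ ((n : ℤ) - 2) * τ 0 ^ 2 := by
  have ht := hP.t_ne
  have h : (t ^ ((n : ℤ) - 1)) ^ 2 / t ^ n = t ^ ((n : ℤ) - 2) := by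
    rw [← zpow_natCast t n, ← zpow_natCast, ← zpow_mul, ← zpow_sub₀ ht]
    congr 1; push_cast; ring
  rw [← h]; ring

lemma LimParams.tpow₃ (hP : LimParams n N τ q t) :
    q * ((t ^ ((n : ℤ) - 1)) ^ 2 * τ 0 ^ 2) / t = q * t ^ (2 * (n : ℤ) - 3) * τ 0 ^ 2 := by
  have ht := hP.t_ne
  have h : (t ^ ((n : ℤ) - 1)) ^ 2 / t = t ^ (2 * (n : ℤ) - 3) := by
    rw [← zpow_natCast, ← zpow_mul]
    nth_rewrite 2 [← zpow_one t]
    rw [← zpow_sub₀ ht]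
    congr 1; push_cast; ring
  rw [← h]; ring

lemma leadWeight_eq (hP : LimParams n N τ q t) (hα : Admissible α) (μ : Fin n → ℕ) :
    leadWeight n N α τ q t μ = leadBase n N α τ q t μ *
      (∏ r ∈ Ici (2 : Fin 6), leadPart n N α τ q t μ r) * (1 / pairProd n N α τ q t) := by
  have hb := hα.expBounds
  have b1 := hb.ge 4 (by decide)
  have b2 := hb.le 4 (by decide)
  have n0 := hP.ne 0
  have n4 := hP.ne 4
  have hs := zpow_ne_zero ((n : ℤ) - 1) hP.t_ne
  have e4 : C0 (leadFac (1 + α 0 - α 4)) q t (rect n N)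
      (q * t ^ ((n : ℤ) - 1) * τ 0 / τ 4) = C0 (leadFac (α 4 - α 0)) q t (rect n N)
        (t ^ ((n : ℤ) - 1) * τ 1 * τ 4) := by
    rw [C0_rect_leadFac hP.q_ne hP.t_ne _ (by linarith) (by linarith)]
    congr 2
    · ring
    · rw [sub_eq_add_neg, zpow_add₀ hP.q_ne, zpow_one, ← hP.bal₁]
      have hq := hP.q_ne
      field_simp
  rw [pairProd_eq hP hα, prod_Ici_two]
  simp only [leadWeight, leadBase, leadPart]
  rw [e4, hP.tpow₂, hP.tpow₃, hP.bal₁, ← mul_assoc q]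
  simp only [div_eq_mul_inv, mul_inv, inv_inv, one_mul]
  ring

/-- The monomial attached to a `C⁰`-symbol. -/
def mono (q t : ℂ) (μ : Fin n → ℕ) (x : ℂ) : ℂ :=
  (-x) ^ size μ * q ^ nStatConj μ * (t ^ nStat μ)⁻¹

lemma leadPart_zero (hP : LimParams n N τ q t) (hα : Admissible α) (h0 : α 0 = 0)
    (μ : Fin n → ℕ) {r : Fin 6} (hr : 2 ≤ r) :
    let s := t ^ ((n : ℤ) - 1)
    let c := C0 oneSub q t μ
    let cN := C0 oneSub q t (rect n N)
    leadPart n N α τ q t μ r = (if α r = 0 then c (s * τ 0 * τ r) * cN (s * τ 1 * τ r) /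
        c (q * s * τ 0 / τ r) *
        (-(q * s * τ 0 / τ r)) ^ size μ * q ^ nStatConj μ * t ^ (-nStat μ) else 1) *
      (if α r = 1 then c (s * τ 0 * τ r) * cN (q ^ (1 - (N : ℤ)) / (τ 1 * τ r)) /
        c (q * s * τ 0 / τ r) *
        (-(s * τ 0 * τ r)) ^ (-size μ) * q ^ (-nStatConj μ) * t ^ nStat μ else 1) := by
  have hb := hα.expBounds
  have b1 := hb.ge r hr
  have b2 := hb.le r hr
  have n0 := hP.ne 0
  have n1 := hP.ne 1
  have nr := hP.ne r
  have hs := zpow_ne_zero ((n : ℤ) - 1) hP.t_ne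
  have hq := hP.q_ne
  have ht := hP.t_ne
  have up : t ^ ((n : ℤ) - 1) * τ 0 * τ r ≠ 0 := mul_ne_zero (mul_ne_zero hs n0) nr
  have up' : t ^ ((n : ℤ) - 1) * τ 1 * τ r ≠ 0 := mul_ne_zero (mul_ne_zero hs n1) nr
  have dn : q * t ^ ((n : ℤ) - 1) * τ 0 / τ r ≠ 0 :=
    div_ne_zero (mul_ne_zero (mul_ne_zero hq hs) n0) nr
  have e1 : q ^ (1 - (N : ℤ)) * t ^ ((n : ℤ) - 1) / (t ^ ((n : ℤ) - 1) * τ 1 * τ r) =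
      q ^ (1 - (N : ℤ)) / (τ 1 * τ r) := by
    rw [mul_assoc, mul_comm (q ^ _), mul_div_mul_left _ _ hs]
  simp only [leadPart]
  rw [h0] at b1 b2 ⊢
  rw [C0_leadFac_nonneg hq ht μ up (by linarith) (by linarith),
    C0_rect_eval hq ht up' (by linarith) (by linarith),
    C0_leadFac_nonneg hq ht μ dn (by linarith) (by linarith), e1, C0_neg hq ht _ up,
    C0_neg hq ht _ dn]
  simp only [zero_add, add_zero, sub_zero]
  rcases b1.eq_or_lt with h | h
  · rw [← h]
    simp only [sub_zero, one_ne_zero, zero_ne_one, if_true, if_false, mul_one, one_mul]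
    rw [zpow_neg]
    simp only [div_eq_mul_inv, mul_inv, inv_inv]
    ring
  · rcases (show α r ≤ 1 by linarith).eq_or_lt with h' | h'
    · rw [h']
      simp only [sub_self, one_ne_zero, zero_ne_one, if_true, if_false, mul_one, one_mul]
      simp only [zpow_neg, div_eq_mul_inv, mul_inv, inv_inv]
      ring
    · have a1 : (1 - α r ≠ 0) := by linarith
      have a2 : (1 - α r ≠ 1) := by linarith
      simp [h.ne', h'.ne, a1, a2]

lemma leadPart_half (hP : LimParams n N τ q t) (hα : Admissible α) (h0 : α 0 = -(1 / 2))
    (μ : Fin n → ℕ) {r : Fin 6} (hr : 2 ≤ r) :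
    let s := t ^ ((n : ℤ) - 1)
    let c := C0 oneSub q t μ
    let cN := C0 oneSub q t (rect n N)
    leadPart n N α τ q t μ r = mono q t μ (s * τ 0 * τ r) *
      ((if α r = -(1 / 2) then c (s * τ 0 * τ r) * cN (s * τ 1 * τ r) *
        (-(q * s * τ 0 / τ r)) ^ size μ * q ^ nStatConj μ * t ^ (-nStat μ) /
        c (q * s * τ 0 / τ r) else 1) *
      (if α r = 1 / 2 then c (s * τ 0 * τ r) * cN (q ^ (1 - (N : ℤ)) / (τ 1 * τ r)) /
        c (q * s * τ 0 / τ r) *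
        (-(s * τ 0 * τ r)) ^ (-size μ) * q ^ (-nStatConj μ) * t ^ nStat μ else 1)) := by
  have hb := hα.expBounds
  have b1 := hb.ge r hr
  have b2 := hb.le r hr
  have n0 := hP.ne 0
  have n1 := hP.ne 1
  have nr := hP.ne r
  have hs := zpow_ne_zero ((n : ℤ) - 1) hP.t_ne
  have hq := hP.q_ne
  have ht := hP.t_ne
  have up : t ^ ((n : ℤ) - 1) * τ 0 * τ r ≠ 0 := mul_ne_zero (mul_ne_zero hs n0) nr
  have up' : t ^ ((n : ℤ) - 1) * τ 1 * τ r ≠ 0 := mul_ne_zero (mul_ne_zero hs n1) nr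
  have dn : q * t ^ ((n : ℤ) - 1) * τ 0 / τ r ≠ 0 :=
    div_ne_zero (mul_ne_zero (mul_ne_zero hq hs) n0) nr
  have e1 : q ^ (1 - (N : ℤ)) * t ^ ((n : ℤ) - 1) / (t ^ ((n : ℤ) - 1) * τ 1 * τ r) =
      q ^ (1 - (N : ℤ)) / (τ 1 * τ r) := by
    rw [mul_assoc, mul_comm (q ^ _), mul_div_mul_left _ _ hs]
  simp only [leadPart]
  rw [h0] at b1 b2 ⊢
  rw [C0_leadFac_nonpos q t μ _ (by linarith) (by linarith),
    C0_rect_eval hq ht up' (by linarith) (by linarith),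
    C0_leadFac_nonneg hq ht μ dn (by linarith) (by linarith), e1, C0_neg hq ht _ up,
    C0_neg hq ht _ dn, mono]
  rcases b1.eq_or_lt with h | h
  · rw [← h]
    norm_num
    simp only [div_eq_mul_inv, mul_inv, inv_inv]
    ring
  · rcases b2.eq_or_lt with h' | h'
    · rw [h']
      norm_num
      have m1 := zpow_ne_zero (size μ) (neg_ne_zero.2 up)
      have m2 := zpow_ne_zero (nStatConj μ) hq
      have m3 := zpow_ne_zero (nStat μ) ht
      generalize (-(t ^ ((n : ℤ) - 1) * τ 0 * τ r)) ^ size μ = X1 at *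
      generalize q ^ nStatConj μ = X2 at *
      generalize t ^ nStat μ = X3 at *
      have : X1 * X2 * X3⁻¹ * (X1⁻¹ * X2⁻¹ * X3) = 1 := by field_simp
      rw [mul_comm]
      linear_combination (exp := 1) (-1 : ℂ) * (C0 oneSub q t μ (t ^ ((n : ℤ) - 1) * τ 0 * τ r) *
        C0 oneSub q t (rect n N) (q ^ (1 - (N : ℤ)) / (τ 1 * τ r)) /
          C0 oneSub q t μ (q * t ^ ((n : ℤ) - 1) * τ 0 / τ r)) * this
    · have a1 : (-(1 / 2) + α r ≠ -1) := by linarith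
      have a2 : (-(1 / 2) + α r ≠ 0) := by linarith
      have a3 : (-(1 / 2) + α r < 0) := by linarith
      have a4 : (1 + -(1 / 2) - α r ≠ 0) := by linarith
      have a5 : (1 + -(1 / 2) - α r ≠ 1) := by linarith
      have a6 : (α r - -(1 / 2) ≠ 0) := by linarith
      have a7 : (α r - -(1 / 2) ≠ 1) := by linarith
      have a8 : (α r ≠ 1 / 2) := by linarith
      rw [if_neg a1, if_neg a2, if_pos a3, if_neg a4, if_neg a5, if_neg a6, if_neg a7,
        if_neg h.ne', if_neg a8]
      simp

lemma leadPart_mid (hP : LimParams n N τ q t) (hα : Admissible α) (h0 : α 0 < 0)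
    (h0' : -(1 / 2) < α 0) (μ : Fin n → ℕ) {r : Fin 6} (hr : 2 ≤ r) :
    let s := t ^ ((n : ℤ) - 1)
    let c := C0 oneSub q t μ
    let cN := C0 oneSub q t (rect n N)
    leadPart n N α τ q t μ r =
      (if α r = α 0 then (q * s ^ 2 * τ 0 ^ 2) ^ size μ * q ^ (2 * nStatConj μ) *
        t ^ (-2 * nStat μ) / c (q * s * τ 0 / τ r) * cN (s * τ 1 * τ r) else 1) *
      (if α 0 < α r ∧ α r < -α 0 then
        (-(s * τ 0 * τ r)) ^ size μ * q ^ nStatConj μ * t ^ (-nStat μ) else 1) *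
      (if α r = -α 0 then c (s * τ 0 * τ r) else 1) *
      (if α r = 1 + α 0 then cN (q * s * τ 0 / τ r) / c (q * s * τ 0 / τ r) else 1) := by
  have hb := hα.expBounds
  have b1 := hb.ge r hr
  have b2 := hb.le r hr
  have n0 := hP.ne 0
  have n1 := hP.ne 1
  have nr := hP.ne r
  have hs := zpow_ne_zero ((n : ℤ) - 1) hP.t_ne
  have hq := hP.q_ne
  have ht := hP.t_ne
  have up : t ^ ((n : ℤ) - 1) * τ 0 * τ r ≠ 0 := mul_ne_zero (mul_ne_zero hs n0) nr
  have up' : t ^ ((n : ℤ) - 1) * τ 1 * τ r ≠ 0 := mul_ne_zero (mul_ne_zero hs n1) nr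
  have dn : q * t ^ ((n : ℤ) - 1) * τ 0 / τ r ≠ 0 :=
    div_ne_zero (mul_ne_zero (mul_ne_zero hq hs) n0) nr
  have e1 : q ^ (1 - (N : ℤ)) * t ^ ((n : ℤ) - 1) / (t ^ ((n : ℤ) - 1) * τ 1 * τ r) =
      q * t ^ ((n : ℤ) - 1) * τ 0 / τ r := by
    rw [sub_eq_add_neg, zpow_add₀ hq, zpow_one, ← hP.bal₁]
    generalize t ^ ((n : ℤ) - 1) = s at *
    field_simp
  simp only [leadPart]
  rw [C0_rect_eval hq ht up' (by linarith) (by linarith),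
    C0_leadFac_nonneg hq ht μ dn (by linarith) (by linarith), e1, C0_neg hq ht _ dn]
  rcases lt_trichotomy (α r) (-α 0) with h | h | h
  · rw [C0_leadFac_nonpos q t μ _ (by linarith) (by linarith), C0_neg hq ht _ up,
      if_neg (by linarith : α 0 + α r ≠ -1), if_neg (by linarith : α 0 + α r ≠ 0),
      if_pos (by linarith : α 0 + α r < 0), if_neg (by linarith : α r - α 0 ≠ 1),
      if_neg (by linarith : 1 + α 0 - α r ≠ 0), if_neg h.ne, if_neg (by linarith : α r ≠ 1 + α 0)]
    rcases b1.eq_or_lt with h' | h'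
    · rw [if_pos (by linarith), if_pos (by linarith), if_pos h'.symm, if_neg (by simp [h'])]
      have : (-(t ^ ((n : ℤ) - 1) * τ 0 * τ r)) ^ size μ *
          (-(q * t ^ ((n : ℤ) - 1) * τ 0 / τ r)) ^ size μ =
          (q * (t ^ ((n : ℤ) - 1)) ^ 2 * τ 0 ^ 2) ^ size μ := by
        rw [← mul_zpow]
        congr 1
        generalize t ^ ((n : ℤ) - 1) = s at *
        field_simp
      rw [← this, mul_comm 2, zpow_mul, show (-2 * nStat μ) = (nStat μ) * (-2) by ring, zpow_mul,
        zpow_neg]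
      simp only [div_eq_mul_inv, mul_inv, inv_inv, zpow_ofNat]
      ring
    · rw [if_neg (by linarith), if_neg (by linarith), if_neg h'.ne', if_pos ⟨h', h⟩, zpow_neg]
      simp
  · rw [C0_leadFac_nonneg hq ht μ up (by linarith) (by linarith),
      if_pos (by linarith : α 0 + α r = 0), if_neg (by linarith : α 0 + α r ≠ 1),
      if_neg (by linarith : α r - α 0 ≠ 1), if_neg (by linarith : α r - α 0 ≠ 0),
      if_neg (by linarith : 1 + α 0 - α r ≠ 0), if_neg (by linarith : 1 + α 0 - α r ≠ 1),
      if_pos h, if_neg (by linarith : α r ≠ 1 + α 0), if_neg (by linarith : α r ≠ α 0),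
      if_neg (show ¬(α 0 < α r ∧ α r < -α 0) from fun h' => by linarith [h'.2])]
    simp
  · rw [C0_leadFac_nonneg hq ht μ up (by linarith) (by linarith),
      if_neg (by linarith : α 0 + α r ≠ 0), if_neg (by linarith : α 0 + α r ≠ 1),
      if_neg (by linarith : α r - α 0 ≠ 0),
      if_neg (by linarith : 1 + α 0 - α r ≠ 1),
      if_neg h.ne', if_neg (by linarith : α r ≠ α 0),
      if_neg (show ¬(α 0 < α r ∧ α r < -α 0) from fun h' => by linarith [h'.2])]
    rcases b2.eq_or_lt with h' | h'
    · rw [if_pos (by linarith), if_pos (by linarith), if_pos (by linarith)]; simp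
    · rw [if_neg (by linarith), if_neg (by linarith), if_neg (by linarith)]; simp

end LimWeight

section LimWeight

variable {n N : ℕ} {α : Fin 6 → ℝ} {τ : ℂ⁶} {q t : ℂ}

lemma neg_one_zpow_sq (M : ℤ) : ((-1 : ℂ) ^ M) ^ 2 = 1 := by
  rw [← zpow_natCast, zpow_comm]; norm_num

lemma LimParams.tpow₂' (hP : LimParams n N τ q t) :
    t ^ ((n : ℤ) - 2) = t ^ ((n : ℤ) - 1) / t := by
  rw [show (n : ℤ) - 2 = n - 1 - 1 by ring, zpow_sub_one₀ hP.t_ne]; rfl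

lemma LimParams.tpow₃' (hP : LimParams n N τ q t) :
    t ^ (2 * (n : ℤ) - 3) = (t ^ ((n : ℤ) - 1)) ^ 2 / t := by
  rw [show 2 * (n : ℤ) - 3 = (n - 1) * 2 - 1 by ring, zpow_sub_one₀ hP.t_ne, zpow_mul]; rfl

variable {m : ℕ} {l : Fin m → ℕ} {x : ℂ}

lemma C0_leadFac_zero : C0 (leadFac 0) q t l x = C0 oneSub q t l x := boxProd_leadFac_zero

lemma Cm_leadFac_zero : Cm (leadFac 0) q t l x = Cm oneSub q t l x := boxProd_leadFac_zero

lemma Cp_leadFac_zero : Cp (leadFac 0) q t l x = Cp oneSub q t l x := boxProd_leadFac_zero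

lemma Cm_leadFac_one (hq : q ≠ 0) (ht : t ≠ 0) :
    Cm (leadFac 1) q t l q = Cm oneSub q t l q / Cm (fun y => -y) q t l q :=
  boxProd_leadFac_one hq ht hq

lemma leadBase_zero (hP : LimParams n N τ q t) (h0 : α 0 = 0) {μ : Fin n → ℕ}
    (hμ : Antitone μ) :
    let s := t ^ ((n : ℤ) - 1)
    let c := C0 oneSub q t μ
    let cN := C0 oneSub q t (rect n N)
    leadBase n N α τ q t μ =
      C0 oneSub q t (twiceSq μ) (q * s ^ 2 * τ 0 ^ 2) * (c (t ^ n) * c (q ^ (-(N : ℤ)))) *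
        (1 / (q * s ^ 4 * τ 0 ^ 3 * τ 1)) ^ size μ *
        q ^ (-2 * nStatConj μ) * t ^ (4 * nStat μ) /
      (c (q * t ^ ((n : ℤ) - 2) * τ 0 ^ 2) * c (q * s * τ 0 / τ 1) *
        (Cm oneSub q t μ q * Cm oneSub q t μ t) *
        (Cp oneSub q t μ (s ^ 2 * τ 0 ^ 2) *
          Cp oneSub q t μ (q * t ^ (2 * (n : ℤ) - 3) * τ 0 ^ 2)) *
        cN (τ 1 / τ 0)) := by
  have hq := hP.q_ne
  have ht := hP.t_ne
  have n0 := hP.ne 0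
  have n1 := hP.ne 1
  have hs := zpow_ne_zero ((n : ℤ) - 1) ht
  have x0 : q * (t ^ ((n : ℤ) - 1)) ^ 2 * τ 0 ^ 2 ≠ 0 := by positivity
  have x1 : q * t ^ ((n : ℤ) - 2) * τ 0 ^ 2 ≠ 0 :=
    mul_ne_zero (mul_ne_zero hq (zpow_ne_zero _ ht)) (pow_ne_zero _ n0)
  have x2 : q * t ^ ((n : ℤ) - 1) * τ 0 / τ 1 ≠ 0 :=
    div_ne_zero (mul_ne_zero (mul_ne_zero hq hs) n0) n1
  have x3 : q * t ^ (2 * (n : ℤ) - 3) * τ 0 ^ 2 ≠ 0 :=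
    mul_ne_zero (mul_ne_zero hq (zpow_ne_zero _ ht)) (pow_ne_zero _ n0)
  have e4 : Cp (leadFac 1) q t μ (q * t ^ (2 * (n : ℤ) - 3) * τ 0 ^ 2) =
      Cp oneSub q t μ (q * t ^ (2 * (n : ℤ) - 3) * τ 0 ^ 2) /
        Cp (fun y => -y) q t μ (q * t ^ (2 * (n : ℤ) - 3) * τ 0 ^ 2) :=
    boxProd_leadFac_one hq ht x3
  have e6 : ∀ {m : ℕ} (l : Fin m → ℕ) x, x ≠ 0 → C0 (leadFac 1) q t l x =
    C0 oneSub q t l x / C0 (fun y => -y) q t l x := fun _ _ hx => boxProd_leadFac_one hq ht hx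
  have mon : C0 (fun y => -y) q t μ (q * t ^ ((n : ℤ) - 2) * τ 0 ^ 2) *
      C0 (fun y => -y) q t μ (q * t ^ ((n : ℤ) - 1) * τ 0 / τ 1) *
      Cm (fun y => -y) q t μ q * Cp (fun y => -y) q t μ (q * t ^ (2 * (n : ℤ) - 3) * τ 0 ^ 2) /
      C0 (fun y => -y) q t (twiceSq μ) (q * (t ^ ((n : ℤ) - 1)) ^ 2 * τ 0 ^ 2) =
      (1 / (q * (t ^ ((n : ℤ) - 1)) ^ 4 * τ 0 ^ 3 * τ 1)) ^ size μ *
        q ^ (-2 * nStatConj μ) * t ^ (4 * nStat μ) := by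
    rw [C0_neg hq ht _ x1, C0_neg hq ht _ x2, Cm_neg hq ht hμ hq, Cp_neg hq ht hμ x3,
      C0_neg_twiceSq hq ht _ x0, hP.tpow₂', hP.tpow₃', show -2 * nStatConj μ = nStatConj μ * (-2) by
      ring, mul_comm 4, zpow_mul q, zpow_mul t, zpow_neg (q ^ nStatConj μ)]
    have hsg := neg_one_zpow_sq (size μ)
    simp only [zpow_ofNat, neg_eq_neg_one_mul (_ * _), neg_eq_neg_one_mul (_ / _),
      neg_eq_neg_one_mul q, mul_zpow, div_zpow, one_zpow, ← zpow_natCast (_ : ℂ) 2,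
      ← zpow_natCast (_ : ℂ) 3, ← zpow_natCast (_ : ℂ) 4, zpow_comm (_ : ℂ) _ (size μ)]
    simp only [zpow_natCast]
    have m1 := zpow_ne_zero (size μ) hq
    have m2 := zpow_ne_zero (nStatConj μ) hq
    have m3 := zpow_ne_zero (nStat μ) ht
    have m4 := zpow_ne_zero (size μ) hs
    have m5 := zpow_ne_zero (size μ) ht
    have m6 := zpow_ne_zero (size μ) n0
    have m7 := zpow_ne_zero (size μ) n1
    generalize nStatConj μ = a at *
    generalize nStat μ = b at *
    generalize size μ = M at *
    generalize t ^ ((n : ℤ) - 1) = s at *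
    field_simp
    linear_combination (((-1 : ℂ) ^ M) ^ 2 + 1) * hsg
  simp only [leadBase]
  rw [h0]
  norm_num only [mul_zero, add_zero]
  simp only [Cm_leadFac_one hq ht, Cm_leadFac_zero, Cp_leadFac_zero, e4, C0_leadFac_zero, e6 _ _ x0,
    e6 _ _ x1, e6 _ _ x2]
  rw [mul_assoc _ _ (t ^ (4 * nStat μ)), mul_assoc _ (_ ^ size μ), ← mul_assoc (_ ^ size μ), ← mon]
  simp only [div_eq_mul_inv, mul_inv, inv_inv]
  ring

lemma leadBase_mid (hP : LimParams n N τ q t) (h0 : α 0 < 0) (h0' : -(1 / 2) < α 0)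
    {μ : Fin n → ℕ} (hμ : Antitone μ) :
    let s := t ^ ((n : ℤ) - 1)
    let c := C0 oneSub q t μ
    leadBase n N α τ q t μ =
      c (t ^ n) * c (q ^ (-(N : ℤ))) * (τ 0 ^ 2 * s ^ 2) ^ (-size μ) *
        q ^ (-2 * nStatConj μ) * t ^ (4 * nStat μ) /
      (Cm oneSub q t μ q * Cm oneSub q t μ t) := by
  have hq := hP.q_ne
  have ht := hP.t_ne
  have n0 := hP.ne 0
  have hs := zpow_ne_zero ((n : ℤ) - 1) ht
  have x1 : (t ^ ((n : ℤ) - 1)) ^ 2 * τ 0 ^ 2 ≠ 0 := by positivity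
  have e3 : ∀ x, Cp (leadFac (2 * α 0)) q t μ x = Cp (fun y => -y) q t μ x := fun x =>
    boxProd_leadFac_neg (by linarith) (by linarith)
  have e4 : ∀ x, Cp (leadFac (1 + 2 * α 0)) q t μ x = 1 := fun x =>
    boxProd_leadFac_pos (by linarith) (by linarith)
  have e6 : ∀ {m : ℕ} (l : Fin m → ℕ) x, C0 (leadFac (1 + 2 * α 0)) q t l x = 1 := fun _ _ =>
    boxProd_leadFac_pos (by linarith) (by linarith)
  have e7 : ∀ x, C0 (leadFac (-2 * α 0)) q t (rect n N) x = 1 := fun _ =>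
    boxProd_leadFac_pos (by linarith) (by linarith)
  have mon : Cm (fun y => -y) q t μ q / Cp (fun y => -y) q t μ ((t ^ ((n : ℤ) - 1)) ^ 2 * τ 0 ^ 2) =
      (τ 0 ^ 2 * (t ^ ((n : ℤ) - 1)) ^ 2) ^ (-size μ) * q ^ (-2 * nStatConj μ) *
        t ^ (4 * nStat μ) := by
    rw [Cm_neg hq ht hμ hq, Cp_neg hq ht hμ x1, show -2 * nStatConj μ = nStatConj μ * (-2) by
      ring, mul_comm 4, zpow_mul q, zpow_mul t, zpow_neg, zpow_neg,
      neg_eq_neg_one_mul q, neg_eq_neg_one_mul (_ * _), mul_zpow (-1), mul_zpow (-1),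
      mul_comm (τ 0 ^ 2)]
    have m0 : ((-1 : ℂ)) ^ size μ ≠ 0 := zpow_ne_zero _ (by norm_num)
    have m1 := zpow_ne_zero (size μ) hq
    have m2 := zpow_ne_zero (nStatConj μ) hq
    have m3 := zpow_ne_zero (nStat μ) ht
    have m4 := zpow_ne_zero (size μ) x1
    simp only [zpow_ofNat]
    generalize nStatConj μ = a at *
    generalize nStat μ = b at *
    generalize size μ = M at *
    generalize (t ^ ((n : ℤ) - 1)) ^ 2 * τ 0 ^ 2 = y at *
    field_simp
  simp only [leadBase]
  simp only [Cm_leadFac_one hq ht, Cm_leadFac_zero, e3, e4, C0_leadFac_zero, e6, e7]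
  rw [mul_assoc _ _ (t ^ (4 * nStat μ)),
    mul_assoc _ (_ ^ (-size μ)), ← mul_assoc (_ ^ (-size μ)), ← mon]
  simp only [div_eq_mul_inv, mul_inv, inv_inv, inv_one]
  ring

lemma leadBase_half (hP : LimParams n N τ q t) (h0 : α 0 = -(1 / 2)) {μ : Fin n → ℕ}
    (hμ : Antitone μ) :
    let s := t ^ ((n : ℤ) - 1)
    let c := C0 oneSub q t μ
    let cN := C0 oneSub q t (rect n N)
    leadBase n N α τ q t μ * ∏ r ∈ Ici (2 : Fin 6), mono q t μ (s * τ 0 * τ r) =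
      C0 oneSub q t (twiceSq μ) (q * s ^ 2 * τ 0 ^ 2) * (c (t ^ n) * c (q ^ (-(N : ℤ)))) *
        (q * τ 0 / τ 1) ^ size μ * q ^ (2 * nStatConj μ) /
      (c (q * t ^ ((n : ℤ) - 2) * τ 0 ^ 2) * c (q * s * τ 0 / τ 1) *
        (Cm oneSub q t μ q * Cm oneSub q t μ t) *
        (Cp oneSub q t μ (s ^ 2 * τ 0 ^ 2) *
          Cp oneSub q t μ (q * t ^ (2 * (n : ℤ) - 3) * τ 0 ^ 2)) *
        cN (q ^ (1 - (N : ℤ)) * s * τ 0 / τ 1)) := by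
  have hq := hP.q_ne
  have ht := hP.t_ne
  have n0 := hP.ne 0
  have n1 := hP.ne 1
  have hs := zpow_ne_zero ((n : ℤ) - 1) ht
  have x1 : (t ^ ((n : ℤ) - 1)) ^ 2 * τ 0 ^ 2 ≠ 0 := by positivity
  have e4 : ∀ x, Cp (leadFac (-1)) q t μ x = Cp (fun y => -y) q t μ x * Cp oneSub q t μ x :=
    fun x => boxProd_leadFac_neg_one
  have e6 : C0 (leadFac 1) q t (rect n N) (τ 1 / τ 0) =
      C0 oneSub q t (rect n N) (q ^ (1 - (N : ℤ)) * t ^ ((n : ℤ) - 1) * τ 0 / τ 1) := by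
    rw [C0_rect_leadFac hq ht _ zero_le_one le_rfl, sub_self, C0_leadFac_zero, div_div_eq_mul_div]
  have mon : Cm (fun y => -y) q t μ q / Cp (fun y => -y) q t μ ((t ^ ((n : ℤ) - 1)) ^ 2 * τ 0 ^ 2) *
      (mono q t μ (t ^ ((n : ℤ) - 1) * τ 0 * τ 2) * mono q t μ (t ^ ((n : ℤ) - 1) * τ 0 * τ 3) *
        mono q t μ (t ^ ((n : ℤ) - 1) * τ 0 * τ 4) * mono q t μ (t ^ ((n : ℤ) - 1) * τ 0 * τ 5)) =
      (q * τ 0 / τ 1) ^ size μ * q ^ (2 * nStatConj μ) := by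
    rw [Cm_neg hq ht hμ hq, Cp_neg hq ht hμ x1, mul_comm 2, zpow_mul q,
      neg_eq_neg_one_mul q, neg_eq_neg_one_mul (_ * _), mul_zpow (-1), mul_zpow (-1)]
    have hprod : (-(t ^ ((n : ℤ) - 1) * τ 0 * τ 2)) ^ size μ *
        (-(t ^ ((n : ℤ) - 1) * τ 0 * τ 3)) ^ size μ *
        (-(t ^ ((n : ℤ) - 1) * τ 0 * τ 4)) ^ size μ *
        (-(t ^ ((n : ℤ) - 1) * τ 0 * τ 5)) ^ size μ =
        (q * τ 0 / τ 1) ^ size μ * ((t ^ ((n : ℤ) - 1)) ^ 2 * τ 0 ^ 2) ^ size μ := by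
      simp only [← mul_zpow]
      congr 1
      have b1 := hP.bal₁
      have b2 := hP.bal₂
      have b3 : q ^ (-(N : ℤ)) * q ^ ((N : ℤ) + 1) = q := by
        rw [← zpow_add₀ hq]; ring_nf; exact zpow_one q
      rw [← b1, ← b2] at b3
      generalize t ^ ((n : ℤ) - 1) = s at *
      rw [eq_comm, div_mul_eq_mul_div, div_eq_iff n1]
      linear_combination (-(s ^ 2 * τ 0 ^ 3)) * b3
    simp only [mono]
    have m0 : ((-1 : ℂ)) ^ size μ ≠ 0 := zpow_ne_zero _ (by norm_num)
    have m1 := zpow_ne_zero (size μ) hq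
    have m2 := zpow_ne_zero (nStatConj μ) hq
    have m3 := zpow_ne_zero (nStat μ) ht
    have m4 := zpow_ne_zero (size μ) x1
    simp only [zpow_ofNat]
    generalize (-(t ^ ((n : ℤ) - 1) * τ 0 * τ 2)) ^ size μ = y2 at *
    generalize (-(t ^ ((n : ℤ) - 1) * τ 0 * τ 3)) ^ size μ = y3 at *
    generalize (-(t ^ ((n : ℤ) - 1) * τ 0 * τ 4)) ^ size μ = y4 at *
    generalize (-(t ^ ((n : ℤ) - 1) * τ 0 * τ 5)) ^ size μ = y5 at *
    generalize (q * τ 0 / τ 1) ^ size μ = y6 at *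
    generalize nStatConj μ = a at *
    generalize nStat μ = b at *
    generalize size μ = M at *
    generalize (t ^ ((n : ℤ) - 1)) ^ 2 * τ 0 ^ 2 = y at *
    field_simp
    linear_combination hprod
  simp only [leadBase]
  rw [prod_Ici_two, h0]
  norm_num only [mul_zero, add_zero]
  simp only [Cm_leadFac_one hq ht, Cm_leadFac_zero, Cp_leadFac_zero, e4, C0_leadFac_zero, e6]
  rw [mul_assoc _ _ (q ^ (2 * nStatConj μ)), ← mon]
  simp only [div_eq_mul_inv, mul_inv, inv_inv]
  ring

/-- The product of the leading coefficients of all theta functions is the limiting weight. -/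
lemma leadWeight_eq_limWeight (hP : LimParams n N τ q t) (hα : Admissible α) {μ : Fin n → ℕ}
    (hμ : Antitone μ) : leadWeight n N α τ q t μ = limWeight n N α τ q t μ := by
  rw [leadWeight_eq hP hα, limWeight]
  split_ifs with h1 h2
  · rw [prod_congr rfl fun r hr => leadPart_zero hP hα h1 μ (mem_Ici.1 hr),
      leadBase_zero hP h1 hμ, limWeightZero, prod_mul_distrib]
    simp only [prod_filter, mul_assoc]
  · have h0 : α 0 < 0 := lt_of_le_of_ne hα.upper h1
    rw [prod_congr rfl fun r hr => leadPart_mid hP hα h0 h2 μ (mem_Ici.1 hr),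
      leadBase_mid hP h0 h2 hμ, limWeightMid, prod_mul_distrib, prod_mul_distrib,
      prod_mul_distrib]
    simp only [prod_filter, mul_assoc]
  · have h0 : α 0 = -(1 / 2) := le_antisymm (not_lt.1 h2) hα.lower
    rw [prod_congr rfl fun r hr => leadPart_half hP hα h0 μ (mem_Ici.1 hr),
      prod_mul_distrib, ← mul_assoc, leadBase_half hP h0 hμ, limWeightHalf,
      prod_mul_distrib]
    simp only [prod_filter, mul_assoc]

end LimWeight

/-! ### Denominators supported on a given hypersurface -/

section Denominators

variable {σ : Type}

/-- The Nullstellensatz for a prime polynomial. -/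
lemma prime_dvd_of_zeros [Finite σ] {π Q : ℂ[σ]} (hπ : Prime π)
    (h : ∀ y, eval y π = 0 → eval y Q = 0) : π ∣ Q := by
  have hP : (Ideal.span {π}).IsPrime := (Ideal.span_singleton_prime hπ.ne_zero).2 hπ
  rw [← Ideal.mem_span_singleton,
    ← IsPrime.vanishingIdeal_zeroLocus (K := ℂ) (Ideal.span {π}),
    mem_vanishingIdeal_iff]
  intro y hy
  have := h y (by simpa using hy π (Ideal.mem_span_singleton_self π))
  simpa using this

lemma totalDegree_pos_of_prime {π : ℂ[σ]} (hπ : Prime π) : 1 ≤ π.totalDegree := by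
  by_contra h
  have h0 : π.totalDegree = 0 := by omega
  rw [totalDegree_eq_zero_iff_eq_C] at h0
  refine hπ.not_isUnit ?_
  rw [h0]
  refine (IsUnit.mk0 (π.coeff 0) fun h1 => hπ.ne_zero ?_).map C
  rw [h0, h1, map_zero]

lemma dvd_pow_totalDegree {D T : ℂ[σ]} (hD : D ≠ 0)
    (h : ∀ π, Prime π → π ∣ D → π ∣ T) : D ∣ T ^ D.totalDegree := by
  induction D using UniqueFactorizationMonoid.induction_on_prime with
  | h₁ => exact absurd rfl hD
  | h₂ u hu => exact hu.dvd
  | h₃ a π ha hπ ih =>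
    rw [totalDegree_mul_of_isDomain hπ.ne_zero ha, pow_add]
    refine mul_dvd_mul ?_ (ih ha fun ρ hρ hd => h ρ hρ (hd.mul_left π))
    exact dvd_pow (h π hπ (dvd_mul_right π a)) (by have := totalDegree_pos_of_prime hπ; omega)

/-- If numerators vanish where denominators do, outside of the zeros of `T`, then powers of `T`
serve as denominators. -/
lemma LinearGrowth.of_zeros [Finite σ] {ι : Type} {A : ι → Rat σ} {w : ι → ℝ} {P T : ℂ[σ]}
    (hP : P ≠ 0) (h : LinearGrowth P A w)
    (hz : ∀ i, ∀ y ∈ goodSet T, ¬RegAt (A i) y →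
      eval y (IsFractionRing.num (ℂ[σ]) (A i)) = 0)
    (hT : ∀ y, eval y T ≠ 0 → ∀ i, y i ≠ 0) :
    LinearGrowth T A w := by
  obtain ⟨c, hc0, hc⟩ := h.nonneg
  refine ⟨c * (1 + P.totalDegree + P.totalDegree * T.totalDegree), fun i => ?_⟩
  obtain ⟨N, m, h1, h2, h3⟩ := hc i
  have hw : 0 ≤ c * (1 + |w i|) := by positivity
  set D : ℂ[σ] := (IsFractionRing.den (ℂ[σ]) (A i) : ℂ[σ]) with hDdef
  set U := IsFractionRing.num (ℂ[σ]) (A i) with hU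
  have hD0 : D ≠ 0 := nonZeroDivisors.coe_ne_zero _
  have hDP : D ∣ P ^ m := den_dvd h3
  have hdeg : D.totalDegree ≤ m * P.totalDegree :=
    (totalDegree_le_of_dvd_of_isDomain hDP (pow_ne_zero _ hP)).trans
      (totalDegree_pow _ _)
  have hUdeg : U.totalDegree ≤ N.totalDegree := by
    obtain ⟨E, hE⟩ := hDP
    have h4 := num_mul_eq h3
    rw [hE, ← hDdef, mul_comm N, mul_left_comm] at h4
    have h5 : U * E = N := mul_left_cancel₀ hD0 h4
    rcases eq_or_ne N 0 with h0 | h0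
    · have hE0 : E ≠ 0 := by
        rintro rfl
        rw [mul_zero] at hE
        exact pow_ne_zero _ hP hE
      have : U = 0 := by
        rw [h0] at h5
        exact (mul_eq_zero.1 h5).resolve_right hE0
      rw [this]; simp
    · exact totalDegree_le_of_dvd_of_isDomain ⟨E, h5.symm⟩ h0
  have hDT : D ∣ T ^ D.totalDegree := by
    refine dvd_pow_totalDegree hD0 fun π hπ hd => ?_
    have h6 : π ∣ U * T := prime_dvd_of_zeros hπ fun y hy => by
      rw [map_mul]
      by_cases hTy : eval y T = 0
      · rw [hTy, mul_zero]
      · rw [hz i y ⟨hT y hTy, hTy⟩, zero_mul]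
        intro hreg
        obtain ⟨E, hE⟩ := hd
        refine hreg ?_
        rw [← hDdef, hE, map_mul, hy, zero_mul]
    refine (hπ.dvd_or_dvd h6).resolve_left fun hU' => hπ.not_isUnit ?_
    exact (IsFractionRing.num_den_reduced (ℂ[σ]) (A i)) hU' hd
  obtain ⟨E, hE⟩ := hDT.trans (pow_dvd_pow T hdeg)
  have hdT : ((U * E).totalDegree : ℝ) ≤
      N.totalDegree + m * P.totalDegree * T.totalDegree := by
    have h7 : E.totalDegree ≤ m * P.totalDegree * T.totalDegree := by
      rcases eq_or_ne T 0 with h0 | h0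
      · rcases Nat.eq_zero_or_pos (m * P.totalDegree) with h8 | h8
        · rw [h8, pow_zero] at hE
          have := totalDegree_le_of_dvd_of_isDomain
            (⟨D, by rw [hE, mul_comm]⟩ : E ∣ 1) one_ne_zero
          rw [totalDegree_one] at this
          omega
        · rw [h0, zero_pow h8.ne'] at hE
          have : E = 0 := (mul_eq_zero.1 hE.symm).resolve_left hD0
          rw [this]; simp
      · exact (totalDegree_le_of_dvd_of_isDomain ⟨D, by rw [hE, mul_comm]⟩
          (pow_ne_zero _ h0)).trans (totalDegree_pow _ _)
    have := totalDegree_mul U E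
    exact_mod_cast this.trans (add_le_add hUdeg h7)
  have hP0 : (0 : ℝ) ≤ P.totalDegree := Nat.cast_nonneg _
  have hT0 : (0 : ℝ) ≤ T.totalDegree := Nat.cast_nonneg _
  have a1 := mul_le_mul_of_nonneg_right h1 hP0
  have a2 := mul_le_mul_of_nonneg_right a1 hT0
  have a3 : 0 ≤ c * (1 + |w i|) * P.totalDegree := by positivity
  have a4 : 0 ≤ c * (1 + |w i|) * P.totalDegree * T.totalDegree := by positivity
  refine ⟨U * E, m * P.totalDegree, ?_, ?_, ?_⟩
  · push_cast
    nlinarith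
  · nlinarith
  · rw [hE, map_mul, ← mul_assoc, mul_den_eq_num, map_mul]

end Denominators

/-! ### Uniqueness of coefficients -/

/-- The smallest exponent with a nonzero coefficient would dominate the series. -/
lemma coeff_eq_zero {ι : Type} {w : ι → ℝ} (hw : ∀ B : ℝ, {i | w i ≤ B}.Finite)
    (hinj : Function.Injective w) {c : ι → ℂ} {b : ι → ℝ} (hb : ∀ i, ‖c i‖ ≤ b i) {ε : ℝ}
    (hε : 0 < ε) (hs : Summable fun i => b i * ε ^ w i)
    (h : ∀ p : ℂ, 0 < ‖p‖ → ‖p‖ < ε → HasSum (fun i => c i * ppow p (w i)) 0) (i : ι) :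
    c i = 0 := by
  by_contra hi
  -- the smallest exponent with a nonzero coefficient
  obtain ⟨j, hj, hmin⟩ := ((hw (w i)).inter_of_left {i | c i ≠ 0}).toFinset.exists_min_image w
    ⟨i, by simp [hi]⟩
  rw [Set.Finite.mem_toFinset] at hj
  have hmin' : ∀ k, c k ≠ 0 → w j ≤ w k := fun k hk => by
    rcases le_or_gt (w k) (w i) with h1 | h1
    · exact hmin k (by rw [Set.Finite.mem_toFinset]; exact ⟨h1, hk⟩)
    · exact (show w j ≤ w i from hj.1).trans h1.le
  let A : {k // c k ≠ 0} → Rat (Fin 0) := fun k =>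
    algebraMap (MvPolynomial (Fin 0) ℂ) (Rat (Fin 0)) (C (c k))
  have hA : ∀ k x, ratEval (A k) x = c k := fun k x => by
    rw [(ratEval_algebraMap _ x).2, eval_C]
  have hG : GExp (fun _ _ => 0) A fun k => w k := by
    refine ⟨fun B => (hw B).preimage Subtype.val_injective.injOn, 1, one_ne_zero,
      ⟨0, fun k => ⟨C (c k), 0, by simp, by simp, by simp [A]⟩⟩, fun K _ _ =>
      ⟨ε, hε, fun k => b k, fun k x _ => by rw [hA]; exact hb k,
        hs.comp_injective Subtype.val_injective, fun x _ p hp hpε => ?_⟩⟩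
    simp only [hA]
    have := h p hp hpε
    rw [← Function.Injective.hasSum_iff (Subtype.val_injective (p := fun k => c k ≠ 0))] at this
    · exact this
    · intro k hk
      have : c k = 0 := by
        by_contra h0
        exact hk ⟨⟨k, h0⟩, rfl⟩
      rw [this, zero_mul]
  have hL : Lead (fun (_ : Fin 0 → ℂ) _ => 0) (w j) fun _ => c j := by
    refine ⟨_, _, _, hG, fun k => hmin' k k.2, 1, one_ne_zero, fun x _ => ?_⟩
    have : (hG.finite_le (w j)).toFinset = {⟨j, hj.2⟩} := by
      ext k
      simp only [Set.Finite.mem_toFinset, Set.mem_ofPred_eq, mem_singleton]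
      refine ⟨fun h1 => Subtype.ext (hinj (le_antisymm h1 (hmin' k k.2))), fun h1 => by rw [h1]⟩
    rw [this, sum_singleton, hA]
  obtain ⟨R, hR, hlim⟩ := hL.tendsto
  have hRx : eval (Fin.elim0 : Fin 0 → ℂ) R ≠ 0 := fun h0 => hR <|
    funext fun x => by rw [Subsingleton.elim x Fin.elim0, h0, map_zero]
  have := (hlim {Fin.elim0} isCompact_singleton (by
    rintro x rfl; exact ⟨fun i => i.elim0, hRx⟩)).tendsto_at (Set.mem_singleton _)
  simp only [mul_zero] at this
  exact hj.2 (tendsto_nhds_unique this tendsto_const_nhds)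

/-! ### Expansions of functions that are holomorphic along lines -/

lemma hasSum_circleIntegral {ι : Type*} [Countable ι] {ρ : ℝ} (hρ : 0 ≤ ρ) {g : ι → ℂ → ℂ}
    {G : ℂ → ℂ} {b : ι → ℝ} (hg : ∀ i, ContinuousOn (g i) (sphere 0 ρ))
    (hb : ∀ i, ∀ z ∈ sphere (0 : ℂ) ρ, ‖g i z‖ ≤ b i) (hs : Summable b)
    (h : ∀ z ∈ sphere (0 : ℂ) ρ, HasSum (fun i => g i z) (G z)) :
    HasSum (fun i => ∮ z in C(0, ρ), g i z) (∮ z in C(0, ρ), G z) := by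
  have hm : ∀ θ : ℝ, circleMap 0 ρ θ ∈ sphere (0 : ℂ) ρ := circleMap_mem_sphere 0 hρ
  simp only [circleIntegral]
  refine intervalIntegral.hasSum_integral_of_dominated_convergence (fun i _ => ρ * b i)
    (fun i => ?_) (fun i => Eventually.of_forall fun θ _ => ?_)
    (Eventually.of_forall fun θ _ => hs.mul_left ρ) (by simp) (Eventually.of_forall fun θ _ => ?_)
  · have hc : Continuous fun θ => g i (circleMap 0 ρ θ) :=
      (hg i).comp_continuous (continuous_circleMap 0 ρ) hm
    have : Continuous fun θ => deriv (circleMap 0 ρ) θ • g i (circleMap 0 ρ θ) := by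
      simp only [deriv_circleMap, smul_eq_mul]
      exact ((continuous_circleMap 0 ρ).mul continuous_const).mul hc
    exact this.aestronglyMeasurable
  · rw [norm_smul]
    refine mul_le_mul (by simp [abs_of_nonneg hρ]) (hb i _ (hm θ)) (norm_nonneg _) hρ
  · exact (h _ (hm θ)).const_smul (deriv (circleMap 0 ρ) θ)

lemma countable_of_finite_le {ι : Type*} {w : ι → ℝ} (hw : ∀ B : ℝ, {i | w i ≤ B}.Finite) :
    Countable ι := by
  have : (Set.univ : Set ι) = ⋃ k : ℕ, {i | w i ≤ k} := by
    refine (Set.eq_univ_of_forall fun i => ?_).symm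
    obtain ⟨k, hk⟩ := exists_nat_ge (w i)
    exact Set.mem_iUnion.2 ⟨k, hk⟩
  rw [← Set.countable_univ_iff, this]
  exact Set.countable_iUnion fun k => (hw k).countable

section Lines

variable {σ : Type}

/-- The restriction of a polynomial to a line. -/
def linePoly (Q : ℂ[σ]) (y v : σ → ℂ) : Polynomial ℂ :=
  aeval (fun i => Polynomial.C (y i) + Polynomial.C (v i) * Polynomial.X) Q

lemma eval_linePoly (Q : ℂ[σ]) (y v : σ → ℂ) (z : ℂ) :
    (linePoly Q y v).eval z = eval (y + z • v) Q := by
  have h : (fun i => Polynomial.aeval z (Polynomial.C (y i) + Polynomial.C (v i) * Polynomial.X)) =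
      y + z • v := by
    funext i
    simp [mul_comm (v i)]
  rw [linePoly, ← Polynomial.coe_aeval_eq_eval, comp_aeval_apply, h]
  rfl

lemma differentiableAt_ratEval_line {a : Rat σ} {y v : σ → ℂ} {z : ℂ}
    (h : RegAt a (y + z • v)) : DifferentiableAt ℂ (fun z : ℂ => ratEval a (y + z • v)) z := by
  simp only [ratEval, ← eval_linePoly]
  refine (Polynomial.differentiable _).differentiableAt.div
    (Polynomial.differentiable _).differentiableAt ?_
  rw [eval_linePoly]
  exact h

variable {ι : Type} {F : (σ → ℂ) → ℂ → ℂ} {A : ι → Rat σ} {w : ι → ℝ}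
  {P T : ℂ[σ]}

lemma NormalConv.union {K L : Set (σ → ℂ)} (hw : ∀ B : ℝ, {i | w i ≤ B}.Finite)
    (hK : NormalConv F A w K) (hL : NormalConv F A w L) : NormalConv F A w (K ∪ L) := by
  obtain ⟨ε, hε, b, hb, h1, h2, h3⟩ := hK.shrink hw
  obtain ⟨ε', hε', b', hb', h1', h2', h3'⟩ := hL.shrink hw
  refine ⟨min ε ε', by positivity, fun i => b i + b' i, fun i x hx => ?_, ?_, fun x hx p hp hpε => ?_⟩
  · rcases hx with hx | hx
    · exact (h1 i x hx).trans (by linarith [hb' i])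
    · exact (h1' i x hx).trans (by linarith [hb i])
  · refine ((h2 (min ε ε') (by positivity) (min_le_left _ _)).add
      (h2' (min ε ε') (by positivity) (min_le_right _ _))).congr fun i => by ring
  · rcases hx with hx | hx
    · exact h3 x hx p hp (hpε.trans_le (min_le_left _ _))
    · exact h3' x hx p hp (hpε.trans_le (min_le_right _ _))

variable [Finite σ]

lemma isOpen_goodSet (P : ℂ[σ]) : IsOpen (goodSet P) := by
  have : goodSet P = (⋂ i, {x : σ → ℂ | x i ≠ 0}) ∩ {x | eval x P ≠ 0} := by
    ext; simp [goodSet]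
  rw [this]
  exact (isOpen_iInter_of_finite fun i =>
    isOpen_ne_fun (continuous_apply i) continuous_const).inter (isOpen_eval_ne_zero P)

/-- Through each point outside the zeros of `T` there is a line that is not contained in the zeros
of `P` and along which `F` is holomorphic, locally uniformly for small `p`. -/
def HoloLines (F : (σ → ℂ) → ℂ → ℂ) (P T : ℂ[σ]) : Prop :=
  ∀ y₀ ∈ goodSet T, ∃ v : σ → ℂ, eval (y₀ + v) P ≠ 0 ∧
    ∃ ρ₀ : ℝ, 0 < ρ₀ ∧ ∃ ε₀ : ℝ, 0 < ε₀ ∧ ∃ U ∈ 𝓝 y₀, ∀ p : ℂ, 0 < ‖p‖ → ‖p‖ < ε₀ → ∀ y ∈ U,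
      ∀ z : ℂ, ‖z‖ < ρ₀ → DifferentiableAt ℂ (fun z : ℂ => F (y + z • v) p) z

/-- A circle around a point of the line avoiding the zeros of `P`. -/
lemma exists_circle {y₀ v : σ → ℂ} (hy : y₀ ∈ goodSet T)
    (hv : eval (y₀ + v) P ≠ 0) {ρ₀ : ℝ} (hρ₀ : 0 < ρ₀) :
    ∃ ρ : ℝ, 0 < ρ ∧ ρ < ρ₀ ∧ (∀ z : ℂ, ‖z‖ ≤ ρ → y₀ + z • v ∈ goodSet T) ∧
      ∀ z : ℂ, z ≠ 0 → ‖z‖ ≤ ρ → y₀ + z • v ∈ goodSet P := by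
  have hc : Continuous fun z : ℂ => y₀ + z • v := by fun_prop
  have h1 : ∀ᶠ z : ℂ in 𝓝 0, y₀ + z • v ∈ goodSet T := by
    refine hc.continuousAt.eventually_mem ((isOpen_goodSet T).mem_nhds ?_)
    simpa using hy
  have h2 : ∀ᶠ z : ℂ in 𝓝 0, z ≠ 0 → eval (y₀ + z • v) P ≠ 0 := by
    suffices h : ∀ᶠ z : ℂ in 𝓝[≠] 0, eval (y₀ + z • v) P ≠ 0 from
      eventually_nhdsWithin_iff.1 h
    have hL : linePoly P y₀ v ≠ 0 := fun h0 => hv <| by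
      rw [← one_smul ℂ v, ← eval_linePoly, h0, Polynomial.eval_zero]
    have hfin := Polynomial.finite_setOfPred_isRoot hL
    have : ∀ᶠ z : ℂ in 𝓝[≠] 0, z ∉ {z | (linePoly P y₀ v).IsRoot z} \ {0} := by
      refine nhdsWithin_le_nhds ((hfin.subset Set.sdiff_subset).isClosed.isOpen_compl.mem_nhds ?_)
      simp
    filter_upwards [this, self_mem_nhdsWithin] with z hz hz0 h0
    exact hz ⟨by rw [Set.mem_ofPred_eq, Polynomial.IsRoot, eval_linePoly, h0], hz0⟩
  obtain ⟨r, hr, hB⟩ := eventually_nhds_iff_ball.1 (h1.and h2)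
  refine ⟨min (r / 2) (ρ₀ / 2), by positivity, (min_le_right _ _).trans_lt (by linarith),
    fun z hz => (hB z ?_).1, fun z hz0 hz => ⟨(hB z ?_).1.1, (hB z ?_).2 hz0⟩⟩ <;>
  · rw [mem_ball_zero_iff]
    exact (hz.trans (min_le_left _ _)).trans_lt (by linarith)

/-- Where the denominator of a coefficient vanishes, so does the numerator: otherwise a Cauchy
integral over a small circle of a line through the point would not vanish. -/
lemma num_eq_zero (hw : ∀ B : ℝ, {i | w i ≤ B}.Finite) (hinj : Function.Injective w)
    (hg : LinearGrowth P A w)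
    (hc : ∀ K : Set (σ → ℂ), IsCompact K → K ⊆ goodSet P → NormalConv F A w K)
    (hL : HoloLines F P T) (i : ι) {y₀ : σ → ℂ} (hy : y₀ ∈ goodSet T) (hreg : ¬RegAt (A i) y₀) :
    eval y₀ (IsFractionRing.num (ℂ[σ]) (A i)) = 0 := by
  have : Countable ι := countable_of_finite_le hw
  obtain ⟨v, hv, ρ₀, hρ₀, ε₀, hε₀, U, hU, hd⟩ := hL y₀ hy
  obtain ⟨ρ, hρ, hρρ, -, hgood⟩ := exists_circle hy hv hρ₀
  have hsph : ∀ z ∈ sphere (0 : ℂ) ρ, y₀ + z • v ∈ goodSet P := fun z hz => by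
    rw [mem_sphere_zero_iff_norm] at hz
    exact hgood z (norm_pos_iff.1 (by rw [hz]; exact hρ)) hz.le
  obtain ⟨ε, hε, b, hb, h1, h2, h3⟩ := (hc ((fun z : ℂ => y₀ + z • v) '' sphere 0 ρ)
    ((isCompact_sphere 0 ρ).image (by fun_prop)) (by rintro _ ⟨z, hz, rfl⟩; exact hsph z hz)).shrink
    hw
  have hcont : ∀ j, ContinuousOn (fun z : ℂ => ratEval (A j) (y₀ + z • v)) (sphere 0 ρ) :=
    fun j z hz => (differentiableAt_ratEval_line
      (hg.regAt j (hsph z hz))).continuousAt.continuousWithinAt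
  have hint : ∀ k : ℕ, ∮ z in C(0, ρ), z ^ k * ratEval (A i) (y₀ + z • v) = 0 := by
    intro k
    refine coeff_eq_zero hw hinj (c := fun j => ∮ z in C(0, ρ), z ^ k * ratEval (A j) (y₀ + z • v))
      (b := fun j => 2 * Real.pi * ρ * (ρ ^ k * b j)) (fun j => ?_) (ε := min ε ε₀) (by positivity)
      ?_ (fun p hp hpε => ?_) i
    · refine circleIntegral.norm_integral_le_of_norm_le_const hρ.le fun z hz => ?_
      rw [norm_mul, norm_pow, mem_sphere_zero_iff_norm.1 hz]
      exact mul_le_mul_of_nonneg_left (h1 j _ ⟨z, hz, rfl⟩) (by positivity)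
    · refine ((h2 (min ε ε₀) (by positivity) (min_le_left _ _)).mul_left
        (2 * Real.pi * ρ * ρ ^ k)).congr fun j => by ring
    · have hp0 : p ≠ 0 := norm_pos_iff.1 hp
      have key := hasSum_circleIntegral (ι := ι) hρ.le
        (g := fun j z => z ^ k * ratEval (A j) (y₀ + z • v) * ppow p (w j))
        (G := fun z => z ^ k * F (y₀ + z • v) p) (b := fun j => ρ ^ k * (b j * ‖p‖ ^ w j))
        (fun j => ((continuous_pow k).continuousOn.mul (hcont j)).mul continuousOn_const)
        (fun j z hz => by
          rw [norm_mul, norm_mul, norm_pow, mem_sphere_zero_iff_norm.1 hz, norm_ppow hp0, mul_assoc]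
          exact mul_le_mul_of_nonneg_left (mul_le_mul_of_nonneg_right (h1 j _ ⟨z, hz, rfl⟩)
            (by positivity)) (by positivity))
        ((h2 ‖p‖ hp (hpε.le.trans (min_le_left _ _))).mul_left _)
        (fun z hz => by
          simpa only [mul_assoc] using (h3 _ ⟨z, hz, rfl⟩ p hp
            (hpε.trans_le (min_le_left _ _))).mul_left (z ^ k))
      have hzero : ∮ z in C(0, ρ), z ^ k * F (y₀ + z • v) p = 0 := by
        have hdiff : DifferentiableOn ℂ (fun z => z ^ k * F (y₀ + z • v) p) (ball 0 ρ₀) :=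
          fun z hz => ((differentiableAt_pow k).mul (hd p hp (hpε.trans_le (min_le_right _ _)) y₀
            (mem_of_mem_nhds hU) z (mem_ball_zero_iff.1 hz))).differentiableWithinAt
        refine DiffContOnCl.circleIntegral_eq_zero hρ.le
          (DifferentiableOn.diffContOnCl (hdiff.mono ?_))
        rw [closure_ball _ hρ.ne']
        exact closedBall_subset_ball hρρ
      rw [hzero] at key
      refine key.congr_fun fun j => ?_
      rw [mul_comm, ← circleIntegral.integral_const_mul]
      congr 1
      ext z
      ring
  -- the order of vanishing of the denominator along the line
  set D := linePoly (IsFractionRing.den (ℂ[σ]) (A i) : ℂ[σ]) y₀ v with hD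
  set M := linePoly (IsFractionRing.num (ℂ[σ]) (A i)) y₀ v with hM
  have hDne : ∀ z : ℂ, z ≠ 0 → ‖z‖ ≤ ρ → D.eval z ≠ 0 := fun z hz0 hz => by
    rw [hD, eval_linePoly]; exact hg.regAt i (hgood z hz0 hz)
  have hD0 : D ≠ 0 := fun h0 => hDne ρ (by exact_mod_cast hρ.ne') (by simp [abs_of_pos hρ])
    (by rw [h0, Polynomial.eval_zero])
  have hDroot : D.IsRoot 0 := by
    rw [Polynomial.IsRoot, hD, eval_linePoly, zero_smul, add_zero]
    exact not_not.1 hreg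
  obtain ⟨H, hH, hH0⟩ := D.exists_eq_pow_rootMultiplicity_mul_and_not_dvd hD0 0
  obtain ⟨k, hk⟩ : ∃ k, D.rootMultiplicity 0 = k + 1 :=
    ⟨_, (Nat.succ_pred_eq_of_pos ((Polynomial.rootMultiplicity_pos hD0).2 hDroot)).symm⟩
  rw [hk, Polynomial.C_0, sub_zero] at hH
  have hHne : ∀ z : ℂ, ‖z‖ ≤ ρ → H.eval z ≠ 0 := fun z hz h0 => by
    rcases eq_or_ne z 0 with rfl | hz0
    · exact hH0 (Polynomial.dvd_iff_isRoot.2 h0)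
    · refine hDne z hz0 hz ?_
      rw [hH, Polynomial.eval_mul, h0, mul_zero]
  have hcauchy := DiffContOnCl.circleIntegral_sub_inv_smul (R := ρ) (c := 0) (w := 0)
    (f := fun z => M.eval z / H.eval z) (DifferentiableOn.diffContOnCl fun z hz => by
      rw [closure_ball _ hρ.ne', mem_closedBall_zero_iff] at hz
      exact (M.differentiable.differentiableAt.div H.differentiable.differentiableAt
        (hHne z hz)).differentiableWithinAt) (mem_ball_self hρ)
  have hsame : (∮ z in C(0, ρ), (z - 0)⁻¹ • (M.eval z / H.eval z)) =
      ∮ z in C(0, ρ), z ^ k * ratEval (A i) (y₀ + z • v) := by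
    refine circleIntegral.integral_congr hρ.le fun z hz => ?_
    have hz' := mem_sphere_zero_iff_norm.1 hz
    have hz0 : z ≠ 0 := norm_pos_iff.1 (by rw [hz']; exact hρ)
    have := hHne z hz'.le
    rw [ratEval, ← eval_linePoly, ← eval_linePoly, ← hD, ← hM, hH, smul_eq_mul, sub_zero,
      Polynomial.eval_mul, Polynomial.eval_pow, Polynomial.eval_X]
    field_simp
    ring
  rw [hsame, hint k, smul_eq_mul, eq_comm] at hcauchy
  have h4 : M.eval 0 / H.eval 0 = 0 :=
    (mul_eq_zero.1 hcauchy).resolve_left Complex.two_pi_I_ne_zero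
  have h5 : M.eval 0 = 0 := (div_eq_zero_iff.1 h4).resolve_right (hHne 0 (by simpa using hρ.le))
  rwa [hM, eval_linePoly, zero_smul, add_zero] at h5

/-- A series that converges normally on the complement of the zeros of `P` converges normally on
the complement of the zeros of `T`, by the mean value property on circles. -/
lemma HoloLines.extend (hw : ∀ B : ℝ, {i | w i ≤ B}.Finite) (hinj : Function.Injective w)
    (hP : P ≠ 0) (hg : LinearGrowth P A w)
    (hc : ∀ K : Set (σ → ℂ), IsCompact K → K ⊆ goodSet P → NormalConv F A w K)
    (hT : ∀ y, eval y T ≠ 0 → ∀ i, y i ≠ 0) (hL : HoloLines F P T) :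
    LinearGrowth T A w ∧
      ∀ K : Set (σ → ℂ), IsCompact K → K ⊆ goodSet T → NormalConv F A w K := by
  have : Countable ι := countable_of_finite_le hw
  have hgT : LinearGrowth T A w :=
    hg.of_zeros hP (fun i y hy hreg => num_eq_zero hw hinj hg hc hL i hy hreg) hT
  refine ⟨hgT, fun K hK hKT => ?_⟩
  have : Fintype σ := Fintype.ofFinite σ
  refine hK.induction_on (p := NormalConv F A w) ?_ ?_ ?_ ?_
  · exact ⟨1, one_pos, 0, by simp, by simp [summable_zero], by simp⟩
  · rintro s t hst ⟨ε, hε, b, h1, h2, h3⟩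
    exact ⟨ε, hε, b, fun i x hx => h1 i x (hst hx), h2, fun x hx => h3 x (hst hx)⟩
  · exact fun s t hs ht => hs.union hw ht
  intro y₀ hy₀
  have hy := hKT hy₀
  obtain ⟨v, hv, ρ₀, hρ₀, ε₀, hε₀, U, hU, hd⟩ := hL y₀ hy
  obtain ⟨ρ, hρ, hρρ, hdisc, hgood⟩ := exists_circle hy hv hρ₀
  have hcont2 : Continuous fun a : (σ → ℂ) × ℂ => a.1 + a.2 • v := by fun_prop
  -- a neighbourhood of the point over which discs and circles stay in the good sets
  obtain ⟨δ, hδ, hδU, hδT, hδP⟩ : ∃ δ : ℝ, 0 < δ ∧ closedBall y₀ δ ⊆ U ∧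
      (∀ y ∈ closedBall y₀ δ, ∀ z ∈ closedBall (0 : ℂ) ρ, y + z • v ∈ goodSet T) ∧
      ∀ y ∈ closedBall y₀ δ, ∀ z ∈ sphere (0 : ℂ) ρ, y + z • v ∈ goodSet P := by
    obtain ⟨u₁, v₁, hu₁, -, hyu₁, hzv₁, huv₁⟩ := generalized_tube_lemma (isCompact_singleton (x := y₀))
      (isCompact_closedBall (0 : ℂ) ρ) ((isOpen_goodSet T).preimage hcont2) (by
        rintro ⟨y, z⟩ ⟨rfl, hz⟩
        exact hdisc z (mem_closedBall_zero_iff.1 hz))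
    obtain ⟨u₂, v₂, hu₂, -, hyu₂, hzv₂, huv₂⟩ := generalized_tube_lemma (isCompact_singleton (x := y₀))
      (isCompact_sphere (0 : ℂ) ρ) ((isOpen_goodSet P).preimage hcont2) (by
        rintro ⟨y, z⟩ ⟨rfl, hz⟩
        have hz := mem_sphere_zero_iff_norm.1 hz
        exact hgood z (norm_pos_iff.1 (hz ▸ hρ)) hz.le)
    obtain ⟨δ, hδ, hB⟩ := nhds_basis_closedBall.mem_iff.1
      (inter_mem hU (inter_mem (hu₁.mem_nhds (hyu₁ rfl)) (hu₂.mem_nhds (hyu₂ rfl))))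
    exact ⟨δ, hδ, fun y hy => (hB hy).1, fun y hy z hz => @huv₁ (y, z) ⟨(hB hy).2.1, hzv₁ hz⟩,
      fun y hy z hz => @huv₂ (y, z) ⟨(hB hy).2.2, hzv₂ hz⟩⟩
  refine ⟨closedBall y₀ δ, mem_nhdsWithin_of_mem_nhds (closedBall_mem_nhds y₀ hδ), ?_⟩
  obtain ⟨ε, hε, b, hb, h1, h2, h3⟩ := (hc ((fun a : (σ → ℂ) × ℂ => a.1 + a.2 • v) ''
    (closedBall y₀ δ ×ˢ sphere 0 ρ))
    (((isCompact_closedBall y₀ δ).prod (isCompact_sphere 0 ρ)).image hcont2)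
    (by rintro _ ⟨⟨y, z⟩, ⟨hy, hz⟩, rfl⟩; exact hδP y hy z hz)).shrink hw
  have hρ' : (0 : ℂ) ∈ ball (0 : ℂ) ρ := mem_ball_self hρ
  have hmean : ∀ y ∈ closedBall y₀ δ, ∀ i,
      (2 * Real.pi * Complex.I : ℂ)⁻¹ • (∮ z in C(0, ρ), (z - 0)⁻¹ • ratEval (A i) (y + z • v)) =
        ratEval (A i) y := by
    intro y hy i
    have := DiffContOnCl.two_pi_i_inv_smul_circleIntegral_sub_inv_smul (R := ρ) (c := 0) (w := 0)
      (f := fun z : ℂ => ratEval (A i) (y + z • v)) (DifferentiableOn.diffContOnCl fun z hz => by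
        rw [closure_ball _ hρ.ne'] at hz
        exact (differentiableAt_ratEval_line
          (hgT.regAt i (hδT y hy z hz))).differentiableWithinAt) hρ'
    simpa using this
  have hmeanF : ∀ y ∈ closedBall y₀ δ, ∀ p : ℂ, 0 < ‖p‖ → ‖p‖ < ε₀ →
      (2 * Real.pi * Complex.I : ℂ)⁻¹ • (∮ z in C(0, ρ), (z - 0)⁻¹ • F (y + z • v) p) = F y p := by
    intro y hy p hp hpε
    have := DiffContOnCl.two_pi_i_inv_smul_circleIntegral_sub_inv_smul (R := ρ) (c := 0) (w := 0)
      (f := fun z : ℂ => F (y + z • v) p) (DifferentiableOn.diffContOnCl fun z hz => by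
        rw [closure_ball _ hρ.ne', mem_closedBall_zero_iff] at hz
        exact (hd p hp hpε y (hδU hy) z (hz.trans_lt hρρ)).differentiableWithinAt) hρ'
    simpa using this
  have hsz : ∀ z ∈ sphere (0 : ℂ) ρ, ‖(z - 0)⁻¹‖ = ρ⁻¹ := fun z hz => by
    rw [sub_zero, norm_inv, mem_sphere_zero_iff_norm.1 hz]
  have hK' : ∀ y ∈ closedBall y₀ δ, ∀ z ∈ sphere (0 : ℂ) ρ,
      y + z • v ∈ (fun a : (σ → ℂ) × ℂ => a.1 + a.2 • v) ''
        (closedBall y₀ δ ×ˢ sphere 0 ρ) := fun y hy z hz => ⟨(y, z), ⟨hy, hz⟩, rfl⟩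
  refine ⟨min ε ε₀, by positivity, b, fun i y hy => ?_, h2 _ (by positivity) (min_le_left _ _),
    fun y hy p hp hpε => ?_⟩
  · rw [← hmean y hy i]
    refine (circleIntegral.norm_two_pi_i_inv_smul_integral_le_of_norm_le_const hρ.le
      (C := ρ⁻¹ * b i) fun z hz => ?_).trans (by rw [mul_inv_cancel_left₀ hρ.ne'])
    rw [norm_smul, hsz z hz]
    exact mul_le_mul_of_nonneg_left (h1 i _ (hK' y hy z hz)) (by positivity)
  · have hp0 : p ≠ 0 := norm_pos_iff.1 hp
    have key := hasSum_circleIntegral (ι := ι) hρ.le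
      (g := fun i z => (z - 0)⁻¹ • ratEval (A i) (y + z • v) * ppow p (w i))
      (G := fun z => (z - 0)⁻¹ • F (y + z • v) p) (b := fun i => ρ⁻¹ * (b i * ‖p‖ ^ w i))
      (fun i => by
        simp only [smul_eq_mul]
        refine ContinuousOn.mul (ContinuousOn.mul ?_ fun z hz => (differentiableAt_ratEval_line
          (hg.regAt i (hδP y hy z hz))).continuousAt.continuousWithinAt) continuousOn_const
        refine ContinuousOn.inv₀ (by fun_prop) fun z hz h0 => ?_
        have := hsz z hz
        rw [h0, inv_zero, norm_zero] at this
        exact (inv_ne_zero hρ.ne') this.symm)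
      (fun i z hz => by
        rw [norm_mul, norm_smul, hsz z hz, norm_ppow hp0, mul_assoc]
        exact mul_le_mul_of_nonneg_left (mul_le_mul_of_nonneg_right (h1 i _ (hK' y hy z hz))
          (by positivity)) (by positivity))
      ((h2 ‖p‖ hp (hpε.le.trans (min_le_left _ _))).mul_left _)
      (fun z hz => by
        simpa only [smul_eq_mul, mul_assoc] using (h3 _ (hK' y hy z hz) p hp
          (hpε.trans_le (min_le_left _ _))).mul_left (z - 0)⁻¹)
    have key2 := key.const_smul (2 * Real.pi * Complex.I : ℂ)⁻¹
    rw [hmeanF y hy p hp (hpε.trans_le (min_le_right _ _))] at key2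
    refine key2.congr_fun fun i => ?_
    rw [← hmean y hy i, smul_mul_assoc]
    congr 1
    rw [mul_comm, ← circleIntegral.integral_const_mul]
    congr 1
    ext z
    ring

end Lines

/-! ### Holomorphy of abelian functions away from their poles -/

/-- The zeros `y` of `θ(y p^γ; p)` tend to `0`, `1` or `∞` as `p → 0`. -/
lemma theta_scaled_ne_zero {y₀ : ℂ} (h0 : y₀ ≠ 0) (h1 : y₀ ≠ 1) (γ : ℝ) :
    ∀ᶠ a : ℂ × ℂ in 𝓝[≠] 0 ×ˢ 𝓝 y₀, theta a.1 (a.2 * ppow a.1 γ) ≠ 0 := by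
  -- integers other than `γ` have a positive distance from `γ`
  obtain ⟨d, hd, hd'⟩ : ∃ d : ℝ, 0 < d ∧ ∀ l : ℤ, (l : ℝ) ≠ γ → d ≤ l - γ ∨ l - γ ≤ -d := by
    refine ⟨min (⌊γ⌋ + 1 - γ) (γ - ⌈γ⌉ + 1), lt_min (by linarith [Int.lt_floor_add_one γ])
      (by linarith [Int.ceil_lt_add_one γ]), fun l hl => ?_⟩
    rcases lt_or_gt_of_ne hl with h | h
    · have : (l : ℝ) + 1 ≤ ⌈γ⌉ := by exact_mod_cast Int.lt_ceil.2 h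
      exact Or.inr (by linarith [min_le_right (⌊γ⌋ + 1 - γ) (γ - ⌈γ⌉ + 1)])
    · have : (⌊γ⌋ : ℝ) + 1 ≤ l := by exact_mod_cast Int.floor_lt.2 h
      exact Or.inl (by linarith [min_le_left (⌊γ⌋ + 1 - γ) (γ - ⌈γ⌉ + 1)])
  have hy : 0 < ‖y₀‖ := norm_pos_iff.2 h0
  have hlim : Tendsto (fun p : ℂ => ‖p‖ ^ d) (𝓝[≠] 0) (𝓝 0) := by
    have c : ContinuousAt (fun p : ℂ => ‖p‖ ^ d) 0 :=
      continuous_norm.continuousAt.rpow_const (Or.inr hd.le)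
    have := c.tendsto
    rw [norm_zero, Real.zero_rpow hd.ne'] at this
    exact this.mono_left nhdsWithin_le_nhds
  have e1 : ∀ᶠ p : ℂ in 𝓝[≠] 0, ‖p‖ ^ d < ‖y₀‖ / 2 ∧ ‖p‖ ^ d < (2 * ‖y₀‖)⁻¹ ∧ ‖p‖ < 1 ∧ p ≠ 0 := by
    have h2 : ∀ᶠ p : ℂ in 𝓝[≠] 0, ‖p‖ < 1 :=
      nhdsWithin_le_nhds (continuous_norm.continuousAt.eventually_lt_const (by simp))
    filter_upwards [hlim.eventually_lt_const (half_pos hy),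
      hlim.eventually_lt_const (by positivity : 0 < (2 * ‖y₀‖)⁻¹), h2, self_mem_nhdsWithin]
      with p a b c e using ⟨a, b, c, e⟩
  have e2 : ∀ᶠ y : ℂ in 𝓝 y₀, ‖y₀‖ / 2 < ‖y‖ ∧ ‖y‖ < 2 * ‖y₀‖ ∧ y ≠ 1 :=
    (continuous_norm.continuousAt.eventually_const_lt (by linarith)).and
      ((continuous_norm.continuousAt.eventually_lt_const (by linarith)).and
        (continuousAt_id.eventually_ne h1))
  filter_upwards [e1.prod_mk e2] with ⟨p, y⟩ ⟨⟨hp1, hp2, hp3, hp0⟩, hy1, hy2, hy3⟩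
  have hp : 0 < ‖p‖ := norm_pos_iff.2 hp0
  have hy0 : y ≠ 0 := norm_pos_iff.1 (by linarith)
  refine theta_ne_zero hp0 hp3 (mul_ne_zero hy0 (ppow_ne_zero hp0 γ)) fun l hl => ?_
  have hl' : y = ppow p (l - γ) := by
    rw [ppow_sub hp0, eq_div_iff (ppow_ne_zero hp0 γ), hl]
    simp [ppow]
  by_cases hlγ : (l : ℝ) = γ
  · rw [hlγ, sub_self, ppow_zero] at hl'
    exact hy3 hl'
  have hn : ‖y‖ = ‖p‖ ^ ((l : ℝ) - γ) := by rw [hl', norm_ppow hp0]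
  rcases hd' l hlγ with h | h
  · have := Real.rpow_le_rpow_of_exponent_ge hp hp3.le h
    linarith
  · have := Real.rpow_le_rpow_of_exponent_ge hp hp3.le h
    rw [Real.rpow_neg hp.le, ← hn] at this
    have h3 : 2 * ‖y₀‖ < (‖p‖ ^ d)⁻¹ := (lt_inv_comm₀ (by positivity) (by positivity)).1 hp2
    linarith

section Abelian

variable {n m : ℕ} {u q p : ℂ}

lemma analyticAt_poleFactor_arg {E : Type*} [NormedAddCommGroup E] [NormedSpace ℂ E]
    {z : E → Fin n → ℂ} {u q : E → ℂ} {x : E} (hp1 : ‖p‖ < 1) (hp : p ≠ 0)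
    (hz : ∀ i, AnalyticAt ℂ (fun x => z x i) x) (hu : AnalyticAt ℂ u x) (hq : AnalyticAt ℂ q x)
    (hz0 : ∀ i, z x i ≠ 0) (hu0 : u x ≠ 0) (hq0 : q x ≠ 0) :
    AnalyticAt ℂ (fun x => poleFactor n m (u x) (q x) p (z x)) x := by
  simp only [poleFactor]
  refine analyticAt_fun_prod _ fun i _ => analyticAt_fun_prod _ fun r _ => ?_
  have h1 : AnalyticAt ℂ (fun x => p * q x * z x i / u x * q x ^ r) x :=
    (((analyticAt_const.fun_mul hq).fun_mul (hz i)).fun_div hu hu0).fun_mul (hq.fun_pow r)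
  have h2 : AnalyticAt ℂ (fun x => p * q x * (z x i)⁻¹ / u x * q x ^ r) x :=
    (((analyticAt_const.fun_mul hq).fun_mul ((hz i).fun_inv (hz0 i))).fun_div hu hu0).fun_mul
      (hq.fun_pow r)
  have hne := hz0 i
  exact ((analyticAt_theta hp1 (by positivity)).comp_of_eq h1 rfl).fun_mul
    ((analyticAt_theta hp1 (by positivity)).comp_of_eq h2 rfl)

/-- The pole factor can be divided out where it does not vanish. -/
lemma IsAbelian.analyticAt {f : (Fin n → ℂ) → ℂ} (hf : IsAbelian n m u q p f) (hu : u ≠ 0)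
    (hq : q ≠ 0) (hp : p ≠ 0) (hp1 : ‖p‖ < 1) {z : Fin n → ℂ} (hz : ∀ i, z i ≠ 0)
    (h0 : poleFactor n m u q p z ≠ 0) : AnalyticAt ℂ f z := by
  obtain ⟨H, hH, h⟩ := hf.holo
  have hP : AnalyticAt ℂ (poleFactor n m u q p) z :=
    analyticAt_poleFactor_arg (z := fun z => z) hp1 hp (fun i => (ContinuousLinearMap.proj (R := ℂ)
      (φ := fun _ : Fin n => ℂ) i).analyticAt z) analyticAt_const
      analyticAt_const hz hu hq
  refine ((hH z hz).fun_div hP h0).congr ?_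
  filter_upwards [hP.continuousAt.eventually_ne h0, (isOpen_torus (σ := Fin n)).mem_nhds hz]
    with y hy hy0
  rw [← h y hy0 hy, mul_div_cancel_left₀ _ hy]

end Abelian

/-! ### Substitution of Laurent monomials -/

section Substitution

variable {σ : Type} {ψ : ℂ⁶ → σ → ℂ}

/-- All coordinates of `ψ` are Laurent monomials. -/
def IsMonomial (ψ : ℂ⁶ → σ → ℂ) : Prop := ∀ k, ∃ d, MDeg 0 d fun x => ψ x k

lemma IsMonomial.ne_zero (hψ : IsMonomial ψ) {x : ℂ⁶} (hx : ∀ i, x i ≠ 0) (k : σ) :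
    ψ x k ≠ 0 := (hψ k).choose_spec.ne_zero hx

lemma IsMonomial.continuousOn (hψ : IsMonomial ψ) : ContinuousOn ψ (torus (Fin 6)) :=
  continuousOn_pi.2 fun k => (hψ k).choose_spec.analyticOnNhd.continuousOn

variable [Fintype σ]

/-- Substitution in polynomials, with a common denominator that does not vanish on the torus. -/
lemma IsMonomial.exists_subst (hψ : IsMonomial ψ) : ∃ (D : ℕ) (M : ℂ[Fin 6]), M ≠ 0 ∧
    (∀ x : ℂ⁶, (∀ i, x i ≠ 0) → eval x M ≠ 0) ∧ M.totalDegree ≤ D ∧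
    ∀ (N : ℂ[σ]) (d : ℕ), N.totalDegree ≤ d → ∃ N' : ℂ[Fin 6],
      N'.totalDegree ≤ d * D ∧ ∀ x : ℂ⁶, (∀ i, x i ≠ 0) →
        eval x N' = eval (ψ x) N * eval x M ^ d := by
  classical
  choose e k hk0 hk using hψ
  let a : σ → ℂ[Fin 6] := fun j => ∏ i, X i ^ (k j i).toNat
  let b : σ → ℂ[Fin 6] := fun j => ∏ i, X i ^ (-k j i).toNat
  have hb : ∀ j, ∀ x : ℂ⁶, (∀ i, x i ≠ 0) → eval x (b j) ≠ 0 := fun j x hx => by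
    rw [eval_monomial]
    exact prod_ne_zero_iff.2 fun i _ => pow_ne_zero _ (hx i)
  set M : ℂ[Fin 6] := ∏ j, b j with hM
  have hMx : ∀ x : ℂ⁶, (∀ i, x i ≠ 0) → eval x M ≠ 0 := fun x hx => by
    rw [hM, map_prod]
    exact prod_ne_zero_iff.2 fun j _ => hb j x hx
  let c : σ → ℂ[Fin 6] := fun j => a j * ∏ l ∈ univ.erase j, b l
  have hc : ∀ j, ∀ x : ℂ⁶, (∀ i, x i ≠ 0) →
      eval x (c j) = ψ x j * eval x M := fun j x hx => by
    have h1 : ψ x j * eval x (b j) = eval x (a j) := by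
      have := hb j x hx
      rw [eval_monomial] at this
      rw [show ψ x j = _ from hk j x hx, prod_zpow_split _ hx, eval_monomial,
        eval_monomial, div_mul_cancel₀ _ this]
    rw [hM, ← mul_prod_erase univ b (mem_univ j), map_mul, map_mul, ← h1]
    ring
  refine ⟨M.totalDegree + ∑ j, (c j).totalDegree, M, prod_ne_zero_iff.2 fun j _ =>
    prod_X_pow_ne_zero _, hMx, Nat.le_add_right _ _, fun N d hd => ?_⟩
  set D := M.totalDegree + ∑ j, (c j).totalDegree with hD
  have hcD : ∀ j, (c j).totalDegree ≤ D := fun j =>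
    (single_le_sum (f := fun j => (c j).totalDegree) (fun _ _ => Nat.zero_le _)
      (mem_univ j)).trans (Nat.le_add_left _ _)
  have hm : ∀ m ∈ N.support, ∑ j, m j ≤ d := fun m hm => by
    rw [← Finsupp.degree_eq_sum]
    exact (le_totalDegree hm).trans hd
  refine ⟨∑ m ∈ N.support, C (N.coeff m) * ((∏ j, c j ^ m j) * M ^ (d - ∑ j, m j)),
    totalDegree_finsetSum_le fun m hmN => ?_, fun x hx => ?_⟩
  · have h1 : (∏ j, c j ^ m j).totalDegree ≤ (∑ j, m j) * D := by
      refine (totalDegree_finsetProd _ _).trans ?_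
      rw [sum_mul]
      exact sum_le_sum fun j _ => (totalDegree_pow _ _).trans
        (Nat.mul_le_mul_left _ (hcD j))
    have h2 : (M ^ (d - ∑ j, m j)).totalDegree ≤ (d - ∑ j, m j) * D :=
      (totalDegree_pow _ _).trans (Nat.mul_le_mul_left _ (Nat.le_add_right _ _))
    calc _ ≤ 0 + ((∑ j, m j) * D + (d - ∑ j, m j) * D) := by
          refine (totalDegree_mul _ _).trans (Nat.add_le_add
            (totalDegree_C _).le ((totalDegree_mul _ _).trans
              (Nat.add_le_add h1 h2)))
      _ = d * D := by rw [zero_add, ← add_mul, Nat.add_sub_cancel' (hm m hmN)]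
  · rw [eval_eq' (ψ x) N, sum_mul, map_sum]
    refine sum_congr rfl fun m hmN => ?_
    rw [map_mul, map_mul, eval_C, map_prod, map_pow, mul_assoc]
    congr 1
    conv_rhs => rw [← Nat.add_sub_cancel' (hm m hmN), pow_add, ← mul_assoc,
      ← prod_pow_eq_pow_sum, ← prod_mul_distrib]
    congr 1
    refine prod_congr rfl fun j _ => ?_
    rw [map_pow, hc j x hx, mul_pow]

lemma IsMonomial.ratFun (hψ : IsMonomial ψ) {T : ℂ[σ]} {x₀ : ℂ⁶}
    (hx₀ : ∀ i, x₀ i ≠ 0) (h0 : eval (ψ x₀) T ≠ 0) :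
    RatFun fun x => eval (ψ x) T := by
  obtain ⟨D, M, hM, hMx, -, hsub⟩ := hψ.exists_subst
  obtain ⟨T', -, hT'⟩ := hsub T _ le_rfl
  refine ⟨T', M ^ T.totalDegree, ?_, pow_ne_zero _ hM, fun x hx => ?_⟩
  · rintro rfl
    have := hT' x₀ hx₀
    rw [map_zero] at this
    exact mul_ne_zero h0 (pow_ne_zero _ (hMx x₀ hx₀)) this.symm
  · rw [hT' x hx.1, map_pow, mul_div_cancel_right₀ _ (pow_ne_zero _ (hMx x hx.1))]

/-- Substitution of Laurent monomials in an expansion. -/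
lemma IsMonomial.gexp (hψ : IsMonomial ψ) {ι : Type} {F : (σ → ℂ) → ℂ → ℂ} {A : ι → Rat σ}
    {w : ι → ℝ} {T : ℂ[σ]} (hw : ∀ B : ℝ, {i | w i ≤ B}.Finite)
    (hg : LinearGrowth T A w)
    (hc : ∀ K : Set (σ → ℂ), IsCompact K → K ⊆ goodSet T → NormalConv F A w K) {x₀ : ℂ⁶}
    (hx₀ : ∀ i, x₀ i ≠ 0) (h0 : eval (ψ x₀) T ≠ 0) :
    ∃ B : ι → Rat (Fin 6), GExp (fun x => F (ψ x)) B w ∧ ∃ R : ℂ[Fin 6], R ≠ 0 ∧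
      ∀ x ∈ goodSet R, ∀ i, ratEval (B i) x = ratEval (A i) (ψ x) := by
  obtain ⟨D, M, hM, hMx, hMD, hsub⟩ := hψ.exists_subst
  obtain ⟨T', hT'D, hT'⟩ := hsub T _ le_rfl
  have hT'0 : T' ≠ 0 := by
    rintro rfl
    have := hT' x₀ hx₀
    rw [map_zero] at this
    exact mul_ne_zero h0 (pow_ne_zero _ (hMx x₀ hx₀)) this.symm
  set τ := T.totalDegree with hτ
  obtain ⟨c, hc0, hcc⟩ := hg.nonneg
  choose N m h1 h2 h3 using hcc
  choose N' hN'D hN' using fun i => hsub (N i) _ le_rfl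
  set d : ι → ℕ := fun i => (N i).totalDegree with hd
  have hP : T' * M ≠ 0 := mul_ne_zero hT'0 hM
  have hP' : ∀ i, algebraMap (ℂ[Fin 6]) (Rat (Fin 6)) ((T' * M) ^ (m i + d i)) ≠ 0 :=
    fun i => by
      simpa using (map_ne_zero_iff _ (IsFractionRing.injective (ℂ[Fin 6])
        (Rat (Fin 6)))).2 (pow_ne_zero (m i + d i) hP)
  set L : ι → ℂ[Fin 6] := fun i => N' i * M ^ (τ * m i) * T' ^ d i * M ^ m i with hL
  set B : ι → Rat (Fin 6) := fun i => algebraMap _ _ (L i) /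
    algebraMap (ℂ[Fin 6]) (Rat (Fin 6)) ((T' * M) ^ (m i + d i)) with hB
  have hBe : ∀ i, B i * algebraMap (ℂ[Fin 6]) (Rat (Fin 6)) ((T' * M) ^ (m i + d i)) =
      algebraMap _ _ (L i) := fun i => div_mul_cancel₀ _ (hP' i)
  have hgood : ∀ x ∈ goodSet (T' * M), ψ x ∈ goodSet T := fun x hx => by
    refine ⟨hψ.ne_zero hx.1, fun h => hx.2 ?_⟩
    rw [map_mul, hT' x hx.1, h, zero_mul, zero_mul]
  have hev : ∀ x ∈ goodSet (T' * M), ∀ i, ratEval (B i) x = ratEval (A i) (ψ x) := by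
    intro x hx i
    have hTx := (hgood x hx).2
    have hMx' := hMx x hx.1
    rw [(ratEval_of_mul_eq (hBe i) (by rw [map_pow]; exact pow_ne_zero _ hx.2)).2,
      (ratEval_of_mul_eq (h3 i) (by rw [map_pow]; exact pow_ne_zero _ hTx)).2]
    simp only [hL, map_mul, map_pow, hT' x hx.1, hN' i x hx.1]
    generalize eval (ψ x) T = a at *
    generalize eval x M = b at *
    generalize eval (ψ x) (N i) = e at *
    rw [div_eq_div_iff (by positivity) (by positivity)]
    ring
  refine ⟨B, ⟨hw, T' * M, hP, ?_, fun K hK hKP => ?_⟩, T' * M, hP, hev⟩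
  · refine ⟨c * (2 + (1 + τ + τ + 1) * D), fun i => ⟨L i, m i + d i, ?_, ?_, hBe i⟩⟩
    · have : 0 ≤ c * (1 + |w i|) * ((1 + τ + τ + 1) * D : ℝ) := by positivity
      push_cast
      linarith [h1 i, h2 i]
    · have hdeg : (L i).totalDegree ≤ d i * D + τ * m i * D + d i * (τ * D) + m i * D := by
        refine (totalDegree_mul _ _).trans (Nat.add_le_add
          ((totalDegree_mul _ _).trans (Nat.add_le_add
            ((totalDegree_mul _ _).trans (Nat.add_le_add (hN'D i) ?_)) ?_)) ?_)
        exacts [(totalDegree_pow _ _).trans (Nat.mul_le_mul_left _ hMD),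
          (totalDegree_pow _ _).trans (Nat.mul_le_mul_left _ hT'D),
          (totalDegree_pow _ _).trans (Nat.mul_le_mul_left _ hMD)]
      have hdeg' : ((L i).totalDegree : ℝ) ≤ d i * D + τ * m i * D + d i * (τ * D) + m i * D := by
        exact_mod_cast hdeg
      have a1 := mul_le_mul_of_nonneg_right (h2 i) (by positivity : (0 : ℝ) ≤ (1 + τ) * D)
      have a2 := mul_le_mul_of_nonneg_right (h1 i) (by positivity : (0 : ℝ) ≤ (τ + 1) * D)
      have a3 : 0 ≤ c * (1 + |w i|) := by positivity
      linarith
  · have hKt : K ⊆ torus (Fin 6) := fun x hx => (hKP hx).1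
    obtain ⟨ε, hε, b, g1, g2, g3⟩ := hc (ψ '' K) (hK.image_of_continuousOn
      (hψ.continuousOn.mono hKt)) (by rintro _ ⟨x, hx, rfl⟩; exact hgood x (hKP hx))
    refine ⟨ε, hε, b, fun i x hx => ?_, g2, fun x hx p hp hpε => ?_⟩
    · rw [hev x (hKP hx) i]; exact g1 i _ ⟨x, hx, rfl⟩
    · simp only [hev x (hKP hx)]; exact g3 _ ⟨x, hx, rfl⟩ p hp hpε

end Substitution

/-! ### Leading terms at the nodes -/

section Lines

variable {n k : ℕ}

/-- The polynomial `P` at fixed values of `z₁, …, z_n`. -/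
def fixZ (zs : Fin n → ℂ) (P : ℂ[AVar n k]) : ℂ[AVar n k] :=
  aeval (Sum.elim (fun i => C (zs i)) fun j => X (inr j)) P

lemma eval_fixZ (zs : Fin n → ℂ) (P : ℂ[AVar n k]) (y : AVar n k → ℂ) :
    eval y (fixZ zs P) = eval (Sum.elim zs fun j => y (inr j)) P := by
  have h : (fun a => aeval (R := ℂ) y (Sum.elim (fun i => C (zs i))
      (fun j => X (inr j)) a : ℂ[AVar n k])) =
      Sum.elim zs fun j => y (inr j) := by
    funext a
    rcases a with i | j <;> simp
  have h2 := comp_aeval_apply (f := (Sum.elim (fun i => C (zs i))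
      fun j => X (inr j) : AVar n k → ℂ[AVar n k]))
      (aeval (R := ℂ) y) P
  rw [h] at h2
  exact h2

/-- A polynomial whose zeros contain the limits, as `p → 0`, of the poles of functions in
`Ã^{(n)}(u)`, as well as the coordinate hyperplanes. -/
def limPoles (n k m : ℕ) : ℂ[AVar n k] :=
  let u := X (inr (inr 0))
  let q := X (inr (inr 1))
  (∏ i, ∏ r ∈ range m,
    ((u - q ^ (r + 1) * X (inl i)) *
      (X (inl i) * u - q ^ (r + 1)))) * ∏ a, X a

lemma eval_limPoles (m : ℕ) (y : AVar n k → ℂ) : eval y (limPoles n k m) ≠ 0 ↔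
    (∀ i, ∀ r < m, y (inr (inr 0)) ≠ y (inr (inr 1)) ^ (r + 1) * y (inl i) ∧
      y (inl i) * y (inr (inr 0)) ≠ y (inr (inr 1)) ^ (r + 1)) ∧
      ∀ a, y a ≠ 0 := by
  simp [limPoles, prod_eq_zero_iff, sub_eq_zero, not_or]

variable {m : ℕ} {ζ : Fin n → ℝ} {γ : ℝ} {β : Fin k → ℝ} {f : ParamFun n k}

lemma poleFactor_scaled_ne_zero (ζ : Fin n → ℝ) (γ : ℝ) {y₀ : AVar n k → ℂ}
    (hy : eval y₀ (limPoles n k m) ≠ 0) :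
    ∀ᶠ a : ℂ × (AVar n k → ℂ) in 𝓝[≠] 0 ×ˢ 𝓝 y₀,
      poleFactor n m (a.2 (inr (inr 0)) * ppow a.1 γ) (a.2 (inr (inr 1))) a.1
        (fun i => a.2 (inl i) * ppow a.1 (ζ i)) ≠ 0 := by
  obtain ⟨h1, h2⟩ := (eval_limPoles m y₀).1 hy
  have hu := h2 (inr (inr 0))
  have hq := h2 (inr (inr 1))
  have ap : ∀ a, ContinuousAt (fun y : AVar n k → ℂ => y a) y₀ := fun a =>
    (continuous_apply a).continuousAt
  have key : ∀ i, ∀ r ∈ range m, ∀ᶠ a : ℂ × (AVar n k → ℂ) in 𝓝[≠] 0 ×ˢ 𝓝 y₀,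
      theta a.1 (a.2 (inr (inr 1)) ^ (r + 1) * a.2 (inl i) / a.2 (inr (inr 0)) *
        ppow a.1 (1 + ζ i - γ)) ≠ 0 ∧
      theta a.1 (a.2 (inr (inr 1)) ^ (r + 1) / (a.2 (inl i) * a.2 (inr (inr 0))) *
        ppow a.1 (1 - ζ i - γ)) ≠ 0 := by
    intro i r hr
    have hz := h2 (inl i)
    obtain ⟨h3, h4⟩ := h1 i r (mem_range.1 hr)
    have c1 : ContinuousAt (fun y : AVar n k → ℂ =>
        y (inr (inr 1)) ^ (r + 1) * y (inl i) / y (inr (inr 0))) y₀ :=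
      (((ap _).pow _).mul (ap _)).div (ap _) hu
    have c2 : ContinuousAt (fun y : AVar n k → ℂ =>
        y (inr (inr 1)) ^ (r + 1) / (y (inl i) * y (inr (inr 0)))) y₀ :=
      ((ap _).pow _).div ((ap _).mul (ap _)) (mul_ne_zero hz hu)
    exact ((tendsto_id.prodMap c1.tendsto).eventually (theta_scaled_ne_zero (by positivity)
      (fun h => h3 ((div_eq_one_iff_eq hu).1 h).symm) _)).and
      ((tendsto_id.prodMap c2.tendsto).eventually (theta_scaled_ne_zero (by positivity)
      (fun h => h4 ((div_eq_one_iff_eq (mul_ne_zero hz hu)).1 h).symm) _))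
  have hp : ∀ᶠ a : ℂ × (AVar n k → ℂ) in 𝓝[≠] 0 ×ˢ 𝓝 y₀, a.1 ≠ 0 :=
    tendsto_fst.eventually self_mem_nhdsWithin
  filter_upwards [hp, eventually_all.2 fun i => (eventually_all_finset (range m)).2 (key i)]
    with a hp ha
  refine prod_ne_zero_iff.2 fun i _ => prod_ne_zero_iff.2 fun r hr => ?_
  obtain ⟨h3, h4⟩ := ha i r hr
  have e1 := ppow_ne_zero hp γ
  have e2 := ppow_ne_zero hp (ζ i)
  refine mul_ne_zero ?_ ?_
  · convert h3 using 2
    rw [ppow_sub hp, ppow_add hp, ppow_one, pow_succ]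
    simp only [div_eq_mul_inv, mul_inv]
    ring
  · convert h4 using 2
    rw [ppow_sub hp, ppow_sub hp, ppow_one, pow_succ]
    simp only [div_eq_mul_inv, mul_inv]
    ring

/-- The lines on which only the coordinates `z` vary, as functions in `Ã^{(n)}(u)` are holomorphic
in `z` off the zeros of the pole factor. -/
lemma holoLines_shifted (hA : ∀ (u : ℂ) (s : Fin k → ℂ) (q t p : ℂ), u ≠ 0 → (∀ j, s j ≠ 0) →
      q ≠ 0 → t ≠ 0 → 0 < ‖p‖ → ‖p‖ < 1 → IsAbelian n m u q p (fun z => f z u s q t p))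
    {P : ℂ[AVar n k]} (zs : Fin n → ℂ) :
    HoloLines (shifted f ζ γ β) P (fixZ zs P * limPoles n k m) := by
  intro y₀ hy
  rw [goodSet_mul] at hy
  have h0 : y₀ ∈ torus (AVar n k) := hy.1.1
  refine ⟨Sum.elim (fun i => zs i - y₀ (inl i)) 0, ?_, ?_⟩
  · convert hy.1.2 using 1
    rw [eval_fixZ]
    congr 2
    funext a
    rcases a with i | j <;> simp
  set v : AVar n k → ℂ := Sum.elim (fun i => zs i - y₀ (inl i)) 0 with hv
  have hfilter := (poleFactor_scaled_ne_zero ζ γ hy.2.2).and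
    (tendsto_snd.eventually (isOpen_torus.mem_nhds h0))
  obtain ⟨p1, hp1, p2, hp2, hpq⟩ := eventually_prod_iff.1 hfilter
  obtain ⟨ε, hε, hB⟩ := eventually_nhds_iff_ball.1 (eventually_nhdsWithin_iff.1 hp1)
  have hc : ContinuousAt (fun a : (AVar n k → ℂ) × ℂ => a.1 + a.2 • v) (y₀, 0) := by fun_prop
  have hc' : ∀ᶠ a : (AVar n k → ℂ) × ℂ in 𝓝 y₀ ×ˢ 𝓝 0, p2 (a.1 + a.2 • v) := by
    rw [← nhds_prod_eq]
    exact hc.eventually (by simpa using hp2)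
  obtain ⟨U, hU, V, hV, hUV⟩ := eventually_prod_iff.1 hc'
  obtain ⟨ρ, hρ, hVB⟩ := eventually_nhds_iff_ball.1 hV
  refine ⟨ρ, hρ, min ε 1, by positivity, {y | U y}, hU, fun p hp hpε y hy z hz => ?_⟩
  have hp0 : p ≠ 0 := norm_pos_iff.1 hp
  obtain ⟨g1, g2⟩ := hpq (hB p (by simpa using hpε.trans_le (min_le_left _ _)) hp0)
    (hUV hy (hVB z (by simpa using hz)))
  have hy' : ∀ b, y (inr b) ≠ 0 := fun b => by simpa [hv] using! g2 (inr b)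
  have e : ∀ b, (y + z • v) (inr b) = y (inr b) := fun b => by simp [hv]
  have hfun : (fun z : ℂ => shifted f ζ γ β (y + z • v) p) = fun z : ℂ =>
      f (fun i => (y (inl i) + z * v (inl i)) * ppow p (ζ i))
        (y (inr (inr 0)) * ppow p γ) (fun j => y (inr (inl j)) * ppow p (β j))
        (y (inr (inr 1))) (y (inr (inr 2))) p := by
    funext z
    simp [shifted, hv]
  rw [hfun]
  have hd := ((hA (y (inr (inr 0)) * ppow p γ) (fun j => y (inr (inl j)) * ppow p (β j))
    (y (inr (inr 1))) (y (inr (inr 2))) p (mul_ne_zero (hy' _) (ppow_ne_zero hp0 _))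
    (fun j => mul_ne_zero (hy' _) (ppow_ne_zero hp0 _)) (hy' _) (hy' _) hp
    (hpε.trans_le (min_le_right _ _))).analyticAt (mul_ne_zero (hy' _) (ppow_ne_zero hp0 _)) (hy' _)
    hp0 (hpε.trans_le (min_le_right _ _))
    (z := fun i => (y (inl i) + z * v (inl i)) * ppow p (ζ i))
    (fun i => mul_ne_zero (g2 (inl i)) (ppow_ne_zero hp0 _)) (by
      have := g1
      simp only [e] at this
      exact this)).differentiableAt
  exact hd.comp (f := fun z : ℂ => fun i => (y (inl i) + z * v (inl i)) * ppow p (ζ i)) z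
    (by fun_prop)

end Lines

section Nodes

variable {n N : ℕ} {α : Fin 6 → ℝ} {μ : Fin n → ℕ} {j : Fin 6} {f : ParamFun n 3}

/-- The values of the variables `z, s, u, q, t` at a node, with `u = t_j`. -/
def nodePoint (n N : ℕ) (j : Fin 6) (μ : Fin n → ℕ) (x : ℂ⁶) : AVar n 3 → ℂ :=
  aPoint (node (balanced n N x 0) (x 4) (x 5) μ) (balanced n N x j)
    ![balanced n N x 0, balanced n N x 2, balanced n N x 3] (x 4) (x 5)

lemma isMonomial_nodePoint : IsMonomial (nodePoint n N j μ) := by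
  have hb : ∀ r, ∃ d, MDeg 0 d fun x => balanced n N x r := fun r =>
    ⟨_, balanced_mdeg_zero n N r⟩
  rintro (i | k | k)
  · exact ⟨_, ((balanced_mdeg_zero n N 0).mul ((mdeg_coord 0 5).pow _)).mul
      ((mdeg_coord 0 4).pow _)⟩
  · fin_cases k
    exacts [hb 0, hb 2, hb 3]
  · fin_cases k
    exacts [hb j, ⟨_, mdeg_coord 0 4⟩, ⟨_, mdeg_coord 0 5⟩]

lemma shifted_nodePoint (x : ℂ⁶) (p : ℂ) :
    scaledFun α j f (nodePoint n N j μ x) p =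
      f (node (scaled α (balanced n N x) p 0) (x 4) (x 5) μ) (scaled α (balanced n N x) p j)
        ![scaled α (balanced n N x) p 0, scaled α (balanced n N x) p 2,
          scaled α (balanced n N x) p 3] (x 4) (x 5) p := by
  have h1 : (fun i => nodePoint n N j μ x (inl i) * ppow p (α 0)) =
      node (scaled α (balanced n N x) p 0) (x 4) (x 5) μ := by
    funext i
    simp only [nodePoint, aPoint, Sum.elim_inl, node, scaled]
    ring
  have h2 : (fun k => nodePoint n N j μ x (inr (inl k)) * ppow p (![α 0, α 2, α 3] k)) =
      ![scaled α (balanced n N x) p 0, scaled α (balanced n N x) p 2,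
          scaled α (balanced n N x) p 3] := by
    funext k
    fin_cases k <;> rfl
  simp only [scaledFun, shifted, h1, h2]
  rfl

/-- The parameters `(t₀, t₂, t₃, t₄, q, t)` for given values of `s, u, q, t`, where `u = t_j`. -/
def nodeParam (n N : ℕ) (j : Fin 6) (y : AVar n 3 → ℂ) : ℂ⁶ :=
  ![y (inr (inl 0)), y (inr (inl 1)), y (inr (inl 2)),
    if j = 4 then y (inr (inr 0)) else
      y (inr (inr 1)) ^ ((N : ℤ) + 1) * y (inr (inr 2)) ^ (1 - (n : ℤ)) /
        (y (inr (inl 1)) * y (inr (inl 2)) * y (inr (inr 0))),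
    y (inr (inr 1)), y (inr (inr 2))]

lemma nodeParam_ne_zero {y : AVar n 3 → ℂ} (hy : ∀ a, y (inr a) ≠ 0) (i : Fin 6) :
    nodeParam n N j y i ≠ 0 := by
  fin_cases i <;> try exact hy _
  show (if j = 4 then _ else _) ≠ 0
  split_ifs
  · exact hy _
  · exact div_ne_zero (mul_ne_zero (zpow_ne_zero _ (hy _)) (zpow_ne_zero _ (hy _)))
      (mul_ne_zero (mul_ne_zero (hy _) (hy _)) (hy _))

lemma nodePoint_nodeParam (hj : j = 4 ∨ j = 5) {y : AVar n 3 → ℂ}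
    (hy : ∀ a, y (inr a) ≠ 0) (a : Fin 3 ⊕ Fin 3) :
    nodePoint n N j μ (nodeParam n N j y) (inr a) = y (inr a) := by
  rcases a with k | k <;> fin_cases k <;> try rfl
  rcases hj with rfl | rfl
  · rfl
  have h1 := hy (inl 1)
  have h2 := hy (inl 2)
  have hu := hy (inr 0)
  have hq := zpow_ne_zero ((N : ℤ) + 1) (hy (inr 1))
  have ht := zpow_ne_zero (1 - (n : ℤ)) (hy (inr 2))
  show y (inr (inr 1)) ^ ((N : ℤ) + 1) * y (inr (inr 2)) ^ (1 - (n : ℤ)) /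
    (y (inr (inl 1)) * y (inr (inl 2)) *
      (y (inr (inr 1)) ^ ((N : ℤ) + 1) * y (inr (inr 2)) ^ (1 - (n : ℤ)) /
        (y (inr (inl 1)) * y (inr (inl 2)) * y (inr (inr 0))))) =
      y (inr (inr 0))
  field_simp

lemma nodeParam_nodePoint (hj : j = 4 ∨ j = 5) {x : ℂ⁶} (hx : ∀ i, x i ≠ 0) :
    nodeParam n N j (nodePoint n N j μ x) = x := by
  funext i
  fin_cases i <;> try rfl
  rcases hj with rfl | rfl
  · rfl
  have h1 := hx 1
  have h2 := hx 2
  have h3 := hx 3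
  have hq := zpow_ne_zero ((N : ℤ) + 1) (hx 4)
  have ht := zpow_ne_zero (1 - (n : ℤ)) (hx 5)
  show x 4 ^ ((N : ℤ) + 1) * x 5 ^ (1 - (n : ℤ)) / (x 1 * x 2 *
    (x 4 ^ ((N : ℤ) + 1) * x 5 ^ (1 - (n : ℤ)) / (x 1 * x 2 * x 3))) = x 3
  field_simp

lemma continuousAt_nodeParam {y : AVar n 3 → ℂ} (hy : ∀ a, y (inr a) ≠ 0) :
    ContinuousAt (nodeParam n N j) y := by
  have ap : ∀ a, ContinuousAt (fun y : AVar n 3 → ℂ => y a) y := fun a =>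
    (continuous_apply a).continuousAt
  refine continuousAt_pi.2 fun i => ?_
  fin_cases i <;> try exact ap _
  show ContinuousAt (fun y : AVar n 3 → ℂ => if j = 4 then y (inr (inr 0)) else
      y (inr (inr 1)) ^ ((N : ℤ) + 1) * y (inr (inr 2)) ^ (1 - (n : ℤ)) /
        (y (inr (inl 1)) * y (inr (inl 2)) * y (inr (inr 0)))) y
  split_ifs
  · exact ap _
  · exact (((ap _).zpow₀ _ (Or.inl (hy _))).mul ((ap _).zpow₀ _ (Or.inl (hy _)))).div
      (((ap _).mul (ap _)).mul (ap _)) (mul_ne_zero (mul_ne_zero (hy _) (hy _)) (hy _))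

/-- The leading term of `f` at the nodes is the value of its leading coefficient there: `limPoles`
serves as denominator, and it does not vanish at generic nodes. -/
lemma lead_nodePoint (hf : InATilde f) (hj : j = 4 ∨ j = 5) :
    Lead (fun x p => scaledFun α j f (nodePoint n N j μ x) p) (val (scaledFun α j f))
      (fun x => lcAt α j f (balanced n N x) (x 4) (x 5) μ) := by
  obtain ⟨hM, m, hA, -⟩ := hf
  set F := scaledFun α j f with hF
  have hexp : HasPExpansion F (pCoeff F) := by
    have h : ∃ a, HasPExpansion F a := (hM _ _ _).2
    rw [pCoeff, dif_pos h]
    exact h.choose_spec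
  have hG := GExp.of_hasPExpansion hexp
  obtain ⟨P, hP, hlin, hconv⟩ := hG.converges
  -- a point of the torus outside the zeros of `P`
  have rP : RatFun fun y => eval y P := ⟨P, 1, hP, one_ne_zero, fun x _ => by simp⟩
  obtain ⟨y, hy0, hy⟩ := (dense_of_mem_residual (torus_mem_residual.and rP.residual_ne_zero)).nonempty
  set zs : Fin n → ℂ := fun i => y (inl i)
  obtain ⟨hlinT, hconvT⟩ := (holoLines_shifted hA zs).extend hG.finite_le Subtype.val_injective hP
    hlin hconv (T := fixZ zs P * limPoles n 3 m) fun a ha =>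
      ((eval_limPoles m a).1 (right_ne_zero_of_mul (by rwa [map_mul] at ha))).2
  -- both factors of the new denominator are nonzero at generic nodes
  have hψ : IsMonomial (nodePoint n N j μ) := isMonomial_nodePoint
  have r1 : RatFun fun x => eval (nodePoint n N j μ x) (fixZ zs P) := by
    refine hψ.ratFun (nodeParam_ne_zero (n := n) (N := N) (j := j) fun a => hy0 (inr a)) ?_
    rw [eval_fixZ]
    convert hy using 3
    funext a
    rcases a with i | a
    exacts [rfl, nodePoint_nodeParam hj (fun a => hy0 _) a]
  have r2 : RatFun fun x => eval (nodePoint n N j μ x) (limPoles n 3 m) := by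
    have hx : ∀ i, (![1, 1, 1, 2, 1, 1] : ℂ⁶) i ≠ 0 := by
      intro i; fin_cases i <;> simp
    refine hψ.ratFun hx ((eval_limPoles _ _).2 ⟨fun i r _ => ?_, hψ.ne_zero hx⟩)
    rcases hj with rfl | rfl <;> simp [nodePoint, aPoint, balanced, node]
  obtain ⟨x₀, hx₀, hx₀'⟩ : ∃ x₀ : ℂ⁶, (∀ i, x₀ i ≠ 0) ∧
      eval (nodePoint n N j μ x₀) (fixZ zs P * limPoles n 3 m) ≠ 0 := by
    obtain ⟨x₀, h1, h2⟩ := (dense_of_mem_residual (torus_mem_residual.and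
      (r1.mul r2).residual_ne_zero)).nonempty
    exact ⟨x₀, h1, by rw [map_mul]; exact h2⟩
  obtain ⟨B, hB, R, hR, hev⟩ := hψ.gexp hG.finite_le hlinT hconvT hx₀ hx₀'
  have hle : ∀ i : {e // pCoeff F e ≠ 0}, val F ≤ i := fun i => by
    obtain ⟨L, -, hL⟩ := bddBelow_of_finite_le hG.finite_le
    exact csInf_le ⟨-L, fun e he => hL ⟨e, he⟩⟩ i.2
  refine ⟨_, B, _, hB, hle, R, hR, fun x hx => ?_⟩
  simp only [hev x hx]
  have hmem : ∀ i : {e // pCoeff F e ≠ 0}, i ∈ (hB.finite_le (val F)).toFinset ↔ (i : ℝ) = val F :=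
    fun i => by
      simp only [Set.Finite.mem_toFinset, Set.mem_ofPred_eq]
      exact ⟨fun h => le_antisymm h (hle i), fun h => h.le⟩
  show ratEval (pCoeff F (val F)) (nodePoint n N j μ x) = _
  by_cases h : pCoeff F (val F) = 0
  · rw [h, (ratEval_zero _).2, sum_eq_zero]
    intro i hi
    exact absurd ((hmem i).1 hi ▸ h) i.2
  · rw [sum_eq_single ⟨val F, h⟩]
    · exact fun i hi hne => absurd (Subtype.ext ((hmem i).1 hi)) hne
    · exact fun hne => absurd ((hmem ⟨val F, h⟩).2 rfl) hne

end Nodes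

/-! ### Restriction of meromorphic functions -/

section Restriction

variable {E : Type*} [NormedAddCommGroup E] [NormedSpace ℂ E]

/-- The derivative in the direction `v`. -/
def dirDeriv (v : E) (H : E → ℂ) : E → ℂ := fun y => fderiv ℂ H y v

lemma analyticOnNhd_dirDeriv {v : E} {H : E → ℂ} {V : Set E} (hH : AnalyticOnNhd ℂ H V) (k : ℕ) :
    AnalyticOnNhd ℂ ((dirDeriv v)^[k] H) V := by
  induction k with
  | zero => exact hH
  | succ k ih =>
    rw [Function.iterate_succ_apply']
    intro y hy
    exact ((ContinuousLinearMap.apply ℂ ℂ v).analyticAt _).comp (ih y hy).fderiv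

lemma iteratedDeriv_line {v : E} {H : E → ℂ} {V : Set E} (hV : IsOpen V)
    (hH : AnalyticOnNhd ℂ H V) (y : E) (k : ℕ) : ∀ z : ℂ, y + z • v ∈ V →
      iteratedDeriv k (fun z : ℂ => H (y + z • v)) z = (dirDeriv v)^[k] H (y + z • v) := by
  induction k with
  | zero => intro z _; simp
  | succ k ih =>
    intro z hz
    have hc : Continuous fun z : ℂ => y + z • v := by fun_prop
    have he : iteratedDeriv k (fun z : ℂ => H (y + z • v)) =ᶠ[𝓝 z]
        fun z => (dirDeriv v)^[k] H (y + z • v) := by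
      filter_upwards [hc.continuousAt.eventually_mem (hV.mem_nhds hz)] with a ha using ih a ha
    rw [iteratedDeriv_succ, he.deriv_eq, Function.iterate_succ_apply']
    have h1 : HasDerivAt (fun z : ℂ => y + z • v) v z := by
      simpa using ((hasDerivAt_id z).smul_const v).const_add y
    exact ((analyticOnNhd_dirDeriv hH k _ hz).differentiableAt.hasFDerivAt.comp_hasDerivAt z h1).deriv

/-- If `h` vanishes to order `k`, then the `k`-th coefficient of `f h` is `f(0)` times that of
`h`. -/
lemma iteratedDeriv_mul_of_zeros {f h : ℂ → ℂ} (hf : AnalyticAt ℂ f 0) (hh : AnalyticAt ℂ h 0)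
    {k : ℕ} (h0 : ∀ j < k, iteratedDeriv j h 0 = 0) :
    iteratedDeriv k (fun z => f z * h z) 0 = f 0 * iteratedDeriv k h 0 := by
  rw [iteratedDeriv_fun_mul hf.contDiffAt hh.contDiffAt, sum_eq_single 0]
  · simp
  · intro i hi hi0
    rw [h0 (k - i) (by have := mem_range.1 hi; omega), mul_zero]
  · simp

/-- A meromorphic function `F` that is analytic along the lines through `ψ(x)` with directions in
`V`, for generic `x`, is meromorphic on the image of `ψ`, provided that `ψ` is transversal to `V`.
The denominator of `F` may vanish on the image of `ψ`; then the quotient of the first Taylor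
coefficients, along a line, that do not vanish takes its place. -/
lemma exists_mero_comp {D E : Type*} [NormedAddCommGroup D] [NormedSpace ℂ D]
    [NormedAddCommGroup E] [NormedSpace ℂ E] [CompleteSpace E] {F : E → ℂ} {ψ : D → E} {Q : D → ℂ}
    {x₀ : D} {V : Set E} {G H : E → ℂ} (hG : AnalyticAt ℂ G (ψ x₀)) (hH : AnalyticAt ℂ H (ψ x₀))
    (hH0 : ∃ᶠ y in 𝓝 (ψ x₀), H y ≠ 0) (hF : ∀ᶠ y in 𝓝 (ψ x₀), H y ≠ 0 → F y = G y / H y)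
    (hψ : AnalyticAt ℂ ψ x₀) (hQ : AnalyticAt ℂ Q x₀) (hQ0 : ∃ᶠ x in 𝓝 x₀, Q x ≠ 0)
    (hline : ∀ᶠ x in 𝓝 x₀, Q x ≠ 0 → ∀ v ∈ V, AnalyticAt ℂ (fun z : ℂ => F (ψ x + z • v)) 0)
    (htrans : ∀ U ∈ 𝓝 x₀, ∀ᶠ y in 𝓝 (ψ x₀), ∃ x ∈ U, y - ψ x ∈ V) :
    ∃ G' H' : D → ℂ, AnalyticAt ℂ G' x₀ ∧ AnalyticAt ℂ H' x₀ ∧ (∃ᶠ x in 𝓝 x₀, H' x ≠ 0) ∧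
      ∀ᶠ x in 𝓝 x₀, H' x ≠ 0 → F (ψ x) = G' x / H' x := by
  classical
  obtain ⟨r, hr, hB⟩ := eventually_nhds_iff_ball.1
    (hG.eventually_analyticAt.and (hH.eventually_analyticAt.and hF))
  have hGB : AnalyticOnNhd ℂ G (ball (ψ x₀) r) := fun y hy => (hB y hy).1
  have hHB : AnalyticOnNhd ℂ H (ball (ψ x₀) r) := fun y hy => (hB y hy).2.1
  obtain ⟨δ, hδ, hψB⟩ := eventually_nhds_iff_ball.1 ((hψ.continuousAt.eventually_mem
    (ball_mem_nhds (ψ x₀) (by positivity : 0 < r / 6))).and hψ.eventually_analyticAt)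
  have hψr : ∀ x ∈ ball x₀ δ, ψ x ∈ ball (ψ x₀) r := fun x hx =>
    ball_subset_ball (by linarith) (hψB x hx).1
  obtain ⟨y₁, hy₁, ⟨x₁, hx₁, hv⟩, hy₁B⟩ := (hH0.and_eventually
    ((htrans _ (ball_mem_nhds x₀ hδ)).and
      (ball_mem_nhds (ψ x₀) (by positivity : 0 < r / 6)))).exists
  set v := y₁ - ψ x₁ with hvdef
  set K : ℕ → E → ℂ := fun k => (dirDeriv v)^[k] H with hK
  have hKan : ∀ k, AnalyticOnNhd ℂ (fun x => K k (ψ x)) (ball x₀ δ) := fun k x hx =>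
    (analyticOnNhd_dirDeriv hHB k _ (hψr x hx)).comp_of_eq (hψB x hx).2 rfl
  have hzero : ∀ k, (¬∃ᶠ x in 𝓝 x₀, K k (ψ x) ≠ 0) → ∀ x ∈ ball x₀ δ, K k (ψ x) = 0 := by
    intro k hk
    exact (hKan k).eqOn_zero_of_preconnected_of_eventuallyEq_zero
      (convex_ball x₀ δ).isPreconnected (mem_ball_self hδ)
      ((not_frequently.1 hk).mono fun x hx => not_not.1 hx)
  have hex : ∃ k, ∃ᶠ x in 𝓝 x₀, K k (ψ x) ≠ 0 := by
    by_contra! hall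
    have hd : DifferentiableOn ℂ (fun z : ℂ => H (ψ x₁ + z • v)) (ball 0 2) := by
      intro z hz
      rw [mem_ball_zero_iff] at hz
      have hmem : ψ x₁ + z • v ∈ ball (ψ x₀) r := by
        have a1 := mem_ball_iff_norm.1 (hψB x₁ hx₁).1
        have a2 := mem_ball_iff_norm.1 hy₁B
        have a3 : ‖v‖ ≤ r / 3 := by
          calc ‖v‖ = ‖(y₁ - ψ x₀) - (ψ x₁ - ψ x₀)‖ := by rw [sub_sub_sub_cancel_right]
            _ ≤ _ := (norm_sub_le _ _).trans (by linarith)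
        rw [mem_ball_iff_norm, add_sub_right_comm]
        have a4 : ‖z • v‖ ≤ 2 * (r / 3) := by
          rw [norm_smul]; exact mul_le_mul hz.le a3 (norm_nonneg _) (by norm_num)
        exact (norm_add_le _ _).trans_lt (by linarith)
      exact ((hHB _ hmem).differentiableAt.comp z (by fun_prop)).differentiableWithinAt
    have ht := Complex.taylorSeries_eq_on_ball' (z := 1) (by simp) hd
    have h0 : ∀ k, iteratedDeriv k (fun z : ℂ => H (ψ x₁ + z • v)) 0 = 0 := fun k => by
      rw [iteratedDeriv_line isOpen_ball hHB _ _ _ (by simpa using hψr x₁ hx₁), zero_smul,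
        add_zero]
      exact hzero k (by simpa using hall k) x₁ hx₁
    simp only [h0, mul_zero, zero_mul, tsum_zero, one_smul] at ht
    exact hy₁ (by rw [ht, hvdef, add_sub_cancel])
  set k := Nat.find hex with hk
  have hkz : ∀ j < k, ∀ x ∈ ball x₀ δ, K j (ψ x) = 0 := fun j hj =>
    hzero j (Nat.find_min hex hj)
  have hx₀ := mem_ball_self (x := x₀) hδ
  refine ⟨fun x => Q x * (dirDeriv v)^[k] G (ψ x), fun x => Q x * K k (ψ x),
    hQ.fun_mul ((analyticOnNhd_dirDeriv hGB k _ (hψr x₀ hx₀)).comp_of_eq hψ rfl),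
    hQ.fun_mul (hKan k x₀ hx₀), frequently_mul_ne_zero hQ (hKan k x₀ hx₀) hQ0 (Nat.find_spec hex), ?_⟩
  filter_upwards [hline, ball_mem_nhds x₀ hδ] with x hx hxB hne
  have hf := hx (left_ne_zero_of_mul hne) v hv
  have hx0 : ψ x + (0 : ℂ) • v ∈ ball (ψ x₀) r := by simpa using hψr x hxB
  have hl : AnalyticAt ℂ (fun z : ℂ => ψ x + z • v) 0 := by fun_prop
  have hh : AnalyticAt ℂ (fun z : ℂ => H (ψ x + z • v)) 0 := (hHB _ hx0).comp_of_eq hl rfl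
  have hg : AnalyticAt ℂ (fun z : ℂ => G (ψ x + z • v)) 0 := (hGB _ hx0).comp_of_eq hl rfl
  have hit : ∀ j, iteratedDeriv j (fun z : ℂ => H (ψ x + z • v)) 0 = K j (ψ x) := fun j => by
    rw [iteratedDeriv_line isOpen_ball hHB _ _ _ hx0, zero_smul, add_zero]
  have hfh : (fun z : ℂ => F (ψ x + z • v) * H (ψ x + z • v)) =ᶠ[𝓝 0]
      fun z : ℂ => G (ψ x + z • v) := by
    refine ((hf.fun_mul hh).frequently_eq_iff_eventually_eq hg).1 (Eventually.frequently ?_)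
    rcases hh.eventually_eq_zero_or_eventually_ne_zero with h | h
    · refine absurd ?_ (right_ne_zero_of_mul hne)
      rw [← hit k, EventuallyEq.iteratedDeriv_eq (g := fun _ => 0) k h]
      simp
    · filter_upwards [h, nhdsWithin_le_nhds (hl.continuousAt.eventually_mem
        (isOpen_ball.mem_nhds hx0))] with z hz hzB
      rw [(hB _ hzB).2.2 hz, div_mul_cancel₀ _ hz]
  have key := iteratedDeriv_mul_of_zeros hf hh (k := k) fun j hj => by rw [hit, hkz j hj x hxB]
  rw [hfh.iteratedDeriv_eq, iteratedDeriv_line isOpen_ball hGB _ _ _ hx0, hit, zero_smul,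
    add_zero] at key
  rw [key, mul_div_mul_left _ _ (left_ne_zero_of_mul hne), mul_div_cancel_right₀ _
    (right_ne_zero_of_mul hne)]

end Restriction

section NodeMero

variable {n N : ℕ} {α : Fin 6 → ℝ} {μ : Fin n → ℕ} {j : Fin 6} {f : ParamFun n 3}

/-- The pole factor does not vanish at generic nodes. -/
lemma residual_poleFactor_ne_zero (n N m : ℕ) (μ : Fin n → ℕ) (hj : j = 4 ∨ j = 5) {p a b : ℂ}
    (hp : p ≠ 0) (hp1 : ‖p‖ < 1) (ha : a ≠ 0) (hb : b ≠ 0) :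
    ∀ᶠ x in residual ℂ⁶, poleFactor n m (balanced n N x j * b) (x 4) p
      (fun i => node (balanced n N x 0) (x 4) (x 5) μ i * a) ≠ 0 := by
  have hz : ∀ i, MDeg 0 1 fun x => node (balanced n N x 0) (x 4) (x 5) μ i := fun i =>
    (((balanced_mdeg_zero n N 0).mul ((mdeg_coord 0 5).pow _)).mul ((mdeg_coord 0 4).pow _)).congr
      (by simp) fun _ _ => rfl
  have hu : MDeg 0 0 fun x => balanced n N x j :=
    (balanced_mdeg_zero n N j).congr (by rcases hj with rfl | rfl <;> simp) fun _ _ => rfl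
  have hq : ∀ r : ℕ, MDeg 0 0 fun x => x 4 ^ r := fun r =>
    ((mdeg_coord 0 4).pow r).congr (by simp) fun _ _ => rfl
  have key : ∀ i, ∀ r : ℕ, ∀ᶠ x in residual ℂ⁶,
      theta p (x 4 ^ (r + 1) * node (balanced n N x 0) (x 4) (x 5) μ i / balanced n N x j *
        (p * a / b)) ≠ 0 ∧
      theta p (x 4 ^ (r + 1) / (node (balanced n N x 0) (x 4) (x 5) μ i * balanced n N x j) *
        (p / (a * b))) ≠ 0 := fun i r =>
    ((((hq _).mul (hz i)).div hu).theta_ne_zero (by simp) (div_ne_zero (mul_ne_zero hp ha) hb)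
      hp hp1).and (((hq _).div ((hz i).mul hu)).theta_ne_zero (by simp)
        (div_ne_zero hp (mul_ne_zero ha hb)) hp hp1)
  filter_upwards [eventually_all.2 fun i => (eventually_all_finset (range m)).2
    fun r _ => key i r] with x hx
  refine prod_ne_zero_iff.2 fun i _ => prod_ne_zero_iff.2 fun r hr => ?_
  obtain ⟨h1, h2⟩ := hx i r hr
  refine mul_ne_zero ?_ ?_
  · convert h1 using 2
    simp only [pow_succ, div_eq_mul_inv, mul_inv]
    ring
  · convert h2 using 2
    simp only [pow_succ, div_eq_mul_inv, mul_inv]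
    ring

/-- The values of `f` at the nodes are meromorphic functions of the parameters. -/
lemma mero_nodePoint (hf : InATilde f) (hj : j = 4 ∨ j = 5) {p : ℂ} (hp : 0 < ‖p‖)
    (hp1 : ‖p‖ < 1) :
    IsMeroOn (fun x => scaledFun α j f (nodePoint n N j μ x) p) (torus (Fin 6)) := by
  obtain ⟨hM, m, hA, -⟩ := hf
  have hp0 : p ≠ 0 := norm_pos_iff.1 hp
  have hψ : IsMonomial (nodePoint n N j μ) := isMonomial_nodePoint
  have hψan : ∀ x ∈ torus (Fin 6), ∀ a, AnalyticAt ℂ (fun x => nodePoint n N j μ x a) x :=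
    fun x hx a => (hψ a).choose_spec.analyticOnNhd x hx
  have a0 := ppow_ne_zero hp0 (α 0)
  have aj := ppow_ne_zero hp0 (α j)
  intro x₀ hx₀
  obtain ⟨G, H, hG, hH, hH0, hF⟩ := (hM (fun _ => α 0) (α j) ![α 0, α 2, α 3]).1 p hp hp1
    (nodePoint n N j μ x₀) (hψ.ne_zero hx₀)
  refine exists_mero_comp (F := fun y => scaledFun α j f y p) (V := {v | ∀ a, v (inr a) = 0})
    (Q := fun x => poleFactor n m (balanced n N x j * ppow p (α j)) (x 4) p
      (fun i => node (balanced n N x 0) (x 4) (x 5) μ i * ppow p (α 0)))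
    hG hH hH0 hF (analyticAt_pi_iff.2 (hψan x₀ hx₀)) ?_
    (frequently_of_residual (residual_poleFactor_ne_zero n N m μ hj hp0 hp1 a0 aj) x₀) ?_ ?_
  · have hne := hψ.ne_zero hx₀
    exact analyticAt_poleFactor_arg hp1 hp0
      (fun i => (hψan x₀ hx₀ (inl i)).fun_mul analyticAt_const)
      ((hψan x₀ hx₀ (inr (inr 0))).fun_mul analyticAt_const)
      (hψan x₀ hx₀ (inr (inr 1))) (fun i => mul_ne_zero (hne (inl i)) a0)
      (mul_ne_zero (hne (inr (inr 0))) aj) (hne (inr (inr 1)))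
  · filter_upwards [isOpen_torus.mem_nhds hx₀] with x hx hQ v hv
    set y := nodePoint n N j μ x with hy
    have hy0 : ∀ a, y a ≠ 0 := hψ.ne_zero hx
    have hfun : (fun z : ℂ => scaledFun α j f (y + z • v) p) = fun z : ℂ =>
        f (fun i => (y (inl i) + z * v (inl i)) * ppow p (α 0))
          (y (inr (inr 0)) * ppow p (α j))
          (fun k => y (inr (inl k)) * ppow p (![α 0, α 2, α 3] k))
          (y (inr (inr 1))) (y (inr (inr 2))) p := by
      funext z
      simp [scaledFun, shifted, show ∀ a, v (inr a) = 0 from hv]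
    rw [hfun]
    have hab := hA (y (inr (inr 0)) * ppow p (α j))
      (fun k => y (inr (inl k)) * ppow p (![α 0, α 2, α 3] k)) (y (inr (inr 1)))
      (y (inr (inr 2))) p (mul_ne_zero (hy0 _) aj)
      (fun k => mul_ne_zero (hy0 _) (ppow_ne_zero hp0 _)) (hy0 _) (hy0 _) hp hp1
    have han := hab.analyticAt (mul_ne_zero (hy0 _) aj) (hy0 _) hp0 hp1
      (z := fun i => y (inl i) * ppow p (α 0)) (fun i => mul_ne_zero (hy0 _) a0) hQ
    have hlin : AnalyticAt ℂ (fun z : ℂ => fun i =>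
        (y (inl i) + z * v (inl i)) * ppow p (α 0)) 0 :=
      analyticAt_pi_iff.2 fun i => by fun_prop
    exact han.comp_of_eq hlin (by simp)
  · intro U hU
    have hne := hψ.ne_zero hx₀
    have hc : ContinuousAt (nodeParam n N j) (nodePoint n N j μ x₀) :=
      continuousAt_nodeParam fun a => hne _
    filter_upwards [hc.eventually_mem (by rwa [nodeParam_nodePoint hj hx₀]),
      isOpen_torus.mem_nhds (show nodePoint n N j μ x₀ ∈ torus _ from hne)] with y hyU hy
    refine ⟨_, hyU, fun a => ?_⟩
    rw [Pi.sub_apply, nodePoint_nodeParam hj (fun a => hy _) a, sub_self]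

end NodeMero

/-! ### The limit of the bilinear form -/

section ForGeneric

variable {σ : Type} {P Q : (σ → ℂ) → Prop}

/-- `P` holds at the points of the torus outside the zeros of some nonzero polynomial. -/
def ForGeneric (P : (σ → ℂ) → Prop) : Prop :=
  ∃ R : ℂ[σ], R ≠ 0 ∧ ∀ x ∈ goodSet R, P x

lemma ForGeneric.and (hP : ForGeneric P) (hQ : ForGeneric Q) : ForGeneric fun x => P x ∧ Q x := by
  obtain ⟨R, hR, h⟩ := hP
  obtain ⟨S, hS, h'⟩ := hQ
  refine ⟨R * S, mul_ne_zero hR hS, fun x hx => ?_⟩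
  rw [goodSet_mul] at hx
  exact ⟨h x hx.1, h' x hx.2⟩

lemma ForGeneric.forall {κ : Type*} (s : Finset κ) {P : κ → (σ → ℂ) → Prop}
    (h : ∀ k ∈ s, ForGeneric (P k)) : ForGeneric fun x => ∀ k ∈ s, P k x := by
  classical
  induction s using Finset.induction_on with
  | empty => exact ⟨1, one_ne_zero, by simp⟩
  | insert i s hi ih =>
    simp only [forall_mem_insert]
    exact (h i (mem_insert_self i s)).and (ih fun j hj => h j (mem_insert_of_mem hj))

lemma RatFun.forGeneric {φ : (σ → ℂ) → ℂ} (hφ : RatFun φ) : ForGeneric fun x => φ x ≠ 0 := by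
  obtain ⟨N, D, hN, hD, h⟩ := hφ
  refine ⟨N * D, mul_ne_zero hN hD, fun x hx => ?_⟩
  rw [goodSet_mul] at hx
  rw [h x hx.2]
  exact div_ne_zero hx.1.2 hx.2.2

end ForGeneric

section Regular

variable {n N : ℕ} {α : Fin 6 → ℝ} {m : ℕ} (l : Fin m → ℕ) {φ : ℂ⁶ → ℂ} {c : Fin 6} {d : ℤ}

lemma forGeneric_boxProd (a b : Fin m → ℕ → ℤ)
    (hk : ∀ i, ∀ j < l i, ∃ c d, d ≠ 0 ∧ MDeg c d fun x => x 4 ^ a i j * x 5 ^ b i j * φ x) :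
    ForGeneric fun x => boxProd oneSub (x 4) (x 5) l a b (φ x) ≠ 0 := by
  have : ForGeneric fun x : ℂ⁶ => ∀ i ∈ univ, ∀ j ∈ range (l i),
      1 - x 4 ^ a i j * x 5 ^ b i j * φ x ≠ 0 :=
    .forall _ fun i _ => .forall _ fun j hj => by
      obtain ⟨c, d, hd, hm⟩ := hk i j (mem_range.1 hj)
      exact (hm.ratFun_const_sub hd 1).forGeneric
  obtain ⟨R, hR, h⟩ := this
  exact ⟨R, hR, fun x hx => prod_ne_zero_iff.2 fun i hi => prod_ne_zero_iff.2
    fun j hj => h x hx i hi j hj⟩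

lemma forGeneric_C0 (hm : MDeg c d φ) (hd : d ≠ 0) (hc : c ≠ 4 ∧ c ≠ 5) :
    ForGeneric fun x => C0 oneSub (x 4) (x 5) l (φ x) ≠ 0 :=
  forGeneric_boxProd l (fun _ j => (j : ℤ)) (fun i _ => -(i : ℤ)) fun i j _ => ⟨c, d, hd,
    ((((mdeg_coord c 4).zpow j).mul ((mdeg_coord c 5).zpow (-(i : ℤ)))).mul hm).congr
      (by simp [hc.1, hc.2]) fun _ _ => rfl⟩

lemma forGeneric_Cp (hm : MDeg c d φ) (hd : d ≠ 0) (hc : c ≠ 4 ∧ c ≠ 5) :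
    ForGeneric fun x => Cp oneSub (x 4) (x 5) l (φ x) ≠ 0 :=
  forGeneric_boxProd l (fun i j => (l i : ℤ) + (j + 1) - 1)
    (fun i j => 2 - (colLen l j : ℤ) - (i + 1)) fun i j _ => ⟨c, d, hd,
    ((((mdeg_coord c 4).zpow _).mul ((mdeg_coord c 5).zpow _)).mul hm).congr
      (by simp [hc.1, hc.2]) fun _ _ => rfl⟩

/-- Any two of `t₂, …, t₅` are independent. -/
lemma mdeg_pair {r s : Fin 6} (hr : 2 ≤ r) (hrs : r < s) : ∃ c : Fin 6, (c ≠ 4 ∧ c ≠ 5) ∧ ∃ d ≠ 0,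
    MDeg c d fun x => x 4 / (balanced n N x r * balanced n N x s) := by
  have h1 := (mdeg_q (c := 1) (by decide)).div
    ((balanced_mdeg_one n N r).mul (balanced_mdeg_one n N s))
  have h2 := (mdeg_q (c := 2) (by decide)).div
    ((balanced_mdeg_two n N r).mul (balanced_mdeg_two n N s))
  by_cases h : (r = 2 ∧ s = 5) ∨ (r = 3 ∧ s = 4)
  · refine ⟨2, by decide, _, ?_, h2⟩
    clear h1 h2
    revert r s; decide
  · refine ⟨1, by decide, _, ?_, h1⟩
    clear h1 h2
    revert r s; decide

lemma forGeneric_limWeightRegular (n N : ℕ) (α : Fin 6 → ℝ) :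
    ForGeneric fun x => ∀ μ ∈ boxPartitions n N,
      LimWeightRegular n N α (balanced n N x) (x 4) (x 5) μ := by
  refine .forall _ fun μ hμ => ?_
  have hanti := (mem_boxPartitions.1 hμ).2
  have hc0 : (0 : Fin 6) ≠ 4 ∧ (0 : Fin 6) ≠ 5 := by decide
  have m0 := balanced_mdeg_zero n N 0
  have m1 := balanced_mdeg_zero n N 1
  have ms : ∀ k : ℤ, MDeg 0 0 fun x => x 5 ^ k := fun k => mdeg_t_zpow (by decide) _
  have mq : MDeg 0 0 fun x => x 4 := mdeg_q (by decide)
  have g1 : ForGeneric fun x : ℂ⁶ => Cm oneSub (x 4) (x 5) μ (x 4) ≠ 0 :=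
    forGeneric_boxProd μ (fun i j => (μ i : ℤ) - (j + 1)) (fun i j => (colLen μ j : ℤ) - (i + 1))
      fun i j hj => ⟨4, (μ i : ℤ) - (j + 1) + 1, by omega, (((mdeg_coord 4 4).zpow _).mul
        ((mdeg_coord 4 5).zpow _)).mul (mdeg_coord 4 4) |>.congr (by simp) fun _ _ => rfl⟩
  have g2 : ForGeneric fun x : ℂ⁶ => Cm oneSub (x 4) (x 5) μ (x 5) ≠ 0 :=
    forGeneric_boxProd μ (fun i j => (μ i : ℤ) - (j + 1)) (fun i j => (colLen μ j : ℤ) - (i + 1))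
      fun i j hj => ⟨5, (colLen μ j : ℤ) - (i + 1) + 1, by
        have := (lt_colLen_iff hanti j i).2 hj
        omega, (((mdeg_coord 5 4).zpow _).mul
        ((mdeg_coord 5 5).zpow _)).mul (mdeg_coord 5 5) |>.congr (by simp) fun _ _ => rfl⟩
  have g3 : ForGeneric fun x : ℂ⁶ => ∀ r ∈ Ici (2 : Fin 6),
      ∀ s ∈ (Ioi r).filter (fun s => α r + α s = 1),
        C0 oneSub (x 4) (x 5) (rect n N) (x 4 / (balanced n N x r * balanced n N x s)) ≠ 0 :=
    .forall _ fun r hr => .forall _ fun s hs => by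
      obtain ⟨c, hc, d, hd, h⟩ := mdeg_pair (n := n) (N := N) (mem_Ici.1 hr)
        (mem_Ioi.1 (mem_filter.1 hs).1)
      exact forGeneric_C0 _ h hd hc
  have g4 : ForGeneric fun x : ℂ⁶ => ∀ r ∈ Ici (2 : Fin 6), C0 oneSub (x 4) (x 5) μ
      (x 4 * x 5 ^ ((n : ℤ) - 1) * balanced n N x 0 / balanced n N x r) ≠ 0 :=
    .forall _ fun r hr => forGeneric_C0 μ
      (((mq.mul (ms _)).mul m0).div (balanced_mdeg_zero n N r)) (by
        rw [mem_Ici] at hr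
        revert r; decide) hc0
  have g5 : ForGeneric fun x : ℂ⁶ => C0 oneSub (x 4) (x 5) μ
      (x 4 * x 5 ^ ((n : ℤ) - 2) * balanced n N x 0 ^ 2) ≠ 0 :=
    forGeneric_C0 μ ((mq.mul (ms _)).mul (m0.pow 2)) (by simp) hc0
  have g6 : ForGeneric fun x : ℂ⁶ => C0 oneSub (x 4) (x 5) μ
      (x 4 * x 5 ^ ((n : ℤ) - 1) * balanced n N x 0 / balanced n N x 1) ≠ 0 :=
    forGeneric_C0 μ (((mq.mul (ms _)).mul m0).div m1) (by simp) hc0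
  have g7 : ForGeneric fun x : ℂ⁶ => Cp oneSub (x 4) (x 5) μ
      ((x 5 ^ ((n : ℤ) - 1)) ^ 2 * balanced n N x 0 ^ 2) ≠ 0 :=
    forGeneric_Cp μ (((ms _).pow 2).mul (m0.pow 2)) (by simp) hc0
  have g8 : ForGeneric fun x : ℂ⁶ => Cp oneSub (x 4) (x 5) μ
      (x 4 * x 5 ^ (2 * (n : ℤ) - 3) * balanced n N x 0 ^ 2) ≠ 0 :=
    forGeneric_Cp μ ((mq.mul (ms _)).mul (m0.pow 2)) (by simp) hc0
  have g9 : ForGeneric fun x : ℂ⁶ => C0 oneSub (x 4) (x 5) (rect n N)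
      (balanced n N x 1 / balanced n N x 0) ≠ 0 := forGeneric_C0 _ (m1.div m0) (by simp) hc0
  have g10 : ForGeneric fun x : ℂ⁶ => C0 oneSub (x 4) (x 5) (rect n N)
      (x 4 ^ (1 - (N : ℤ)) * x 5 ^ ((n : ℤ) - 1) * balanced n N x 0 / balanced n N x 1) ≠ 0 :=
    forGeneric_C0 _ ((((mq.zpow _).mul (ms _)).mul m0).div m1) (by simp) hc0
  obtain ⟨R, hR, h⟩ := g1.and (g2.and (g3.and (g4.and (g5.and (g6.and (g7.and (g8.and
    (g9.and g10))))))))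
  refine ⟨R, hR, fun x hx => ?_⟩
  obtain ⟨h1, h2, h3, h4, h5, h6, h7, h8, h9, h10⟩ := h x hx
  exact ⟨h1, h2, prod_ne_zero_iff.2 fun r hr => prod_ne_zero_iff.2 fun s hs =>
    h3 r hr s hs, fun r hr _ => h4 r (mem_Ici.2 hr), fun _ => ⟨h5, h6, h7, h8⟩,
    fun _ => h9, fun _ => h10⟩

end Regular

section Form

variable {n N : ℕ} {α : Fin 6 → ℝ} {f g : ParamFun n 3}

lemma Admissible.sum_min (hα : Admissible α) :
    min (α 0 + α 2) 0 + min (α 0 + α 3) 0 + min (α 0 + α 4) 0 + min (α 0 + α 5) 0 = 2 * α 0 := by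
  have e : (Ici (2 : Fin 6)) = {2, 3, 4, 5} := by decide
  have h : ∀ a : ℝ, (if a < 0 then a else 0) = min a 0 := fun a => by
    split_ifs with h
    exacts [(min_eq_left h.le).symm, (min_eq_right (not_lt.1 h)).symm]
  rw [← hα.vanish, sum_filter, e]
  simp [h, add_assoc]

lemma limParams_balanced (n N : ℕ) {x : ℂ⁶} (hx : ∀ i, x i ≠ 0) :
    LimParams n N (balanced n N x) (x 4) (x 5) :=
  ⟨balanced_ne_zero n N hx, hx 4, hx 5, balanced_bal₁ n N hx, balanced_bal₂ n N hx⟩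

lemma weight_leadPair_zero (hα : Admissible α) {μ : Fin n → ℕ} (hμ : μ ∈ boxPartitions n N) :
    LeadPair (fun x p => weight n N (scaled α (balanced n N x) p) (x 4) (x 5) p μ) 0
      (fun x => leadWeight n N α (balanced n N x) (x 4) (x 5) μ) :=
  (weight_leadPair hα.expBounds hμ).congr_val (by rw [hα.sum_min, sub_self, mul_zero])

lemma scaledForm_eq (f g : ParamFun n 3) (x : ℂ⁶) (p : ℂ) : scaledForm n N α f g x p =
    ∑ μ ∈ boxPartitions n N, scaledFun α 4 f (nodePoint n N 4 μ x) p *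
      scaledFun α 5 g (nodePoint n N 5 μ x) p *
      weight n N (scaled α (balanced n N x) p) (x 4) (x 5) p μ := by
  simp only [shifted_nodePoint]
  rfl

lemma zero_mem_boxPartitions (n N : ℕ) : 0 ∈ boxPartitions n N :=
  mem_boxPartitions.2 ⟨fun _ => Nat.zero_le _, antitone_const⟩

/-- The leading term of the bilinear form is the sum of the products of the leading terms. -/
lemma lead_scaledForm (hα : Admissible α) (hf : InATilde f) (hg : InATilde g) :
    Lead (scaledForm n N α f g) (val (scaledFun α 4 f) + val (scaledFun α 5 g)) fun x =>
      ∑ μ ∈ boxPartitions n N, lcAt α 4 f (balanced n N x) (x 4) (x 5) μ *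
        lcAt α 5 g (balanced n N x) (x 4) (x 5) μ *
        leadWeight n N α (balanced n N x) (x 4) (x 5) μ :=
  (Lead.sum ⟨_, zero_mem_boxPartitions n N⟩ fun μ hμ =>
    ((lead_nodePoint (N := N) (μ := μ) hf (Or.inl rfl)).mul (lead_nodePoint hg (Or.inr rfl))).mul
      (weight_leadPair_zero hα hμ).lead |>.congr 1 one_ne_zero (fun _ _ _ _ _ => rfl)
        (fun _ _ => rfl) (add_zero _)).congr 1 one_ne_zero
      (fun x _ p _ _ => (scaledForm_eq f g x p).symm) (fun _ _ => rfl) rfl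

lemma inM_scaledForm (hα : Admissible α) (hf : InATilde f) (hg : InATilde g) :
    InM (scaledForm n N α f g) := by
  refine ⟨fun p hp hp1 => ?_, (lead_scaledForm hα hf hg).exists_hasPExpansion⟩
  simp only [scaledForm_eq]
  exact IsMeroOn.sum _ fun μ hμ => ((mero_nodePoint hf (Or.inl rfl) hp hp1).mul
    (mero_nodePoint hg (Or.inr rfl) hp hp1)).mul ((weight_leadPair_zero hα hμ).mero p hp hp1)

lemma tendsto_scaledForm (hα : Admissible α) (hf : InATilde f) (hg : InATilde g) :
    ∃ R : ℂ[Fin 6], R ≠ 0 ∧ ∀ K : Set ℂ⁶, IsCompact K →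
      (∀ x ∈ K, (∀ i, x i ≠ 0) ∧ eval x R ≠ 0) →
      (∀ x ∈ K, ∀ μ ∈ boxPartitions n N,
        LimWeightRegular n N α (balanced n N x) (x 4) (x 5) μ) ∧
      TendstoUniformlyOn
        (fun (p : ℂ) (x : ℂ⁶) =>
          ppow p (-val (scaledFun α 4 f) - val (scaledFun α 5 g)) * scaledForm n N α f g x p)
        (fun x : ℂ⁶ => ∑ μ ∈ boxPartitions n N,
          lcAt α 4 f (balanced n N x) (x 4) (x 5) μ * lcAt α 5 g (balanced n N x) (x 4) (x 5) μ *
            limWeight n N α (balanced n N x) (x 4) (x 5) μ)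
        (𝓝[≠] 0) K := by
  obtain ⟨R, hR, h⟩ := (lead_scaledForm (N := N) hα hf hg).tendsto
  obtain ⟨S, hS, h'⟩ := forGeneric_limWeightRegular n N α
  refine ⟨R * S, mul_ne_zero hR hS, fun K hK hKR => ?_⟩
  have hK' : K ⊆ goodSet R ∩ goodSet S := fun x hx => by
    rw [← goodSet_mul]; exact hKR x hx
  refine ⟨fun x hx => h' x (hK' hx).2, ?_⟩
  have := h K hK fun x hx => (hK' hx).1
  rw [neg_add'] at this
  refine this.congr_right fun x hx => sum_congr rfl fun μ hμ => ?_
  rw [leadWeight_eq_limWeight (limParams_balanced n N (hKR x hx).1) hα (mem_boxPartitions.1 hμ).2]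

end Form

/-! ### The sum of the limiting weights -/

section Continuity

variable {X : Type*} [TopologicalSpace X] {x₀ : X} {τ : X → ℂ⁶} {q t φ : X → ℂ} {n N : ℕ}
  {α : Fin 6 → ℝ}

lemma continuousAt_boxProd {m : ℕ} (l : Fin m → ℕ) (a b : Fin m → ℕ → ℤ) (hq : ContinuousAt q x₀)
    (ht : ContinuousAt t x₀) (hq0 : q x₀ ≠ 0) (ht0 : t x₀ ≠ 0) (hφ : ContinuousAt φ x₀) :
    ContinuousAt (fun x => boxProd oneSub (q x) (t x) l a b (φ x)) x₀ :=
  tendsto_finsetProd _ fun _ _ => tendsto_finsetProd _ fun _ _ =>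
    continuousAt_const.sub (((hq.zpow₀ _ (Or.inl hq0)).mul (ht.zpow₀ _ (Or.inl ht0))).mul hφ)

/-- The limiting weights depend continuously on the parameters where no denominator vanishes. -/
lemma continuousAt_limWeight (hα : Admissible α) {μ : Fin n → ℕ}
    (hτ : ∀ r, ContinuousAt (fun x => τ x r) x₀)
    (hq : ContinuousAt q x₀) (ht : ContinuousAt t x₀) (hτ0 : ∀ r, τ x₀ r ≠ 0) (hq0 : q x₀ ≠ 0)
    (ht0 : t x₀ ≠ 0) (hR : LimWeightRegular n N α (τ x₀) (q x₀) (t x₀) μ) :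
    ContinuousAt (fun x => limWeight n N α (τ x) (q x) (t x) μ) x₀ := by
  have hqz : ∀ k : ℤ, ContinuousAt (fun x => q x ^ k) x₀ := fun k => hq.zpow₀ k (Or.inl hq0)
  have htz : ∀ k : ℤ, ContinuousAt (fun x => t x ^ k) x₀ := fun k => ht.zpow₀ k (Or.inl ht0)
  have hC0 : ∀ {m : ℕ} (l : Fin m → ℕ) {φ : X → ℂ}, ContinuousAt φ x₀ →
      ContinuousAt (fun x => C0 oneSub (q x) (t x) l (φ x)) x₀ := fun l _ h =>
    continuousAt_boxProd l (fun _ j => (j : ℤ)) (fun i _ => -(i : ℤ)) hq ht hq0 ht0 h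
  have hCm : ∀ {φ : X → ℂ}, ContinuousAt φ x₀ →
      ContinuousAt (fun x => Cm oneSub (q x) (t x) μ (φ x)) x₀ := fun h =>
    continuousAt_boxProd μ _ _ hq ht hq0 ht0 h
  have hCp : ∀ {φ : X → ℂ}, ContinuousAt φ x₀ →
      ContinuousAt (fun x => Cp oneSub (q x) (t x) μ (φ x)) x₀ := fun h =>
    continuousAt_boxProd μ _ _ hq ht hq0 ht0 h
  have hpair : ContinuousAt (fun x => 1 / pairProd n N α (τ x) (q x) (t x)) x₀ :=
    continuousAt_const.div (tendsto_finsetProd _ fun r _ => tendsto_finsetProd _ fun s _ =>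
      hC0 _ (hq.div ((hτ r).mul (hτ s)) (mul_ne_zero (hτ0 r) (hτ0 s)))) hR.2.2.1
  obtain ⟨hm1, hm2, -, hr, h5, h6, h7⟩ := hR
  have hs := htz ((n : ℤ) - 1)
  have hs0 : t x₀ ^ ((n : ℤ) - 1) ≠ 0 := zpow_ne_zero _ ht0
  have hsq := (hs.fun_pow 2).fun_mul ((hτ 0).fun_pow 2)
  have hm := (hCm hq).fun_mul (hCm ht)
  have hm0 := mul_ne_zero hm1 hm2
  have hN := (hC0 μ (ht.fun_pow n)).fun_mul (hC0 μ (hqz (-(N : ℤ))))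
  have hnum := (hC0 (twiceSq μ) ((hq.fun_mul (hs.fun_pow 2)).fun_mul
    ((hτ 0).fun_pow 2))).fun_mul hN
  have hc₁ := fun r => hC0 μ ((hs.fun_mul (hτ 0)).fun_mul (hτ r))
  have hqs := (hq.fun_mul hs).fun_mul (hτ 0)
  have hqr := fun r => hqs.div₀ (hτ r) (hτ0 r)
  have hc₂ := fun r => hC0 μ (hqr r)
  have hN₁ := fun r => hC0 (rect n N) ((hs.fun_mul (hτ 1)).fun_mul (hτ r))
  have hN₂ := fun r => hC0 (rect n N)
    ((hqz (1 - (N : ℤ))).div₀ ((hτ 1).fun_mul (hτ r)) (mul_ne_zero (hτ0 1) (hτ0 r)))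
  have hden := (((hC0 μ ((hq.fun_mul (htz ((n : ℤ) - 2))).fun_mul ((hτ 0).fun_pow 2))).fun_mul
    (hc₂ 1)).fun_mul hm).fun_mul ((hCp hsq).fun_mul
      (hCp ((hq.fun_mul (htz (2 * (n : ℤ) - 3))).fun_mul ((hτ 0).fun_pow 2))))
  have hpos := fun r => ((hqr r).fun_neg.zpow₀ (size μ) (Or.inl (neg_ne_zero.2 (div_ne_zero
    (mul_ne_zero (mul_ne_zero hq0 hs0) (hτ0 0)) (hτ0 r)))))
  have hst := fun r => ((hs.fun_mul (hτ 0)).fun_mul (hτ r)).fun_neg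
  have hst0 := fun r => neg_ne_zero.2 (mul_ne_zero (mul_ne_zero hs0 (hτ0 0)) (hτ0 r))
  have hneg := fun (r : Fin 6) (k : ℤ) => (hst r).zpow₀ k (Or.inl (hst0 r))
  have hlast := fun r h => (((((hc₁ r).fun_mul (hN₂ r)).div₀ (hc₂ r) h).fun_mul
    (hneg r (-size μ))).fun_mul (hqz (-nStatConj μ))).fun_mul (htz (nStat μ))
  simp only [limWeight]
  split_ifs with c1 c2
  · obtain ⟨d1, d2, d3, d4⟩ := h5 (Or.inl c1)
    have e0 : q x₀ * (t x₀ ^ ((n : ℤ) - 1)) ^ 4 * τ x₀ 0 ^ 3 * τ x₀ 1 ≠ 0 :=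
      mul_ne_zero (mul_ne_zero (mul_ne_zero hq0 (pow_ne_zero _ hs0)) (pow_ne_zero _ (hτ0 0)))
        (hτ0 1)
    have e1 := (continuousAt_const (y := (1 : ℂ))).div₀ (((hq.fun_mul (hs.fun_pow 4)).fun_mul
      ((hτ 0).fun_pow 3)).fun_mul (hτ 1)) e0
    exact ((((((hnum.fun_mul (e1.zpow₀ _ (Or.inl (one_div_ne_zero e0)))).fun_mul
      (hqz _)).fun_mul (htz _)).div₀
      (hden.fun_mul (hC0 _ ((hτ 1).div₀ (hτ 0) (hτ0 0)))) (mul_ne_zero (mul_ne_zero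
        (mul_ne_zero (mul_ne_zero d1 d2) hm0) (mul_ne_zero d3 d4)) (h6 c1))).fun_mul
      (tendsto_finsetProd _ fun r hr' => ((((hc₁ r).fun_mul (hN₁ r)).div₀ (hc₂ r)
        (hr r (mem_Ici.1 (mem_filter.1 hr').1)
          (Or.inl (by rw [c1, (mem_filter.1 hr').2])))).fun_mul (hpos r)).fun_mul
        (hqz _) |>.fun_mul (htz _))).fun_mul
      (tendsto_finsetProd _ fun r hr' => hlast r (hr r (mem_Ici.1 (mem_filter.1 hr').1)
        (Or.inr (by rw [c1, (mem_filter.1 hr').2, add_zero]))))).fun_mul hpair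
  · have e0 : τ x₀ 0 ^ 2 * (t x₀ ^ ((n : ℤ) - 1)) ^ 2 ≠ 0 :=
      mul_ne_zero (pow_ne_zero _ (hτ0 0)) (pow_ne_zero _ hs0)
    have e1 : q x₀ * (t x₀ ^ ((n : ℤ) - 1)) ^ 2 * τ x₀ 0 ^ 2 ≠ 0 :=
      mul_ne_zero (mul_ne_zero hq0 (pow_ne_zero _ hs0)) (pow_ne_zero _ (hτ0 0))
    exact ((((((((hN.fun_mul ((((hτ 0).fun_pow 2).fun_mul (hs.fun_pow 2)).zpow₀ _
      (Or.inl e0))).fun_mul (hqz _)).fun_mul (htz _)).div₀ hm hm0).fun_mul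
      (tendsto_finsetProd _ fun r hr' => ((((((hq.fun_mul (hs.fun_pow 2)).fun_mul
        ((hτ 0).fun_pow 2)).zpow₀ _ (Or.inl e1)).fun_mul (hqz _)).fun_mul (htz _)).div₀ (hc₂ r)
        (hr r (mem_Ici.1 (mem_filter.1 hr').1)
          (Or.inl (mem_filter.1 hr').2))).fun_mul (hN₁ r))).fun_mul
      (tendsto_finsetProd _ fun r _ => ((hneg r _).fun_mul (hqz _)).fun_mul (htz _))).fun_mul
      (tendsto_finsetProd _ fun r _ => hc₁ r)).fun_mul
      (tendsto_finsetProd _ fun r hr' => (hC0 _ (hqr r)).div₀ (hc₂ r)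
        (hr r (mem_Ici.1 (mem_filter.1 hr').1)
          (Or.inr (mem_filter.1 hr').2)))).fun_mul hpair
  · have c3 : α 0 = -(1 / 2) := le_antisymm (not_lt.1 c2) hα.lower
    obtain ⟨d1, d2, d3, d4⟩ := h5 (Or.inr c3)
    exact (((((hnum.fun_mul (((hq.fun_mul (hτ 0)).div₀ (hτ 1) (hτ0 1)).zpow₀ _
      (Or.inl (div_ne_zero (mul_ne_zero hq0 (hτ0 0)) (hτ0 1))))).fun_mul (hqz _)).div₀
      (hden.fun_mul (hC0 _ ((((hqz _).fun_mul hs).fun_mul (hτ 0)).div₀ (hτ 1) (hτ0 1))))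
      (mul_ne_zero (mul_ne_zero (mul_ne_zero (mul_ne_zero d1 d2) hm0) (mul_ne_zero d3 d4))
        (h7 c3))).fun_mul
      (tendsto_finsetProd _ fun r hr' => (((((hc₁ r).fun_mul (hN₁ r)).fun_mul (hpos r)).fun_mul
        (hqz _)).fun_mul (htz _)).div₀ (hc₂ r) (hr r (mem_Ici.1 (mem_filter.1 hr').1)
          (Or.inl (by rw [c3, (mem_filter.1 hr').2]))))).fun_mul
      (tendsto_finsetProd _ fun r hr' => hlast r (hr r (mem_Ici.1 (mem_filter.1 hr').1)
        (Or.inr (by rw [c3, (mem_filter.1 hr').2]; norm_num))))).fun_mul hpair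

end Continuity

section Generic

/-- Generic points of the parameter space, with a square root `Q` of `q`, are multiplicatively
independent modulo powers of `p`: a relation for `Q` gives one for `q` after squaring. -/
lemma residual_generic (p : ℂ) {b : ℂ⁶} (hb : ∀ i, b i ≠ 0) :
    ∀ᶠ x in residual ℂ⁶, ∀ v : ℂ⁶, v 4 ^ 2 = x 4 * b 4 →
      (∀ i ≠ 4, v i = x i * b i) → Generic v p := by
  have key : ∀ᶠ x in residual ℂ⁶, ∀ k : Fin 6 → ℤ, ∀ l : ℤ, k ≠ 0 →
      p ^ l / ∏ i, b i ^ k i - ∏ i, x i ^ k i ≠ 0 :=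
    eventually_countable_forall.2 fun k => eventually_countable_forall.2 fun l => by
      by_cases hk : k = 0
      · simp [hk]
      obtain ⟨c, hc⟩ := Function.ne_iff.1 hk
      filter_upwards [(MDeg.ratFun_const_sub (⟨k, rfl, fun _ _ => rfl⟩ : MDeg c (k c) _) hc
        (p ^ l / ∏ i, b i ^ k i)).residual_ne_zero] with x hx _ using hx
  filter_upwards [torus_mem_residual, key] with x hx0 hx v h4 hv
  have hv2 : ∀ i, v i ^ 2 = (x i * b i) ^ (if i = 4 then 1 else 2 : ℤ) := fun i => by
    split_ifs with h
    · rw [h, h4, zpow_one]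
    · rw [hv i h]; norm_cast
  have hv0 : ∀ i, v i ≠ 0 := fun i h => by
    have := hv2 i
    rw [h, zero_pow two_ne_zero] at this
    exact zpow_ne_zero _ (mul_ne_zero (hx0 i) (hb i)) this.symm
  refine ⟨hv0, fun k hk l h => hx (fun i => (if i = 4 then 1 else 2 : ℤ) * k i) (2 * l) ?_ ?_⟩
  · obtain ⟨c, hc⟩ := Function.ne_iff.1 hk
    refine Function.ne_iff.2 ⟨c, mul_ne_zero ?_ hc⟩
    split_ifs <;> norm_num
  · rw [sub_eq_zero, div_eq_iff (prod_ne_zero_iff.2 fun i _ => zpow_ne_zero _ (hb i)),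
      ← prod_mul_distrib, mul_comm, zpow_mul, ← h, zpow_ofNat, ← prod_pow]
    refine prod_congr rfl fun i _ => ?_
    rw [← mul_zpow, zpow_mul, ← hv2, ← zpow_natCast, ← zpow_natCast, zpow_comm]

end Generic

section Sum

variable {n N : ℕ} {α : Fin 6 → ℝ}

/-- For fixed `p`, generic parameters satisfy the hypotheses of `EllParams.sum_weight`. The
normalizing factor does not vanish, as otherwise all weights would be `0`. -/
lemma sum_weight_residual (hα : Admissible α) {p : ℂ} (hp : 0 < ‖p‖) (hp1 : ‖p‖ < 1) :
    ∀ᶠ x in residual ℂ⁶, ∑ μ ∈ boxPartitions n N,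
      weight n N (scaled α (balanced n N x) p) (x 4) (x 5) p μ = 1 := by
  have hp0 : p ≠ 0 := norm_pos_iff.1 hp
  filter_upwards [torus_mem_residual,
    residual_generic p (b := ![ppow p (α 0), ppow p (α 2), ppow p (α 3), ppow p (α 4), 1, 1])
      (fun i => by fin_cases i <;> simp [ppow_ne_zero hp0]),
    (weight_leadPair_zero hα (zero_mem_boxPartitions n N)).ne_zero p hp hp1] with x hx0 hx hw
  obtain ⟨Q, hQ⟩ := IsAlgClosed.exists_pow_nat_eq (x 4) two_pos
  have h1 : ppow p (α 0) * ppow p (α 1) = 1 := by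
    rw [← ppow_add hp0, hα.one, add_neg_cancel, ppow_zero]
  have h2 : ppow p (α 2) * ppow p (α 3) * ppow p (α 4) * ppow p (α 5) = p := by
    rw [← ppow_add hp0, ← ppow_add hp0, ← ppow_add hp0, hα.sum_eq, ppow_one]
  have h : EllParams n N (scaled α (balanced n N x) p) Q (x 5) p := by
    refine ⟨hp0, hp1, ?_, ?_, hx _ (by simpa using hQ) fun i hi => ?_⟩
    · rw [hQ, ← balanced_bal₁ n N hx0]
      simp only [scaled]
      linear_combination (x 5 ^ ((n : ℤ) - 1) * balanced n N x 0 * balanced n N x 1) * h1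
    · rw [hQ, ← balanced_bal₂ n N hx0]
      simp only [scaled]
      linear_combination (x 5 ^ ((n : ℤ) - 1) * balanced n N x 2 * balanced n N x 3 *
        balanced n N x 4 * balanced n N x 5) * h2
    · fin_cases i <;> first | exact absurd rfl hi | simp [scaled, balanced]
  have := h.sum_weight
  rw [hQ] at this
  exact this fun h0 => hw (by simp only [weight, h0, div_zero])

/-- The limit of `∑ w_μ = 1` along `p = 1/2, 1/3, …`. -/
lemma sum_limWeight_residual (hα : Admissible α) :
    ∀ᶠ x in residual ℂ⁶, ∑ μ ∈ boxPartitions n N,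
      limWeight n N α (balanced n N x) (x 4) (x 5) μ = 1 := by
  have hL := Lead.sum ⟨_, zero_mem_boxPartitions n N⟩ fun μ hμ =>
    (weight_leadPair_zero (N := N) hα hμ).lead
  obtain ⟨R, hR, h⟩ := hL.tendsto
  have hm : ∀ m : ℕ, 0 < ‖(1 / (m + 2) : ℂ)‖ ∧ ‖(1 / (m + 2) : ℂ)‖ < 1 := fun m => by
    have e : ‖(1 / (m + 2) : ℂ)‖ = 1 / (m + 2) := by
      rw [norm_div, norm_one, ← Nat.cast_two, ← Nat.cast_add, Complex.norm_natCast]; push_cast; rfl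
    rw [e]
    refine ⟨by positivity, (div_lt_one (by positivity)).2 (by linarith [m.cast_nonneg (α := ℝ)])⟩
  have hlim : Tendsto (fun m : ℕ => (1 / (m + 2) : ℂ)) atTop (𝓝[≠] 0) := by
    refine tendsto_nhdsWithin_iff.2 ⟨?_, Eventually.of_forall fun m => norm_pos_iff.1 (hm m).1⟩
    have := (tendsto_add_atTop_iff_nat 2).2 (tendsto_one_div_atTop_nhds_zero_nat (𝕜 := ℂ))
    simpa using this
  filter_upwards [torus_mem_residual,
    residual_of_dense_open (isOpen_eval_ne_zero R) (dense_eval_ne_zero hR),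
    eventually_countable_forall.2 fun m : ℕ =>
      sum_weight_residual (n := n) (N := N) hα (hm m).1 (hm m).2] with x hx0 hxR hx
  have h1 := ((h {x} isCompact_singleton (Set.singleton_subset_iff.2 ⟨hx0, hxR⟩)).tendsto_at
    (Set.mem_singleton x)).comp hlim
  have h2 := tendsto_nhds_unique h1 ((tendsto_const_nhds (x := (1 : ℂ))).congr fun m => by
    rw [Function.comp_apply, hx m, neg_zero, ppow_zero, mul_one])
  rw [← h2]
  exact sum_congr rfl fun μ hμ =>
    (leadWeight_eq_limWeight (limParams_balanced n N hx0) hα (mem_boxPartitions.1 hμ).2).symm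

lemma continuousAt_balanced {x : ℂ⁶} (hx : ∀ i, x i ≠ 0) (r : Fin 6) :
    ContinuousAt (fun y => balanced n N y r) x := by
  obtain ⟨d, ⟨k, -, hk⟩, -⟩ := balanced_mdeg n N 0 r
  have h : ContinuousAt (fun y : ℂ⁶ => ∏ i, y i ^ k i) x := (tendsto_finsetProd _ fun i _ =>
    ContinuousAt.zpow₀ (f := fun y : ℂ⁶ => y i) ((continuous_apply i).continuousAt) _
      (Or.inl (hx i)))
  refine h.congr ?_
  filter_upwards [isOpen_torus.mem_nhds hx] with y hy using (hk y hy).symm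

/-- An identity between continuous functions that holds on a dense set. -/
lemma sum_limWeight (hα : Admissible α) {τ : ℂ⁶} {q t : ℂ} (hτ : ∀ r, τ r ≠ 0)
    (hq : q ≠ 0) (ht : t ≠ 0) (h₁ : t ^ ((n : ℤ) - 1) * τ 0 * τ 1 = q ^ (-(N : ℤ)))
    (h₂ : t ^ ((n : ℤ) - 1) * τ 2 * τ 3 * τ 4 * τ 5 = q ^ ((N : ℤ) + 1))
    (hR : ∀ μ ∈ boxPartitions n N, LimWeightRegular n N α τ q t μ) :
    ∑ μ ∈ boxPartitions n N, limWeight n N α τ q t μ = 1 := by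
  set x : ℂ⁶ := ![τ 0, τ 2, τ 3, τ 4, q, t] with hx
  have hx0 : ∀ i, x i ≠ 0 := fun i => by fin_cases i <;> simp [hx, hτ, hq, ht]
  have e : balanced n N x = τ := by
    have ht' : t ^ ((n : ℤ) - 1) * t ^ (1 - (n : ℤ)) = 1 := by
      rw [← zpow_add₀ ht]; simp
    have h0 := hτ 0
    have h2 := hτ 2
    have h3 := hτ 3
    have h4 := hτ 4
    funext r
    fin_cases r
    · rfl
    · change q ^ (-(N : ℤ)) * t ^ (1 - (n : ℤ)) / τ 0 = τ 1
      rw [← h₁, div_eq_iff h0]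
      linear_combination (τ 0 * τ 1) * ht'
    · rfl
    · rfl
    · rfl
    · change q ^ ((N : ℤ) + 1) * t ^ (1 - (n : ℤ)) / (τ 2 * τ 3 * τ 4) = τ 5
      rw [← h₂, div_eq_iff (mul_ne_zero (mul_ne_zero h2 h3) h4)]
      linear_combination (τ 2 * τ 3 * τ 4 * τ 5) * ht'
  have hc : ContinuousAt (fun y : ℂ⁶ => ∑ μ ∈ boxPartitions n N,
      limWeight n N α (balanced n N y) (y 4) (y 5) μ) x :=
    tendsto_finsetSum _ fun μ hμ => continuousAt_limWeight hα (continuousAt_balanced hx0)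
      (continuous_apply _).continuousAt (continuous_apply _).continuousAt
      (balanced_ne_zero n N hx0) (hx0 4) (hx0 5) (by rw [e]; exact hR μ hμ)
  by_contra h
  have h' : (∑ μ ∈ boxPartitions n N, limWeight n N α (balanced n N x) (x 4) (x 5) μ) ≠ 1 := by
    rw [e]; exact h
  exact ((frequently_of_residual (sum_limWeight_residual hα) x).and_eventually
    (hc.eventually_ne h')).exists.elim fun y hy => hy.2 hy.1

end Sum

end EllipticSelberg

end

theorem mainTheorem2 (n N : ℕ) (α : Fin 6 → ℝ) (hα : EllipticSelberg.Admissible α) :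
    (∀ f g : EllipticSelberg.ParamFun n 3,
      EllipticSelberg.InATilde f → EllipticSelberg.InATilde g →
      EllipticSelberg.InM (EllipticSelberg.scaledForm n N α f g) ∧
      ∃ R : MvPolynomial (Fin 6) ℂ, R ≠ 0 ∧
        ∀ K : Set (Fin 6 → ℂ), IsCompact K →
          (∀ x ∈ K, (∀ i, x i ≠ 0) ∧ MvPolynomial.eval x R ≠ 0) →
          (∀ x ∈ K, ∀ μ ∈ EllipticSelberg.boxPartitions n N,
            EllipticSelberg.LimWeightRegular n N α
              (EllipticSelberg.balanced n N x) (x 4) (x 5) μ) ∧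
          TendstoUniformlyOn
            (fun (p : ℂ) (x : Fin 6 → ℂ) =>
              EllipticSelberg.ppow p
                  (-EllipticSelberg.val (EllipticSelberg.scaledFun α 4 f) -
                    EllipticSelberg.val (EllipticSelberg.scaledFun α 5 g)) *
                EllipticSelberg.scaledForm n N α f g x p)
            (fun x : Fin 6 → ℂ =>
              ∑ μ ∈ EllipticSelberg.boxPartitions n N,
                EllipticSelberg.lcAt α 4 f (EllipticSelberg.balanced n N x) (x 4) (x 5) μ *
                EllipticSelberg.lcAt α 5 g (EllipticSelberg.balanced n N x) (x 4) (x 5) μ *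
                EllipticSelberg.limWeight n N α
                  (EllipticSelberg.balanced n N x) (x 4) (x 5) μ)
            (nhdsWithin 0 {0}ᶜ) K) ∧
    (∀ (τ : Fin 6 → ℂ) (q t : ℂ), (∀ r, τ r ≠ 0) → q ≠ 0 → t ≠ 0 →
      t ^ ((n : ℤ) - 1) * τ 0 * τ 1 = q ^ (-(N : ℤ)) →
      t ^ ((n : ℤ) - 1) * τ 2 * τ 3 * τ 4 * τ 5 = q ^ ((N : ℤ) + 1) →
      (∀ μ ∈ EllipticSelberg.boxPartitions n N,
        EllipticSelberg.LimWeightRegular n N α τ q t μ) →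
      ∑ μ ∈ EllipticSelberg.boxPartitions n N,
        EllipticSelberg.limWeight n N α τ q t μ = 1) := by
  exact ⟨fun f g hf hg => ⟨EllipticSelberg.inM_scaledForm hα hf hg,
    EllipticSelberg.tendsto_scaledForm hα hf hg⟩,
    fun τ q t hτ hq ht h₁ h₂ hR => EllipticSelberg.sum_limWeight hα hτ hq ht h₁ h₂ hR⟩
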